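/- **Setting.** Let $N\ge 1$ and let $Q\subset\mathbb R^N$ be a bounded open set. Let $(\Omega,\mathscr M,\mu)$ be a probability space with an $N$-dimensional dynamical system $\{T(x):\Omega\to\Omega\}_{x\in\mathbb R^N}$: $T(0)=\mathrm{id}$, $T(x+y)=T(x)\circ T(y)$, each $T(x)$ is measurable and preserves $\mu$, and $(x,\omega)\mapsto T(x)\omega$ is measurable for the product of the Lebesgue $\sigma$-algebra of $\mathbb R^N$ with $\mathscr M$. Let $\Phi:[0,\infty)\to[0,\infty)$ be a Young function: $\Phi$ is continuous and convex, $\Phi(t)>0$ for $t>0$, $\Phi(t)/t\to0$ as $t\to0$, and $\Phi(t)/t\to\infty$ as $t\to\infty$. Assume that $\Phi$ and its conjugate $\widetilde\Phi(t)=\sup_{s\ge0}(st-\Phi(s))$ both satisfy $\Delta_2$ (there are $t_0>0$, $k>2$ with $\Phi(2t)\le k\Phi(t)$ for $t\ge t_0$) and $\Delta'$ (there is $\beta>0$ with $\Phi(ts)\le\beta\Phi(t)\Phi(s)$ for all $t,s\ge0$). $L^\Phi$ denotes the Orlicz space of $\Phi$ with its Luxemburg norm. Let $f:\Omega\times\mathbb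 R^N\to\mathbb R$ satisfy: * (H1) $f(\cdot,\lambda)$ is measurable for every $\lambda\in\mathbb R^N$; * (H2) $f(\omega,\cdot)$ is strictly convex for a.e. $\omega$; * (H3) there are $c_1,c_2>0$ with $c_1\Phi(|\lambda|)\le f(\omega,\lambda)\le c_2(1+\Phi(|\lambda|))$ for all $\lambda$ and a.e. $\omega$. **Spaces.** * $\mathcal C^\infty(\Omega)\subset L^\infty(\Omega)$ is the space of functions having stochastic derivatives of all orders in $L^\infty(\Omega)$, where $D_i\psi=\lim_{t\to0}\frac{\psi\circ T(te_i)-\psi}{t}$ in $L^\infty(\Omega)$. * $W^1_\#L^\Phi(\Omega)$ is the completion of $\mathcal C^\infty(\Omega)$ for the seminorm $\sum_{i}\|D_i\psi\|_{L^\Phi(\Omega)}$, and $\overline D_\omega:W^1_\#L^\Phi(\Omega)\to L^\Phi(\Omega)^N$ is the continuous extension of $(D_1,\dots,D_N)$. * $I^\Phi_{nv}(\Omega)$ is the space of $h\in L^\Phi(\Omega)$ with $h\circ T(y)=h$ a.e. for every $y$. * $W^1L^\Phi_{D_x}(Q;L^\Phi(\Omega))$ is the space of $v\in L^\Phi(Q\times\Omega)$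 whose distributional gradient $Dv$ in $x\in Q$ lies in $L^\Phi(Q\times\Omega)^N$, with norm $\|v\|_{L^\Phi}+\|Dv\|_{L^\Phi}$. * $W^1_0L^\Phi_{D_x}(Q;L^\Phi(\Omega))$ is the closure of $\mathcal C_0^\infty(Q)\otimes L^\Phi(\Omega)$ in it, and $W^1_0L^\Phi_{D_x}(Q;I^\Phi_{nv}(\Omega))$ consists of those $v$ in this closure with $v(x,\cdot)\in I^\Phi_{nv}(\Omega)$ for a.e. $x\in Q$. **Convergence.** A family $(w_\epsilon)_{\epsilon>0}$ in $L^\Phi(Q\times\Omega)$ converges weakly stochastically two-scale in the mean to $w_0\in L^\Phi(Q\times\Omega)$ if, as $\epsilon\to0$, $$\iint_{Q\times\Omega}w_\epsilon(x,\omega)\,h(x,T(\epsilon^{-1}x)\omega)\,dx\,d\mu\to\iint_{Q\times\Omega}w_0\,h\,dx\,d\mu\qquad\text{for all }h\in\mathcal C_0^\infty(Q)\otimes\mathcal C^\infty(\Omega).$$ **Theorem.** For every $\epsilon>0$ the functional $$F_\epsilon(v)=\iint_{Q\times\Omega}f(T(\epsilon^{-1}x)\omega,Dv(x,\omega))\,dx\,d\mu$$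 has a unique minimizer $u_\epsilon$ on $W^1_0L^\Phi_{D_x}(Q;L^\Phi(\Omega))$. The homogenized functional $$F(v_0,v_1)=\iint_{Q\times\Omega}f(\omega,Dv_0+\overline D_\omega v_1)\,dx\,d\mu$$ has a unique minimizer $(u_0,u_1)$ on $W^1_0L^\Phi_{D_x}(Q;I^\Phi_{nv}(\Omega))\times L^\Phi(Q;W^1_\#L^\Phi(\Omega))$. As $\epsilon\to0$, $u_\epsilon\to u_0$ weakly stochastically two-scale in the mean in $L^\Phi(Q\times\Omega)$, and, componentwise, $Du_\epsilon\to Du_0+\overline D_\omega u_1$ weakly stochastically two-scale in the mean in $L^\Phi(Q\times\Omega)^N$. -/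

import Mathlib

open MeasureTheory Filter Topology Set
open scoped ENNReal

noncomputable section

/-! ### Young functions and Orlicz spaces -/

/-- A Young function `Φ : [0,∞) → [0,∞)`; only the values on `[0,∞)` are constrained or used. -/
structure YoungFunction where
  toFun : ℝ → ℝ
  continuousOn' : ContinuousOn toFun (Ici 0)
  convexOn' : ConvexOn ℝ (Ici 0) toFun
  pos' : ∀ t, 0 < t → 0 < toFun t
  tendsto_zero' : Tendsto (fun t => toFun t / t) (𝓝[>] 0) (𝓝 0)
  tendsto_atTop' : Tendsto (fun t => toFun t / t) atTop atTop

instance : CoeFun YoungFunction (fun _ => ℝ → ℝ) := ⟨YoungFunction.toFun⟩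

/-- The Fenchel conjugate `t ↦ sup_{s ≥ 0} (s t - Φ s)`; for a Young function the supremum is
finite for every `t`, since `Φ s / s → ∞`. -/
def youngConj (Φ : ℝ → ℝ) (t : ℝ) : ℝ := sSup ((fun s : ℝ => s * t - Φ s) '' Ici 0)

/-- The `Δ₂`-condition at infinity. -/
def Delta2 (Φ : ℝ → ℝ) : Prop :=
  ∃ t₀ k : ℝ, 0 < t₀ ∧ 2 < k ∧ ∀ t, t₀ ≤ t → Φ (2 * t) ≤ k * Φ t

/-- The `Δ'`-condition. -/
def DeltaPrime (Φ : ℝ → ℝ) : Prop :=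
  ∃ β : ℝ, 0 < β ∧ ∀ t s, 0 ≤ t → 0 ≤ s → Φ (t * s) ≤ β * (Φ t * Φ s)

section Orlicz

variable {α : Type*} [MeasurableSpace α]

/-- Membership in the Orlicz space `L^Φ(ν; F)`. -/
def MemOrlicz {F : Type*} [NormedAddCommGroup F] (Φ : YoungFunction) (ν : Measure α)
    (u : α → F) : Prop :=
  AEStronglyMeasurable u ν ∧
    ∃ δ : ℝ, 0 < δ ∧ ∫⁻ a, ENNReal.ofReal (Φ (‖u a‖ / δ)) ∂ν < ∞

/-- The Luxemburg norm, with value `∞` outside the Orlicz space. -/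
def luxNorm {F : Type*} [NormedAddCommGroup F] (Φ : YoungFunction) (ν : Measure α)
    (u : α → F) : ℝ≥0∞ :=
  ⨅ (δ : ℝ) (_ : 0 < δ) (_ : ∫⁻ a, ENNReal.ofReal (Φ (‖u a‖ / δ)) ∂ν ≤ 1), ENNReal.ofReal δ

end Orlicz

namespace YoungFunction

variable (Φ : YoungFunction)

theorem tendsto_nhdsGT_zero : Tendsto Φ (𝓝[>] 0) (𝓝 0) := by
  have h1 : Tendsto (fun t : ℝ => t) (𝓝[>] 0) (𝓝 0) := nhdsWithin_le_nhds
  have h := Φ.tendsto_zero'.mul h1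
  rw [zero_mul] at h
  refine h.congr' ?_
  filter_upwards [self_mem_nhdsWithin] with t ht
  exact div_mul_cancel₀ _ (ne_of_gt ht)

theorem map_zero : Φ 0 = 0 := by
  have h1 : Tendsto Φ (𝓝[>] 0) (𝓝 (Φ 0)) :=
    (Φ.continuousOn' 0 (by simp)).mono_left (nhdsWithin_mono _ Ioi_subset_Ici_self)
  exact tendsto_nhds_unique h1 Φ.tendsto_nhdsGT_zero

theorem nonneg {t : ℝ} (ht : 0 ≤ t) : 0 ≤ Φ t := by
  rcases ht.eq_or_lt with rfl | h
  · exact Φ.map_zero.ge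
  · exact (Φ.pos' t h).le

theorem mono {s t : ℝ} (hs : 0 ≤ s) (hst : s ≤ t) : Φ s ≤ Φ t := by
  rcases hst.eq_or_lt with rfl | h
  · exact le_rfl
  have ht : 0 < t := hs.trans_lt h
  have h0 : 0 ≤ s / t := by positivity
  have h1 : s / t ≤ 1 := (div_le_one ht).2 hst
  have hc := Φ.convexOn'.2 (show t ∈ Ici (0 : ℝ) from ht.le) (show (0 : ℝ) ∈ Ici (0 : ℝ) by simp)
    h0 (show 0 ≤ 1 - s / t by linarith) (by ring)
  simp only [smul_eq_mul, mul_zero, add_zero, Φ.map_zero] at hc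
  rw [div_mul_cancel₀ _ ht.ne'] at hc
  have := Φ.nonneg ht.le
  nlinarith

theorem continuous_abs : Continuous fun t : ℝ => Φ |t| :=
  Φ.continuousOn'.comp_continuous _root_.continuous_abs (fun t => abs_nonneg t)

end YoungFunction

section LuxNorm

variable {α : Type*} [MeasurableSpace α] {ν : Measure α} (Φ : YoungFunction)

theorem luxNorm_congr {f g : α → ℝ} (h : f =ᵐ[ν] g) : luxNorm Φ ν f = luxNorm Φ ν g := by
  have : ∀ δ : ℝ, ∫⁻ a, ENNReal.ofReal (Φ (‖f a‖ / δ)) ∂ν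
      = ∫⁻ a, ENNReal.ofReal (Φ (‖g a‖ / δ)) ∂ν := fun δ =>
    lintegral_congr_ae (by filter_upwards [h] with a ha; rw [ha])
  simp only [luxNorm, this]

theorem luxNorm_neg (f : α → ℝ) : luxNorm Φ ν (-f) = luxNorm Φ ν f := by
  simp [luxNorm]

theorem luxNorm_zero : luxNorm Φ ν (0 : α → ℝ) = 0 := by
  refine le_antisymm (ENNReal.le_of_forall_pos_le_add fun ε hε _ => ?_) zero_le
  rw [zero_add]
  have hε' : (0 : ℝ) < ε := by exact_mod_cast hε
  refine (iInf_le_of_le (ε : ℝ) (iInf_le_of_le hε' (iInf_le_of_le ?_ le_rfl))).trans ?_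
  · simp [Φ.map_zero]
  · simp

theorem luxNorm_add_le {f g : α → ℝ} (hf : AEStronglyMeasurable f ν) :
    luxNorm Φ ν (f + g) ≤ luxNorm Φ ν f + luxNorm Φ ν g := by
  refine ENNReal.le_of_forall_pos_le_add fun ε hε hfin => ?_
  have hf' : luxNorm Φ ν f ≠ ∞ := fun h => by simp [h] at hfin
  have hg' : luxNorm Φ ν g ≠ ∞ := fun h => by simp [h] at hfin
  have he : (0 : ℝ≥0∞) < ((ε / 2 : NNReal) : ℝ≥0∞) := by
    have : 0 < ε / 2 := by positivity
    exact_mod_cast this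
  have h1 := ENNReal.lt_add_right hf' he.ne'
  have h2 := ENNReal.lt_add_right hg' he.ne'
  conv_lhs at h1 => rw [luxNorm]
  conv_lhs at h2 => rw [luxNorm]
  simp only [iInf_lt_iff] at h1 h2
  obtain ⟨a, ha, hfa, h1⟩ := h1
  obtain ⟨b, hb, hgb, h2⟩ := h2
  have hab : 0 < a + b := by positivity
  have key : ∫⁻ x, ENNReal.ofReal (Φ (‖(f + g) x‖ / (a + b))) ∂ν ≤ 1 := by
    have hpt : ∀ x, ENNReal.ofReal (Φ (‖(f + g) x‖ / (a + b))) ≤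
        ENNReal.ofReal (a / (a + b)) * ENNReal.ofReal (Φ (‖f x‖ / a))
        + ENNReal.ofReal (b / (a + b)) * ENNReal.ofReal (Φ (‖g x‖ / b)) := by
      intro x
      have hA : 0 ≤ a / (a + b) := by positivity
      have hB : 0 ≤ b / (a + b) := by positivity
      have hF : 0 ≤ ‖f x‖ / a := by positivity
      have hG : 0 ≤ ‖g x‖ / b := by positivity
      rw [← ENNReal.ofReal_mul hA, ← ENNReal.ofReal_mul hB, ← ENNReal.ofReal_add
        (mul_nonneg hA (Φ.nonneg hF)) (mul_nonneg hB (Φ.nonneg hG))]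
      refine ENNReal.ofReal_le_ofReal ?_
      have hc := Φ.convexOn'.2 (show ‖f x‖ / a ∈ Ici (0 : ℝ) from hF)
        (show ‖g x‖ / b ∈ Ici (0 : ℝ) from hG) hA hB (by field_simp)
      simp only [smul_eq_mul] at hc
      refine le_trans (Φ.mono (by positivity) ?_) hc
      have : a / (a + b) * (‖f x‖ / a) + b / (a + b) * (‖g x‖ / b)
          = (‖f x‖ + ‖g x‖) / (a + b) := by field_simp
      rw [this]
      gcongr
      exact norm_add_le _ _
    have hm : AEMeasurable (fun x => ENNReal.ofReal (a / (a + b)) *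
        ENNReal.ofReal (Φ (‖f x‖ / a))) ν := by
      have h3 : ∀ x, ‖f x‖ / a = |f x / a| := fun x => by
        rw [abs_div, abs_of_pos ha, Real.norm_eq_abs]
      simp only [h3]
      exact ((Φ.continuous_abs.measurable.comp_aemeasurable
        (hf.aemeasurable.div_const a)).ennreal_ofReal).const_mul _
    calc _ ≤ ∫⁻ x, (ENNReal.ofReal (a / (a + b)) * ENNReal.ofReal (Φ (‖f x‖ / a))
        + ENNReal.ofReal (b / (a + b)) * ENNReal.ofReal (Φ (‖g x‖ / b))) ∂ν :=
          lintegral_mono hpt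
      _ ≤ ENNReal.ofReal (a / (a + b)) * 1 + ENNReal.ofReal (b / (a + b)) * 1 := by
          rw [lintegral_add_left' hm, lintegral_const_mul' _ _ ENNReal.ofReal_ne_top,
            lintegral_const_mul' _ _ ENNReal.ofReal_ne_top]
          gcongr
      _ = 1 := by
          rw [mul_one, mul_one, ← ENNReal.ofReal_add (by positivity) (by positivity),
            ← add_div, div_self hab.ne', ENNReal.ofReal_one]
  calc luxNorm Φ ν (f + g) ≤ ENNReal.ofReal (a + b) :=
        iInf_le_of_le (a + b) (iInf_le_of_le hab (iInf_le_of_le key le_rfl))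
    _ = ENNReal.ofReal a + ENNReal.ofReal b := ENNReal.ofReal_add ha.le hb.le
    _ ≤ (luxNorm Φ ν f + (ε / 2 : NNReal)) + (luxNorm Φ ν g + (ε / 2 : NNReal)) :=
        add_le_add h1.le h2.le
    _ = luxNorm Φ ν f + luxNorm Φ ν g + ε := by
        rw [add_add_add_comm, ← ENNReal.coe_add, add_halves]

theorem luxNorm_lt_top [IsProbabilityMeasure ν] {f : α → ℝ} (hf : MemLp f ∞ ν) :
    luxNorm Φ ν f < ∞ := by
  obtain ⟨C, hC⟩ : ∃ C : ℝ, ∀ᵐ a ∂ν, ‖f a‖ ≤ C := by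
    refine ⟨(eLpNorm f ∞ ν).toReal, ?_⟩
    filter_upwards [ae_le_eLpNormEssSup (f := f) (μ := ν)] with a ha
    have h2 := ENNReal.toReal_mono hf.2.ne (by simpa [eLpNorm_exponent_top] using ha)
    simpa using h2
  have h1 : ∀ᶠ t in 𝓝[>] (0 : ℝ), Φ t < 1 :=
    Φ.tendsto_nhdsGT_zero.eventually (gt_mem_nhds one_pos)
  obtain ⟨t, ht1, ht⟩ := (h1.and self_mem_nhdsWithin).exists
  have ht : 0 < t := ht
  set δ : ℝ := (|C| + 1) / t
  have hδ : 0 < δ := by positivity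
  refine (iInf_le_of_le δ (iInf_le_of_le hδ (iInf_le_of_le ?_ le_rfl))).trans_lt
    ENNReal.ofReal_lt_top
  calc _ ≤ ∫⁻ _, (1 : ℝ≥0∞) ∂ν := by
        refine lintegral_mono_ae ?_
        filter_upwards [hC] with a ha
        rw [← ENNReal.ofReal_one]
        refine ENNReal.ofReal_le_ofReal ((Φ.mono (by positivity) ?_).trans ht1.le)
        rw [div_le_iff₀ hδ]
        have : t * δ = |C| + 1 := by simp only [δ]; field_simp
        rw [this]
        linarith [le_abs_self C]
    _ = 1 := by simp

end LuxNorm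

/-! ### Dynamical systems and stochastic calculus -/

/-- `ℝ^N` with the Euclidean norm. -/
abbrev RN (N : ℕ) : Type := EuclideanSpace ℝ (Fin N)

/-- The `i`-th vector of the canonical basis. -/
def stdVec {N : ℕ} (i : Fin N) : RN N := EuclideanSpace.single i 1

/-- An `N`-dimensional measure preserving dynamical system on `(Ω, μ)`. In the last field the
parameter space carries the `σ`-algebra of Lebesgue measurable sets. -/
structure DynSystem (N : ℕ) {Ω : Type*} [MeasurableSpace Ω] (μ : Measure Ω) where
  toFun : RN N → Ω → Ω
  map_zero' : ∀ ω, toFun 0 ω = ω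
  map_add' : ∀ x y ω, toFun (x + y) ω = toFun x (toFun y ω)
  measurePreserving' : ∀ x, MeasurePreserving (toFun x) μ μ
  measurable' : Measurable
    (fun p : NullMeasurableSpace (RN N) volume × Ω => toFun p.1 p.2)

instance {N : ℕ} {Ω : Type*} [MeasurableSpace Ω] (μ : Measure Ω) :
    CoeFun (DynSystem N μ) (fun _ => RN N → Ω → Ω) := ⟨DynSystem.toFun⟩

section Stochastic

variable {N : ℕ} {Ω : Type*} [MeasurableSpace Ω] {μ : Measure Ω}

/-- `g` is the `i`-th stochastic derivative of `f` in `L^∞(Ω)`: the difference quotients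
`(f ∘ T(t e_i) - f) / t` converge to `g` in `L^∞(Ω)` as `t → 0`. -/
def IsStochDeriv (T : DynSystem N μ) (i : Fin N) (f g : Ω → ℝ) : Prop :=
  MemLp f ∞ μ ∧ MemLp g ∞ μ ∧
    Tendsto (fun t : ℝ => eLpNorm (fun ω => (f (T (t • stdVec i) ω) - f ω) / t - g ω) ∞ μ)
      (𝓝[≠] 0) (𝓝 0)

/-- `f` has stochastic derivatives `D^α f` of all orders in `L^∞(Ω)`. -/
def IsStochSmooth (T : DynSystem N μ) (f : Ω → ℝ) : Prop :=
  ∃ F : (Fin N → ℕ) → Ω → ℝ, F 0 = f ∧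
    ∀ a : Fin N → ℕ, MemLp (F a) ∞ μ ∧
      ∀ i : Fin N, IsStochDeriv T i (F a) (F (a + Pi.single i 1))

theorem IsStochDeriv.add {T : DynSystem N μ} {i : Fin N} {f g f' g' : Ω → ℝ}
    (h : IsStochDeriv T i f g) (h' : IsStochDeriv T i f' g') :
    IsStochDeriv T i (f + f') (g + g') := by
  refine ⟨h.1.add h'.1, h.2.1.add h'.2.1, ?_⟩
  have hs := h.2.2.add h'.2.2
  rw [add_zero] at hs
  refine tendsto_of_tendsto_of_tendsto_of_le_of_le tendsto_const_nhds hs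
    (fun _ => zero_le) (fun t => ?_)
  simp only [eLpNorm_exponent_top]
  refine le_trans (le_of_eq ?_) eLpNormEssSup_add_le
  congr 1
  funext ω
  simp only [Pi.add_apply]
  ring

theorem IsStochDeriv.const_smul {T : DynSystem N μ} {i : Fin N} {f g : Ω → ℝ} (c : ℝ)
    (h : IsStochDeriv T i f g) : IsStochDeriv T i (c • f) (c • g) := by
  refine ⟨h.1.const_smul c, h.2.1.const_smul c, ?_⟩
  have hs := ENNReal.Tendsto.const_mul (a := ‖c‖ₑ) h.2.2 (Or.inr (by simp))
  rw [mul_zero] at hs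
  refine hs.congr fun t => ?_
  rw [← eLpNorm_const_smul]
  congr 1
  funext ω
  simp only [Pi.smul_apply, smul_eq_mul]
  ring

theorem IsStochDeriv.unique {T : DynSystem N μ} {i : Fin N} {f g g' : Ω → ℝ}
    (h : IsStochDeriv T i f g) (h' : IsStochDeriv T i f g') : g =ᵐ[μ] g' := by
  have hs := h.2.2.add h'.2.2
  rw [add_zero] at hs
  have hle : ∀ t : ℝ, eLpNorm (g - g') ∞ μ ≤
      eLpNorm (fun ω => (f (T (t • stdVec i) ω) - f ω) / t - g ω) ∞ μ +
      eLpNorm (fun ω => (f (T (t • stdVec i) ω) - f ω) / t - g' ω) ∞ μ := by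
    intro t
    have h1 : eLpNorm (g - g') ∞ μ = eLpNorm
        ((fun ω => (f (T (t • stdVec i) ω) - f ω) / t - g' ω) +
          -(fun ω => (f (T (t • stdVec i) ω) - f ω) / t - g ω)) ∞ μ := by
      congr 1
      funext ω
      simp only [Pi.add_apply, Pi.neg_apply, Pi.sub_apply]
      ring
    rw [h1, add_comm, ← eLpNorm_neg (fun ω => (f (T (t • stdVec i) ω) - f ω) / t - g ω)]
    rw [add_comm]
    simp only [eLpNorm_exponent_top]
    exact eLpNormEssSup_add_le.trans (add_comm _ _).le
  have h0 : eLpNorm (g - g') ∞ μ = 0 :=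
    le_antisymm (ge_of_tendsto' hs hle) zero_le
  rw [eLpNorm_eq_zero_iff (h.2.1.1.sub h'.2.1.1) (by simp)] at h0
  filter_upwards [h0] with ω hω
  simpa [sub_eq_zero] using hω

theorem isStochDeriv_zero (T : DynSystem N μ) (i : Fin N) :
    IsStochDeriv T i (0 : Ω → ℝ) 0 := by
  refine ⟨MemLp.zero, MemLp.zero, ?_⟩
  have h0 : ∀ t : ℝ, eLpNorm (fun ω => ((0 : Ω → ℝ) (T (t • stdVec i) ω) - (0 : Ω → ℝ) ω) / t
      - (0 : Ω → ℝ) ω) ∞ μ = 0 := by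
    intro t
    have : (fun ω => ((0 : Ω → ℝ) (T (t • stdVec i) ω) - (0 : Ω → ℝ) ω) / t
      - (0 : Ω → ℝ) ω) = fun _ => (0 : ℝ) := by
      funext ω
      simp
    rw [this]
    exact eLpNorm_zero
  simp only [h0]
  exact tendsto_const_nhds

/-- The space `C^∞(Ω)` of stochastically smooth functions. -/
def CInf (T : DynSystem N μ) : Submodule ℝ (Ω → ℝ) where
  carrier := {f | IsStochSmooth T f}
  zero_mem' := ⟨fun _ => 0, rfl, fun _ => ⟨MemLp.zero, fun i => isStochDeriv_zero T i⟩⟩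
  add_mem' := by
    rintro f g ⟨F, hF0, hF⟩ ⟨G, hG0, hG⟩
    exact ⟨fun a => F a + G a, by simp only [hF0, hG0],
      fun a => ⟨(hF a).1.add (hG a).1, fun i => ((hF a).2 i).add ((hG a).2 i)⟩⟩
  smul_mem' := by
    rintro c f ⟨F, hF0, hF⟩
    exact ⟨fun a => c • F a, by simp only [hF0],
      fun a => ⟨(hF a).1.const_smul c, fun i => ((hF a).2 i).const_smul c⟩⟩

theorem CInf.exists_deriv {T : DynSystem N μ} (ψ : CInf T) (i : Fin N) :
    ∃ g, IsStochDeriv T i (ψ : Ω → ℝ) g := by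
  obtain ⟨F, hF0, hF⟩ := ψ.2
  exact ⟨_, hF0 ▸ (hF 0).2 i⟩

/-- The `i`-th stochastic derivative `D_i ψ` of `ψ ∈ C^∞(Ω)`. -/
def stochDeriv {T : DynSystem N μ} (i : Fin N) (ψ : CInf T) : Ω → ℝ :=
  (CInf.exists_deriv ψ i).choose

theorem stochDeriv_spec {T : DynSystem N μ} (i : Fin N) (ψ : CInf T) :
    IsStochDeriv T i (ψ : Ω → ℝ) (stochDeriv i ψ) :=
  (CInf.exists_deriv ψ i).choose_spec

/-- The seminorm `‖ψ‖_# = ∑ i, ‖D_i ψ‖_{L^Φ(Ω)}` on `C^∞(Ω)`. -/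
def sharpSeminorm [IsProbabilityMeasure μ] (Φ : YoungFunction) (T : DynSystem N μ) :
    AddGroupSeminorm (CInf T) where
  toFun ψ := ∑ i, (luxNorm Φ μ (stochDeriv i ψ)).toReal
  map_zero' := by
    refine Finset.sum_eq_zero fun i _ => ?_
    rw [luxNorm_congr Φ ((stochDeriv_spec i (0 : CInf T)).unique (isStochDeriv_zero T i)),
      luxNorm_zero, ENNReal.toReal_zero]
  add_le' ψ χ := by
    rw [← Finset.sum_add_distrib]
    refine Finset.sum_le_sum fun i _ => ?_
    have h1 := stochDeriv_spec i ψ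
    have h2 := stochDeriv_spec i χ
    rw [luxNorm_congr Φ ((stochDeriv_spec i (ψ + χ)).unique (h1.add h2)),
      ← ENNReal.toReal_add (luxNorm_lt_top Φ h1.2.1).ne (luxNorm_lt_top Φ h2.2.1).ne]
    exact ENNReal.toReal_mono
      (ENNReal.add_ne_top.2 ⟨(luxNorm_lt_top Φ h1.2.1).ne, (luxNorm_lt_top Φ h2.2.1).ne⟩)
      (luxNorm_add_le Φ h1.2.1.1)
  neg' ψ := by
    refine Finset.sum_congr rfl fun i _ => ?_
    have h1 : IsStochDeriv T i ((-ψ : CInf T) : Ω → ℝ) (-stochDeriv i ψ) := by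
      have := (stochDeriv_spec i ψ).const_smul (-1)
      simpa using this
    rw [luxNorm_congr Φ ((stochDeriv_spec i (-ψ)).unique h1), luxNorm_neg]

/-- The space `C^∞(Ω)` regarded as a seminormed group with the seminorm `‖·‖_#`. -/
def CInfSharp (_Φ : YoungFunction) (T : DynSystem N μ) : Type _ := CInf T

instance [IsProbabilityMeasure μ] (Φ : YoungFunction) (T : DynSystem N μ) :
    SeminormedAddCommGroup (CInfSharp Φ T) :=
  @AddGroupSeminorm.toSeminormedAddCommGroup (CInf T) _ (sharpSeminorm Φ T)

/-- The space `W^1_# L^Φ(Ω)`: the (Hausdorff) completion of `C^∞(Ω)` for `‖·‖_#`. -/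
abbrev WSharp [IsProbabilityMeasure μ] (Φ : YoungFunction) (T : DynSystem N μ) : Type _ :=
  UniformSpace.Completion (CInfSharp Φ T)

/-- `g = D̄_ω w` for `w ∈ W^1_# L^Φ(Ω)`, where `D̄_ω` is the extension by continuity of
`D_ω = (D_1, …, D_N)`: there are `ψ ∈ C^∞(Ω)` arbitrarily close to `w` whose gradients `D_ω ψ`
are arbitrarily close to `g` in `L^Φ(Ω)^N`. -/
def IsStochGrad [IsProbabilityMeasure μ] (Φ : YoungFunction) (T : DynSystem N μ)
    (w : WSharp Φ T) (g : Ω → RN N) : Prop :=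
  AEStronglyMeasurable g μ ∧
    ∀ δ : ℝ, 0 < δ → ∃ ψ : CInfSharp Φ T, ‖w - (ψ : WSharp Φ T)‖ < δ ∧
      ∀ i, luxNorm Φ μ (fun ω => g ω i - stochDeriv (T := T) i ψ ω) < ENNReal.ofReal δ

open Classical in
/-- For `w : Q → W^1_# L^Φ(Ω)`, the function `(x, ω) ↦ (D̄_ω w(x))(ω)` on `Q × Ω`
(a jointly measurable representative, unique almost everywhere). -/
def stochGrad [IsProbabilityMeasure μ] (Φ : YoungFunction) (T : DynSystem N μ)
    (Q : Set (RN N)) (w : RN N → WSharp Φ T) : RN N × Ω → RN N :=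
  if h : ∃ G : RN N × Ω → RN N, AEStronglyMeasurable G ((volume.restrict Q).prod μ) ∧
      ∀ᵐ x ∂(volume.restrict Q), IsStochGrad Φ T (w x) (fun ω => G (x, ω))
  then h.choose else 0

/-- Membership in `I_nv^Φ(Ω)`, the functions of `L^Φ(Ω)` that are invariant under `T`. -/
def MemInv (Φ : YoungFunction) (T : DynSystem N μ) (h : Ω → ℝ) : Prop :=
  MemOrlicz Φ μ h ∧ ∀ y, (fun ω => h (T y ω)) =ᵐ[μ] h

/-! ### Orlicz-Sobolev spaces on `Q × Ω` -/

/-- `φ ∈ C_0^∞(Q)`. -/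
def IsTestFun (Q : Set (RN N)) (φ : RN N → ℝ) : Prop :=
  ContDiff ℝ ((⊤ : ℕ∞) : WithTop ℕ∞) φ ∧ HasCompactSupport φ ∧ tsupport φ ⊆ Q

/-- The algebraic tensor product `C_0^∞(Q) ⊗ X` for a set `X` of functions on `Ω`: the finite sums
of functions `(x, ω) ↦ φ x * h ω`. -/
def testTensor (Q : Set (RN N)) (X : Set (Ω → ℝ)) : Submodule ℝ (RN N × Ω → ℝ) :=
  Submodule.span ℝ {w | ∃ φ h, IsTestFun Q φ ∧ h ∈ X ∧ w = fun p => φ p.1 * h p.2}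

/-- `g ∈ L^Φ(Q × Ω)^N` is the gradient of `v` with respect to `x ∈ Q`, in the sense of
distributions on `Q`. -/
def HasWeakGrad (Φ : YoungFunction) (Q : Set (RN N)) (μ : Measure Ω)
    (v : RN N × Ω → ℝ) (g : RN N × Ω → RN N) : Prop :=
  MemOrlicz Φ ((volume.restrict Q).prod μ) g ∧
    ∀ φ, IsTestFun Q φ → ∀ i, ∀ᵐ ω ∂μ,
      ∫ x in Q, v (x, ω) * fderiv ℝ φ x (stdVec i) = - ∫ x in Q, g (x, ω) i * φ x

open Classical in
/-- The gradient `Dv` of `v` with respect to `x` (unique almost everywhere on `Q × Ω`). -/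
def weakGrad (Φ : YoungFunction) (Q : Set (RN N)) (μ : Measure Ω)
    (v : RN N × Ω → ℝ) : RN N × Ω → RN N :=
  if h : ∃ g, HasWeakGrad Φ Q μ v g then h.choose else 0

/-- Membership in `W^1 L^Φ_{D_x}(Q; L^Φ(Ω))`. -/
def MemW1 (Φ : YoungFunction) (Q : Set (RN N)) (μ : Measure Ω) (v : RN N × Ω → ℝ) : Prop :=
  MemOrlicz Φ ((volume.restrict Q).prod μ) v ∧ ∃ g, HasWeakGrad Φ Q μ v g

/-- Membership in `W^1_0 L^Φ_{D_x}(Q; L^Φ(Ω))`, the closure of `C_0^∞(Q) ⊗ L^Φ(Ω)` in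
`W^1 L^Φ_{D_x}(Q; L^Φ(Ω))`. -/
def MemW10 (Φ : YoungFunction) (Q : Set (RN N)) (μ : Measure Ω) (v : RN N × Ω → ℝ) : Prop :=
  MemW1 Φ Q μ v ∧
    ∀ δ : ℝ≥0∞, 0 < δ → ∃ w ∈ testTensor Q {h : Ω → ℝ | MemOrlicz Φ μ h},
      luxNorm Φ ((volume.restrict Q).prod μ) (v - w) < δ ∧
      luxNorm Φ ((volume.restrict Q).prod μ) (weakGrad Φ Q μ v - weakGrad Φ Q μ w) < δ

/-- Membership in `W^1_0 L^Φ_{D_x}(Q; I_nv^Φ(Ω))`. -/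
def MemW10Inv (Φ : YoungFunction) (T : DynSystem N μ) (Q : Set (RN N))
    (v : RN N × Ω → ℝ) : Prop :=
  MemW10 Φ Q μ v ∧ ∀ᵐ x ∂(volume.restrict Q), MemInv Φ T (fun ω => v (x, ω))

/-! ### The minimization problems and two-scale convergence -/

/-- The functional `F_ε(v) = ∬_{Q × Ω} f(T(x/ε)ω, Dv(x,ω)) dx dμ`. -/
def energyEps (Φ : YoungFunction) (T : DynSystem N μ) (Q : Set (RN N))
    (f : Ω → RN N → ℝ) (ε : ℝ) (v : RN N × Ω → ℝ) : ℝ :=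
  ∫ p, f (T (ε⁻¹ • p.1) p.2) (weakGrad Φ Q μ v p) ∂((volume.restrict Q).prod μ)

/-- `v` minimizes `F_ε` over `W^1_0 L^Φ_{D_x}(Q; L^Φ(Ω))`. -/
def IsMinimizerEps (Φ : YoungFunction) (T : DynSystem N μ) (Q : Set (RN N))
    (f : Ω → RN N → ℝ) (ε : ℝ) (v : RN N × Ω → ℝ) : Prop :=
  MemW10 Φ Q μ v ∧ ∀ w, MemW10 Φ Q μ w → energyEps Φ T Q f ε v ≤ energyEps Φ T Q f ε w

/-- The homogenized functional `F(v₀, v₁) = ∬_{Q × Ω} f(ω, Dv₀ + D̄_ω v₁) dx dμ`. -/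
def energyHom [IsProbabilityMeasure μ] (Φ : YoungFunction) (T : DynSystem N μ)
    (Q : Set (RN N)) (f : Ω → RN N → ℝ) (v₀ : RN N × Ω → ℝ) (v₁ : RN N → WSharp Φ T) : ℝ :=
  ∫ p, f p.2 (weakGrad Φ Q μ v₀ p + stochGrad Φ T Q v₁ p) ∂((volume.restrict Q).prod μ)

/-- Membership in `W^1_0 L^Φ_{D_x}(Q; I_nv^Φ(Ω)) × L^Φ(Q; W^1_# L^Φ(Ω))`. -/
def MemF10 [IsProbabilityMeasure μ] (Φ : YoungFunction) (T : DynSystem N μ)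
    (Q : Set (RN N)) (v₀ : RN N × Ω → ℝ) (v₁ : RN N → WSharp Φ T) : Prop :=
  MemW10Inv Φ T Q v₀ ∧ MemOrlicz Φ (volume.restrict Q) v₁

/-- `(v₀, v₁)` minimizes the homogenized functional. -/
def IsMinimizerHom [IsProbabilityMeasure μ] (Φ : YoungFunction) (T : DynSystem N μ)
    (Q : Set (RN N)) (f : Ω → RN N → ℝ) (v₀ : RN N × Ω → ℝ) (v₁ : RN N → WSharp Φ T) : Prop :=
  MemF10 Φ T Q v₀ v₁ ∧
    ∀ w₀ w₁, MemF10 Φ T Q w₀ w₁ → energyHom Φ T Q f v₀ v₁ ≤ energyHom Φ T Q f w₀ w₁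

/-- Weak stochastic two-scale convergence in the mean in `L^Φ(Q × Ω)` of `(u ε)_{ε > 0}` to `u₀`,
as `ε → 0`. -/
def TwoScaleTendsto (Φ : YoungFunction) (T : DynSystem N μ) (Q : Set (RN N))
    (u : ℝ → RN N × Ω → ℝ) (u₀ : RN N × Ω → ℝ) : Prop :=
  (∀ ε, 0 < ε → MemOrlicz Φ ((volume.restrict Q).prod μ) (u ε)) ∧
  MemOrlicz Φ ((volume.restrict Q).prod μ) u₀ ∧
  ∀ h ∈ testTensor Q (CInf T : Set (Ω → ℝ)),
    Tendsto (fun ε : ℝ =>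
        ∫ p, u ε p * h (p.1, T (ε⁻¹ • p.1) p.2) ∂((volume.restrict Q).prod μ))
      (𝓝[>] 0) (𝓝 (∫ p, u₀ p * h p ∂((volume.restrict Q).prod μ)))

end Stochastic

end

set_option linter.unusedSectionVars false

noncomputable section

/-! ### Growth of Young functions satisfying the `Δ'`-condition together with their conjugate -/

/-! The condition `Δ'` bounds `Φ (t s)` above by a multiple of `Φ t Φ s`, and `Δ'` for the conjugate
dualizes to a bound from below. Hence `x ↦ log Φ (e^x)` is monotone and quasi-additive, so it stays
at bounded distance from a linear function: `Φ` is equivalent to `t ^ p`, and superlinear growth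
forces `1 < p` (`exists_rpow_equiv`). All Orlicz spaces are then `L^p` spaces with equivalent norms.
Slicing identifies `L^p(Q × Ω)` with `L^p(Q; L^p(Ω))`, and `W^1_0` becomes a closed subspace
`sobolev0` of pairs (function, gradient).

The central device is unfolding. Composition with `(x, ω) ↦ (x, T(-x/ε) ω)` is an isometry of `L^p(Q
× Ω)`, because every `T y` preserves `μ`. It turns `F_ε` into the fixed functional `energy`, `G ↦ ∬
f(ω, G)`, minimized over a subspace `unfoldedGraph` depending on `ε`, and it turns two-scale
convergence in the mean into weak convergence of the unfolded functions. What remains is a Mosco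
type convergence of these subspaces to `limitGraph`, the pairs `(U, DU + b)` with `U` invariant and
`b(x)` in the closure of the stochastic gradients.

Weak limits lie in `limitGraph` (`WeakLim.mem_limitGraph`). Integrating an unfolded pair `(u, g)`
against `φ(x)` gives a function on `Ω` in the domain of the closed stochastic gradient, with
gradient `ε (∫ φ g + ∫ u ∂φ)` (`pairing_unfPair_mem_gradGraph`). As `ε → 0` the function becomes
invariant, while the bracket stays in the closed space of stochastic gradients. Conditional
expectation on the invariant sets absorbs the unfolding, preserves Sobolev pairs and kills
stochastic gradients; it therefore identifies `DU` with the average of the limit gradient, and the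
rest is `b`.

Conversely, each gradient part of `limitGraph` is a strong limit of unfolded gradients
(`snd_mem_recoverable_of_mem_limitGraph`). Invariant Sobolev pairs are fixed by unfolding, and `ε
φ(x) ψ(T(x/ε) ω)` has unfolded gradient `φ D_ω ψ + O(ε)`; the fields `φ ⊗ D_ω ψ` span a dense
subspace of the admissible `b`.

Finally, `energy` is continuous, strictly convex and, by the Poincaré inequality, coercive uniformly
in `ε`. Uniform convexity of `L^p` provides weak limits along arbitrary filters
(`UnifConvexFun.exists_weakLim`), every weak limit of minimizers minimizes over `limitGraph`, and
uniqueness of that minimizer makes the whole family converge. The extended gradient `dbar` is a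
closed embedding of `W^1_# L^Φ(Ω)` onto the closure of the stochastic gradients, which translates
the result back to pairs `(u₀, u₁)`. -/

/-- A monotone quasi-additive function is at bounded distance from a linear one. -/
theorem exists_linear_approx_of_quasiAdditive {g : ℝ → ℝ} (hm : Monotone g) {C : ℝ}
    (h : ∀ x y, |g (x + y) - g x - g y| ≤ C) : ∃ p D : ℝ, ∀ x, |g x - p * x| ≤ D := by
  have hC : 0 ≤ C := (abs_nonneg _).trans (h 0 0)
  have hmul : ∀ (n : ℕ) (x : ℝ), |g ((n + 1 : ℕ) * x) - (n + 1 : ℕ) * g x| ≤ n * C := by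
    intro n x
    induction n with
    | zero => simp
    | succ n ih =>
      have h1 := h ((n + 1 : ℕ) * x) x
      have h2 : ((n + 1 : ℕ) * x : ℝ) + x = (n + 1 + 1 : ℕ) * x := by push_cast; ring
      rw [h2] at h1
      rw [abs_le] at *
      push_cast at *
      constructor <;> nlinarith [ih.1, ih.2, h1.1, h1.2]
  -- Computing `g ((m + 1) (n + 1))` in two ways compares `g (m + 1) / (m + 1)` with `g (n + 1) / (n
  -- + 1)`. Every lower bound lies below every upper bound, so the supremum `p` of the former
  -- separates them.
  have key : ∀ m n : ℕ, (g (m + 1 : ℕ) - C) / (m + 1 : ℕ) ≤ (g (n + 1 : ℕ) + C) / (n + 1 : ℕ) := by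
    intro m n
    have h1 := hmul n (m + 1 : ℕ)
    have h2 := hmul m (n + 1 : ℕ)
    rw [mul_comm ((m + 1 : ℕ) : ℝ) ((n + 1 : ℕ) : ℝ)] at h2
    rw [div_le_div_iff₀ (by positivity) (by positivity)]
    rw [abs_le] at h1 h2
    push_cast at *
    nlinarith [h1.1, h1.2, h2.1, h2.2]
  set p : ℝ := ⨆ m : ℕ, (g (m + 1 : ℕ) - C) / (m + 1 : ℕ)
  have hp1 : ∀ m : ℕ, (g (m + 1 : ℕ) - C) / (m + 1 : ℕ) ≤ p := fun m =>
    le_ciSup (f := fun m : ℕ => (g (m + 1 : ℕ) - C) / (m + 1 : ℕ))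
      ⟨(g (0 + 1 : ℕ) + C) / (0 + 1 : ℕ), by rintro _ ⟨k, rfl⟩; exact key k 0⟩ m
  have hp2 : ∀ n : ℕ, p ≤ (g (n + 1 : ℕ) + C) / (n + 1 : ℕ) := fun n => ciSup_le fun m => key m n
  have hnat : ∀ n : ℕ, |g (n + 1 : ℕ) - p * (n + 1 : ℕ)| ≤ C := by
    intro n
    have h1 := hp1 n
    have h2 := hp2 n
    have h3 : (0 : ℝ) < (n + 1 : ℕ) := by positivity
    rw [div_le_iff₀ h3] at h1
    rw [le_div_iff₀ h3] at h2
    rw [abs_le]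
    constructor <;> linarith
  -- Monotonicity traps `g y` between its values at consecutive integers; rounding `y` changes `p *
  -- y` by at most `|p|`.
  have hpos : ∀ y : ℝ, 1 ≤ y → |g y - p * y| ≤ C + |p| := by
    intro y hy
    obtain ⟨n, hn⟩ : ∃ n : ℕ, ⌊y⌋₊ = n + 1 :=
      ⟨⌊y⌋₊ - 1, by have := (Nat.one_le_floor_iff y).2 hy; omega⟩
    have h1 := Nat.floor_le (zero_le_one.trans hy)
    have h2 := Nat.lt_floor_add_one y
    rw [hn] at h1 h2
    have h3 := hm h1
    have h4 := hm h2.le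
    have h5 := hnat n
    have h6 := hnat (n + 1)
    rw [abs_le] at h5 h6
    push_cast at *
    have h7 : p * (y - (n + 1)) ≤ |p| := by
      calc p * (y - (n + 1)) ≤ |p| * (y - (n + 1)) :=
            mul_le_mul_of_nonneg_right (le_abs_self p) (by linarith)
        _ ≤ |p| * 1 := mul_le_mul_of_nonneg_left (by linarith) (abs_nonneg p)
        _ = |p| := mul_one _
    have h8 : p * ((n + 1 + 1) - y) ≤ |p| := by
      calc p * ((n + 1 + 1) - y) ≤ |p| * ((n + 1 + 1) - y) :=
            mul_le_mul_of_nonneg_right (le_abs_self p) (by linarith)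
        _ ≤ |p| * 1 := mul_le_mul_of_nonneg_left (by linarith) (abs_nonneg p)
        _ = |p| := mul_one _
    rw [abs_le]
    constructor <;> nlinarith [h5.1, h5.2, h6.1, h6.2]
  -- An arbitrary `x` is translated beyond `1` by a natural number. The errors are `C + |p|` from
  -- `hpos`, `C` from `hnat` and `C` from quasi-additivity.
  refine ⟨p, 3 * C + |p|, fun x => ?_⟩
  obtain ⟨n, hn⟩ := exists_nat_ge (1 - x)
  have h1 := hpos (x + (n + 1 : ℕ)) (by push_cast; linarith)
  have h2 := hnat n
  have h3 := h x (n + 1 : ℕ)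
  rw [abs_le] at *
  constructor <;> nlinarith [h1.1, h1.2, h2.1, h2.2, h3.1, h3.2]

/-! ### Conjugates, supporting lines and power growth. -/

namespace YoungFunction

variable (Φ : YoungFunction)

theorem bddAbove_conj {t : ℝ} : BddAbove ((fun s : ℝ => s * t - Φ s) '' Ici 0) := by
  obtain ⟨R, hR⟩ := (Φ.tendsto_atTop'.eventually (eventually_ge_atTop t)).exists_forall_of_atTop
  refine ⟨max R 1 * |t|, ?_⟩
  rintro _ ⟨s, hs, rfl⟩
  have hs : 0 ≤ s := hs
  have h0 := Φ.nonneg hs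
  have h1 : (0 : ℝ) ≤ max R 1 * |t| := by positivity
  rcases le_total s (max R 1) with h | h
  · have : s * t ≤ max R 1 * |t| :=
      calc s * t ≤ s * |t| := mul_le_mul_of_nonneg_left (le_abs_self t) hs
        _ ≤ max R 1 * |t| := mul_le_mul_of_nonneg_right h (abs_nonneg t)
    show s * t - Φ s ≤ _
    linarith
  · have hs' : 0 < s := lt_of_lt_of_le (by positivity) h
    have h2 := hR s ((le_max_left _ _).trans h)
    rw [le_div_iff₀ hs'] at h2
    show s * t - Φ s ≤ _
    linarith

theorem mul_sub_le_conj {s : ℝ} (hs : 0 ≤ s) (t : ℝ) : s * t - Φ s ≤ youngConj Φ t :=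
  le_csSup Φ.bddAbove_conj ⟨s, hs, rfl⟩

theorem conj_le {t c : ℝ} (h : ∀ s, 0 ≤ s → s * t - Φ s ≤ c) : youngConj Φ t ≤ c :=
  csSup_le ⟨_, ⟨0, by simp, rfl⟩⟩ (by rintro _ ⟨s, hs, rfl⟩; exact h s hs)

/-- The slope is the right derivative at the interior point `w`, which lies between the slopes of
the chords on the left and on the right. -/
theorem exists_supporting_line {w : ℝ} (hw : 0 < w) :
    ∃ v, 0 ≤ v ∧ ∀ u, 0 ≤ u → Φ w + v * (u - w) ≤ Φ u := by
  have hint : w ∈ interior (Ici (0 : ℝ)) := by simpa using hw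
  set v := derivWithin Φ (Ioi w) w
  have h1 : ∀ u, 0 ≤ u → Φ w + v * (u - w) ≤ Φ u := by
    intro u hu
    rcases lt_trichotomy u w with h | rfl | h
    · have h1 := Φ.convexOn'.slope_le_leftDeriv_of_mem_interior (show u ∈ Ici 0 from hu) hint h
      have h2 := Φ.convexOn'.leftDeriv_le_rightDeriv_of_mem_interior hint
      have h3 := h1.trans h2
      rw [slope_def_field, div_le_iff₀ (by linarith)] at h3
      change _ ≤ v * _ at h3
      linarith
    · simp
    · have h1 := Φ.convexOn'.rightDeriv_le_slope_of_mem_interior hint (show u ∈ Ici 0 from hu) h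
      rw [slope_def_field, le_div_iff₀ (by linarith)] at h1
      change v * _ ≤ _ at h1
      linarith
  refine ⟨v, ?_, h1⟩
  -- At `u = 0`, where `Φ` vanishes, a negative slope would force `Φ w < 0`.
  by_contra hv
  have h2 := h1 (w + 1) (by positivity)
  have h3 := Φ.mono hw.le (show w ≤ w + 1 by linarith)
  have h4 := h1 0 le_rfl
  rw [Φ.map_zero] at h4
  push Not at hv
  have h5 := Φ.nonneg hw.le
  nlinarith

/-- By convexity and `Φ 0 = 0`, the slope `Φ t / t` of the chord from the origin is nondecreasing.
-/
theorem le_slope_mul {r u : ℝ} (hr : 0 < r) (hu : r ≤ u) : u * (Φ r / r) ≤ Φ u := by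
  have hu0 : 0 < u := hr.trans_le hu
  have h0 : 0 ≤ r / u := by positivity
  have h1 : r / u ≤ 1 := (div_le_one hu0).2 hu
  have hc := Φ.convexOn'.2 (show u ∈ Ici (0 : ℝ) from hu0.le) (show (0 : ℝ) ∈ Ici (0 : ℝ) by simp)
    h0 (show 0 ≤ 1 - r / u by linarith) (by ring)
  simp only [smul_eq_mul, mul_zero, add_zero, Φ.map_zero] at hc
  rw [div_mul_cancel₀ _ hu0.ne'] at hc
  calc u * (Φ r / r) ≤ u * ((r / u * Φ u) / r) := by gcongr
    _ = Φ u := by field_simp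

/-- If `Φ` and its conjugate satisfy `Δ'`, then `Φ` is almost supermultiplicative. -/
theorem exists_mul_le (hΦ' : DeltaPrime Φ) (hΨ' : DeltaPrime (youngConj Φ)) :
    ∃ c : ℝ, 0 < c ∧ ∀ r q, 0 < r → 0 < q → c * (Φ r * Φ q) ≤ Φ (r * q) := by
  obtain ⟨β, hβ, hΦ⟩ := hΦ'
  obtain ⟨γ, hγ, hΨ⟩ := hΨ'
  -- Testing the supremum with `s = r` gives this bound. In `hconj'` the terms with `u ≤ r` are at
  -- most `Φ r`, and those with `u ≥ r` are nonpositive since slopes increase. Together with `Δ'`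
  -- for the conjugate, `Ψ (2 Φ r / r)` is comparable to `Φ r`.
  have hconj : ∀ r, 0 < r → Φ r ≤ youngConj Φ (2 * (Φ r / r)) := fun r hr => by
    refine le_trans (le_of_eq ?_) (Φ.mul_sub_le_conj hr.le _)
    field_simp
    ring
  have hconj' : ∀ r, 0 < r → youngConj Φ (Φ r / r) ≤ Φ r := fun r hr => by
    refine Φ.conj_le fun u hu => ?_
    rcases le_total u r with h | h
    · have h1 : u * (Φ r / r) ≤ r * (Φ r / r) :=
        mul_le_mul_of_nonneg_right h (div_nonneg (Φ.nonneg hr.le) hr.le)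
      have h2 : r * (Φ r / r) = Φ r := by field_simp
      linarith [Φ.nonneg hu]
    · linarith [Φ.le_slope_mul hr h, Φ.nonneg hr.le]
  set Ψ := youngConj Φ
  have hΨ2 : 0 < Ψ 2 := by
    obtain ⟨t, ht1, ht⟩ : ∃ t, Φ t / t < 1 ∧ 0 < t :=
      ((Φ.tendsto_zero'.eventually (gt_mem_nhds one_pos)).and self_mem_nhdsWithin).exists
    rw [div_lt_one ht] at ht1
    exact lt_of_lt_of_le (by linarith) (Φ.mul_sub_le_conj ht.le 2)
  set K := γ * Ψ 2
  have hK : 0 < K := by positivity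
  have hup : ∀ r, 0 < r → Ψ (2 * (Φ r / r)) ≤ K * Φ r := fun r hr => by
    calc Ψ (2 * (Φ r / r)) ≤ γ * (Ψ 2 * Ψ (Φ r / r)) :=
          hΨ 2 _ (by norm_num) (div_nonneg (Φ.nonneg hr.le) hr.le)
      _ ≤ γ * (Ψ 2 * Φ r) := by gcongr; exact hconj' r hr
      _ = K * Φ r := by simp only [K]; ring
  -- This is the conjugate, in the variable `v`, of the inequality `Ψ (v s) ≤ γ Ψ s Ψ v`. A
  -- supporting line of `Φ` at `x s / (γ Ψ s)` supplies the optimal `v` and replaces an appeal to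
  -- biconjugation.
  have hdual : ∀ s x, 0 < s → 0 < x → 0 < Ψ s →
      γ * Ψ s * Φ (x * s / (γ * Ψ s)) ≤ Φ x := by
    intro s x hs hx hΨs
    set a := γ * Ψ s
    have ha : 0 < a := by positivity
    obtain ⟨v, hv, hline⟩ := Φ.exists_supporting_line (show 0 < x * s / a by positivity)
    have h1 : Ψ v ≤ x * s / a * v - Φ (x * s / a) := Φ.conj_le fun u hu => by
      have := hline u hu
      linarith
    have h2 : Ψ (v * s) ≤ a * Ψ v := (hΨ v s hv hs.le).trans (by simp only [a]; linarith)
    have h3 := Φ.mul_sub_le_conj hx.le (v * s)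
    have h4 : a * Ψ v ≤ a * (x * s / a * v - Φ (x * s / a)) := by gcongr
    have h5 : a * (x * s / a * v - Φ (x * s / a)) = x * (v * s) - a * Φ (x * s / a) := by
      field_simp
    change x * (v * s) - Φ x ≤ Ψ (v * s) at h3
    linarith
  -- For `s = 2 Φ r / r` and `x = r q` the argument in `hdual` is `2 q Φ r / (γ Ψ s)`, at least `κ
  -- q` because `Ψ s ≤ K Φ r`. The factor `κ` is then removed by `Δ'` for `Φ` in the form `Φ q ≤ β Φ
  -- κ⁻¹ Φ (κ q)`.
  set κ := 2 / (γ * K)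
  have hκ : 0 < κ := by positivity
  have hκ' := Φ.pos' κ⁻¹ (by positivity)
  refine ⟨γ / (β * Φ κ⁻¹), by positivity, fun r q hr hq => ?_⟩
  have hΦr := Φ.pos' r hr
  set s := 2 * (Φ r / r)
  have hs : 0 < s := by positivity
  have h1 : Φ r ≤ Ψ s := hconj r hr
  have hΨs : 0 < Ψ s := hΦr.trans_le h1
  have h2 := hdual s (r * q) hs (by positivity) hΨs
  have h3 : κ * q ≤ r * q * s / (γ * Ψ s) := by
    rw [le_div_iff₀ (by positivity)]
    calc κ * q * (γ * Ψ s) ≤ κ * q * (γ * (K * Φ r)) := by gcongr; exact hup r hr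
      _ = r * q * s := by simp only [κ, s]; field_simp
  have h4 : γ * Φ r * Φ (κ * q) ≤ Φ (r * q) :=
    le_trans (mul_le_mul (by gcongr) (Φ.mono (by positivity) h3) (Φ.nonneg (by positivity))
      (by positivity)) h2
  have h5 : Φ q ≤ β * (Φ κ⁻¹ * Φ (κ * q)) := by
    have := hΦ κ⁻¹ (κ * q) (by positivity) (by positivity)
    rwa [inv_mul_cancel_left₀ hκ.ne'] at this
  calc γ / (β * Φ κ⁻¹) * (Φ r * Φ q) ≤ γ / (β * Φ κ⁻¹) * (Φ r * (β * (Φ κ⁻¹ * Φ (κ * q)))) := by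
        gcongr
    _ = γ * Φ r * Φ (κ * q) := by
        generalize Φ κ⁻¹ = z at *
        field_simp
    _ ≤ _ := h4

/-- If `Φ` and its conjugate satisfy `Δ'`, then `Φ` is equivalent to a power `t ^ p`, `1 < p`. -/
theorem exists_rpow_equiv (hΦ' : DeltaPrime Φ) (hΨ' : DeltaPrime (youngConj Φ)) :
    ∃ p a b : ℝ, 1 < p ∧ 0 < a ∧ 0 < b ∧
      ∀ t, 0 ≤ t → a * t ^ p ≤ Φ t ∧ Φ t ≤ b * t ^ p := by
  obtain ⟨c, hc, hlow⟩ := Φ.exists_mul_le hΦ' hΨ'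
  obtain ⟨β, hβ, hup⟩ := hΦ'
  -- In logarithmic variables the two multiplicative bounds say that `g` is quasi-additive.
  set g : ℝ → ℝ := fun x => Real.log (Φ (Real.exp x))
  have hpos : ∀ x, 0 < Φ (Real.exp x) := fun x => Φ.pos' _ (Real.exp_pos x)
  have hg : Monotone g := fun x y hxy =>
    Real.log_le_log (hpos x) (Φ.mono (Real.exp_pos x).le (Real.exp_le_exp.2 hxy))
  have hquasi : ∀ x y, |g (x + y) - g x - g y| ≤ max (Real.log β) (-Real.log c) := by
    intro x y
    have h1 := hup _ _ (Real.exp_pos x).le (Real.exp_pos y).le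
    have h2 := hlow _ _ (Real.exp_pos x) (Real.exp_pos y)
    rw [← Real.exp_add] at h1 h2
    have hxy := mul_pos (hpos x) (hpos y)
    have h3 := Real.log_le_log (hpos _) h1
    have h4 := Real.log_le_log (mul_pos hc hxy) h2
    rw [Real.log_mul hβ.ne' hxy.ne', Real.log_mul (hpos x).ne' (hpos y).ne'] at h3
    rw [Real.log_mul hc.ne' hxy.ne', Real.log_mul (hpos x).ne' (hpos y).ne'] at h4
    have h5 := le_max_left (Real.log β) (-Real.log c)
    have h6 := le_max_right (Real.log β) (-Real.log c)
    simp only [g]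
    rw [abs_le]
    constructor <;> linarith
  obtain ⟨p, D, hpD⟩ := exists_linear_approx_of_quasiAdditive hg hquasi
  have hbd : ∀ t, 0 < t → Real.exp (-D) * t ^ p ≤ Φ t ∧ Φ t ≤ Real.exp D * t ^ p := by
    intro t ht
    have h := hpD (Real.log t)
    simp only [g, Real.exp_log ht] at h
    rw [abs_le] at h
    have hΦt := Φ.pos' t ht
    rw [Real.rpow_def_of_pos ht, ← Real.exp_add, ← Real.exp_add, ← Real.le_log_iff_exp_le hΦt,
      ← Real.log_le_iff_le_exp hΦt]
    constructor <;> linarith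
  -- For `p ≤ 1` the quotient `Φ t / t` would stay below `exp D` for `t ≥ 1`, against superlinear
  -- growth.
  have hp : 1 < p := by
    by_contra hp
    push Not at hp
    obtain ⟨t, ht, ht1⟩ := ((Φ.tendsto_atTop'.eventually (eventually_gt_atTop (Real.exp D))).and
      (eventually_ge_atTop 1)).exists
    have ht0 : 0 < t := by linarith
    rw [lt_div_iff₀ ht0] at ht
    have h1 := (hbd t ht0).2
    have h2 : t ^ p ≤ t := by
      calc t ^ p ≤ t ^ (1 : ℝ) := Real.rpow_le_rpow_of_exponent_le ht1 hp
        _ = t := Real.rpow_one t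
    have h3 := mul_le_mul_of_nonneg_left h2 (Real.exp_pos D).le
    linarith
  refine ⟨p, Real.exp (-D), Real.exp D, hp, Real.exp_pos _, Real.exp_pos _, fun t ht => ?_⟩
  rcases ht.eq_or_lt with rfl | ht
  · rw [Φ.map_zero, Real.zero_rpow (by linarith)]
    simp
  · exact hbd t ht

end YoungFunction

/-! ### Orlicz spaces of Young functions equivalent to a power -/

namespace YoungFunction

/-- `Φ` is equivalent to the power `t ^ p` with constants `a` and `b`, and `1 < p`. -/
structure IsPower (Φ : YoungFunction) (p a b : ℝ) : Prop where
  one_lt : 1 < p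
  lower_pos : 0 < a
  upper_pos : 0 < b
  lower : ∀ t, 0 ≤ t → a * t ^ p ≤ Φ t
  upper : ∀ t, 0 ≤ t → Φ t ≤ b * t ^ p

namespace IsPower

variable {Φ : YoungFunction} {p a b : ℝ} {α : Type*} [MeasurableSpace α] {ν : Measure α}
  {F : Type*} [NormedAddCommGroup F]

theorem pos (h : Φ.IsPower p a b) : 0 < p := zero_lt_one.trans h.one_lt

theorem one_le_ofReal (h : Φ.IsPower p a b) : (1 : ℝ≥0∞) ≤ ENNReal.ofReal p := by
  rw [← ENNReal.ofReal_one]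
  exact ENNReal.ofReal_le_ofReal h.one_lt.le

theorem ofReal_div_mul_enorm_rpow (h : Φ.IsPower p a b) {c δ : ℝ} (hc : 0 < c) (hδ : 0 < δ)
    (x : F) : ENNReal.ofReal (c * (‖x‖ / δ) ^ p) = ENNReal.ofReal (c / δ ^ p) * ‖x‖ₑ ^ p := by
  rw [← ofReal_norm, ENNReal.ofReal_rpow_of_nonneg (norm_nonneg x) h.pos.le,
    ← ENNReal.ofReal_mul (by positivity), Real.div_rpow (norm_nonneg x) hδ.le]
  congr 1
  field_simp

theorem le_modular (h : Φ.IsPower p a b) {δ : ℝ} (hδ : 0 < δ) (u : α → F) :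
    ENNReal.ofReal (a / δ ^ p) * ∫⁻ x, ‖u x‖ₑ ^ p ∂ν
      ≤ ∫⁻ x, ENNReal.ofReal (Φ (‖u x‖ / δ)) ∂ν := by
  rw [← lintegral_const_mul' _ _ ENNReal.ofReal_ne_top]
  refine lintegral_mono fun x => ?_
  simp only
  rw [← h.ofReal_div_mul_enorm_rpow h.lower_pos hδ]
  exact ENNReal.ofReal_le_ofReal (h.lower _ (by positivity))

theorem modular_le (h : Φ.IsPower p a b) {δ : ℝ} (hδ : 0 < δ) (u : α → F) :
    ∫⁻ x, ENNReal.ofReal (Φ (‖u x‖ / δ)) ∂ν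
      ≤ ENNReal.ofReal (b / δ ^ p) * ∫⁻ x, ‖u x‖ₑ ^ p ∂ν := by
  rw [← lintegral_const_mul' _ _ ENNReal.ofReal_ne_top]
  refine lintegral_mono fun x => ?_
  simp only
  rw [← h.ofReal_div_mul_enorm_rpow h.upper_pos hδ]
  exact ENNReal.ofReal_le_ofReal (h.upper _ (by positivity))

theorem eLpNorm_rpow (h : Φ.IsPower p a b) (u : α → F) :
    eLpNorm u (ENNReal.ofReal p) ν ^ p = ∫⁻ x, ‖u x‖ₑ ^ p ∂ν := by
  have hp := h.pos
  rw [eLpNorm_eq_lintegral_rpow_enorm_toReal (by simpa using hp) ENNReal.ofReal_ne_top,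
    ENNReal.toReal_ofReal hp.le, ← ENNReal.rpow_mul, one_div, inv_mul_cancel₀ hp.ne',
    ENNReal.rpow_one]

theorem memOrlicz_iff (h : Φ.IsPower p a b) {u : α → F} :
    MemOrlicz Φ ν u ↔ MemLp u (ENNReal.ofReal p) ν := by
  refine and_congr_right fun _ => ⟨?_, fun hu => ⟨1, one_pos, ?_⟩⟩
  · rintro ⟨δ, hδ, hfin⟩
    have h1 := (h.le_modular (ν := ν) hδ u).trans_lt hfin
    rw [← h.eLpNorm_rpow] at h1
    by_contra hn
    rw [not_lt, top_le_iff] at hn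
    rw [hn, ENNReal.top_rpow_of_pos h.pos, ENNReal.mul_top] at h1
    · exact lt_irrefl _ h1
    · have := h.lower_pos
      have : 0 < a / δ ^ p := by positivity
      simpa using this
  · refine (h.modular_le one_pos u).trans_lt (ENNReal.mul_lt_top ENNReal.ofReal_lt_top ?_)
    rw [← h.eLpNorm_rpow]
    exact ENNReal.rpow_lt_top_of_nonneg h.pos.le hu.ne

/-- Each `δ` admissible in the Luxemburg infimum satisfies `a ‖u‖_p ^ p ≤ δ ^ p`. -/
theorem mul_eLpNorm_le_luxNorm (h : Φ.IsPower p a b) (u : α → F) :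
    ENNReal.ofReal (a ^ (1 / p)) * eLpNorm u (ENNReal.ofReal p) ν ≤ luxNorm Φ ν u := by
  have ha := h.lower_pos
  have hp := h.pos
  refine le_iInf fun δ => le_iInf fun hδ => le_iInf fun hI => ?_
  have h1 := (h.le_modular (ν := ν) hδ u).trans hI
  rw [← h.eLpNorm_rpow] at h1
  rw [← ENNReal.rpow_le_rpow_iff hp, ENNReal.mul_rpow_of_nonneg _ _ hp.le,
    ENNReal.ofReal_rpow_of_nonneg (by positivity) hp.le, ← Real.rpow_mul ha.le, one_div,
    inv_mul_cancel₀ hp.ne', Real.rpow_one, ENNReal.ofReal_rpow_of_nonneg hδ.le hp.le]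
  have h2 : a = δ ^ p * (a / δ ^ p) := by field_simp
  rw [h2, ENNReal.ofReal_mul (by positivity), mul_assoc]
  exact (mul_le_mul_right h1 _).trans (mul_one _).le

theorem luxNorm_le_mul_eLpNorm (h : Φ.IsPower p a b) (u : α → F) :
    luxNorm Φ ν u ≤ ENNReal.ofReal (b ^ (1 / p)) * eLpNorm u (ENNReal.ofReal p) ν := by
  have hb := h.upper_pos
  have hp := h.pos
  have hb' : 0 < b ^ (1 / p) := by positivity
  rcases eq_or_ne (eLpNorm u (ENNReal.ofReal p) ν) ∞ with hn | hn
  · rw [hn, ENNReal.mul_top (by simpa using hb')]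
    exact le_top
  set r := (eLpNorm u (ENNReal.ofReal p) ν).toReal
  have hr : eLpNorm u (ENNReal.ofReal p) ν = ENNReal.ofReal r := (ENNReal.ofReal_toReal hn).symm
  have hr0 : 0 ≤ r := ENNReal.toReal_nonneg
  rw [hr, ← ENNReal.ofReal_mul hb'.le]
  refine ENNReal.le_of_forall_pos_le_add fun ε hε _ => ?_
  have hε : (0 : ℝ) < ε := by exact_mod_cast hε
  -- The added `ε` keeps `δ` positive when the `L^p` norm vanishes.
  set δ : ℝ := b ^ (1 / p) * r + ε
  have hδ : 0 < δ := by positivity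
  have hI : ∫⁻ x, ENNReal.ofReal (Φ (‖u x‖ / δ)) ∂ν ≤ 1 := by
    refine (h.modular_le hδ u).trans ?_
    rw [← h.eLpNorm_rpow, hr, ENNReal.ofReal_rpow_of_nonneg hr0 hp.le,
      ← ENNReal.ofReal_mul (by positivity), ← ENNReal.ofReal_one]
    refine ENNReal.ofReal_le_ofReal ?_
    rw [div_mul_eq_mul_div, div_le_one (by positivity)]
    calc b * r ^ p = (b ^ (1 / p) * r) ^ p := by
          rw [Real.mul_rpow hb'.le hr0, ← Real.rpow_mul hb.le, one_div, inv_mul_cancel₀ hp.ne',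
            Real.rpow_one]
      _ ≤ δ ^ p := Real.rpow_le_rpow (by positivity) (by simp only [δ]; linarith) hp.le
  refine (iInf_le_of_le δ (iInf_le_of_le hδ (iInf_le_of_le hI le_rfl))).trans ?_
  simp only [δ]
  rw [ENNReal.ofReal_add (by positivity) hε.le]
  simp

end IsPower

end YoungFunction

/-! ### Uniformly convex functions and weak limits along filters -/

section WeakLimits

variable {ι Z : Type*} [NormedAddCommGroup Z] [NormedSpace ℝ Z]

/-- `z₀` lies in every closed convex set that eventually contains `z i` along `l`. -/
def WeakLim (l : Filter ι) (z : ι → Z) (z₀ : Z) : Prop :=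
  ∀ C : Set Z, IsClosed C → Convex ℝ C → (∀ᶠ i in l, z i ∈ C) → z₀ ∈ C

/-- A convex function that is uniformly convex on its sublevel sets. -/
structure UnifConvexFun (M : Z → ℝ) : Prop where
  continuous : Continuous M
  convex : ConvexOn ℝ univ M
  nonneg : ∀ z, 0 ≤ M z
  gap : ∀ R δ : ℝ, 0 < δ → ∃ η : ℝ, 0 < η ∧ ∀ x y, M x ≤ R → M y ≤ R → δ ≤ ‖x - y‖ →
    M ((1 / 2 : ℝ) • (x + y)) ≤ (M x + M y) / 2 - η

theorem WeakLim.map {W : Type*} [NormedAddCommGroup W] [NormedSpace ℝ W] {l : Filter ι}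
    {z : ι → Z} {z₀ : Z} (h : WeakLim l z z₀) (A : Z →L[ℝ] W) :
    WeakLim l (fun i => A (z i)) (A z₀) := fun C hC hC' hz =>
  h (A ⁻¹' C) (hC.preimage A.continuous) (hC'.linear_preimage A.toLinearMap) hz

theorem WeakLim.le_of_eventually_le {l : Filter ι} {z : ι → Z} {z₀ : Z} (h : WeakLim l z z₀)
    {E : Z → ℝ} (hE : Continuous E) (hE' : ConvexOn ℝ univ E) {c : ℝ}
    (hz : ∀ᶠ i in l, E (z i) ≤ c) : E z₀ ≤ c := by
  have := h {x | E x ≤ c} (isClosed_le hE continuous_const)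
    (by simpa using hE'.convex_le c) hz
  exact this

theorem WeakLim.eq_zero_of_tendsto_norm {l : Filter ι} {z : ι → Z} {z₀ : Z} (h : WeakLim l z z₀)
    (hz : Tendsto (fun i => ‖z i‖) l (𝓝 0)) : z₀ = 0 := by
  rw [← norm_le_zero_iff]
  refine le_of_forall_pos_le_add fun ε hε => ?_
  rw [zero_add]
  exact h.le_of_eventually_le continuous_norm (convexOn_norm convex_univ)
    (hz.eventually (eventually_le_nhds hε))

/-- A bounded real family converges along an ultrafilter by compactness. Eventually it lies in each
closed ball about its limit, so `A z₀` lies in all these balls and equals the limit. -/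
theorem WeakLim.tendsto {U : Ultrafilter ι} {z : ι → Z} {z₀ : Z}
    (h : WeakLim (U : Filter ι) z z₀) (A : Z →L[ℝ] ℝ) {B : ℝ} (hB : ∀ᶠ i in (U : Filter ι), ‖z i‖ ≤ B) :
    Tendsto (fun i => A (z i)) U (𝓝 (A z₀)) := by
  have hbd : ∀ᶠ i in (U : Filter ι), A (z i) ∈ Metric.closedBall (0 : ℝ) (‖A‖ * B) := by
    filter_upwards [hB] with i hi
    rw [mem_closedBall_zero_iff]
    exact (A.le_opNorm _).trans (mul_le_mul_of_nonneg_left hi (norm_nonneg _))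
  obtain ⟨c, -, hc⟩ := (isCompact_closedBall (0 : ℝ) (‖A‖ * B)).ultrafilter_le_nhds
    (U.map fun i => A (z i)) (le_principal_iff.2 hbd)
  have hc : Tendsto (fun i => A (z i)) U (𝓝 c) := hc
  have : A z₀ = c := by
    rw [← sub_eq_zero, ← abs_nonpos_iff]
    refine le_of_forall_pos_le_add fun ε hε => ?_
    rw [zero_add]
    have h1 : A z₀ ∈ Metric.closedBall c ε := (h.map A) _ Metric.isClosed_closedBall
      (convex_closedBall c ε) (hc.eventually (Metric.closedBall_mem_nhds c hε))
    simpa [Real.dist_eq] using h1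
  rwa [this]

/-- Weak sequential compactness in the form needed for direct methods: a family on which a
uniformly convex function is bounded has a weak limit along every filter. -/
theorem UnifConvexFun.exists_weakLim [CompleteSpace Z] {M : Z → ℝ} (hM : UnifConvexFun M)
    {l : Filter ι} [l.NeBot] {z : ι → Z} {R : ℝ} (hz : ∀ᶠ i in l, M (z i) ≤ R) :
    ∃ z₀, WeakLim l z z₀ := by
  -- `K S` is the closed convex hull of a tail, `d S` the infimum of `M` on it, and `D` the supremum
  -- of `d S` over all tails. The weak limit is obtained as the limit of near-minimizers of `M` on
  -- tails whose `d S` is close to `D`.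
  set K : Set ι → Set Z := fun S => closure (convexHull ℝ (z '' S))
  have hKconv : ∀ S, Convex ℝ (K S) := fun S => (convex_convexHull ℝ _).closure
  have hKmono : ∀ {S S'}, S ⊆ S' → K S ⊆ K S' := fun h =>
    closure_mono (convexHull_mono (image_mono h))
  set S₀ : Set ι := {i | M (z i) ≤ R}
  have hS₀ : S₀ ∈ l := hz
  have hne : ∀ S ∈ l, (K S).Nonempty := fun S hS =>
    ((l.nonempty_of_mem hS).image z).convexHull.closure
  set d : Set ι → ℝ := fun S => sInf (M '' K S)
  have hbdd : ∀ S, BddBelow (M '' K S) := fun S =>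
    ⟨0, by rintro _ ⟨x, -, rfl⟩; exact hM.nonneg x⟩
  have hdle : ∀ S, ∀ x ∈ K S, d S ≤ M x := fun S x hx => csInf_le (hbdd S) ⟨x, hx, rfl⟩
  have hdR : ∀ S ∈ l, d S ≤ R := by
    intro S hS
    obtain ⟨i, hi, hi'⟩ := l.nonempty_of_mem (inter_mem hS hS₀)
    exact (hdle S (z i) (subset_closure (subset_convexHull ℝ _ ⟨i, hi, rfl⟩))).trans hi'
  have hdmono : ∀ {S S'}, S ∈ l → S ⊆ S' → d S' ≤ d S := fun hS h =>
    csInf_le_csInf (hbdd _) ((hne _ hS).image M) (image_mono (hKmono h))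
  set D : ℝ := sSup (d '' l.sets)
  have hDbdd : BddAbove (d '' l.sets) := ⟨R, by rintro _ ⟨S, hS, rfl⟩; exact hdR S hS⟩
  have hdD : ∀ S ∈ l, d S ≤ D := fun S hS => le_csSup hDbdd ⟨S, hS, rfl⟩
  have hex : ∀ e : ℝ, 0 < e → ∃ S ∈ l, D - e < d S := by
    intro e he
    obtain ⟨_, ⟨S, hS, rfl⟩, h⟩ := exists_lt_of_lt_csSup
      (show (d '' l.sets).Nonempty from ⟨_, univ, l.univ_sets, rfl⟩) (sub_lt_self D he)
    exact ⟨S, hS, h⟩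
  have hpt : ∀ S ∈ l, ∀ e : ℝ, 0 < e → ∃ x ∈ K S, M x < D + e := by
    intro S hS e he
    obtain ⟨_, ⟨x, hx, rfl⟩, h⟩ := exists_lt_of_csInf_lt ((hne S hS).image M)
      (show sInf (M '' K S) < D + e from lt_of_le_of_lt (hdD S hS) (by linarith))
    exact ⟨x, hx, h⟩
  choose! η hη hgap using hM.gap (D + 1)
  -- Two points of `K S` with `M < D + e` at distance at least `δ` would have a midpoint in `K S`
  -- with `M < D + e - η δ ≤ D - e < d S`.
  have hpair : ∀ δ : ℝ, 0 < δ → ∀ e, 0 < e → e ≤ η δ / 2 → e ≤ 1 → ∀ S, D - e < d S →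
      ∀ x ∈ K S, ∀ y ∈ K S, M x < D + e → M y < D + e → ‖x - y‖ < δ := by
    intro δ hδ e he he1 he2 S hS x hx y hy hMx hMy
    by_contra hcon
    push Not at hcon
    have h1 := hgap δ hδ x y (by linarith) (by linarith) hcon
    have h2 : (1 / 2 : ℝ) • (x + y) ∈ K S := by
      rw [smul_add]
      exact hKconv S hx hy (by norm_num) (by norm_num) (by norm_num)
    have h3 := hdle S _ h2
    linarith
  set e : ℕ → ℝ := fun n => min 1 (η (1 / (n + 1 : ℝ)) / 2)
  have hδ : ∀ n : ℕ, (0 : ℝ) < 1 / (n + 1 : ℝ) := fun n => by positivity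
  have he : ∀ n, 0 < e n := fun n => lt_min one_pos (half_pos (hη _ (hδ n)))
  choose S hSl hSd using fun n => hex (e n) (he n)
  -- Intersecting finitely many tails puts `x k` into `K (S n)` for all `n ≤ k`, so that `hpair`
  -- applies to every later pair.
  set S' : ℕ → Set ι := fun n => ⋂ k ∈ Finset.range (n + 1), S k
  have hS'l : ∀ n, S' n ∈ l := fun n => (biInter_finset_mem _).2 fun k _ => hSl k
  have hS'S : ∀ {n k}, k ≤ n → S' n ⊆ S k := fun {n k} h =>
    biInter_subset_of_mem (by simpa using Nat.lt_succ_of_le h)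
  set m : ℕ → ℝ := fun n => (Finset.range (n + 1)).inf' ⟨0, by simp⟩ e
  have hm : ∀ n, 0 < m n := fun n => (Finset.lt_inf'_iff _).2 fun k _ => he k
  have hme : ∀ {n k}, k ≤ n → m n ≤ e k := fun {n k} h =>
    Finset.inf'_le _ (by simpa using Nat.lt_succ_of_le h)
  choose x hxK hxM using fun n => hpt (S' n) (hS'l n) (m n) (hm n)
  have hclose : ∀ n, ∀ y ∈ K (S n), M y < D + e n → ∀ k, n ≤ k → ‖x k - y‖ < 1 / (n + 1 : ℝ) := by
    intro n y hy hMy k hk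
    refine hpair _ (hδ n) (e n) (he n) (min_le_right _ _) (min_le_left _ _) (S n) (hSd n) _
      (hKmono (hS'S hk) (hxK k)) y hy ((hxM k).trans_le ?_) hMy
    linarith [hme hk]
  have hcau : CauchySeq x := by
    rw [Metric.cauchySeq_iff']
    intro ε hε
    obtain ⟨n, hn⟩ := exists_nat_one_div_lt hε
    refine ⟨n, fun k hk => ?_⟩
    rw [dist_eq_norm]
    refine (hclose n (x n) (hKmono (hS'S le_rfl) (hxK n)) ((hxM n).trans_le ?_) k hk).trans hn
    linarith [hme (le_refl n)]
  obtain ⟨z₀, hz₀⟩ := cauchySeq_tendsto_of_complete hcau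
  -- Near-minimizers on `K (A ∩ S n)` also lie in `K (S n)`, hence are asymptotic to `x n`. The
  -- limit therefore belongs to the hull of every tail.
  have hmem : ∀ A ∈ l, z₀ ∈ K A := by
    intro A hA
    choose y hyK hyM using fun n => hpt (A ∩ S n) (inter_mem hA (hSl n)) (e n) (he n)
    have hlim : Tendsto y atTop (𝓝 z₀) := by
      have h0 : Tendsto (fun n => x n - y n) atTop (𝓝 0) := by
        rw [tendsto_zero_iff_norm_tendsto_zero]
        refine squeeze_zero (fun _ => norm_nonneg _)
          (fun n => (hclose n (y n) (hKmono inter_subset_right (hyK n)) (hyM n) n le_rfl).le)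
          tendsto_one_div_add_atTop_nhds_zero_nat
      simpa using hz₀.sub h0
    exact isClosed_closure.mem_of_tendsto hlim
      (Eventually.of_forall fun n => hKmono inter_subset_left (hyK n))
  refine ⟨z₀, fun C hC hC' hz => ?_⟩
  have h1 := hmem _ hz
  have h2 : z '' {i | z i ∈ C} ⊆ C := by rintro _ ⟨i, hi, rfl⟩; exact hi
  exact closure_minimal (convexHull_min h2 hC') hC h1

/-- For the maximum norm one component carries the separation and gains `η`; the other only needs
convexity. Nonnegativity keeps each summand below `R`. -/
theorem UnifConvexFun.prod {W : Type*} [NormedAddCommGroup W] [NormedSpace ℝ W] {M : Z → ℝ}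
    {M' : W → ℝ} (h : UnifConvexFun M) (h' : UnifConvexFun M') :
    UnifConvexFun fun z : Z × W => M z.1 + M' z.2 where
  continuous := (h.continuous.comp continuous_fst).add (h'.continuous.comp continuous_snd)
  convex := (h.convex.comp_linearMap (LinearMap.fst ℝ Z W)).add
    (h'.convex.comp_linearMap (LinearMap.snd ℝ Z W))
  nonneg z := add_nonneg (h.nonneg _) (h'.nonneg _)
  gap R δ hδ := by
    obtain ⟨η, hη, hg⟩ := h.gap R δ hδ
    obtain ⟨η', hη', hg'⟩ := h'.gap R δ hδ
    refine ⟨min η η', lt_min hη hη', fun x y hx hy hxy => ?_⟩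
    have e1 := min_le_left η η'
    have e2 := min_le_right η η'
    have n1 := h.nonneg x.1
    have n2 := h.nonneg y.1
    have n3 := h'.nonneg x.2
    have n4 := h'.nonneg y.2
    have c1 := h.convex.2 (mem_univ x.1) (mem_univ y.1) (show (0 : ℝ) ≤ 1 / 2 by norm_num)
      (show (0 : ℝ) ≤ 1 / 2 by norm_num) (by norm_num)
    have c2 := h'.convex.2 (mem_univ x.2) (mem_univ y.2) (show (0 : ℝ) ≤ 1 / 2 by norm_num)
      (show (0 : ℝ) ≤ 1 / 2 by norm_num) (by norm_num)
    rw [← smul_add] at c1 c2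
    simp only [smul_eq_mul] at c1 c2
    simp only [Prod.smul_fst, Prod.smul_snd, Prod.fst_add, Prod.snd_add]
    rw [Prod.norm_def] at hxy
    rcases le_max_iff.1 hxy with hxy | hxy
    · have := hg x.1 y.1 (by linarith) (by linarith) hxy
      linarith
    · have := hg' x.2 y.2 (by linarith) (by linarith) hxy
      linarith

theorem UnifConvexFun.pi {κ : Type*} [Fintype κ] {M : Z → ℝ} (h : UnifConvexFun M) :
    UnifConvexFun fun z : κ → Z => ∑ i, M (z i) where
  continuous := continuous_finsetSum _ fun i _ => h.continuous.comp (continuous_apply i)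
  convex := by
    refine ⟨convex_univ, fun x _ y _ a b ha hb hab => ?_⟩
    simp only [smul_eq_mul, Finset.mul_sum, ← Finset.sum_add_distrib]
    exact Finset.sum_le_sum fun i _ => h.convex.2 (mem_univ (x i)) (mem_univ (y i)) ha hb hab
  nonneg z := Finset.sum_nonneg fun i _ => h.nonneg _
  gap R δ hδ := by
    classical
    obtain ⟨η, hη, hg⟩ := h.gap R δ hδ
    refine ⟨η, hη, fun x y hx hy hxy => ?_⟩
    have hc : ∀ i, M ((1 / 2 : ℝ) • (x i + y i)) ≤ (M (x i) + M (y i)) / 2 := fun i => by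
      have c1 := h.convex.2 (mem_univ (x i)) (mem_univ (y i)) (show (0 : ℝ) ≤ 1 / 2 by norm_num)
        (show (0 : ℝ) ≤ 1 / 2 by norm_num) (by norm_num)
      rw [← smul_add] at c1
      simp only [smul_eq_mul] at c1
      linarith
    obtain ⟨j, hj⟩ : ∃ j, δ ≤ ‖x j - y j‖ := by
      by_contra hcon
      push Not at hcon
      exact absurd hxy (not_le.2 ((pi_norm_lt_iff hδ).2 hcon))
    have hR : ∀ w : κ → Z, ∑ i, M (w i) ≤ R → M (w j) ≤ R := fun w hw =>
      (Finset.single_le_sum (f := fun i => M (w i)) (fun i _ => h.nonneg _)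
        (Finset.mem_univ j)).trans hw
    have hgj := hg (x j) (y j) (hR x hx) (hR y hy) hj
    simp only [Pi.smul_apply, Pi.add_apply]
    rw [← Finset.sum_add_distrib, Finset.sum_div,
      ← Finset.add_sum_erase _ _ (Finset.mem_univ j),
      ← Finset.add_sum_erase _ (fun i => (M (x i) + M (y i)) / 2) (Finset.mem_univ j)]
    have := Finset.sum_le_sum (s := Finset.univ.erase j) fun i _ => hc i
    linarith

end WeakLimits

/-! ### Uniform convexity of `L^p` -/

/-- A quantitative form of the strict convexity of `‖·‖ ^ p`. -/
def PowerUC (F : Type*) [NormedAddCommGroup F] [NormedSpace ℝ F] (p : ℝ) : Prop :=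
  ∀ δ : ℝ, 0 < δ → ∃ η : ℝ, 0 < η ∧ ∀ a b : F, δ * (‖a‖ ^ p + ‖b‖ ^ p) ≤ ‖a - b‖ ^ p →
    ‖(1 / 2 : ℝ) • (a + b)‖ ^ p ≤ (1 - η) * ((‖a‖ ^ p + ‖b‖ ^ p) / 2)

section PowerUC

variable {F : Type*} [NormedAddCommGroup F] {p : ℝ}

section

variable [NormedSpace ℝ F]

theorem convexOn_norm_rpow (hp : 1 ≤ p) : ConvexOn ℝ univ fun x : F => ‖x‖ ^ p := by
  have h := convexOn_norm (E := F) convex_univ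
  refine ⟨convex_univ, fun x _ y _ a b ha hb hab => ?_⟩
  have h1 := (convexOn_rpow hp).2 (norm_nonneg x) (norm_nonneg y) ha hb hab
  have h2 := h.2 (mem_univ x) (mem_univ y) ha hb hab
  exact (Real.rpow_le_rpow (norm_nonneg _) h2 (by linarith)).trans h1

theorem norm_midpoint_rpow_le (hp : 1 ≤ p) (a b : F) :
    ‖(1 / 2 : ℝ) • (a + b)‖ ^ p ≤ (‖a‖ ^ p + ‖b‖ ^ p) / 2 := by
  have c1 := (convexOn_norm_rpow (F := F) hp).2 (mem_univ a) (mem_univ b)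
    (show (0 : ℝ) ≤ 1 / 2 by norm_num) (show (0 : ℝ) ≤ 1 / 2 by norm_num) (by norm_num)
  rw [← smul_add] at c1
  simp only [smul_eq_mul] at c1
  linarith

theorem norm_sub_rpow_le (hp : 1 ≤ p) (a b : F) :
    ‖a - b‖ ^ p ≤ 2 ^ p * (‖a‖ ^ p + ‖b‖ ^ p) := by
  have h := norm_midpoint_rpow_le hp a (-b)
  rw [norm_neg, ← sub_eq_add_neg, norm_smul, Real.mul_rpow (norm_nonneg _) (norm_nonneg _)] at h
  have h2 : ‖(1 / 2 : ℝ)‖ ^ p * 2 ^ p = 1 := by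
    rw [← Real.mul_rpow (norm_nonneg _) (by norm_num)]
    norm_num
  have h3 : (0 : ℝ) < 2 ^ p := by positivity
  have h4 : (0 : ℝ) ≤ ‖a‖ ^ p + ‖b‖ ^ p := by positivity
  calc ‖a - b‖ ^ p = 2 ^ p * (‖(1 / 2 : ℝ)‖ ^ p * ‖a - b‖ ^ p) := by
        rw [← mul_assoc, mul_comm (2 ^ p : ℝ), h2, one_mul]
    _ ≤ 2 ^ p * ((‖a‖ ^ p + ‖b‖ ^ p) / 2) := by gcongr
    _ ≤ _ := by
      have : (‖a‖ ^ p + ‖b‖ ^ p) / 2 ≤ ‖a‖ ^ p + ‖b‖ ^ p := by linarith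
      gcongr

/-- If `|a| ≠ |b|`, strict convexity of `t ^ p` applies. Otherwise `a = -b ≠ 0` and the midpoint
vanishes. -/
theorem abs_midpoint_rpow_lt (hp : 1 < p) {a b : ℝ} (hab : a ≠ b) :
    |(1 / 2 : ℝ) * (a + b)| ^ p < (|a| ^ p + |b| ^ p) / 2 := by
  have h1 : |(1 / 2 : ℝ) * (a + b)| ≤ 1 / 2 * |a| + 1 / 2 * |b| := by
    rw [abs_mul, abs_of_pos (by norm_num : (0 : ℝ) < 1 / 2), ← mul_add]
    gcongr
    exact abs_add_le a b
  by_cases h : |a| = |b|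
  · have hab' : a = -b := (abs_eq_abs.1 h).resolve_left hab
    have hb : b ≠ 0 := fun hb => hab (by rw [hab', hb, neg_zero])
    subst hab'
    rw [neg_add_cancel, mul_zero, abs_zero, Real.zero_rpow (by linarith), abs_neg]
    have : 0 < |b| := abs_pos.2 hb
    positivity
  · have h2 := (strictConvexOn_rpow hp).2 (abs_nonneg a) (abs_nonneg b) h
      (show (0 : ℝ) < 1 / 2 by norm_num) (show (0 : ℝ) < 1 / 2 by norm_num) (by norm_num)
    simp only [smul_eq_mul] at h2
    have h3 := Real.rpow_le_rpow (abs_nonneg _) h1 (show 0 ≤ p by linarith)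
    linarith

/-- By homogeneity it suffices to treat `|a| ^ p + |b| ^ p = 1`. The pairs that are also separated
form a compact set on which the strict midpoint inequality holds, hence holds with a uniform margin.
-/
theorem powerUC_real (hp : 1 < p) : PowerUC ℝ p := by
  intro δ hδ
  have hp0 : 0 < p := by linarith
  have hcont : Continuous fun t : ℝ => |t| ^ p :=
    continuous_abs.rpow_const fun _ => Or.inr hp0.le
  set K : Set (ℝ × ℝ) := {z | |z.1| ^ p + |z.2| ^ p = 1 ∧ δ ≤ |z.1 - z.2| ^ p}
  have hKclosed : IsClosed K := by
    have h1 : IsClosed {z : ℝ × ℝ | |z.1| ^ p + |z.2| ^ p = 1} :=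
      isClosed_eq ((hcont.comp continuous_fst).add (hcont.comp continuous_snd)) continuous_const
    have h2 : IsClosed {z : ℝ × ℝ | δ ≤ |z.1 - z.2| ^ p} :=
      isClosed_le continuous_const (hcont.comp (continuous_fst.sub continuous_snd))
    exact h1.inter h2
  have hKcomp : IsCompact K := by
    refine (isCompact_closedBall (0 : ℝ × ℝ) 1).of_isClosed_subset hKclosed ?_
    rintro ⟨s, t⟩ ⟨h, -⟩
    simp only at h
    have h1 : ∀ r : ℝ, |r| ^ p ≤ 1 → |r| ≤ 1 := fun r hr => by
      have := (Real.rpow_le_rpow_iff (abs_nonneg r) zero_le_one hp0).1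
        (by rwa [Real.one_rpow])
      exact this
    rw [mem_closedBall_zero_iff, Prod.norm_def]
    refine max_le (h1 s ?_) (h1 t ?_)
    · linarith [Real.rpow_nonneg (abs_nonneg t) p]
    · linarith [Real.rpow_nonneg (abs_nonneg s) p]
  obtain ⟨η, hη, hgap⟩ : ∃ η : ℝ, 0 < η ∧ ∀ z ∈ K,
      |(1 / 2 : ℝ) * (z.1 + z.2)| ^ p ≤ (1 - η) * (1 / 2) := by
    rcases K.eq_empty_or_nonempty with hK | hK
    · exact ⟨1, one_pos, by simp [hK]⟩
    obtain ⟨w, hw, hmax⟩ := hKcomp.exists_isMaxOn hK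
      (f := fun z : ℝ × ℝ => |(1 / 2 : ℝ) * (z.1 + z.2)| ^ p)
      (hcont.comp (continuous_const.mul (continuous_fst.add continuous_snd))).continuousOn
    have hne : w.1 ≠ w.2 := by
      intro h
      have := hw.2
      rw [h, sub_self, abs_zero, Real.zero_rpow hp0.ne'] at this
      linarith
    have hlt := abs_midpoint_rpow_lt hp hne
    rw [hw.1] at hlt
    refine ⟨1 - 2 * |(1 / 2 : ℝ) * (w.1 + w.2)| ^ p, by linarith, fun z hz => ?_⟩
    have : |(1 / 2 : ℝ) * (z.1 + z.2)| ^ p ≤ |(1 / 2 : ℝ) * (w.1 + w.2)| ^ p := hmax hz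
    linarith
  refine ⟨η, hη, fun a b hab => ?_⟩
  simp only [Real.norm_eq_abs, smul_eq_mul] at *
  set s : ℝ := |a| ^ p + |b| ^ p
  have hs0 : 0 ≤ s := by positivity
  rcases hs0.eq_or_lt with hs | hs
  · have h1 := norm_midpoint_rpow_le hp.le a b
    simp only [Real.norm_eq_abs, smul_eq_mul] at h1
    change _ ≤ s / 2 at h1
    rw [← hs] at h1 ⊢
    linarith
  set r : ℝ := s ^ (1 / p)
  have hr : 0 < r := by positivity
  have hrp : r ^ p = s := by
    simp only [r]
    rw [← Real.rpow_mul hs0, one_div, inv_mul_cancel₀ hp0.ne', Real.rpow_one]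
  have hsc : ∀ t : ℝ, |t / r| ^ p = |t| ^ p / s := fun t => by
    rw [abs_div, abs_of_pos hr, Real.div_rpow (abs_nonneg t) hr.le, hrp]
  have hK : (a / r, b / r) ∈ K := by
    refine ⟨?_, ?_⟩
    · simp only [hsc]
      rw [← add_div, div_self hs.ne']
    · simp only [← sub_div, hsc]
      rwa [le_div_iff₀ hs]
  have h1 := hgap _ hK
  simp only [← add_div, ← mul_div_assoc, hsc] at h1
  rw [div_le_iff₀ hs] at h1
  linarith

/-- On a sublevel set the sum `‖x‖ ^ p + ‖y‖ ^ p` is less than `2 |R| + 1`, which makes an absolute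
separation relative. It is also at least `δ ^ p / 2 ^ p`, which makes the relative gain absolute. -/
theorem PowerUC.unifConvexFun (hp : 1 < p) (h : PowerUC F p) :
    UnifConvexFun fun x : F => ‖x‖ ^ p where
  continuous := continuous_norm.rpow_const fun _ => Or.inr (by linarith)
  convex := convexOn_norm_rpow hp.le
  nonneg x := by positivity
  gap R δ hδ := by
    have hR : 0 < 2 * |R| + 1 := by positivity
    obtain ⟨η, hη, hg⟩ := h (δ ^ p / (2 * |R| + 1)) (by positivity)
    refine ⟨η * (δ ^ p / 2 ^ p) / 2, by positivity, fun x y hx hy hxy => ?_⟩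
    have h1 : δ ^ p ≤ ‖x - y‖ ^ p := Real.rpow_le_rpow hδ.le hxy (by linarith)
    have h2 : δ ^ p / (2 * |R| + 1) * (‖x‖ ^ p + ‖y‖ ^ p) ≤ δ ^ p := by
      rw [div_mul_eq_mul_div, div_le_iff₀ hR]
      exact mul_le_mul_of_nonneg_left (by linarith [le_abs_self R]) (by positivity)
    have h3 := hg x y (h2.trans h1)
    have h4 : δ ^ p / 2 ^ p ≤ ‖x‖ ^ p + ‖y‖ ^ p := by
      rw [div_le_iff₀ (by positivity), mul_comm]
      exact h1.trans (norm_sub_rpow_le hp.le x y)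
    have h5 := mul_le_mul_of_nonneg_left h4 hη.le
    linarith

end

variable {α : Type*} [MeasurableSpace α] {ν : Measure α}

theorem integrable_norm_rpow_coeFn (hp : 0 < p) (f : Lp F (ENNReal.ofReal p) ν) :
    Integrable (fun x => ‖f x‖ ^ p) ν := by
  have := (Lp.memLp f).integrable_norm_rpow (by simpa using hp) ENNReal.ofReal_ne_top
  rwa [ENNReal.toReal_ofReal hp.le] at this

theorem norm_rpow_eq_integral (hp : 0 < p) (f : Lp F (ENNReal.ofReal p) ν) :
    ‖f‖ ^ p = ∫ x, ‖f x‖ ^ p ∂ν := by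
  have h0 : 0 ≤ ∫ x, ‖f x‖ ^ p ∂ν := integral_nonneg fun x => by positivity
  rw [Lp.norm_def, (Lp.memLp f).eLpNorm_eq_integral_rpow_norm (by simpa using hp)
    ENNReal.ofReal_ne_top, ENNReal.toReal_ofReal hp.le, ENNReal.toReal_ofReal (by positivity),
    ← Real.rpow_mul h0, inv_mul_cancel₀ hp.ne', Real.rpow_one]

/-- Separation in `L^p` gives none at individual points, so the pointwise inequality is first put
into the form `hpt`, valid for all pairs and linear in the `p`-th powers; it can then be integrated.
-/
theorem PowerUC.lp [NormedSpace ℝ F] [Fact (1 ≤ ENNReal.ofReal p)] (hp : 1 < p) (h : PowerUC F p) :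
    PowerUC (Lp F (ENNReal.ofReal p) ν) p := by
  intro δ hδ
  have hp0 : 0 < p := by linarith
  obtain ⟨η, hη, hg⟩ := h (δ / 2) (by positivity)
  set C : ℝ := 2 ^ p
  have hC : 0 < C := by positivity
  -- For nearby `a`, `b` the correction has the harmless sign and convexity suffices. Otherwise the
  -- gain `η (‖a‖ ^ p + ‖b‖ ^ p) / 2` dominates `η / (2 C) * ‖a - b‖ ^ p`.
  have hpt : ∀ a b : F, ‖(1 / 2 : ℝ) • (a + b)‖ ^ p ≤ (‖a‖ ^ p + ‖b‖ ^ p) / 2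
      - η / (2 * C) * (‖a - b‖ ^ p - δ / 2 * (‖a‖ ^ p + ‖b‖ ^ p)) := by
    intro a b
    have hc := norm_midpoint_rpow_le hp.le a b
    have hk : 0 < η / (2 * C) := by positivity
    rcases le_total (δ / 2 * (‖a‖ ^ p + ‖b‖ ^ p)) (‖a - b‖ ^ p) with hab | hab
    · have h1 := hg a b hab
      have h2 := mul_le_mul_of_nonneg_left (norm_sub_rpow_le hp.le a b) hk.le
      have h3 : η / (2 * C) * (2 ^ p * (‖a‖ ^ p + ‖b‖ ^ p)) = η * (‖a‖ ^ p + ‖b‖ ^ p) / 2 := by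
        change η / (2 * C) * (C * _) = _
        field_simp
      have h4 : 0 ≤ η / (2 * C) * (δ / 2 * (‖a‖ ^ p + ‖b‖ ^ p)) := by positivity
      linarith
    · have : η / (2 * C) * (‖a - b‖ ^ p - δ / 2 * (‖a‖ ^ p + ‖b‖ ^ p)) ≤ 0 :=
        mul_nonpos_of_nonneg_of_nonpos hk.le (by linarith)
      linarith
  refine ⟨η * δ / (2 * C), by positivity, fun f g hfg => ?_⟩
  have hint := fun u : Lp F (ENNReal.ofReal p) ν => integrable_norm_rpow_coeFn hp0 u
  have h1 : ‖(1 / 2 : ℝ) • (f + g)‖ ^ p ≤ (‖f‖ ^ p + ‖g‖ ^ p) / 2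
      - η / (2 * C) * (‖f - g‖ ^ p - δ / 2 * (‖f‖ ^ p + ‖g‖ ^ p)) := by
    simp only [norm_rpow_eq_integral hp0]
    have hs := (hint f).add (hint g)
    have hd := (hint (f - g)).sub (hs.const_mul (δ / 2))
    have e0 : ∫ x, (‖f x‖ ^ p + ‖g x‖ ^ p) ∂ν = ∫ x, ‖f x‖ ^ p ∂ν + ∫ x, ‖g x‖ ^ p ∂ν :=
      integral_add (hint f) (hint g)
    have e1 : ∫ x, ((‖f x‖ ^ p + ‖g x‖ ^ p) / 2 - η / (2 * C) *
        (‖(f - g : Lp F (ENNReal.ofReal p) ν) x‖ ^ p - δ / 2 * (‖f x‖ ^ p + ‖g x‖ ^ p))) ∂ν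
        = (∫ x, ‖f x‖ ^ p ∂ν + ∫ x, ‖g x‖ ^ p ∂ν) / 2 - η / (2 * C) *
        (∫ x, ‖(f - g : Lp F (ENNReal.ofReal p) ν) x‖ ^ p ∂ν
          - δ / 2 * (∫ x, ‖f x‖ ^ p ∂ν + ∫ x, ‖g x‖ ^ p ∂ν)) := by
      refine (integral_sub (hs.div_const 2) (hd.const_mul (η / (2 * C)))).trans ?_
      refine congrArg₂ _ ((integral_div _ _).trans (by rw [← e0]; rfl)) ?_
      refine (integral_const_mul _ _).trans (congrArg _ ?_)
      refine (integral_sub (hint (f - g)) (hs.const_mul (δ / 2))).trans (congrArg _ ?_)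
      exact (integral_const_mul _ _).trans (by rw [← e0]; rfl)
    rw [← e1]
    refine integral_mono_ae (hint _) ((hs.div_const 2).sub (hd.const_mul (η / (2 * C)))) ?_
    filter_upwards [Lp.coeFn_smul (1 / 2 : ℝ) (f + g), Lp.coeFn_add f g, Lp.coeFn_sub f g]
      with x e1 e2 e3
    simp only [e1, e2, e3, Pi.smul_apply, Pi.add_apply, Pi.sub_apply]
    exact hpt _ _
  have hk : 0 < η / (2 * C) := by positivity
  have h2 := mul_le_mul_of_nonneg_left hfg hk.le
  have h3 : η / (2 * C) * (δ * (‖f‖ ^ p + ‖g‖ ^ p)) = η * δ / (2 * C) * (‖f‖ ^ p + ‖g‖ ^ p) := by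
    ring
  linarith

end PowerUC

/-! ### Slicing: `L^q(α × Ω) ≃ L^q(α; L^q(Ω))` -/

section Slices

variable {α Ω : Type*} [MeasurableSpace α] [MeasurableSpace Ω] {lam : Measure α} {μ : Measure Ω}
  {q : ℝ≥0∞}

open Classical in
/-- The slice `u (x, ·)`, as an element of `L^q(Ω)`. -/
def sliceFun (q : ℝ≥0∞) (μ : Measure Ω) (u : α × Ω → ℝ) (x : α) : Lp ℝ q μ :=
  if h : MemLp (fun ω => u (x, ω)) q μ then h.toLp _ else 0

theorem sliceFun_eq {u : α × Ω → ℝ} {x : α} (h : MemLp (fun ω => u (x, ω)) q μ) :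
    sliceFun q μ u x = h.toLp _ := dif_pos h

theorem coeFn_sliceFun {u : α × Ω → ℝ} {x : α} (h : MemLp (fun ω => u (x, ω)) q μ) :
    sliceFun q μ u x =ᵐ[μ] fun ω => u (x, ω) := by
  rw [sliceFun_eq h]
  exact h.coeFn_toLp

theorem enorm_lp_rpow {F : Type*} [NormedAddCommGroup F] [Fact (1 ≤ q)] (hq : q ≠ ∞)
    (f : Lp F q μ) : ‖f‖ₑ ^ q.toReal = ∫⁻ ω, ‖f ω‖ₑ ^ q.toReal ∂μ := by
  have hq0 : q ≠ 0 := (zero_lt_one.trans_le (Fact.out : 1 ≤ q)).ne'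
  have hr : 0 < q.toReal := ENNReal.toReal_pos hq0 hq
  rw [Lp.enorm_def, eLpNorm_eq_lintegral_rpow_enorm_toReal hq0 hq, ← ENNReal.rpow_mul, one_div,
    inv_mul_cancel₀ hr.ne', ENNReal.rpow_one]

variable [SFinite lam] [IsFiniteMeasure μ]

theorem ae_memLp_slice [Fact (1 ≤ q)] (hq : q ≠ ∞) {u : α × Ω → ℝ} (hu : MemLp u q (lam.prod μ)) :
    ∀ᵐ x ∂lam, MemLp (fun ω => u (x, ω)) q μ := by
  have hq0 : q ≠ 0 := (zero_lt_one.trans_le (Fact.out : 1 ≤ q)).ne'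
  have h1 := hu.1.prodMk_left
  have h2 := hu.2
  rw [eLpNorm_lt_top_iff_lintegral_rpow_enorm_lt_top hq0 hq,
    lintegral_prod _ (hu.1.enorm.pow_const _)] at h2
  have h3 := ae_lt_top' ((hu.1.enorm.pow_const _).lintegral_prod_right') h2.ne
  filter_upwards [h1, h3] with x hx1 hx3
  exact ⟨hx1, (eLpNorm_lt_top_iff_lintegral_rpow_enorm_lt_top hq0 hq).2 hx3⟩

theorem lintegral_sliceFun [Fact (1 ≤ q)] (hq : q ≠ ∞) {u : α × Ω → ℝ}
    (hu : MemLp u q (lam.prod μ)) :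
    ∫⁻ x, ‖sliceFun q μ u x‖ₑ ^ q.toReal ∂lam = ∫⁻ z, ‖u z‖ₑ ^ q.toReal ∂(lam.prod μ) := by
  rw [lintegral_prod _ (hu.1.enorm.pow_const _)]
  refine lintegral_congr_ae ?_
  filter_upwards [ae_memLp_slice hq hu] with x hx
  rw [enorm_lp_rpow hq]
  refine lintegral_congr_ae ?_
  filter_upwards [coeFn_sliceFun hx] with ω hω
  rw [hω]

theorem sliceFun_add_ae [Fact (1 ≤ q)] (hq : q ≠ ∞) {u v : α × Ω → ℝ}
    (hu : MemLp u q (lam.prod μ)) (hv : MemLp v q (lam.prod μ)) :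
    sliceFun q μ (u + v) =ᵐ[lam] fun x => sliceFun q μ u x + sliceFun q μ v x := by
  filter_upwards [ae_memLp_slice hq hu, ae_memLp_slice hq hv] with x hx hx'
  rw [sliceFun_eq hx, sliceFun_eq hx', sliceFun_eq (u := u + v) (hx.add hx')]
  exact MemLp.toLp_add hx hx'

theorem sliceFun_smul_ae [Fact (1 ≤ q)] (hq : q ≠ ∞) (c : ℝ) {u : α × Ω → ℝ}
    (hu : MemLp u q (lam.prod μ)) :
    sliceFun q μ (c • u) =ᵐ[lam] fun x => c • sliceFun q μ u x := by
  filter_upwards [ae_memLp_slice hq hu] with x hx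
  rw [sliceFun_eq hx, sliceFun_eq (u := c • u) (hx.const_smul c)]
  exact MemLp.toLp_const_smul c hx

theorem sliceFun_sub_ae [Fact (1 ≤ q)] (hq : q ≠ ∞) {u v : α × Ω → ℝ}
    (hu : MemLp u q (lam.prod μ)) (hv : MemLp v q (lam.prod μ)) :
    sliceFun q μ (u - v) =ᵐ[lam] fun x => sliceFun q μ u x - sliceFun q μ v x := by
  filter_upwards [ae_memLp_slice hq hu, ae_memLp_slice hq hv] with x hx hx'
  rw [sliceFun_eq hx, sliceFun_eq hx', sliceFun_eq (u := u - v) (hx.sub hx')]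
  exact MemLp.toLp_sub hx hx'

theorem sliceFun_congr_ae [Fact (1 ≤ q)] {u v : α × Ω → ℝ} (h : u =ᵐ[lam.prod μ] v) :
    sliceFun q μ u =ᵐ[lam] sliceFun q μ v := by
  have h1 : ∀ᵐ x ∂lam, ∀ᵐ ω ∂μ, u (x, ω) = v (x, ω) := Measure.ae_ae_of_ae_prod h
  filter_upwards [h1] with x hx
  by_cases hu : MemLp (fun ω => u (x, ω)) q μ
  · have hv : MemLp (fun ω => v (x, ω)) q μ := (memLp_congr_ae hx).1 hu
    rw [sliceFun_eq hu, sliceFun_eq hv]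
    exact (MemLp.toLp_eq_toLp_iff hu hv).2 hx
  · have hv : ¬ MemLp (fun ω => v (x, ω)) q μ := fun hv => hu ((memLp_congr_ae hx).2 hv)
    rw [sliceFun, sliceFun, dif_neg hu, dif_neg hv]

/-- The space `L^q(Ω)` need not be separable, so weak measurability would not be enough. A `π`-`λ`
argument starting from rectangles gives strong measurability, since countable disjoint unions of
slices converge in `L^q` for finite `q`. -/
theorem stronglyMeasurable_indicator_slice [Fact (1 ≤ q)] (hq : q ≠ ∞) (c : ℝ) (s : Set (α × Ω))
    (hs : MeasurableSet s) : StronglyMeasurable fun x =>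
      indicatorConstLp q (measurable_prodMk_left (x := x) hs) (measure_ne_top μ _) c := by
  refine MeasurableSpace.induction_on_inter
    (C := fun s hs => StronglyMeasurable fun x =>
      indicatorConstLp q (measurable_prodMk_left (x := x) hs) (measure_ne_top μ _) c)
    generateFrom_prod.symm isPiSystem_prod ?_ ?_ ?_ ?_ s hs
  · convert (stronglyMeasurable_const (b := (0 : Lp ℝ q μ)) : StronglyMeasurable fun _ : α => _)
    simp only [preimage_empty]
    exact indicatorConstLp_empty
  · rintro _ ⟨A, hA, B, hB, rfl⟩
    have : (fun x => indicatorConstLp q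
        (measurable_prodMk_left (x := x) (MeasurableSet.prod hA hB)) (measure_ne_top μ _) c)
        = A.indicator fun _ => indicatorConstLp q hB (measure_ne_top μ _) c := by
      funext x
      by_cases hx : x ∈ A
      · simp only [indicator_of_mem hx]
        congr 1
        ext ω
        simp [hx]
      · simp only [indicator_of_notMem hx]
        have : Prod.mk x ⁻¹' A ×ˢ B = ∅ := by
          ext ω
          simp [hx]
        simp only [this]
        exact indicatorConstLp_empty
    rw [this]
    exact stronglyMeasurable_const.indicator hA
  · intro t ht h
    have : (fun x => indicatorConstLp q (measurable_prodMk_left (x := x) ht.compl)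
        (measure_ne_top μ _) c) = fun x => indicatorConstLp q MeasurableSet.univ
          (measure_ne_top μ _) c - indicatorConstLp q (measurable_prodMk_left (x := x) ht)
        (measure_ne_top μ _) c := by
      funext x
      rw [eq_sub_iff_add_eq, ← indicatorConstLp_disjoint_union]
      · congr 1
        ext ω
        simp
      · exact disjoint_compl_left.preimage _
    rw [this]
    exact stronglyMeasurable_const.sub h
  · intro g hd hg h
    set U : ℕ → Set (α × Ω) := fun n => ⋃ k ∈ Finset.range n, g k
    have hU : ∀ n, MeasurableSet (U n) := fun n =>
      Finset.measurableSet_biUnion _ fun k _ => hg k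
    have hUs : ∀ n, StronglyMeasurable fun x =>
        indicatorConstLp q (measurable_prodMk_left (x := x) (hU n)) (measure_ne_top μ _) c := by
      intro n
      induction n with
      | zero =>
        convert (stronglyMeasurable_const (b := (0 : Lp ℝ q μ)) : StronglyMeasurable fun _ : α => _)
        simp only [U, Finset.range_zero, Finset.notMem_empty, iUnion_of_empty, iUnion_empty,
          preimage_empty]
        exact indicatorConstLp_empty
      | succ n ih =>
        have : (fun x => indicatorConstLp q (measurable_prodMk_left (x := x) (hU (n + 1)))
            (measure_ne_top μ _) c) = fun x =>
            indicatorConstLp q (measurable_prodMk_left (x := x) (hU n)) (measure_ne_top μ _) c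
            + indicatorConstLp q (measurable_prodMk_left (x := x) (hg n)) (measure_ne_top μ _) c := by
          funext x
          rw [← indicatorConstLp_disjoint_union]
          · congr 1
            rw [← preimage_union]
            congr 1
            simp only [U, Finset.range_add_one, Finset.set_biUnion_insert]
            rw [union_comm]
          · refine Disjoint.preimage _ ?_
            simp only [U, disjoint_iUnion_left]
            intro k hk
            exact hd (Finset.mem_range.1 hk).ne
        rw [this]
        exact ih.add (h n)
    refine stronglyMeasurable_of_tendsto atTop hUs ?_
    rw [tendsto_pi_nhds]
    intro x
    refine tendsto_indicatorConstLp_set hq ?_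
    have hmono : Monotone fun n => Prod.mk x ⁻¹' U n := fun m n hmn =>
      preimage_mono (biUnion_subset_biUnion_left (by simpa using hmn))
    have hun : Prod.mk x ⁻¹' (⋃ i, g i) = ⋃ n, Prod.mk x ⁻¹' U n := by
      rw [← preimage_iUnion]
      congr 1
      ext z
      simp only [U, mem_iUnion, Finset.mem_range, exists_prop]
      exact ⟨fun ⟨i, hi⟩ => ⟨i + 1, i, Nat.lt_succ_self i, hi⟩, fun ⟨_, i, _, hi⟩ => ⟨i, hi⟩⟩
    have hanti : Tendsto (fun n => μ ((⋃ n, Prod.mk x ⁻¹' U n) \ Prod.mk x ⁻¹' U n)) atTop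
        (𝓝 (μ (⋂ n, (⋃ n, Prod.mk x ⁻¹' U n) \ Prod.mk x ⁻¹' U n))) := by
      refine tendsto_measure_iInter_atTop (fun n => ?_) (fun m n hmn => ?_) ⟨0, measure_ne_top _ _⟩
      · exact ((MeasurableSet.iUnion fun n => measurable_prodMk_left (hU n)).diff
          (measurable_prodMk_left (hU n))).nullMeasurableSet
      · exact sdiff_subset_sdiff_right (hmono hmn)
    have hempty : (⋂ n, (⋃ n, Prod.mk x ⁻¹' U n) \ Prod.mk x ⁻¹' U n) = ∅ := by
      rw [← sdiff_iUnion, sdiff_self]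
    rw [hempty, measure_empty] at hanti
    refine hanti.congr fun n => ?_
    rw [hun]
    congr 1
    rw [symmDiff_of_le (subset_iUnion (fun n => Prod.mk x ⁻¹' U n) n)]

theorem aestronglyMeasurable_sliceFun [Fact (1 ≤ q)] (hq : q ≠ ∞) {u : α × Ω → ℝ}
    (hu : MemLp u q (lam.prod μ)) : AEStronglyMeasurable (sliceFun q μ u) lam := by
  have hq0 : q ≠ 0 := (zero_lt_one.trans_le (Fact.out : 1 ≤ q)).ne'
  have hr : 0 < q.toReal := ENNReal.toReal_pos hq0 hq
  refine MemLp.induction hq (motive := fun u => AEStronglyMeasurable (sliceFun q μ u) lam)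
    ?_ ?_ ?_ ?_ hu
  · intro c s hs _
    have : sliceFun q μ (s.indicator fun _ => c) = fun x =>
        indicatorConstLp q (measurable_prodMk_left (x := x) hs) (measure_ne_top μ _) c := by
      funext x
      have hx : MemLp (fun ω => s.indicator (fun _ => c) (x, ω)) q μ :=
        memLp_indicator_const q (measurable_prodMk_left hs) c (Or.inr (measure_ne_top μ _))
      rw [sliceFun_eq hx]
      rfl
    rw [this]
    exact (stronglyMeasurable_indicator_slice hq c s hs).aestronglyMeasurable
  · intro f g _ hf hg hf' hg'
    exact (hf'.add hg').congr (sliceFun_add_ae hq hf hg).symm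
  · refine IsSeqClosed.isClosed fun f f₀ hf hlim => ?_
    have hk : ∀ n, ∫⁻ x, ‖sliceFun q μ (f n - f₀ : Lp ℝ q (lam.prod μ)) x‖ₑ ^ q.toReal ∂lam
        = ‖f n - f₀‖ₑ ^ q.toReal := fun n => by
      rw [lintegral_sliceFun hq (Lp.memLp _), enorm_lp_rpow hq]
    have h0 : Tendsto (fun n => ‖f n - f₀‖ₑ ^ q.toReal) atTop (𝓝 0) := by
      have h1 : Tendsto (fun n => ‖f n - f₀‖ₑ) atTop (𝓝 0) := by
        have := (tendsto_iff_edist_tendsto_0).1 hlim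
        simpa only [edist_eq_enorm_sub] using this
      have := (ENNReal.continuous_rpow_const (y := q.toReal)).tendsto 0 |>.comp h1
      rwa [ENNReal.zero_rpow_of_pos hr] at this
    -- Along a subsequence converging at a summable rate, the slices converge in `L^q(Ω)` for almost
    -- every `x`, and strong measurability passes to the limit.
    have hev : ∀ n : ℕ, ∃ k, ‖f k - f₀‖ₑ ^ q.toReal ≤ (2⁻¹ : ℝ≥0∞) ^ n := fun n =>
      (h0.eventually (ge_mem_nhds (ENNReal.pow_pos (by simp) n))).exists
    choose φ hφ using hev
    have hmem : ∀ n, MemLp (f (φ n) - f₀ : Lp ℝ q (lam.prod μ)) q (lam.prod μ) :=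
      fun n => Lp.memLp _
    have hmeas : ∀ n, AEMeasurable (fun x => ∫⁻ ω,
        ‖(f (φ n) - f₀ : Lp ℝ q (lam.prod μ)) (x, ω)‖ₑ ^ q.toReal ∂μ) lam := fun n =>
      ((hmem n).1.enorm.pow_const _).lintegral_prod_right'
    have hsum : ∫⁻ x, ∑' n, ∫⁻ ω,
        ‖(f (φ n) - f₀ : Lp ℝ q (lam.prod μ)) (x, ω)‖ₑ ^ q.toReal ∂μ ∂lam ≠ ∞ := by
      rw [lintegral_tsum hmeas]
      refine ((ENNReal.tsum_le_tsum fun n => ?_).trans_lt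
        (show ∑' n : ℕ, (2⁻¹ : ℝ≥0∞) ^ n < ∞ by
          rw [ENNReal.tsum_geometric, ENNReal.one_sub_inv_two, inv_inv]
          exact ENNReal.ofNat_lt_top)).ne
      rw [← lintegral_prod _ ((hmem n).1.enorm.pow_const _), ← enorm_lp_rpow hq]
      exact hφ n
    have hfin := ae_lt_top' (AEMeasurable.tsum hmeas) hsum
    refine aestronglyMeasurable_of_tendsto_ae atTop (fun n => hf (φ n)) ?_
    have h1 : ∀ᵐ x ∂lam, ∀ n, sliceFun q μ (f (φ n) - f₀ : Lp ℝ q (lam.prod μ)) x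
        = sliceFun q μ (f (φ n)) x - sliceFun q μ f₀ x := by
      rw [ae_all_iff]
      intro n
      filter_upwards [sliceFun_congr_ae (μ := μ) (q := q) (Lp.coeFn_sub (f (φ n)) f₀),
        sliceFun_sub_ae hq (Lp.memLp (f (φ n))) (Lp.memLp f₀)] with x hx hx'
      rw [hx, hx']
    have h2 : ∀ᵐ x ∂lam, ∀ n,
        MemLp (fun ω => (f (φ n) - f₀ : Lp ℝ q (lam.prod μ)) (x, ω)) q μ := by
      rw [ae_all_iff]
      exact fun n => ae_memLp_slice hq (hmem n)
    filter_upwards [hfin, h1, h2] with x hx hx1 hx2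
    rw [tendsto_iff_edist_tendsto_0]
    have h3 := ENNReal.tendsto_atTop_zero_of_tsum_ne_top hx.ne
    have h4 := (ENNReal.continuous_rpow_const (y := q.toReal⁻¹)).tendsto 0 |>.comp h3
    rw [ENNReal.zero_rpow_of_pos (inv_pos.2 hr)] at h4
    refine h4.congr fun n => ?_
    rw [edist_eq_enorm_sub, ← hx1, Function.comp_apply,
      ← ENNReal.rpow_rpow_inv hr.ne' ‖sliceFun q μ _ x‖ₑ, enorm_lp_rpow hq]
    congr 1
    refine lintegral_congr_ae ?_
    filter_upwards [coeFn_sliceFun (hx2 n)] with ω hω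
    rw [hω]
  · intro f g hfg _ hf
    exact hf.congr (sliceFun_congr_ae hfg)

theorem memLp_sliceFun [Fact (1 ≤ q)] (hq : q ≠ ∞) {u : α × Ω → ℝ}
    (hu : MemLp u q (lam.prod μ)) : MemLp (sliceFun q μ u) q lam := by
  have hq0 : q ≠ 0 := (zero_lt_one.trans_le (Fact.out : 1 ≤ q)).ne'
  refine ⟨aestronglyMeasurable_sliceFun hq hu, ?_⟩
  rw [eLpNorm_lt_top_iff_lintegral_rpow_enorm_lt_top hq0 hq, lintegral_sliceFun hq hu]
  exact (eLpNorm_lt_top_iff_lintegral_rpow_enorm_lt_top hq0 hq).1 hu.2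

/-- The slicing map as a linear isometry. -/
def sliceIsometry [Fact (1 ≤ q)] (lam : Measure α) [SFinite lam] (μ : Measure Ω)
    [IsFiniteMeasure μ] (hq : q ≠ ∞) : Lp ℝ q (lam.prod μ) →ₗᵢ[ℝ] Lp (Lp ℝ q μ) q lam where
  toFun f := (memLp_sliceFun hq (Lp.memLp f)).toLp _
  map_add' f g := by
    rw [← MemLp.toLp_add, MemLp.toLp_eq_toLp_iff]
    exact (sliceFun_congr_ae (Lp.coeFn_add f g)).trans
      (sliceFun_add_ae hq (Lp.memLp f) (Lp.memLp g))
  map_smul' c f := by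
    rw [RingHom.id_apply, ← MemLp.toLp_const_smul, MemLp.toLp_eq_toLp_iff]
    exact (sliceFun_congr_ae (Lp.coeFn_smul c f)).trans (sliceFun_smul_ae hq c (Lp.memLp f))
  norm_map' f := by
    have hq0 : q ≠ 0 := (zero_lt_one.trans_le (Fact.out : 1 ≤ q)).ne'
    change ‖(memLp_sliceFun hq (Lp.memLp f)).toLp _‖ = ‖f‖
    rw [Lp.norm_toLp, Lp.norm_def]
    congr 1
    rw [eLpNorm_eq_lintegral_rpow_enorm_toReal hq0 hq, lintegral_sliceFun hq (Lp.memLp f),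
      eLpNorm_eq_lintegral_rpow_enorm_toReal hq0 hq]

theorem coeFn_sliceIsometry [Fact (1 ≤ q)] (hq : q ≠ ∞) (f : Lp ℝ q (lam.prod μ)) :
    ∀ᵐ x ∂lam, sliceIsometry lam μ hq f x =ᵐ[μ] fun ω => f (x, ω) := by
  filter_upwards [(memLp_sliceFun hq (Lp.memLp f)).coeFn_toLp, ae_memLp_slice hq (Lp.memLp f)]
    with x hx hx'
  have : sliceIsometry lam μ hq f x = sliceFun q μ f x := hx
  rw [this]
  exact coeFn_sliceFun hx'

/-- The range of an isometry of a complete space is closed, and it contains every indicator function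
with a value `c ∈ L^q(Ω)`, as the slicing of `1_s(x) c(ω)`. -/
theorem sliceIsometry_surjective [Fact (1 ≤ q)] (hq : q ≠ ∞) :
    Function.Surjective (sliceIsometry (q := q) lam μ hq) := by
  have hcl : IsClosed (range (sliceIsometry (q := q) lam μ hq)) :=
    (sliceIsometry (q := q) lam μ hq).isometry.isClosedEmbedding.isClosed_range
  intro F
  refine Lp.induction hq (motive := fun F => F ∈ range (sliceIsometry (q := q) lam μ hq))
    (fun c s hs hsμ => ?_) ?_ hcl F
  · have hm : MemLp (fun z : α × Ω => s.indicator (fun _ => (1 : ℝ)) z.1 * c z.2) q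
        (lam.prod μ) := by
      have hq0 : q ≠ 0 := (zero_lt_one.trans_le (Fact.out : 1 ≤ q)).ne'
      have hmeas : AEStronglyMeasurable
          (fun z : α × Ω => s.indicator (fun _ => (1 : ℝ)) z.1 * c z.2) (lam.prod μ) :=
        ((stronglyMeasurable_const.indicator hs).aestronglyMeasurable.comp_fst).mul
          (Lp.aestronglyMeasurable c).comp_snd
      refine ⟨hmeas, ?_⟩
      rw [eLpNorm_lt_top_iff_lintegral_rpow_enorm_lt_top hq0 hq,
        lintegral_prod _ (hmeas.enorm.pow_const _)]
      have hr : 0 < q.toReal := ENNReal.toReal_pos hq0 hq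
      have e1 : ∀ x, ∫⁻ ω, ‖s.indicator (fun _ => (1 : ℝ)) x * c ω‖ₑ ^ q.toReal ∂μ
          = s.indicator (fun _ => ‖c‖ₑ ^ q.toReal) x := by
        intro x
        by_cases hx : x ∈ s
        · simp only [indicator_of_mem hx, one_mul]
          rw [enorm_lp_rpow hq]
        · simp [indicator_of_notMem hx, hr]
      simp only [e1]
      rw [lintegral_indicator hs, setLIntegral_const]
      exact ENNReal.mul_lt_top (ENNReal.rpow_lt_top_of_nonneg hr.le enorm_ne_top) hsμ
    refine ⟨hm.toLp _, ?_⟩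
    refine Lp.ext ?_
    have h1 : ∀ᵐ x ∂lam, ∀ᵐ ω ∂μ, hm.toLp _ (x, ω) = s.indicator (fun _ => (1 : ℝ)) x * c ω :=
      Measure.ae_ae_of_ae_prod hm.coeFn_toLp
    filter_upwards [coeFn_sliceIsometry hq (hm.toLp _), h1,
      (indicatorConstLp_coeFn (p := q) (hs := hs) (hμs := hsμ.ne) (c := c))] with x hx hx1 hx2
    rw [Lp.simpleFunc.coe_indicatorConst, hx2]
    refine Lp.ext ?_
    by_cases hxs : x ∈ s
    · rw [indicator_of_mem hxs]
      filter_upwards [hx, hx1] with ω h3 h4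
      rw [h3, h4, indicator_of_mem hxs, one_mul]
    · rw [indicator_of_notMem hxs]
      filter_upwards [hx, hx1, Lp.coeFn_zero ℝ q μ] with ω h3 h4 h5
      rw [h3, h4, h5, indicator_of_notMem hxs, zero_mul, Pi.zero_apply]
  · rintro f g hf hg - ⟨a, ha⟩ ⟨b, hb⟩
    exact ⟨a + b, by rw [map_add, ha, hb]⟩

/-- Slicing is an isometric isomorphism `L^q(α × Ω) ≃ L^q(α; L^q(Ω))`. -/
def sliceEquiv [Fact (1 ≤ q)] (lam : Measure α) [SFinite lam] (μ : Measure Ω)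
    [IsFiniteMeasure μ] (hq : q ≠ ∞) : Lp ℝ q (lam.prod μ) ≃ₗᵢ[ℝ] Lp (Lp ℝ q μ) q lam :=
  LinearIsometryEquiv.ofSurjective (sliceIsometry lam μ hq) (sliceIsometry_surjective hq)

theorem coeFn_sliceEquiv [Fact (1 ≤ q)] (hq : q ≠ ∞) (f : Lp ℝ q (lam.prod μ)) :
    ∀ᵐ x ∂lam, sliceEquiv lam μ hq f x =ᵐ[μ] fun ω => f (x, ω) :=
  coeFn_sliceIsometry hq f

theorem coeFn_sliceEquiv_toLp [Fact (1 ≤ q)] (hq : q ≠ ∞) {u : α × Ω → ℝ}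
    (hu : MemLp u q (lam.prod μ)) :
    ∀ᵐ x ∂lam, sliceEquiv lam μ hq (hu.toLp u) x =ᵐ[μ] fun ω => u (x, ω) := by
  filter_upwards [coeFn_sliceEquiv hq (hu.toLp u), Measure.ae_ae_of_ae_prod hu.coeFn_toLp]
    with x h1 h2
  exact h1.trans h2

end Slices

/-! ### Weighted integrals of `L^q` functions -/

section WeightedIntegrals

variable {α : Type*} [MeasurableSpace α] {lam : Measure α} [IsFiniteMeasure lam]
  {q : ℝ≥0∞} [Fact (1 ≤ q)] {Y : Type*} [NormedAddCommGroup Y] [NormedSpace ℝ Y]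

/-- `φ` is a bounded measurable weight. -/
def BddMeas (lam : Measure α) (φ : α → ℝ) : Prop :=
  AEStronglyMeasurable φ lam ∧ ∃ C : ℝ, ∀ x, ‖φ x‖ ≤ C

theorem integrable_coeFn (F : Lp Y q lam) : Integrable F lam :=
  (Lp.memLp F).integrable Fact.out

theorem BddMeas.integrable_smul {φ : α → ℝ} (hφ : BddMeas lam φ) {F : α → Y}
    (hF : Integrable F lam) : Integrable (fun x => φ x • F x) lam := by
  obtain ⟨C, hC⟩ := hφ.2
  exact hF.bdd_smul C hφ.1 (ae_of_all _ hC)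

theorem exists_norm_integral_smul_le {φ : α → ℝ} (hφ : BddMeas lam φ) :
    ∃ C : ℝ, ∀ F : Lp Y q lam, ‖∫ x, φ x • F x ∂lam‖ ≤ C * ‖F‖ := by
  obtain ⟨C, hC⟩ := hφ.2
  -- The norm of the inclusion of `L^q` in `L¹` over a finite measure space.
  set K : ℝ≥0∞ := lam univ ^ (1 / (1 : ℝ≥0∞).toReal - 1 / q.toReal)
  have hK : K ≠ ∞ := by
    refine ENNReal.rpow_ne_top_of_nonneg ?_ (measure_ne_top _ _)
    rcases eq_or_ne q ∞ with h | h
    · simp [h]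
    · have : (1 : ℝ) ≤ q.toReal := by
        rw [← ENNReal.toReal_one]
        exact ENNReal.toReal_mono h Fact.out
      have := div_le_one_of_le₀ this (by positivity)
      simp only [ENNReal.toReal_one, div_one]
      linarith
  refine ⟨|C| * K.toReal, fun F => ?_⟩
  have h1 : ∫ x, ‖F x‖ ∂lam ≤ K.toReal * ‖F‖ := by
    rw [integral_norm_eq_lintegral_enorm (Lp.aestronglyMeasurable F), ← eLpNorm_one_eq_lintegral_enorm,
      Lp.norm_def, mul_comm, ← ENNReal.toReal_mul]
    exact ENNReal.toReal_mono (ENNReal.mul_ne_top (Lp.eLpNorm_ne_top F) hK)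
      (eLpNorm_le_eLpNorm_mul_rpow_measure_univ Fact.out (Lp.aestronglyMeasurable F))
  calc ‖∫ x, φ x • F x ∂lam‖ ≤ ∫ x, |C| * ‖F x‖ ∂lam := by
        refine norm_integral_le_of_norm_le ((integrable_coeFn F).norm.const_mul _)
          (ae_of_all _ fun x => ?_)
        rw [norm_smul]
        gcongr
        exact (hC x).trans (le_abs_self C)
    _ ≤ |C| * K.toReal * ‖F‖ := by
        rw [integral_const_mul, mul_assoc]
        gcongr

/-- The weighted integral `F ↦ ∫ φ F`, as a continuous linear map. -/
def wInt {φ : α → ℝ} (hφ : BddMeas lam φ) : Lp Y q lam →L[ℝ] Y :=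
  LinearMap.mkContinuousOfExistsBound
    { toFun := fun F => ∫ x, φ x • F x ∂lam
      map_add' := fun F G => by
        rw [← integral_add (hφ.integrable_smul (integrable_coeFn F))
          (hφ.integrable_smul (integrable_coeFn G))]
        refine integral_congr_ae ?_
        filter_upwards [Lp.coeFn_add F G] with x hx
        rw [hx, Pi.add_apply, smul_add]
      map_smul' := fun c F => by
        rw [RingHom.id_apply, ← integral_smul]
        refine integral_congr_ae ?_
        filter_upwards [Lp.coeFn_smul c F] with x hx
        rw [hx, Pi.smul_apply, smul_comm] }
    (exists_norm_integral_smul_le hφ)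

theorem wInt_apply {φ : α → ℝ} (hφ : BddMeas lam φ) (F : Lp Y q lam) :
    wInt hφ F = ∫ x, φ x • F x ∂lam := rfl

theorem bddMeas_indicator {A : Set α} (hA : MeasurableSet A) :
    BddMeas lam (A.indicator fun _ => (1 : ℝ)) :=
  ⟨(stronglyMeasurable_const.indicator hA).aestronglyMeasurable, 1, fun x => by
    by_cases hx : x ∈ A <;> simp [hx]⟩

theorem wInt_indicator {A : Set α} (hA : MeasurableSet A) (g : Lp ℝ q lam) :
    wInt (bddMeas_indicator hA) g = ∫ x in A, g x ∂lam := by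
  rw [wInt_apply, ← integral_indicator hA]
  refine integral_congr_ae (ae_of_all _ fun x => ?_)
  by_cases hx : x ∈ A <;> simp [hx]

theorem wInt_compLp [CompleteSpace Y] {W : Type*} [NormedAddCommGroup W] [NormedSpace ℝ W]
    [CompleteSpace W]
    {φ : α → ℝ} (hφ : BddMeas lam φ) (A : Y →L[ℝ] W) (F : Lp Y q lam) :
    wInt hφ (A.compLp F) = A (wInt hφ F) := by
  rw [wInt_apply, wInt_apply, ← A.integral_comp_comm (hφ.integrable_smul (integrable_coeFn F))]
  refine integral_congr_ae ?_
  filter_upwards [A.coeFn_compLp F] with x hx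
  rw [hx, map_smul]

/-- The weighted integral of slices is the pointwise weighted integral. -/
theorem wInt_sliceEquiv_toLp {Ω : Type*} [MeasurableSpace Ω] {μ : Measure Ω} [IsFiniteMeasure μ]
    (hq : q ≠ ∞) {φ : α → ℝ} (hφ : BddMeas lam φ) {u : α × Ω → ℝ} (hu : MemLp u q (lam.prod μ)) :
    (wInt hφ (sliceEquiv lam μ hq (hu.toLp u)) : Lp ℝ q μ) =ᵐ[μ] fun ω => ∫ x, φ x * u (x, ω) ∂lam := by
  have hint : Integrable (fun z : α × Ω => φ z.1 * u z) (lam.prod μ) := by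
    obtain ⟨C, hC⟩ := hφ.2
    exact (hu.integrable Fact.out).bdd_mul (c := C) hφ.1.comp_fst (ae_of_all _ fun z => hC z.1)
  -- Both sides are compared by integrating over measurable `A ⊆ Ω`. This is a continuous functional
  -- on `L^q(Ω)`, so it commutes with the Bochner integral, and the claim becomes Fubini's theorem.
  refine Integrable.ae_eq_of_forall_setIntegral_eq _ _ (integrable_coeFn _)
    hint.integral_prod_right fun A hA _ => ?_
  have hL := wInt_compLp hφ (wInt (q := q) (bddMeas_indicator (lam := μ) hA))
    (sliceEquiv lam μ hq (hu.toLp u))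
  rw [← wInt_indicator hA, ← hL, wInt_apply]
  have h1 : ∫ ω in A, ∫ x, φ x * u (x, ω) ∂lam ∂μ = ∫ x, ∫ ω in A, φ x * u (x, ω) ∂μ ∂lam := by
    have : Integrable (fun z : α × Ω => φ z.1 * u z) (lam.prod (μ.restrict A)) := by
      refine hint.mono_measure ?_
      exact Measure.prod_mono le_rfl Measure.restrict_le_self
    exact (integral_integral_swap (f := fun x ω => φ x * u (x, ω)) this).symm
  rw [h1]
  refine integral_congr_ae ?_
  filter_upwards [(wInt (q := q) (bddMeas_indicator (lam := μ) hA)).coeFn_compLp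
    (sliceEquiv lam μ hq (hu.toLp u)), coeFn_sliceEquiv_toLp hq hu] with x h2 h3
  rw [h2, wInt_indicator hA, integral_const_mul, smul_eq_mul]
  congr 1
  exact integral_congr_ae (ae_restrict_of_ae h3)

end WeightedIntegrals

/-! ### Test functions -/

section TestFunctions

variable {N : ℕ}

/-- The smooth compactly supported functions on `ℝ^N`. -/
def CcInf (N : ℕ) : Submodule ℝ (RN N → ℝ) where
  carrier := {χ | ContDiff ℝ ((⊤ : ℕ∞) : WithTop ℕ∞) χ ∧ HasCompactSupport χ}
  zero_mem' := ⟨contDiff_const, HasCompactSupport.zero⟩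
  add_mem' := fun h h' => ⟨h.1.add h'.1, h.2.add h'.2⟩
  smul_mem' := fun c _ h => ⟨h.1.const_smul c, h.2.smul_left (f := fun _ => c)⟩

/-- Smooth compactly supported functions on `ℝ^N`. -/
abbrev TestFn (N : ℕ) : Type := CcInf N

instance : CoeFun (TestFn N) (fun _ => RN N → ℝ) := ⟨Subtype.val⟩

namespace TestFn

theorem contDiff (χ : TestFn N) : ContDiff ℝ ((⊤ : ℕ∞) : WithTop ℕ∞) (χ : RN N → ℝ) := χ.2.1

theorem hasCompactSupport (χ : TestFn N) : HasCompactSupport (χ : RN N → ℝ) := χ.2.2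

theorem continuous (χ : TestFn N) : Continuous (χ : RN N → ℝ) := χ.contDiff.continuous

theorem differentiable (χ : TestFn N) : Differentiable ℝ (χ : RN N → ℝ) :=
  χ.contDiff.differentiable (by simp)

theorem integrable (χ : TestFn N) : Integrable (χ : RN N → ℝ) :=
  χ.continuous.integrable_of_hasCompactSupport χ.hasCompactSupport

theorem exists_bound (χ : TestFn N) : ∃ C : ℝ, ∀ x, ‖(χ : RN N → ℝ) x‖ ≤ C :=
  χ.hasCompactSupport.exists_bound_of_continuous χ.continuous

theorem bddMeas (χ : TestFn N) (lam : Measure (RN N)) : BddMeas lam (χ : RN N → ℝ) :=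
  ⟨χ.continuous.aestronglyMeasurable, χ.exists_bound⟩

/-- The partial derivative `∂_i`, as an endomorphism. -/
def pd (i : Fin N) : TestFn N →ₗ[ℝ] TestFn N where
  toFun χ := ⟨fun x => fderiv ℝ (χ : RN N → ℝ) x (stdVec i),
    (χ.contDiff.fderiv_right (m := ((⊤ : ℕ∞) : WithTop ℕ∞)) (by simp)).clm_apply contDiff_const,
    χ.hasCompactSupport.fderiv_apply (𝕜 := ℝ) (stdVec i)⟩
  map_add' χ χ' := by
    ext x
    change fderiv ℝ ((χ : RN N → ℝ) + (χ' : RN N → ℝ)) x _ = fderiv ℝ (χ : RN N → ℝ) x _ + fderiv ℝ _ x _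
    rw [fderiv_add (χ.differentiable x) (χ'.differentiable x), add_apply]
  map_smul' c χ := by
    ext x
    change fderiv ℝ (c • (χ : RN N → ℝ)) x _ = c • fderiv ℝ (χ : RN N → ℝ) x _
    rw [fderiv_const_smul (χ.differentiable x), smul_apply]

theorem pd_apply (i : Fin N) (χ : TestFn N) (x : RN N) :
    (pd i χ : RN N → ℝ) x = fderiv ℝ (χ : RN N → ℝ) x (stdVec i) := rfl

/-- Symmetry of the second derivative. It allows iterated derivatives to be indexed by multi-indices
in `moll_mem_cInf`. -/
theorem pd_comm (i j : Fin N) : Commute (S := Module.End ℝ (TestFn N)) (pd i) (pd j) := by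
  refine LinearMap.ext fun χ => Subtype.ext (funext fun x => ?_)
  have h2 : ∀ v w : RN N, fderiv ℝ (fun y => fderiv ℝ (χ : RN N → ℝ) y v) x w
      = fderiv ℝ (fderiv ℝ (χ : RN N → ℝ)) x w v := by
    intro v w
    have hd : DifferentiableAt ℝ (fderiv ℝ (χ : RN N → ℝ)) x :=
      (χ.contDiff.fderiv_right (m := ((⊤ : ℕ∞) : WithTop ℕ∞)) (by simp)).differentiable
        (by simp) x
    rw [fderiv_clm_apply hd (differentiableAt_const v)]
    simp
  have hs : IsSymmSndFDerivAt ℝ (χ : RN N → ℝ) x :=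
    (χ.contDiff.contDiffAt).isSymmSndFDerivAt
      (by rw [minSmoothness_of_isRCLikeNormedField]
          exact WithTop.coe_le_coe.2 (le_top (a := (2 : ℕ∞))))
  change fderiv ℝ (fun y => fderiv ℝ (χ : RN N → ℝ) y (stdVec j)) x (stdVec i)
    = fderiv ℝ (fun y => fderiv ℝ (χ : RN N → ℝ) y (stdVec i)) x (stdVec j)
  rw [h2, h2]
  exact hs _ _

/-- Difference quotients of a test function converge in `L¹`. -/
theorem tendsto_integral_diffQuot (χ : TestFn N) (i : Fin N) {s : ℝ} (hs : s ≠ 0) :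
    Tendsto (fun t : ℝ => ∫ x, ‖((χ : RN N → ℝ) (x - (t / s) • stdVec i) - (χ : RN N → ℝ) x) / t
      - (-s⁻¹) * (pd i χ : RN N → ℝ) x‖) (𝓝[≠] 0) (𝓝 0) := by
  obtain ⟨L, hL⟩ := χ.contDiff.lipschitzWith_of_hasCompactSupport χ.hasCompactSupport (by simp)
  obtain ⟨C, hC⟩ := (pd i χ).exists_bound
  have hC0 : 0 ≤ C := (norm_nonneg _).trans (hC 0)
  have hst : ‖(stdVec i : RN N)‖ = 1 := by simp [stdVec]
  -- For `|t / s| < 1` all translated supports stay in the closed unit neighbourhood of the support;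
  -- on it the integrand is bounded by the Lipschitz constant and the bound of the derivative.
  set K : Set (RN N) := Metric.cthickening 1 (tsupport (χ : RN N → ℝ))
  have hK : IsCompact K := χ.hasCompactSupport.isCompact.cthickening
  have hzero : 𝓝 (0 : ℝ) = 𝓝 (∫ _ : RN N, ‖(0 : ℝ)‖) := by simp
  rw [hzero]
  refine tendsto_integral_filter_of_dominated_convergence
    (K.indicator fun _ => ‖s⁻¹‖ * L + ‖s⁻¹‖ * C) (Eventually.of_forall fun t => ?_) ?_ ?_ ?_
  · refine Continuous.aestronglyMeasurable ?_
    have h1 := χ.continuous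
    have h2 := (pd i χ).continuous
    fun_prop
  · have hev : ∀ᶠ t : ℝ in 𝓝[≠] 0, ‖t / s‖ < 1 := by
      have h1 : Tendsto (fun t : ℝ => ‖t / s‖) (𝓝[≠] 0) (𝓝 ‖(0 : ℝ) / s‖) :=
        ((continuous_id.div_const s).norm.tendsto 0).mono_left nhdsWithin_le_nhds
      rw [zero_div, norm_zero] at h1
      exact h1.eventually (gt_mem_nhds one_pos)
    filter_upwards [hev, self_mem_nhdsWithin] with t ht ht0
    refine ae_of_all _ fun x => ?_
    have ht0 : t ≠ 0 := ht0
    by_cases hx : x ∈ K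
    · rw [indicator_of_mem hx, norm_norm]
      refine (norm_sub_le _ _).trans (add_le_add ?_ ?_)
      · rw [norm_div, div_le_iff₀ (norm_pos_iff.2 ht0)]
        have h3 := hL.dist_le_mul (x - (t / s) • stdVec i) x
        rw [dist_eq_norm, dist_eq_norm, sub_sub_cancel_left, norm_neg, norm_smul, hst, mul_one] at h3
        refine h3.trans (le_of_eq ?_)
        rw [norm_div, norm_inv]
        field_simp
      · rw [norm_mul, norm_neg]
        gcongr
        exact hC x
    · have h1 : x ∉ tsupport (χ : RN N → ℝ) := fun h =>
        hx (Metric.self_subset_cthickening _ h)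
      have h2 : x - (t / s) • stdVec i ∉ tsupport (χ : RN N → ℝ) := fun h => by
        refine hx (Metric.mem_cthickening_of_dist_le x _ 1 _ h ?_)
        rw [dist_eq_norm, sub_sub_cancel, norm_smul, hst, mul_one]
        exact ht.le
      have h3 : x ∉ tsupport (pd i χ : RN N → ℝ) := fun h =>
        h1 (tsupport_fderiv_apply_subset ℝ (stdVec i) h)
      rw [indicator_of_notMem hx, image_eq_zero_of_notMem_tsupport h1,
        image_eq_zero_of_notMem_tsupport h2, image_eq_zero_of_notMem_tsupport h3]
      simp
  · exact (integrable_indicator_iff hK.measurableSet).2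
      (integrableOn_const hK.measure_lt_top.ne)
  · refine ae_of_all _ fun x => ?_
    refine Tendsto.norm ?_
    have hd : HasDerivAt (fun t : ℝ => (χ : RN N → ℝ) (x - (t / s) • stdVec i))
        (-s⁻¹ * (pd i χ : RN N → ℝ) x) 0 := by
      have h1 : HasDerivAt (fun t : ℝ => x - (t / s) • stdVec i) (-(s⁻¹ • (stdVec i : RN N))) 0 := by
        have := (((hasDerivAt_id (0 : ℝ)).div_const s).smul_const (stdVec i : RN N)).const_sub x
        simpa using this
      have h2 : HasFDerivAt (χ : RN N → ℝ) (fderiv ℝ (χ : RN N → ℝ) x)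
          (x - ((0 : ℝ) / s) • stdVec i) := by
        simpa using (χ.differentiable x).hasFDerivAt
      have := h2.comp_hasDerivAt (0 : ℝ) h1
      exact HasDerivAt.congr_deriv this (by simp [pd_apply])
    have h3 := hd.tendsto_slope_zero
    have h4 : Tendsto (fun t : ℝ => t⁻¹ • ((χ : RN N → ℝ) (x - ((0 + t) / s) • stdVec i)
        - (χ : RN N → ℝ) (x - ((0 : ℝ) / s) • stdVec i)) - -s⁻¹ * (pd i χ : RN N → ℝ) x)
        (𝓝[≠] 0) (𝓝 0) := by
      have := h3.sub_const (-s⁻¹ * (pd i χ : RN N → ℝ) x)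
      rwa [sub_self] at this
    refine h4.congr fun t => ?_
    simp only [zero_add, zero_div, zero_smul, sub_zero, smul_eq_mul]
    ring

end TestFn

end TestFunctions

/-! ### The skew product `(x, ω) ↦ (x, T(s x) ω)` -/

section SkewProduct

variable {N : ℕ} {Ω : Type*} [MeasurableSpace Ω] {μ : Measure Ω}

/-- The map `(x, ω) ↦ (x, T(s x) ω)`. -/
def skew (T : DynSystem N μ) (s : ℝ) (z : RN N × Ω) : RN N × Ω := (z.1, T (s • z.1) z.2)

theorem DynSystem.neg_apply_apply (T : DynSystem N μ) (y : RN N) (ω : Ω) : T (-y) (T y ω) = ω := by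
  rw [← T.map_add', neg_add_cancel, T.map_zero']

theorem skew_neg_skew (T : DynSystem N μ) (s : ℝ) (z : RN N × Ω) : skew T (-s) (skew T s z) = z := by
  simp only [skew, neg_smul, T.neg_apply_apply]

/-- The dynamical system is measurable only for the Lebesgue sets of `ℝ^N`. This bridges to the
product measure on the Borel product: the claim holds on rectangles and propagates by a `π`-`λ`
argument. -/
theorem nullMeasurableSet_of_measurable_nullMeasurableSpace [SFinite μ] {A : Set (RN N × Ω)}
    (hA : MeasurableSet (α := NullMeasurableSpace (RN N) volume × Ω) A) :
    NullMeasurableSet A ((volume : Measure (RN N)).prod μ) := by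
  refine MeasurableSpace.induction_on_inter (α := NullMeasurableSpace (RN N) volume × Ω)
    (C := fun A _ => NullMeasurableSet (α := RN N × Ω) A ((volume : Measure (RN N)).prod μ))
    generateFrom_prod.symm isPiSystem_prod ?_ ?_ ?_ ?_ A hA
  · exact nullMeasurableSet_empty
  · rintro _ ⟨B, hB, C, hC, rfl⟩
    exact NullMeasurableSet.prod (α := RN N) hB (MeasurableSet.nullMeasurableSet hC)
  · exact fun t _ ht => ht.compl
  · exact fun f _ _ hf => NullMeasurableSet.iUnion hf

theorem measurable_smul_nullMeasurableSpace {s : ℝ} (hs : s ≠ 0) :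
    Measurable (fun x : NullMeasurableSpace (RN N) volume =>
      (show NullMeasurableSpace (RN N) volume from s • (show RN N from x))) := by
  intro A hA
  have hq : Measure.QuasiMeasurePreserving (fun x : RN N => s • x) volume volume := by
    refine ⟨measurable_const_smul s, ?_⟩
    rw [Measure.map_addHaar_smul _ hs]
    exact Measure.smul_absolutelyContinuous
  exact NullMeasurableSet.preimage (α := RN N) (β := RN N) hA hq

theorem nullMeasurableSet_preimage_skew [SFinite μ] (T : DynSystem N μ) {s : ℝ} (hs : s ≠ 0)
    {A : Set (RN N × Ω)} (hA : MeasurableSet A) :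
    NullMeasurableSet (skew T s ⁻¹' A) ((volume : Measure (RN N)).prod μ) := by
  have h1 : Measurable (fun p : NullMeasurableSpace (RN N) volume × Ω => (show RN N from p.1)) :=
    fun B hB => measurable_fst (show MeasurableSet (α := NullMeasurableSpace (RN N) volume) B from
      hB.nullMeasurableSet)
  have h2 : Measurable (fun p : NullMeasurableSpace (RN N) volume × Ω =>
      T (s • (show RN N from p.1)) p.2) :=
    T.measurable'.comp (((measurable_smul_nullMeasurableSpace hs).comp measurable_fst).prodMk
      measurable_snd)
  exact nullMeasurableSet_of_measurable_nullMeasurableSpace ((h1.prodMk h2) hA)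

/-- The reference measure `dx ⊗ μ` on `Q × Ω`. -/
abbrev prodMeas (Q : Set (RN N)) (μ : Measure Ω) : Measure (RN N × Ω) :=
  (volume.restrict Q).prod μ

theorem prodMeas_absolutelyContinuous [SFinite μ] (Q : Set (RN N)) :
    prodMeas Q μ ≪ (volume : Measure (RN N)).prod μ :=
  (Measure.prod_mono Measure.restrict_le_self le_rfl).absolutelyContinuous

variable [SFinite μ] {Q : Set (RN N)} (T : DynSystem N μ) {s : ℝ}

theorem Measurable.aemeasurable_comp_skew {β : Type*} [MeasurableSpace β]
    [MeasurableSpace.CountablyGenerated β] (hs : s ≠ 0) {g : RN N × Ω → β} (hg : Measurable g) :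
    AEMeasurable (g ∘ skew T s) (prodMeas Q μ) := by
  have h : NullMeasurable (g ∘ skew T s) ((volume : Measure (RN N)).prod μ) := fun A hA =>
    nullMeasurableSet_preimage_skew T hs (hg hA)
  exact h.aemeasurable.mono_ac (prodMeas_absolutelyContinuous Q)

/-- Fubini: for fixed `x` the map `T (s • x)` preserves `μ`. -/
theorem lintegral_comp_skew_of_measurable (hs : s ≠ 0) {g : RN N × Ω → ℝ≥0∞} (hg : Measurable g) :
    ∫⁻ z, g (skew T s z) ∂(prodMeas Q μ) = ∫⁻ z, g z ∂(prodMeas Q μ) := by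
  change ∫⁻ z, (g ∘ skew T s) z ∂(prodMeas Q μ) = _
  rw [lintegral_prod _ hg.aemeasurable, lintegral_prod _ (hg.aemeasurable_comp_skew T hs)]
  refine lintegral_congr fun x => ?_
  exact (T.measurePreserving' (s • x)).lintegral_comp (hg.comp measurable_prodMk_left)

theorem ae_comp_skew (hs : s ≠ 0) {P : RN N × Ω → Prop} (h : ∀ᵐ z ∂(prodMeas Q μ), P z) :
    ∀ᵐ z ∂(prodMeas Q μ), P (skew T s z) := by
  obtain ⟨A, hsub, hA, hA0⟩ := exists_measurable_superset_of_null (ae_iff.1 h)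
  have h1 := lintegral_comp_skew_of_measurable (Q := Q) T hs (measurable_one.indicator hA)
  rw [lintegral_indicator_one hA, hA0] at h1
  have h2 := (lintegral_eq_zero_iff'
    ((measurable_one.indicator hA).aemeasurable_comp_skew (β := ℝ≥0∞) T hs)).1 h1
  filter_upwards [h2] with z hz
  by_contra hcon
  have : skew T s z ∈ A := hsub hcon
  simp [indicator_of_mem this] at hz

theorem aemeasurable_comp_skew {β : Type*} [MeasurableSpace β]
    [MeasurableSpace.CountablyGenerated β] (hs : s ≠ 0) {g : RN N × Ω → β}
    (hg : AEMeasurable g (prodMeas Q μ)) : AEMeasurable (g ∘ skew T s) (prodMeas Q μ) := by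
  refine (hg.measurable_mk.aemeasurable_comp_skew (Q := Q) T hs).congr ?_
  filter_upwards [ae_comp_skew T hs hg.ae_eq_mk] with z hz
  exact hz.symm

theorem lintegral_comp_skew (hs : s ≠ 0) {g : RN N × Ω → ℝ≥0∞}
    (hg : AEMeasurable g (prodMeas Q μ)) :
    ∫⁻ z, g (skew T s z) ∂(prodMeas Q μ) = ∫⁻ z, g z ∂(prodMeas Q μ) := by
  rw [lintegral_congr_ae (ae_comp_skew T hs hg.ae_eq_mk), lintegral_congr_ae hg.ae_eq_mk]
  exact lintegral_comp_skew_of_measurable T hs hg.measurable_mk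

theorem aestronglyMeasurable_comp_skew (hs : s ≠ 0) {g : RN N × Ω → ℝ}
    (hg : AEStronglyMeasurable g (prodMeas Q μ)) :
    AEStronglyMeasurable (g ∘ skew T s) (prodMeas Q μ) :=
  (aemeasurable_comp_skew T hs hg.aemeasurable).aestronglyMeasurable

theorem eLpNorm_comp_skew {q : ℝ≥0∞} (hq0 : q ≠ 0) (hq : q ≠ ∞) (hs : s ≠ 0) {g : RN N × Ω → ℝ}
    (hg : AEStronglyMeasurable g (prodMeas Q μ)) :
    eLpNorm (g ∘ skew T s) q (prodMeas Q μ) = eLpNorm g q (prodMeas Q μ) := by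
  rw [eLpNorm_eq_lintegral_rpow_enorm_toReal hq0 hq, eLpNorm_eq_lintegral_rpow_enorm_toReal hq0 hq]
  congr 1
  exact lintegral_comp_skew T hs (hg.enorm.pow_const _)

theorem MemLp.comp_skew {q : ℝ≥0∞} (hq0 : q ≠ 0) (hq : q ≠ ∞) (hs : s ≠ 0) {g : RN N × Ω → ℝ}
    (hg : MemLp g q (prodMeas Q μ)) : MemLp (g ∘ skew T s) q (prodMeas Q μ) :=
  ⟨aestronglyMeasurable_comp_skew T hs hg.1, by rw [eLpNorm_comp_skew T hq0 hq hs hg.1]; exact hg.2⟩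

theorem integral_comp_skew (hs : s ≠ 0) {g : RN N × Ω → ℝ}
    (hg : AEStronglyMeasurable g (prodMeas Q μ)) :
    ∫ z, g (skew T s z) ∂(prodMeas Q μ) = ∫ z, g z ∂(prodMeas Q μ) := by
  by_cases hi : Integrable g (prodMeas Q μ)
  · have hi' := memLp_one_iff_integrable.1
      (MemLp.comp_skew (q := 1) T one_ne_zero ENNReal.one_ne_top hs (memLp_one_iff_integrable.2 hi))
    change ∫ z, (g ∘ skew T s) z ∂(prodMeas Q μ) = _
    rw [integral_eq_lintegral_pos_part_sub_lintegral_neg_part hi,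
      integral_eq_lintegral_pos_part_sub_lintegral_neg_part hi']
    congr 2
    · exact lintegral_comp_skew T hs hg.aemeasurable.ennreal_ofReal
    · exact lintegral_comp_skew T hs hg.aemeasurable.neg.ennreal_ofReal
  -- Both integrals are zero by convention here, because integrability transfers back through the
  -- inverse map `skew T (-s)`.
  · rw [integral_undef hi, integral_undef]
    intro h
    refine hi ((memLp_one_iff_integrable.1 (MemLp.comp_skew (q := 1) T one_ne_zero
      ENNReal.one_ne_top (neg_ne_zero.2 hs) (memLp_one_iff_integrable.2 h))).congr ?_)
    refine ae_of_all _ fun z => ?_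
    have := skew_neg_skew T (-s) z
    rw [neg_neg] at this
    simp only [Function.comp_apply, this]

/-- The unfolding isometry `u ↦ u ∘ skew T s` of `L^q(Q × Ω)`. -/
def unfoldIso {q : ℝ≥0∞} [Fact (1 ≤ q)] (Q : Set (RN N)) (hq : q ≠ ∞) (hs : s ≠ 0) :
    Lp ℝ q (prodMeas Q μ) →ₗᵢ[ℝ] Lp ℝ q (prodMeas Q μ) where
  toFun f := (MemLp.comp_skew T (zero_lt_one.trans_le Fact.out).ne' hq hs (Lp.memLp f)).toLp _
  map_add' f g := by
    rw [← MemLp.toLp_add, MemLp.toLp_eq_toLp_iff]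
    exact ae_comp_skew T hs (Lp.coeFn_add f g)
  map_smul' c f := by
    rw [RingHom.id_apply, ← MemLp.toLp_const_smul, MemLp.toLp_eq_toLp_iff]
    exact ae_comp_skew T hs (Lp.coeFn_smul c f)
  norm_map' f := by
    change ‖(MemLp.comp_skew T (zero_lt_one.trans_le Fact.out).ne' hq hs (Lp.memLp f)).toLp _‖ = _
    rw [Lp.norm_toLp, eLpNorm_comp_skew T (zero_lt_one.trans_le Fact.out).ne' hq hs
      (Lp.aestronglyMeasurable f), Lp.norm_def]

theorem coeFn_unfoldIso {q : ℝ≥0∞} [Fact (1 ≤ q)] (hq : q ≠ ∞) (hs : s ≠ 0)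
    (f : Lp ℝ q (prodMeas Q μ)) :
    unfoldIso T Q hq hs f =ᵐ[prodMeas Q μ] fun z => f (skew T s z) :=
  MemLp.coeFn_toLp
    (MemLp.comp_skew T (zero_lt_one.trans_le Fact.out).ne' hq hs (Lp.memLp f))

theorem unfoldIso_neg_unfoldIso {q : ℝ≥0∞} [Fact (1 ≤ q)] (hq : q ≠ ∞) (hs : s ≠ 0)
    (hs' : -s ≠ 0) (f : Lp ℝ q (prodMeas Q μ)) :
    unfoldIso T Q hq hs' (unfoldIso T Q hq hs f) = f := by
  refine Lp.ext ?_
  filter_upwards [coeFn_unfoldIso T hq hs' (unfoldIso T Q hq hs f),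
    ae_comp_skew T hs' (coeFn_unfoldIso T hq hs f)] with z h1 h2
  rw [h1, h2]
  congr 1
  have := skew_neg_skew T (-s) z
  rwa [neg_neg] at this

end SkewProduct

/-! ### The Koopman representation -/

section Koopman

variable {N : ℕ} {Ω : Type*} [MeasurableSpace Ω] {μ : Measure Ω} (T : DynSystem N μ)
  {q : ℝ≥0∞} [Fact (1 ≤ q)]

/-- The Koopman isometry `h ↦ h ∘ T y` of `L^q(Ω)`. -/
def koopman (q : ℝ≥0∞) [Fact (1 ≤ q)] (y : RN N) : Lp ℝ q μ →ₗᵢ[ℝ] Lp ℝ q μ :=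
  Lp.compMeasurePreservingₗᵢ ℝ (T y) (T.measurePreserving' y)

theorem coeFn_koopman (y : RN N) (h : Lp ℝ q μ) :
    koopman T q y h =ᵐ[μ] fun ω => h (T y ω) :=
  Lp.coeFn_compMeasurePreserving h (T.measurePreserving' y)

theorem koopman_add (x y : RN N) (h : Lp ℝ q μ) :
    koopman T q (x + y) h = koopman T q y (koopman T q x h) := by
  refine Lp.ext ?_
  filter_upwards [coeFn_koopman T (x + y) h, coeFn_koopman T y (koopman T q x h),
    (T.measurePreserving' y).quasiMeasurePreserving.ae (coeFn_koopman T x h)] with ω h1 h2 h3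
  rw [h1, h2, h3, T.map_add']

theorem koopman_zero (h : Lp ℝ q μ) : koopman T q 0 h = h := by
  refine Lp.ext ?_
  filter_upwards [coeFn_koopman T 0 h] with ω h1
  rw [h1, T.map_zero']

theorem sliceEquiv_unfoldIso [IsFiniteMeasure μ] {Q : Set (RN N)} (hq : q ≠ ∞) {s : ℝ} (hs : s ≠ 0)
    (f : Lp ℝ q (prodMeas Q μ)) : ∀ᵐ x ∂(volume.restrict Q),
      sliceEquiv (volume.restrict Q) μ hq (unfoldIso T Q hq hs f) x
        = koopman T q (s • x) (sliceEquiv (volume.restrict Q) μ hq f x) := by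
  filter_upwards [coeFn_sliceEquiv hq (unfoldIso T Q hq hs f), coeFn_sliceEquiv hq f,
    Measure.ae_ae_of_ae_prod (coeFn_unfoldIso T hq hs f)] with x h1 h2 h3
  refine Lp.ext ?_
  filter_upwards [h1, h3, coeFn_koopman T (s • x) (sliceEquiv (volume.restrict Q) μ hq f x),
    (T.measurePreserving' (s • x)).quasiMeasurePreserving.ae h2] with ω g1 g2 g3 g4
  rw [g1, g2, g3, g4]
  rfl

end Koopman

/-! ### Mollification along the flow -/

section Mollification

variable {N : ℕ} {Ω : Type*} [MeasurableSpace Ω] {μ : Measure Ω} [IsProbabilityMeasure μ]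
  (T : DynSystem N μ) {s C : ℝ} {h : Ω → ℝ}

/-- The average `∫ χ(x) h(T(s x) ω) dx`. -/
def moll (s : ℝ) (h : Ω → ℝ) (χ : RN N → ℝ) (ω : Ω) : ℝ := ∫ x, χ x * h (T (s • x) ω)

theorem aestronglyMeasurable_orbit (hs : s ≠ 0) (hh : Measurable h) (ω : Ω) :
    AEStronglyMeasurable (fun x : RN N => h (T (s • x) ω)) volume := by
  have h2 : Measurable (fun x : NullMeasurableSpace (RN N) volume =>
      h (T (s • (show RN N from x)) ω)) :=
    hh.comp (T.measurable'.comp ((measurable_smul_nullMeasurableSpace hs).prodMk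
      measurable_const))
  have h3 : NullMeasurable (fun x : RN N => h (T (s • x) ω)) volume := fun A hA => h2 hA
  exact h3.aemeasurable.aestronglyMeasurable

theorem aestronglyMeasurable_orbit_prod (hs : s ≠ 0) (hh : Measurable h) :
    AEStronglyMeasurable (fun z : RN N × Ω => h (T (s • z.1) z.2))
      ((volume : Measure (RN N)).prod μ) := by
  have := aestronglyMeasurable_comp_skew (Q := univ) T hs
    (g := fun z => h z.2) (hh.comp measurable_snd).aestronglyMeasurable
  rwa [prodMeas, Measure.restrict_univ] at this

variable {T}

theorem integrable_mul_orbit (hs : s ≠ 0) (hh : Measurable h) (hC : ∀ ω, ‖h ω‖ ≤ C)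
    {χ : RN N → ℝ} (hχ : Integrable χ) (ω : Ω) :
    Integrable (fun x => χ x * h (T (s • x) ω)) :=
  hχ.mul_bdd (c := C) (aestronglyMeasurable_orbit T hs hh ω) (ae_of_all _ fun _ => hC _)

theorem norm_moll_le (hC : ∀ ω, ‖h ω‖ ≤ C) {χ : RN N → ℝ} (hχ : Integrable χ) (ω : Ω) :
    ‖moll T s h χ ω‖ ≤ C * ∫ x, ‖χ x‖ := by
  rw [← integral_const_mul]
  refine norm_integral_le_of_norm_le (hχ.norm.const_mul C) (ae_of_all _ fun x => ?_)
  rw [norm_mul, mul_comm]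
  exact mul_le_mul_of_nonneg_right (hC _) (norm_nonneg _)

theorem memLp_moll (hs : s ≠ 0) (hh : Measurable h) (hC : ∀ ω, ‖h ω‖ ≤ C) (χ : TestFn N) :
    MemLp (moll T s h χ) ∞ μ := by
  refine memLp_top_of_bound ?_ _ (ae_of_all _ (norm_moll_le hC χ.integrable))
  have h1 : AEStronglyMeasurable (fun z : RN N × Ω => χ z.1 * h (T (s • z.1) z.2))
      ((volume : Measure (RN N)).prod μ) :=
    χ.continuous.aestronglyMeasurable.comp_fst.mul (aestronglyMeasurable_orbit_prod T hs hh)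
  exact h1.prod_swap.integral_prod_right'

/-- Moving `ω` by `T (t e_i)` translates the weight `χ` by `(t / s) e_i`. The difference quotient
thus falls on `χ`, where it converges in `L¹`, and the bound on `h` turns this into uniform
convergence in `ω`. -/
theorem isStochDeriv_moll (hs : s ≠ 0) (hh : Measurable h) (hC : ∀ ω, ‖h ω‖ ≤ C) (χ : TestFn N)
    (i : Fin N) : IsStochDeriv T i (moll T s h χ) (moll T s h ((-s⁻¹) • TestFn.pd i χ : TestFn N)) := by
  refine ⟨memLp_moll hs hh hC χ, memLp_moll hs hh hC _, ?_⟩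
  have hlim := (TestFn.tendsto_integral_diffQuot χ i hs).const_mul C
  rw [mul_zero] at hlim
  have hlim' := ENNReal.tendsto_ofReal hlim
  rw [ENNReal.ofReal_zero] at hlim'
  refine tendsto_of_tendsto_of_tendsto_of_le_of_le' tendsto_const_nhds hlim'
    (Eventually.of_forall fun _ => zero_le) ?_
  filter_upwards with t
  rw [eLpNorm_exponent_top]
  refine eLpNormEssSup_le_of_ae_bound (ae_of_all _ fun ω => ?_)
  have hshift : moll T s h χ (T (t • stdVec i) ω)
      = ∫ x, χ (x - (t / s) • stdVec i) * h (T (s • x) ω) := by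
    rw [moll, ← integral_sub_right_eq_self (μ := (volume : Measure (RN N))) _ ((t / s) • stdVec i)]
    refine integral_congr_ae (ae_of_all _ fun x => ?_)
    simp only
    rw [← T.map_add']
    congr 3
    rw [smul_sub, smul_smul, mul_div_cancel₀ _ hs, sub_add_cancel]
  have hi1 : Integrable (fun x => χ (x - (t / s) • stdVec i) * h (T (s • x) ω)) :=
    integrable_mul_orbit hs hh hC (χ.integrable.comp_sub_right _) ω
  have hi2 := integrable_mul_orbit (T := T) hs hh hC χ.integrable ω
  have hi3 := integrable_mul_orbit (T := T) hs hh hC ((-s⁻¹) • TestFn.pd i χ : TestFn N).integrable ω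
  have heq : (moll T s h χ (T (t • stdVec i) ω) - moll T s h χ ω) / t
      - moll T s h ((-s⁻¹) • TestFn.pd i χ : TestFn N) ω
      = moll T s h (fun x => (χ (x - (t / s) • stdVec i) - χ x) / t
        - (-s⁻¹) * (TestFn.pd i χ) x) ω := by
    rw [hshift]
    simp only [moll]
    rw [← integral_sub hi1 hi2, ← integral_div]
    refine (integral_sub ((hi1.sub hi2).div_const t) hi3).symm.trans ?_
    refine integral_congr_ae (ae_of_all _ fun x => ?_)
    simp only [Submodule.coe_smul, Pi.smul_apply, Pi.sub_apply, smul_eq_mul]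
    ring
  rw [heq]
  refine norm_moll_le hC ?_ ω
  exact (((χ.integrable.comp_sub_right _).sub χ.integrable).div_const t).sub
    ((TestFn.pd i χ).integrable.const_mul _)

/-- Mollifications along the flow of bounded functions are stochastically smooth. -/
theorem moll_mem_cInf (hs : s ≠ 0) (hh : Measurable h) (hC : ∀ ω, ‖h ω‖ ≤ C) (χ : TestFn N) :
    moll T s h χ ∈ CInf T := by
  set D : Fin N → Module.End ℝ (TestFn N) := fun i => (-s⁻¹) • TestFn.pd i
  have hD : ∀ i j, Commute (D i) (D j) := fun i j =>
    ((TestFn.pd_comm i j).smul_right _).smul_left _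
  have hcomm : ∀ a b : Fin N → ℕ, ((Finset.univ : Finset (Fin N)) : Set (Fin N)).Pairwise
      fun i j => Commute (D i ^ a i) (D j ^ b j) := fun a b i _ j _ _ => (hD i j).pow_pow _ _
  -- The derivative of multi-index `a` is the mollification with weight `P a χ`. The endomorphism
  -- ring is not commutative, so the product is formed from commuting factors.
  set P : (Fin N → ℕ) → Module.End ℝ (TestFn N) := fun a =>
    Finset.univ.noncommProd (fun i => D i ^ a i) (hcomm a a)
  have hP : ∀ a i, P (a + Pi.single i 1) = D i * P a := by
    intro a i
    simp only [P]
    rw [← Finset.mul_noncommProd_erase _ (Finset.mem_univ i) (fun j => D j ^ a j),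
      ← Finset.mul_noncommProd_erase _ (Finset.mem_univ i), ← mul_assoc]
    congr 1
    · simp [pow_succ']
    · refine Finset.noncommProd_congr rfl (fun j hj => ?_) _
      simp [Pi.single_eq_of_ne (Finset.ne_of_mem_erase hj)]
  refine ⟨fun a => moll T s h (P a χ), ?_, fun a => ⟨memLp_moll hs hh hC _, fun i => ?_⟩⟩
  · have : P 0 = 1 := by
      simp only [P, Pi.zero_apply, pow_zero]
      exact Finset.noncommProd_eq_pow_card _ _ _ 1 (fun _ _ => rfl) |>.trans (one_pow _)
    simp only [this, Module.End.one_apply]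
  · have := isStochDeriv_moll (T := T) hs hh hC (P a χ) i
    simp only [hP]
    exact this

end Mollification

/-! ### Classes of stochastically smooth functions -/

section SmoothClasses

variable {N : ℕ} {Ω : Type*} [MeasurableSpace Ω] {μ : Measure Ω} [IsProbabilityMeasure μ]
  {T : DynSystem N μ} {q : ℝ≥0∞} [Fact (1 ≤ q)]

/-- The class in `L^q(Ω)` of a bounded function. -/
def topToLp (q : ℝ≥0∞) {u : Ω → ℝ} (hu : MemLp u ∞ μ) : Lp ℝ q μ := (hu.mono_exponent le_top).toLp u

theorem coeFn_topToLp {u : Ω → ℝ} (hu : MemLp u ∞ μ) : topToLp q hu =ᵐ[μ] u :=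
  MemLp.coeFn_toLp _

theorem topToLp_congr {u v : Ω → ℝ} (hu : MemLp u ∞ μ) (hv : MemLp v ∞ μ) (h : u =ᵐ[μ] v) :
    topToLp q hu = topToLp q hv := (MemLp.toLp_eq_toLp_iff _ _).2 h

theorem CInf.memLp (ψ : CInf T) : MemLp (ψ : Ω → ℝ) ∞ μ := by
  obtain ⟨F, hF0, hF⟩ := ψ.2
  exact hF0 ▸ (hF 0).1

/-- The class of `ψ ∈ C^∞(Ω)` together with the classes of its derivatives. -/
def gradPair (q : ℝ≥0∞) [Fact (1 ≤ q)] (T : DynSystem N μ) :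
    CInf T →ₗ[ℝ] Lp ℝ q μ × (Fin N → Lp ℝ q μ) where
  toFun ψ := (topToLp q (CInf.memLp ψ), fun i => topToLp q (stochDeriv_spec i ψ).2.1)
  map_add' ψ χ := by
    refine Prod.ext rfl (funext fun i => ?_)
    refine (topToLp_congr (stochDeriv_spec i (ψ + χ)).2.1
      ((stochDeriv_spec i ψ).add (stochDeriv_spec i χ)).2.1
      ((stochDeriv_spec i (ψ + χ)).unique ((stochDeriv_spec i ψ).add (stochDeriv_spec i χ)))).trans
      rfl
  map_smul' c ψ := by
    refine Prod.ext rfl (funext fun i => ?_)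
    refine (topToLp_congr (stochDeriv_spec i (c • ψ)).2.1
      ((stochDeriv_spec i ψ).const_smul c).2.1
      ((stochDeriv_spec i (c • ψ)).unique ((stochDeriv_spec i ψ).const_smul c))).trans rfl

theorem gradPair_fst (ψ : CInf T) : (gradPair q T ψ).1 = topToLp q (CInf.memLp ψ) := rfl

theorem gradPair_snd (ψ : CInf T) (i : Fin N) :
    (gradPair q T ψ).2 i = topToLp q (stochDeriv_spec i ψ).2.1 := rfl

theorem gradPair_snd_eq (ψ : CInf T) (i : Fin N) {g : Ω → ℝ} (hg : IsStochDeriv T i ψ g) :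
    (gradPair q T ψ).2 i = topToLp q hg.2.1 :=
  topToLp_congr (stochDeriv_spec i ψ).2.1 hg.2.1 ((stochDeriv_spec i ψ).unique hg)

/-- Shifting the family of all derivatives shows that a derivative of a smooth function is smooth.
Facts about orbits of smooth functions thereby extend to their derivatives. -/
theorem exists_gradPair_fst_eq_snd (ψ : CInf T) (i : Fin N) :
    ∃ ψ' : CInf T, (gradPair q T ψ').1 = (gradPair q T ψ).2 i := by
  obtain ⟨F, hF0, hF⟩ := ψ.2
  refine ⟨⟨F (Pi.single i 1), fun a => F (Pi.single i 1 + a), by simp, fun a => ⟨(hF _).1,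
    fun j => ?_⟩⟩, ?_⟩
  · have := (hF (Pi.single i 1 + a)).2 j
    rwa [add_assoc] at this
  · have h1 : IsStochDeriv T i (ψ : Ω → ℝ) (F (Pi.single i 1)) := by
      have := (hF 0).2 i
      rwa [zero_add, hF0] at this
    rw [gradPair_snd_eq ψ i h1]
    rfl

/-- On a probability space the `L^∞` convergence of the difference quotients implies convergence in
`L^q`. -/
theorem hasDerivAt_koopman_zero (ψ : CInf T) (i : Fin N) :
    HasDerivAt (fun t : ℝ => koopman T q (t • stdVec i) (gradPair q T ψ).1)
      ((gradPair q T ψ).2 i) 0 := by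
  rw [hasDerivAt_iff_tendsto_slope_zero, tendsto_iff_norm_sub_tendsto_zero]
  have h := (stochDeriv_spec i ψ).2.2
  have h' := (ENNReal.tendsto_toReal ENNReal.zero_ne_top).comp h
  rw [ENNReal.toReal_zero] at h'
  refine squeeze_zero' (Eventually.of_forall fun _ => norm_nonneg _) ?_ h'
  have hfin : ∀ᶠ t in 𝓝[≠] (0 : ℝ), eLpNorm (fun ω => ((ψ : Ω → ℝ) (T (t • stdVec i) ω)
      - (ψ : Ω → ℝ) ω) / t - stochDeriv i ψ ω) ∞ μ < ∞ :=
    h.eventually (gt_mem_nhds ENNReal.zero_lt_top)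
  filter_upwards [hfin] with t ht
  rw [Lp.norm_def]
  refine ENNReal.toReal_mono ht.ne ?_
  have hae : (t⁻¹ • (koopman T q ((0 + t) • stdVec i) (gradPair q T ψ).1
      - koopman T q ((0 : ℝ) • stdVec i) (gradPair q T ψ).1) - (gradPair q T ψ).2 i : Lp ℝ q μ)
      =ᵐ[μ] fun ω => ((ψ : Ω → ℝ) (T (t • stdVec i) ω) - (ψ : Ω → ℝ) ω) / t - stochDeriv i ψ ω := by
    rw [zero_add, zero_smul, koopman_zero]
    have hψ := coeFn_topToLp (q := q) (CInf.memLp ψ)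
    filter_upwards [Lp.coeFn_sub (t⁻¹ • (koopman T q (t • stdVec i) (gradPair q T ψ).1
      - (gradPair q T ψ).1)) ((gradPair q T ψ).2 i),
      Lp.coeFn_smul t⁻¹ (koopman T q (t • stdVec i) (gradPair q T ψ).1 - (gradPair q T ψ).1),
      Lp.coeFn_sub (koopman T q (t • stdVec i) (gradPair q T ψ).1) (gradPair q T ψ).1,
      coeFn_koopman T (t • stdVec i) (gradPair q T ψ).1, hψ,
      (T.measurePreserving' (t • stdVec i)).quasiMeasurePreserving.ae hψ,
      coeFn_topToLp (q := q) (stochDeriv_spec i ψ).2.1] with ω h1 h2 h3 h4 h5 h6 h7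
    rw [h1, Pi.sub_apply, h2, Pi.smul_apply, h3, Pi.sub_apply, h4, gradPair_fst, h5, h6,
      gradPair_snd, h7, smul_eq_mul]
    ring
  rw [eLpNorm_congr_ae hae]
  refine eLpNorm_le_eLpNorm_of_exponent_le le_top ?_
  exact ((Lp.aestronglyMeasurable _).congr hae)

theorem hasDerivAt_koopman (ψ : CInf T) (i : Fin N) (y : RN N) (t : ℝ) :
    HasDerivAt (fun t : ℝ => koopman T q (y + t • stdVec i) (gradPair q T ψ).1)
      (koopman T q (y + t • stdVec i) ((gradPair q T ψ).2 i)) t := by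
  have h0 := hasDerivAt_koopman_zero (q := q) ψ i
  have h1 : HasDerivAt (fun r : ℝ => koopman T q ((r - t) • stdVec i) (gradPair q T ψ).1)
      ((gradPair q T ψ).2 i) t := by
    have := HasDerivAt.scomp t (by simpa using h0) ((hasDerivAt_id t).sub_const t)
      (g₁ := fun t : ℝ => koopman T q (t • stdVec i) (gradPair q T ψ).1)
      (g₁' := (gradPair q T ψ).2 i)
    simpa [Function.comp_def] using this
  have h2 := (koopman T q (y + t • stdVec i)).toContinuousLinearMap.hasFDerivAt.comp_hasDerivAt t h1
  refine h2.congr_of_eventuallyEq (Eventually.of_forall fun r => ?_)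
  simp only [Function.comp_apply, LinearIsometry.coe_toContinuousLinearMap]
  rw [← koopman_add]
  congr 2
  rw [sub_smul]
  abel

/-- The mean value inequality; Koopman operators are isometries, so the derivative along the orbit
has constant norm. -/
theorem norm_koopman_sub_le (ψ : CInf T) (i : Fin N) (t : ℝ) :
    ‖koopman T q (t • stdVec i) (gradPair q T ψ).1 - (gradPair q T ψ).1‖
      ≤ |t| * ‖(gradPair q T ψ).2 i‖ := by
  have h := convex_univ.norm_image_sub_le_of_norm_hasDerivWithin_le
    (f := fun t : ℝ => koopman T q (0 + t • stdVec i) (gradPair q T ψ).1)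
    (f' := fun t => koopman T q (0 + t • stdVec i) ((gradPair q T ψ).2 i))
    (C := ‖(gradPair q T ψ).2 i‖) (s := univ) (x := 0) (y := t)
    (fun r _ => (hasDerivAt_koopman ψ i 0 r).hasDerivWithinAt)
    (fun r _ => by rw [LinearIsometry.norm_map]) (mem_univ _) (mem_univ _)
  simp only [zero_add, zero_smul, koopman_zero, sub_zero, Real.norm_eq_abs] at h
  rwa [mul_comm]

/-- Telescoping along the coordinate directions, each Koopman operator being an isometry. -/
theorem norm_koopman_sub_le_sum {h : Lp ℝ q μ} {c : Fin N → ℝ}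
    (hc : ∀ i (t : ℝ), ‖koopman T q (t • stdVec i) h - h‖ ≤ |t| * c i) (y : RN N) :
    ‖koopman T q y h - h‖ ≤ ∑ i, |y i| * c i := by
  have key : ∀ S : Finset (Fin N), ‖koopman T q (∑ i ∈ S, y i • stdVec i) h - h‖
      ≤ ∑ i ∈ S, |y i| * c i := by
    classical
    intro S
    induction S using Finset.induction_on with
    | empty => simp [koopman_zero]
    | insert j S hj ih =>
      rw [Finset.sum_insert hj, Finset.sum_insert hj, koopman_add]
      have e : koopman T q (∑ i ∈ S, y i • stdVec i) (koopman T q (y j • stdVec j) h) - h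
          = koopman T q (∑ i ∈ S, y i • stdVec i) (koopman T q (y j • stdVec j) h - h)
            + (koopman T q (∑ i ∈ S, y i • stdVec i) h - h) := by
        rw [map_sub]
        abel
      rw [e]
      refine (norm_add_le _ _).trans (add_le_add ?_ ih)
      rw [LinearIsometry.norm_map]
      exact hc j _
  have hy : ∑ i, y i • (stdVec i : RN N) = y := by
    ext k
    simp [stdVec, Finset.sum_apply, Pi.single_apply]
  have := key Finset.univ
  rwa [hy] at this

/-- The derivatives give a Lipschitz bound. Continuity on smooth classes is all that the averages
over orbits require. -/
theorem continuous_koopman (ψ : CInf T) :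
    Continuous fun y => koopman T q y (gradPair q T ψ).1 := by
  rw [continuous_iff_continuousAt]
  intro y₀
  rw [ContinuousAt, tendsto_iff_norm_sub_tendsto_zero]
  have hb : ∀ y, ‖koopman T q y (gradPair q T ψ).1 - koopman T q y₀ (gradPair q T ψ).1‖
      ≤ ∑ i, |(y - y₀) i| * ‖(gradPair q T ψ).2 i‖ := by
    intro y
    have e : koopman T q y (gradPair q T ψ).1
        = koopman T q y₀ (koopman T q (y - y₀) (gradPair q T ψ).1) := by
      rw [← koopman_add, sub_add_cancel]
    rw [e, ← map_sub, LinearIsometry.norm_map]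
    exact norm_koopman_sub_le_sum (norm_koopman_sub_le ψ) _
  refine squeeze_zero (fun _ => norm_nonneg _) hb ?_
  have hcont : Continuous fun y : RN N => ∑ i, |(y - y₀) i| * ‖(gradPair q T ψ).2 i‖ := by
    fun_prop
  have := hcont.tendsto y₀
  simpa using this

theorem continuous_koopman_snd (ψ : CInf T) (i : Fin N) :
    Continuous fun y => koopman T q y ((gradPair q T ψ).2 i) := by
  obtain ⟨ψ', h⟩ := exists_gradPair_fst_eq_snd (q := q) ψ i
  rw [← h]
  exact continuous_koopman ψ'

/-- The closure in `L^q(Ω) × L^q(Ω)^N` of the graph of the stochastic gradient. -/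
def gradGraph (q : ℝ≥0∞) [Fact (1 ≤ q)] (T : DynSystem N μ) :
    Submodule ℝ (Lp ℝ q μ × (Fin N → Lp ℝ q μ)) :=
  (LinearMap.range (gradPair q T)).topologicalClosure

/-- The closure in `L^q(Ω)^N` of the stochastic gradients. -/
def gradRange (q : ℝ≥0∞) [Fact (1 ≤ q)] (T : DynSystem N μ) :
    Submodule ℝ (Fin N → Lp ℝ q μ) :=
  (LinearMap.range (LinearMap.snd ℝ _ _ ∘ₗ gradPair q T)).topologicalClosure

theorem isClosed_gradGraph : IsClosed (gradGraph q T : Set (Lp ℝ q μ × (Fin N → Lp ℝ q μ))) :=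
  Submodule.isClosed_topologicalClosure _

theorem isClosed_gradRange : IsClosed (gradRange q T : Set (Fin N → Lp ℝ q μ)) :=
  Submodule.isClosed_topologicalClosure _

theorem gradPair_mem (ψ : CInf T) : gradPair q T ψ ∈ gradGraph q T :=
  Submodule.le_topologicalClosure _ ⟨ψ, rfl⟩

theorem gradPair_snd_mem (ψ : CInf T) : (gradPair q T ψ).2 ∈ gradRange q T :=
  Submodule.le_topologicalClosure _ ⟨ψ, rfl⟩

theorem gradGraph_induction {P : Lp ℝ q μ × (Fin N → Lp ℝ q μ) → Prop}
    (hP : IsClosed {z | P z}) (h : ∀ ψ : CInf T, P (gradPair q T ψ)) {z}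
    (hz : z ∈ gradGraph q T) : P z := by
  have hz' : z ∈ closure (LinearMap.range (gradPair q T) : Set (Lp ℝ q μ × (Fin N → Lp ℝ q μ))) :=
    hz
  refine closure_minimal ?_ hP hz'
  rintro _ ⟨ψ, rfl⟩
  exact h ψ

theorem gradRange_induction {P : (Fin N → Lp ℝ q μ) → Prop}
    (hP : IsClosed {z | P z}) (h : ∀ ψ : CInf T, P (gradPair q T ψ).2) {z}
    (hz : z ∈ gradRange q T) : P z := by
  have hz' : z ∈ closure (LinearMap.range (LinearMap.snd ℝ _ _ ∘ₗ gradPair q T) :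
    Set (Fin N → Lp ℝ q μ)) := hz
  refine closure_minimal ?_ hP hz'
  rintro _ ⟨ψ, rfl⟩
  exact h ψ

theorem snd_mem_gradRange {z : Lp ℝ q μ × (Fin N → Lp ℝ q μ)} (hz : z ∈ gradGraph q T) :
    z.2 ∈ gradRange q T :=
  gradGraph_induction (isClosed_gradRange.preimage continuous_snd) gradPair_snd_mem hz

theorem norm_koopman_sub_le_of_mem_gradGraph {z : Lp ℝ q μ × (Fin N → Lp ℝ q μ)}
    (hz : z ∈ gradGraph q T) (i : Fin N) (t : ℝ) :
    ‖koopman T q (t • stdVec i) z.1 - z.1‖ ≤ |t| * ‖z.2 i‖ := by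
  refine gradGraph_induction (P := fun z => ‖koopman T q (t • stdVec i) z.1 - z.1‖ ≤ |t| * ‖z.2 i‖)
    (isClosed_le ?_ ?_) (fun ψ => norm_koopman_sub_le ψ i t) hz
  · exact (((koopman T q (t • stdVec i)).continuous.comp continuous_fst).sub continuous_fst).norm
  · exact continuous_const.mul ((continuous_apply i).comp continuous_snd).norm

/-- The mollification of a bounded function along the flow is in the graph of the gradient. -/
theorem moll_mem_gradGraph {s C : ℝ} (hs : s ≠ 0) {h : Ω → ℝ} (hh : Measurable h)
    (hC : ∀ ω, ‖h ω‖ ≤ C) (χ : TestFn N) :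
    (topToLp q (memLp_moll (T := T) hs hh hC χ),
      fun i => (-s⁻¹) • topToLp q (memLp_moll (T := T) hs hh hC (TestFn.pd i χ))) ∈ gradGraph q T := by
  have h1 := gradPair_mem (q := q) (⟨_, moll_mem_cInf (T := T) hs hh hC χ⟩ : CInf T)
  convert h1 using 1
  refine Prod.ext rfl (funext fun i => ?_)
  rw [gradPair_snd_eq _ i (isStochDeriv_moll (T := T) hs hh hC χ i)]
  refine ((topToLp_congr (q := q) (((memLp_moll (T := T) hs hh hC (TestFn.pd i χ)).const_smul (-s⁻¹)))
    (isStochDeriv_moll (T := T) hs hh hC χ i).2.1 (ae_of_all _ fun ω => ?_))).symm.symm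
  simp only [moll, Pi.smul_apply, smul_eq_mul]
  rw [← integral_const_mul]
  refine integral_congr_ae (ae_of_all _ fun x => ?_)
  simp only [Submodule.coe_smul, Pi.smul_apply, smul_eq_mul]
  ring

end SmoothClasses

/-! ### The projection onto the invariant functions -/

section InvariantProjection

variable {N : ℕ} {Ω : Type*} [m0 : MeasurableSpace Ω] {μ : Measure Ω} [IsProbabilityMeasure μ]
  (T : DynSystem N μ) {q : ℝ≥0∞} [Fact (1 ≤ q)]

/-- The `σ`-algebra of the measurable sets that are invariant modulo null sets. -/
@[reducible] def invSigma : MeasurableSpace Ω where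
  MeasurableSet' A := MeasurableSet A ∧ ∀ y, T y ⁻¹' A =ᵐ[μ] A
  measurableSet_empty := ⟨MeasurableSet.empty, fun y => by simp⟩
  measurableSet_compl A hA := ⟨hA.1.compl, fun y => by
    rw [preimage_compl]
    exact (hA.2 y).compl⟩
  measurableSet_iUnion A hA := ⟨MeasurableSet.iUnion fun i => (hA i).1, fun y => by
    rw [preimage_iUnion]
    exact Filter.EventuallyEq.countable_iUnion fun i => (hA i).2 y⟩

theorem invSigma_le : invSigma T ≤ m0 := fun _ h => h.1

/-- Two real functions agree once their sublevel sets at rational heights agree, so countably many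
null sets suffice. -/
theorem ae_eq_comp_of_measurable_invSigma {g : Ω → ℝ} (hg : Measurable[invSigma T] g) (y : RN N) :
    (fun ω => g (T y ω)) =ᵐ[μ] g := by
  have h1 : ∀ᵐ ω ∂μ, ∀ r : ℚ, (g (T y ω) < r ↔ g ω < r) := by
    rw [ae_all_iff]
    intro r
    have := (hg (measurableSet_Iio (a := (r : ℝ)))).2 y
    filter_upwards [this] with ω hω
    exact iff_of_eq hω
  filter_upwards [h1] with ω hω
  refine le_antisymm ?_ ?_
  · refine le_of_forall_lt_rat_imp_le fun r hr => ((hω r).2 hr).le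
  · refine le_of_forall_lt_rat_imp_le fun r hr => ((hω r).1 hr).le

theorem exists_measurable_invSigma {g : Ω → ℝ} (hg : Measurable g)
    (h : ∀ y, (fun ω => g (T y ω)) =ᵐ[μ] g) : Measurable[invSigma T] g := fun B hB =>
  ⟨hg hB, fun y => by
    filter_upwards [h y] with ω hω
    exact propext (iff_of_eq (congrArg (· ∈ B) hω))⟩

theorem memLp_condExp_coeFn (h : Lp ℝ q μ) : MemLp (μ[h | invSigma T]) q μ :=
  (Lp.memLp h).condExp Fact.out

/-- The conditional expectation on the invariant `σ`-algebra, on `L^q(Ω)`. -/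
def invProj (q : ℝ≥0∞) [Fact (1 ≤ q)] : Lp ℝ q μ →L[ℝ] Lp ℝ q μ :=
  LinearMap.mkContinuous
    { toFun := fun h => (memLp_condExp_coeFn T h).toLp _
      map_add' := fun f g => by
        rw [← MemLp.toLp_add, MemLp.toLp_eq_toLp_iff]
        exact (condExp_congr_ae (Lp.coeFn_add f g)).trans
          (condExp_add (integrable_coeFn f) (integrable_coeFn g) _)
      map_smul' := fun c f => by
        rw [RingHom.id_apply, ← MemLp.toLp_const_smul, MemLp.toLp_eq_toLp_iff]
        exact (condExp_congr_ae (Lp.coeFn_smul c f)).trans (condExp_smul c _ _) }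
    1 fun f => by
      rw [one_mul]
      change ‖(memLp_condExp_coeFn T f).toLp _‖ ≤ ‖f‖
      rw [Lp.norm_toLp, Lp.norm_def]
      exact ENNReal.toReal_mono (Lp.eLpNorm_ne_top f) (eLpNorm_condExp_le_eLpNorm _ Fact.out)

theorem coeFn_invProj (h : Lp ℝ q μ) : invProj T q h =ᵐ[μ] μ[h | invSigma T] :=
  (memLp_condExp_coeFn T h).coeFn_toLp

/-- On an invariant set `A`, replacing `A` by `T y ⁻¹' A` and using that `T y` preserves `μ` shows
that `h ∘ T y` and `h` have the same integral. -/
theorem invProj_koopman (y : RN N) (h : Lp ℝ q μ) :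
    invProj T q (koopman T q y h) = invProj T q h := by
  refine Lp.ext ((coeFn_invProj T _).trans (EventuallyEq.trans ?_ (coeFn_invProj T h).symm))
  symm
  refine ae_eq_condExp_of_forall_setIntegral_eq (invSigma_le T) (integrable_coeFn _)
    (fun A _ _ => integrable_condExp.integrableOn) (fun A hA _ => ?_)
    stronglyMeasurable_condExp.aestronglyMeasurable
  rw [setIntegral_condExp (invSigma_le T) (integrable_coeFn h) hA]
  have h1 : ∫ ω in A, koopman T q y h ω ∂μ = ∫ ω in T y ⁻¹' A, h (T y ω) ∂μ := by
    rw [setIntegral_congr_set (hA.2 y)]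
    exact integral_congr_ae (ae_restrict_of_ae (coeFn_koopman T y h))
  have hmp := (T.measurePreserving' y).restrict_preimage hA.1
  rw [h1, ← integral_map hmp.measurable.aemeasurable
    (by rw [hmp.map_eq]; exact (Lp.aestronglyMeasurable h).restrict), hmp.map_eq]

theorem koopman_invProj (y : RN N) (h : Lp ℝ q μ) :
    koopman T q y (invProj T q h) = invProj T q h := by
  refine Lp.ext ?_
  have h1 := coeFn_invProj T h
  have h2 := ae_eq_comp_of_measurable_invSigma T
    (stronglyMeasurable_condExp (m := invSigma T) (μ := μ) (f := h)).measurable y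
  filter_upwards [coeFn_koopman T y (invProj T q h), h1, h2,
    (T.measurePreserving' y).quasiMeasurePreserving.ae h1] with ω g1 g2 g3 g4
  rw [g1, g4, g3, g2]

/-- Since `invSigma` asks for invariance only modulo null sets and for one `y` at a time, a
measurable representative of an invariant class is measurable for it. -/
theorem invProj_eq_self {h : Lp ℝ q μ} (hinv : ∀ y, koopman T q y h = h) : invProj T q h = h := by
  obtain ⟨g, hg, hgh⟩ := (Lp.aestronglyMeasurable h)
  have hgi : Measurable[invSigma T] g := by
    refine exists_measurable_invSigma T hg.measurable fun y => ?_
    have h1 := coeFn_koopman T y h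
    rw [hinv y] at h1
    filter_upwards [h1, hgh, (T.measurePreserving' y).quasiMeasurePreserving.ae hgh] with ω g1 g2 g3
    rw [← g3, ← g1, g2]
  refine Lp.ext ((coeFn_invProj T h).trans ((condExp_congr_ae hgh).trans ?_))
  rw [condExp_of_stronglyMeasurable (invSigma_le T) hgi.stronglyMeasurable
    ((integrable_coeFn h).congr hgh)]
  exact hgh.symm

/-- The projection is constant along the orbit `t ↦ ψ ∘ T (t e_i)`, so its derivative there
vanishes. -/
theorem invProj_gradPair_snd (ψ : CInf T) (i : Fin N) : invProj T q ((gradPair q T ψ).2 i) = 0 := by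
  have h1 := (invProj T q).hasFDerivAt.comp_hasDerivAt (0 : ℝ) (hasDerivAt_koopman_zero (q := q) ψ i)
  have h2 : (invProj T q ∘ fun t : ℝ => koopman T q (t • stdVec i) (gradPair q T ψ).1)
      = fun _ => invProj T q (gradPair q T ψ).1 := by
    funext t
    exact invProj_koopman T _ _
  rw [h2] at h1
  exact h1.unique (hasDerivAt_const _ _)

theorem invProj_of_mem_gradRange {g : Fin N → Lp ℝ q μ} (hg : g ∈ gradRange q T) (i : Fin N) :
    invProj T q (g i) = 0 :=
  gradRange_induction (P := fun g => invProj T q (g i) = 0)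
    (isClosed_eq ((invProj T q).continuous.comp (continuous_apply i)) continuous_const)
    (fun ψ => invProj_gradPair_snd T ψ i) hg

end InvariantProjection

/-! ### Vector valued Sobolev functions vanishing on the boundary -/

section Sobolev

variable {N : ℕ} {Q : Set (RN N)} [IsFiniteMeasure ((volume : Measure (RN N)).restrict Q)]
  {q : ℝ≥0∞} [Fact (1 ≤ q)] {Y : Type*} [NormedAddCommGroup Y] [NormedSpace ℝ Y]

theorem TestFn.memLp (φ : TestFn N) (lam : Measure (RN N)) [IsFiniteMeasure lam] (q : ℝ≥0∞) :
    MemLp (φ : RN N → ℝ) q lam := by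
  obtain ⟨C, hC⟩ := φ.exists_bound
  exact MemLp.of_bound φ.continuous.aestronglyMeasurable C (ae_of_all _ hC)

variable (Q q Y) in
/-- Pairs consisting of a function in `L^q(Q; Y)` and a tuple of candidates for its partial
derivatives. -/
abbrev SobPair : Type _ := Lp Y q ((volume : Measure (RN N)).restrict Q) ×
  (Fin N → Lp Y q ((volume : Measure (RN N)).restrict Q))

variable (Q q) in
/-- The elementary tensor `x ↦ φ x • h` as a function in `L^q(Q; Y)`. -/
def tens (φ : TestFn N) (h : Y) : Lp Y q ((volume : Measure (RN N)).restrict Q) :=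
  (ContinuousLinearMap.toSpanSingleton ℝ h).compLp ((φ.memLp (volume.restrict Q) q).toLp _)

theorem coeFn_tens (φ : TestFn N) (h : Y) :
    tens Q q φ h =ᵐ[(volume : Measure (RN N)).restrict Q] fun x => (φ : RN N → ℝ) x • h := by
  filter_upwards [(ContinuousLinearMap.toSpanSingleton ℝ h).coeFn_compLp
    ((φ.memLp (volume.restrict Q) q).toLp _), (φ.memLp (volume.restrict Q) q).coeFn_toLp]
    with x h1 h2
  rw [tens, h1, h2, ContinuousLinearMap.toSpanSingleton_apply]

theorem norm_tens_le (φ : TestFn N) (h : Y) :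
    ‖tens Q q φ h‖ ≤ ‖h‖ * ‖(φ.memLp (volume.restrict Q) q).toLp _‖ := by
  refine (ContinuousLinearMap.norm_compLp_le _ _).trans ?_
  rw [ContinuousLinearMap.norm_toSpanSingleton]

variable (Q q Y) in
/-- `h ↦ φ ⊗ h` as a continuous linear map. -/
def tensL (φ : TestFn N) : Y →L[ℝ] Lp Y q ((volume : Measure (RN N)).restrict Q) :=
  LinearMap.mkContinuous
    { toFun := tens Q q φ
      map_add' := fun h h' => by
        refine Lp.ext ?_
        filter_upwards [coeFn_tens (Q := Q) (q := q) φ (h + h'), coeFn_tens (Q := Q) (q := q) φ h,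
          coeFn_tens (Q := Q) (q := q) φ h', Lp.coeFn_add (tens Q q φ h) (tens Q q φ h')]
          with x h1 h2 h3 h4
        rw [h1, h4, Pi.add_apply, h2, h3, smul_add]
      map_smul' := fun c h => by
        refine Lp.ext ?_
        filter_upwards [coeFn_tens (Q := Q) (q := q) φ (c • h), coeFn_tens (Q := Q) (q := q) φ h,
          Lp.coeFn_smul c (tens Q q φ h)] with x h1 h2 h4
        rw [h1, RingHom.id_apply, h4, Pi.smul_apply, h2, smul_comm] }
    ‖(φ.memLp (volume.restrict Q) q).toLp _‖ fun h => by
      rw [mul_comm]; exact norm_tens_le φ h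

theorem compLp_tens {W : Type*} [NormedAddCommGroup W] [NormedSpace ℝ W] (A : Y →L[ℝ] W)
    (φ : TestFn N) (h : Y) : A.compLp (tens Q q φ h) = tens Q q φ (A h) := by
  refine Lp.ext ?_
  filter_upwards [A.coeFn_compLp (tens Q q φ h), coeFn_tens (Q := Q) (q := q) φ h,
    coeFn_tens (Q := Q) (q := q) φ (A h)] with x h1 h2 h3
  rw [h1, h2, h3, map_smul]

variable (Q q) in
/-- An elementary tensor together with its gradient. -/
def tensPair (φ : TestFn N) (h : Y) : SobPair Q q Y :=
  (tens Q q φ h, fun i => tens Q q (TestFn.pd i φ) h)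

variable (Q q Y) in
/-- The graph of the gradient on `W^1_0(Q; Y)`. -/
def sobolev0 : Submodule ℝ (SobPair Q q Y) :=
  (Submodule.span ℝ {z | ∃ (φ : TestFn N) (h : Y), tsupport (φ : RN N → ℝ) ⊆ Q ∧
    z = tensPair Q q φ h}).topologicalClosure

theorem isClosed_sobolev0 : IsClosed (sobolev0 Q q Y : Set (SobPair Q q Y)) :=
  Submodule.isClosed_topologicalClosure _

theorem tensPair_mem {φ : TestFn N} (hφ : tsupport (φ : RN N → ℝ) ⊆ Q) (h : Y) :
    tensPair Q q φ h ∈ sobolev0 Q q Y :=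
  Submodule.le_topologicalClosure _ (Submodule.subset_span ⟨φ, h, hφ, rfl⟩)

/-- To show that the graph lies in a closed subspace, it suffices to consider tensors. -/
theorem sobolev0_le {S : Submodule ℝ (SobPair Q q Y)}
    (hS : IsClosed (S : Set (SobPair Q q Y)))
    (h : ∀ (φ : TestFn N) (h : Y), tsupport (φ : RN N → ℝ) ⊆ Q → tensPair Q q φ h ∈ S) :
    sobolev0 Q q Y ≤ S := by
  refine Submodule.topologicalClosure_minimal _ (Submodule.span_le.2 ?_) hS
  rintro _ ⟨φ, y, hφ, rfl⟩
  exact h φ y hφ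

theorem compLp_mem_sobolev0 {W : Type*} [NormedAddCommGroup W] [NormedSpace ℝ W] (A : Y →L[ℝ] W)
    {z : SobPair Q q Y} (hz : z ∈ sobolev0 Q q Y) :
    (A.compLp z.1, fun i => A.compLp (z.2 i)) ∈ sobolev0 Q q W := by
  set B := (A.compLpL q ((volume : Measure (RN N)).restrict Q)).prodMap
    (ContinuousLinearMap.piMap fun _ : Fin N => A.compLpL q ((volume : Measure (RN N)).restrict Q))
  have : sobolev0 Q q Y ≤ (sobolev0 Q q W).comap B.toLinearMap := by
    refine sobolev0_le (isClosed_sobolev0.preimage B.continuous) fun φ h hφ => ?_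
    have : B (tensPair Q q φ h) = tensPair Q q φ (A h) := by
      refine Prod.ext (compLp_tens A φ h) (funext fun i => compLp_tens A _ h)
    change B (tensPair Q q φ h) ∈ sobolev0 Q q W
    rw [this]
    exact tensPair_mem hφ _
  exact this hz

theorem wInt_tens [CompleteSpace Y] {φ : RN N → ℝ} (hφ : BddMeas (volume.restrict Q) φ) (η : TestFn N) (h : Y) :
    wInt hφ (tens Q q η h) = (∫ x in Q, φ x * (η : RN N → ℝ) x) • h := by
  rw [wInt_apply, ← integral_smul_const]
  refine integral_congr_ae ?_
  filter_upwards [coeFn_tens (Q := Q) (q := q) η h] with x hx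
  rw [hx, smul_smul]

theorem TestFn.tsupport_pd_subset (η : TestFn N) (i : Fin N) :
    tsupport (TestFn.pd i η : RN N → ℝ) ⊆ tsupport (η : RN N → ℝ) :=
  tsupport_fderiv_apply_subset ℝ (stdVec i)

theorem TestFn.integral_mul_pd (φ η : TestFn N) (i : Fin N) :
    ∫ x, (φ : RN N → ℝ) x * (TestFn.pd i η : RN N → ℝ) x
      = - ∫ x, (TestFn.pd i φ : RN N → ℝ) x * (η : RN N → ℝ) x := by
  have hc := φ.continuous
  have hc' := η.continuous
  have hd := (TestFn.pd i φ).continuous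
  have hd' := (TestFn.pd i η).continuous
  refine integral_mul_fderiv_eq_neg_fderiv_mul_of_integrable ?_ ?_ ?_
    (fun x _ => φ.differentiable x) (fun x _ => η.differentiable x)
  · exact (hd.mul hc').integrable_of_hasCompactSupport η.hasCompactSupport.mul_left
  · exact (hc.mul hd').integrable_of_hasCompactSupport φ.hasCompactSupport.mul_right
  · exact (hc.mul hc').integrable_of_hasCompactSupport φ.hasCompactSupport.mul_right

theorem setIntegral_mul_eq_of_tsupport (f : RN N → ℝ) {η : RN N → ℝ} (hη : tsupport η ⊆ Q) :
    ∫ x in Q, f x * η x = ∫ x, f x * η x := by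
  refine setIntegral_eq_integral_of_forall_compl_eq_zero fun x hx => ?_
  rw [image_eq_zero_of_notMem_tsupport fun h => hx (hη h), mul_zero]

/-- Integration by parts on `W^1_0`. -/
theorem wInt_pd_of_mem_sobolev0 [CompleteSpace Y] {z : SobPair Q q Y} (hz : z ∈ sobolev0 Q q Y)
    (φ : TestFn N) (i : Fin N) :
    wInt ((TestFn.pd i φ).bddMeas (volume.restrict Q)) z.1
      = - wInt (φ.bddMeas (volume.restrict Q)) (z.2 i) := by
  set B : (SobPair Q q Y) →L[ℝ] Y :=
    (wInt ((TestFn.pd i φ).bddMeas (volume.restrict Q))).comp (ContinuousLinearMap.fst ℝ _ _)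
    + ((wInt (φ.bddMeas (volume.restrict Q))).comp (ContinuousLinearMap.proj i)).comp
      (ContinuousLinearMap.snd ℝ _ _)
  -- The support condition sits on `η`, so `φ` may be any test function on `ℝ^N`, not only one
  -- supported in `Q`.
  have : sobolev0 Q q Y ≤ B.ker := by
    refine sobolev0_le B.isClosed_ker fun η h hη => ?_
    rw [LinearMap.mem_ker]
    change wInt ((TestFn.pd i φ).bddMeas (volume.restrict Q)) (tens Q q η h)
      + wInt (φ.bddMeas (volume.restrict Q)) (tens Q q (TestFn.pd i η) h) = 0
    rw [wInt_tens, wInt_tens, ← add_smul, setIntegral_mul_eq_of_tsupport _ hη,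
      setIntegral_mul_eq_of_tsupport _ ((η.tsupport_pd_subset i).trans hη),
      TestFn.integral_mul_pd, add_neg_cancel, zero_smul]
  have h2 := this hz
  rw [LinearMap.mem_ker] at h2
  exact eq_neg_of_add_eq_zero_left h2

/-- A function in `L^q(Q; Y)` whose integrals against test functions in `Q` vanish is zero. -/
theorem eq_zero_of_forall_wInt_eq_zero [CompleteSpace Y] (hQ : IsOpen Q)
    {F : Lp Y q ((volume : Measure (RN N)).restrict Q)}
    (h : ∀ φ : TestFn N, tsupport (φ : RN N → ℝ) ⊆ Q →
      wInt (φ.bddMeas (volume.restrict Q)) F = 0) : F = 0 := by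
  rw [Lp.eq_zero_iff_ae_eq_zero]
  have h1 := hQ.ae_eq_zero_of_integral_contDiff_smul_eq_zero (f := F) (μ := volume)
    (IntegrableOn.locallyIntegrableOn (integrable_coeFn F)) fun g hg hgs hgQ => by
      have := h ⟨g, hg, hgs⟩ hgQ
      rw [wInt_apply] at this
      rw [← this]
      symm
      refine setIntegral_eq_integral_of_forall_compl_eq_zero fun x hx => ?_
      change g x • F x = 0
      rw [image_eq_zero_of_notMem_tsupport fun h => hx (hgQ h), zero_smul]
  exact (ae_restrict_iff' hQ.measurableSet).2 h1

theorem snd_eq_of_mem_sobolev0 [CompleteSpace Y] (hQ : IsOpen Q)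
    {u : Lp Y q ((volume : Measure (RN N)).restrict Q)}
    {g g' : Fin N → Lp Y q ((volume : Measure (RN N)).restrict Q)}
    (h : (u, g) ∈ sobolev0 Q q Y) (h' : (u, g') ∈ sobolev0 Q q Y) : g = g' := by
  funext i
  rw [← sub_eq_zero]
  refine eq_zero_of_forall_wInt_eq_zero hQ fun φ _ => ?_
  have h1 := wInt_pd_of_mem_sobolev0 h φ i
  have h2 := wInt_pd_of_mem_sobolev0 h' φ i
  rw [map_sub, sub_eq_zero]
  exact neg_injective (h1.symm.trans h2)

end Sobolev

/-! ### The Poincaré inequality -/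

section Poincare

variable {N : ℕ} {Q : Set (RN N)} [IsFiniteMeasure ((volume : Measure (RN N)).restrict Q)]
  {q : ℝ≥0∞} [Fact (1 ≤ q)] {Y : Type*} [NormedAddCommGroup Y] [NormedSpace ℝ Y] [CompleteSpace Y]

/-- As `w` vanishes at `x + R e`, the fundamental theorem of calculus bounds `w x` by the integral
of `w'` over a segment of parameter length `R`. Hölder's inequality in `t` and translation
invariance in `x` finish. -/
theorem lintegral_rpow_enorm_le_of_line {p : ℝ} (hp : 1 ≤ p) {R : ℝ} (hR : 0 ≤ R)
    (hQ : MeasurableSet Q) {w w' : RN N → Y}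
    {e : RN N} (hw' : Continuous w')
    (hd : ∀ x t, HasDerivAt (fun t : ℝ => w (x + t • e)) (w' (x + t • e)) t)
    (h0 : ∀ x ∈ Q, w (x + R • e) = 0) :
    ∫⁻ x in Q, ‖w x‖ₑ ^ p ≤ ENNReal.ofReal R ^ p * ∫⁻ x, ‖w' x‖ₑ ^ p := by
  set I : Measure ℝ := volume.restrict (Ioc 0 R)
  have hI : I univ = ENNReal.ofReal R := by simp [I]
  have hp0 : 0 < p := zero_lt_one.trans_le hp
  have hline : ∀ x, Continuous fun t : ℝ => w' (x + t • e) := fun x => by fun_prop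
  have h1 : ∀ x ∈ Q, ‖w x‖ₑ ≤ ∫⁻ t, ‖w' (x + t • e)‖ₑ ∂I := by
    intro x hx
    have h2 : ∫ t in (0 : ℝ)..R, w' (x + t • e) = w (x + R • e) - w (x + (0 : ℝ) • e) :=
      intervalIntegral.integral_eq_sub_of_hasDerivAt (fun t _ => hd x t)
        ((hline x).intervalIntegrable _ _)
    rw [h0 x hx, zero_smul, add_zero, zero_sub, intervalIntegral.integral_of_le hR] at h2
    rw [← enorm_neg, ← h2]
    exact enorm_integral_le_lintegral_enorm _
  have h3 : ∀ x, (∫⁻ t, ‖w' (x + t • e)‖ₑ ∂I) ^ p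
      ≤ ENNReal.ofReal R ^ (p - 1) * ∫⁻ t, ‖w' (x + t • e)‖ₑ ^ p ∂I := by
    intro x
    have hpe : (1 : ℝ≥0∞) ≤ ENNReal.ofReal p := by
      rw [← ENNReal.ofReal_one]; exact ENNReal.ofReal_le_ofReal hp
    have h4 := eLpNorm_le_eLpNorm_mul_rpow_measure_univ (μ := I) hpe
      (hline x).aestronglyMeasurable
    rw [eLpNorm_one_eq_lintegral_enorm, eLpNorm_eq_lintegral_rpow_enorm_toReal
      (by positivity) ENNReal.ofReal_ne_top, ENNReal.toReal_ofReal hp0.le, hI,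
      ENNReal.toReal_one] at h4
    refine (ENNReal.rpow_le_rpow h4 hp0.le).trans (le_of_eq ?_)
    rw [ENNReal.mul_rpow_of_nonneg _ _ hp0.le, ← ENNReal.rpow_mul, ← ENNReal.rpow_mul,
      one_div, inv_mul_cancel₀ hp0.ne', ENNReal.rpow_one, mul_comm]
    congr 2
    field_simp
  have hmeas : Measurable fun z : RN N × ℝ => ‖w' (z.1 + z.2 • e)‖ₑ ^ p :=
    (Continuous.enorm (by fun_prop)).measurable.pow_const p
  calc ∫⁻ x in Q, ‖w x‖ₑ ^ p
      ≤ ∫⁻ x, ENNReal.ofReal R ^ (p - 1) * ∫⁻ t, ‖w' (x + t • e)‖ₑ ^ p ∂I := by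
        refine (setLIntegral_mono' hQ fun x hx => ?_).trans (setLIntegral_le_lintegral Q _)
        exact (ENNReal.rpow_le_rpow (h1 x hx) hp0.le).trans (h3 x)
    _ = ENNReal.ofReal R ^ (p - 1) * ∫⁻ t, (∫⁻ x, ‖w' (x + t • e)‖ₑ ^ p) ∂I := by
        rw [lintegral_const_mul _ hmeas.lintegral_prod_right', lintegral_lintegral_swap
          hmeas.aemeasurable]
    _ = ENNReal.ofReal R ^ (p - 1) * ∫⁻ _, (∫⁻ x, ‖w' x‖ₑ ^ p) ∂I := by
        congr 2
        funext t
        exact lintegral_add_right_eq_self (fun x => ‖w' x‖ₑ ^ p) (t • e)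
    _ = _ := by
        rw [lintegral_const, hI, mul_comm (∫⁻ x, _), ← mul_assoc]
        congr 1
        conv_rhs => rw [← sub_add_cancel p 1]
        rw [ENNReal.rpow_add_of_nonneg _ _ (by linarith) zero_le_one, ENNReal.rpow_one]

/-- Finite sums of tensors have genuine representatives, differentiable along lines and zero outside
`Q`, to which the one-dimensional estimate applies; the general case follows by closure. -/
theorem exists_representative_of_mem_span (i : Fin N) {z : SobPair Q q Y}
    (hz : z ∈ Submodule.span ℝ {z : SobPair Q q Y | ∃ (φ : TestFn N) (h : Y),
      tsupport (φ : RN N → ℝ) ⊆ Q ∧ z = tensPair Q q φ h}) :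
    ∃ w w' : RN N → Y, Continuous w' ∧
      (∀ x t, HasDerivAt (fun t : ℝ => w (x + t • stdVec i)) (w' (x + t • stdVec i)) t) ∧
      (∀ x ∉ Q, w x = 0 ∧ w' x = 0) ∧ z.1 =ᵐ[volume.restrict Q] w ∧
      z.2 i =ᵐ[volume.restrict Q] w' := by
  induction hz using Submodule.span_induction with
  | mem z hz =>
    obtain ⟨φ, h, hφ, rfl⟩ := hz
    refine ⟨fun x => (φ : RN N → ℝ) x • h, fun x => (TestFn.pd i φ : RN N → ℝ) x • h,
      (TestFn.pd i φ).continuous.smul continuous_const, fun x t => ?_, fun x hx => ?_,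
      coeFn_tens φ h, coeFn_tens _ h⟩
    · refine HasDerivAt.smul_const ?_ h
      have h1 : HasDerivAt (fun t : ℝ => x + t • (stdVec i : RN N)) (stdVec i) t := by
        simpa using ((hasDerivAt_id t).smul_const (stdVec i : RN N)).const_add x
      exact (φ.differentiable _).hasFDerivAt.comp_hasDerivAt t h1
    · beta_reduce
      rw [image_eq_zero_of_notMem_tsupport fun h => hx (hφ h),
        image_eq_zero_of_notMem_tsupport fun h => hx (hφ (φ.tsupport_pd_subset i h))]
      simp
  | zero =>
    refine ⟨0, 0, continuous_zero, fun x t => hasDerivAt_const t (0 : Y), fun _ _ => ⟨rfl, rfl⟩,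
      Lp.coeFn_zero _ _ _, Lp.coeFn_zero _ _ _⟩
  | add z z' _ _ h h' =>
    obtain ⟨w, v, hc, hd, h0, h1, h2⟩ := h
    obtain ⟨w', v', hc', hd', h0', h1', h2'⟩ := h'
    refine ⟨w + w', v + v', hc.add hc', fun x t => (hd x t).add (hd' x t), fun x hx => ?_,
      (Lp.coeFn_add _ _).trans (h1.add h1'), (Lp.coeFn_add _ _).trans (h2.add h2')⟩
    simp [h0 x hx, h0' x hx]
  | smul c z _ h =>
    obtain ⟨w, v, hc, hd, h0, h1, h2⟩ := h
    refine ⟨c • w, c • v, hc.const_smul c, fun x t => (hd x t).const_smul c, fun x hx => ?_,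
      (Lp.coeFn_smul _ _).trans (h1.const_smul c), (Lp.coeFn_smul _ _).trans (h2.const_smul c)⟩
    simp [h0 x hx]

/-- The Poincaré inequality on `W^1_0(Q; Y)` for bounded `Q`. -/
theorem exists_norm_le_of_mem_sobolev0 (hq : q ≠ ∞) (hQ : MeasurableSet Q)
    (hb : Bornology.IsBounded Q) (i : Fin N) :
    ∃ R : ℝ, 0 ≤ R ∧ ∀ z ∈ sobolev0 Q q Y, ‖z.1‖ ≤ R * ‖z.2 i‖ := by
  obtain ⟨r, hr⟩ := hb.subset_closedBall 0
  have hp : 1 ≤ q.toReal := by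
    rw [← ENNReal.toReal_one]
    exact ENNReal.toReal_mono hq Fact.out
  have hp0 : 0 < q.toReal := zero_lt_one.trans_le hp
  -- This exceeds the diameter of `Q`, so `x + R e_i` lies outside `Q` for each `x ∈ Q`.
  set R : ℝ := 2 * |r| + 1
  have hR : 0 ≤ R := by positivity
  refine ⟨R, hR, fun z hz => ?_⟩
  refine closure_minimal (t := {z : SobPair Q q Y | ‖z.1‖ ≤ R * ‖z.2 i‖}) (fun z hz => ?_)
    (isClosed_le (by fun_prop) (by fun_prop)) hz
  obtain ⟨w, w', hc, hd, h0, h1, h2⟩ := exists_representative_of_mem_span i hz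
  have h3 : ∀ x ∈ Q, w (x + R • stdVec i) = 0 := fun x hx => by
    refine (h0 _ fun hx' => ?_).1
    have hn := norm_sub_le (x + R • stdVec i) x
    have e1 := mem_closedBall_zero_iff.1 (hr hx)
    have e2 := mem_closedBall_zero_iff.1 (hr hx')
    rw [add_sub_cancel_left, norm_smul, Real.norm_of_nonneg hR,
      show ‖(stdVec i : RN N)‖ = 1 by simp [stdVec]] at hn
    have := le_abs_self r
    simp only [R] at hn e2
    linarith
  have h4 := lintegral_rpow_enorm_le_of_line hp hR hQ hc hd h3
  have h5 : ∫⁻ x, ‖w' x‖ₑ ^ q.toReal = ∫⁻ x in Q, ‖w' x‖ₑ ^ q.toReal := by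
    rw [← lintegral_indicator hQ]
    congr 1
    funext x
    by_cases hx : x ∈ Q
    · rw [indicator_of_mem hx]
    · rw [indicator_of_notMem hx, (h0 x hx).2, enorm_zero, ENNReal.zero_rpow_of_pos hp0]
  have h6 : ‖z.1‖ₑ ^ q.toReal = ∫⁻ x in Q, ‖w x‖ₑ ^ q.toReal := by
    rw [enorm_lp_rpow hq]
    exact lintegral_congr_ae (h1.mono fun x hx => by simp only [hx])
  have h7 : ‖z.2 i‖ₑ ^ q.toReal = ∫⁻ x in Q, ‖w' x‖ₑ ^ q.toReal := by
    rw [enorm_lp_rpow hq]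
    exact lintegral_congr_ae (h2.mono fun x hx => by simp only [hx])
  rw [h5, ← h6, ← h7, ← ENNReal.mul_rpow_of_nonneg _ _ hp0.le,
    ENNReal.rpow_le_rpow_iff hp0] at h4
  have h8 := ENNReal.toReal_mono (ENNReal.mul_ne_top ENNReal.ofReal_ne_top enorm_ne_top) h4
  simpa [ENNReal.toReal_ofReal hR] using h8

end Poincare

/-! ### Functions on `Q × Ω` and vector valued functions on `Q` -/

section Joint

variable {N : ℕ} {Ω : Type*} [MeasurableSpace Ω] {μ : Measure Ω} [IsProbabilityMeasure μ]
  {Q : Set (RN N)} [IsFiniteMeasure ((volume : Measure (RN N)).restrict Q)]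
  {q : ℝ≥0∞} [Fact (1 ≤ q)]

/-- The function on `Q × Ω` given by an element of `L^q(Q; L^q(Ω))`. -/
def jointFn (hq : q ≠ ∞) (F : Lp (Lp ℝ q μ) q ((volume : Measure (RN N)).restrict Q)) :
    RN N × Ω → ℝ := (sliceEquiv (volume.restrict Q) μ hq).symm F

/-- The vector field on `Q × Ω` given by a tuple of elements of `L^q(Q; L^q(Ω))`. -/
def jointGrad (hq : q ≠ ∞)
    (G : Fin N → Lp (Lp ℝ q μ) q ((volume : Measure (RN N)).restrict Q)) :
    RN N × Ω → RN N := fun z => WithLp.toLp 2 fun i => jointFn hq (G i) z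

theorem jointGrad_apply (hq : q ≠ ∞)
    (G : Fin N → Lp (Lp ℝ q μ) q ((volume : Measure (RN N)).restrict Q)) (z : RN N × Ω)
    (i : Fin N) : jointGrad hq G z i = jointFn hq (G i) z := rfl

theorem memLp_jointFn (hq : q ≠ ∞) (F : Lp (Lp ℝ q μ) q ((volume : Measure (RN N)).restrict Q)) :
    MemLp (jointFn hq F) q (prodMeas Q μ) := Lp.memLp _

theorem sliceEquiv_toLp_eq (hq : q ≠ ∞) {u : RN N × Ω → ℝ} (hu : MemLp u q (prodMeas Q μ))
    {F : Lp (Lp ℝ q μ) q ((volume : Measure (RN N)).restrict Q)} (h : u =ᵐ[prodMeas Q μ] jointFn hq F) :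
    sliceEquiv (volume.restrict Q) μ hq (hu.toLp u) = F := by
  rw [← (sliceEquiv (volume.restrict Q) μ hq).apply_symm_apply F]
  congr 1
  exact Lp.ext (hu.coeFn_toLp.trans h)

theorem ae_eq_jointFn_toLp (hq : q ≠ ∞) {u : RN N × Ω → ℝ} (hu : MemLp u q (prodMeas Q μ)) :
    u =ᵐ[prodMeas Q μ] jointFn hq (sliceEquiv (volume.restrict Q) μ hq (hu.toLp u)) := by
  rw [jointFn, LinearIsometryEquiv.symm_apply_apply]
  exact hu.coeFn_toLp.symm

theorem exists_ae_eq_jointFn (hq : q ≠ ∞) {u : RN N × Ω → ℝ} (hu : MemLp u q (prodMeas Q μ)) :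
    ∃ F : Lp (Lp ℝ q μ) q ((volume : Measure (RN N)).restrict Q),
      u =ᵐ[prodMeas Q μ] jointFn hq F := ⟨_, ae_eq_jointFn_toLp hq hu⟩

theorem exists_ae_eq_jointGrad (hq : q ≠ ∞) {g : RN N × Ω → RN N}
    (hg : MemLp g q (prodMeas Q μ)) :
    ∃ G : Fin N → Lp (Lp ℝ q μ) q ((volume : Measure (RN N)).restrict Q),
      g =ᵐ[prodMeas Q μ] jointGrad hq G := by
  have h := fun i => ae_eq_jointFn_toLp hq (memLp_piLp_iff.1 hg i)
  refine ⟨fun i => sliceEquiv (volume.restrict Q) μ hq ((memLp_piLp_iff.1 hg i).toLp _), ?_⟩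
  filter_upwards [ae_all_iff.2 h] with z hz
  ext i
  exact hz i

theorem memLp_jointGrad (hq : q ≠ ∞)
    (G : Fin N → Lp (Lp ℝ q μ) q ((volume : Measure (RN N)).restrict Q)) :
    MemLp (jointGrad hq G) q (prodMeas Q μ) :=
  memLp_piLp_iff.2 fun i => memLp_jointFn hq (G i)

theorem jointFn_inj (hq : q ≠ ∞) {F F' : Lp (Lp ℝ q μ) q ((volume : Measure (RN N)).restrict Q)} :
    jointFn hq F =ᵐ[prodMeas Q μ] jointFn hq F' ↔ F = F' := by
  refine ⟨fun h => ?_, fun h => h ▸ ae_eq_rfl⟩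
  exact (sliceEquiv (volume.restrict Q) μ hq).symm.injective (Lp.ext h)

theorem jointGrad_inj (hq : q ≠ ∞)
    {G G' : Fin N → Lp (Lp ℝ q μ) q ((volume : Measure (RN N)).restrict Q)} :
    jointGrad hq G =ᵐ[prodMeas Q μ] jointGrad hq G' ↔ G = G' := by
  refine ⟨fun h => funext fun i => (jointFn_inj hq).1 ?_, fun h => h ▸ ae_eq_rfl⟩
  filter_upwards [h] with z hz
  rw [← jointGrad_apply, hz, jointGrad_apply]

theorem slice_jointFn (hq : q ≠ ∞) (F : Lp (Lp ℝ q μ) q ((volume : Measure (RN N)).restrict Q)) :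
    ∀ᵐ x ∂(volume.restrict Q), F x =ᵐ[μ] fun ω => jointFn hq F (x, ω) := by
  have h := coeFn_sliceEquiv hq ((sliceEquiv (volume.restrict Q) μ hq).symm F)
  rwa [LinearIsometryEquiv.apply_symm_apply] at h

theorem slice_of_ae_eq (hq : q ≠ ∞) {F : Lp (Lp ℝ q μ) q ((volume : Measure (RN N)).restrict Q)}
    {u : RN N × Ω → ℝ} (h : u =ᵐ[prodMeas Q μ] jointFn hq F) :
    ∀ᵐ x ∂(volume.restrict Q), F x =ᵐ[μ] fun ω => u (x, ω) := by
  filter_upwards [slice_jointFn hq F, Measure.ae_ae_of_ae_prod h] with x h1 h2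
  exact h1.trans (EventuallyEq.symm h2)

theorem ae_eq_jointFn_of_slice (hq : q ≠ ∞)
    {F : Lp (Lp ℝ q μ) q ((volume : Measure (RN N)).restrict Q)} {u : RN N × Ω → ℝ}
    (hu : MemLp u q (prodMeas Q μ)) (h : ∀ᵐ x ∂(volume.restrict Q), F x =ᵐ[μ] fun ω => u (x, ω)) :
    u =ᵐ[prodMeas Q μ] jointFn hq F := by
  have : sliceEquiv (volume.restrict Q) μ hq (hu.toLp u) = F := by
    refine Lp.ext ?_
    filter_upwards [h, coeFn_sliceEquiv_toLp hq hu] with x h1 h2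
    exact Lp.ext (h2.trans h1.symm)
  rw [← this]
  exact ae_eq_jointFn_toLp hq hu

theorem jointFn_add (hq : q ≠ ∞) (F F' : Lp (Lp ℝ q μ) q ((volume : Measure (RN N)).restrict Q)) :
    jointFn hq (F + F') =ᵐ[prodMeas Q μ] jointFn hq F + jointFn hq F' := by
  rw [jointFn, map_add]
  exact Lp.coeFn_add _ _

theorem jointFn_sub (hq : q ≠ ∞) (F F' : Lp (Lp ℝ q μ) q ((volume : Measure (RN N)).restrict Q)) :
    jointFn hq (F - F') =ᵐ[prodMeas Q μ] jointFn hq F - jointFn hq F' := by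
  rw [jointFn, map_sub]
  exact Lp.coeFn_sub _ _

theorem jointFn_smul (hq : q ≠ ∞) (c : ℝ)
    (F : Lp (Lp ℝ q μ) q ((volume : Measure (RN N)).restrict Q)) :
    jointFn hq (c • F) =ᵐ[prodMeas Q μ] c • jointFn hq F := by
  rw [jointFn, map_smul]
  exact Lp.coeFn_smul _ _

theorem jointGrad_add (hq : q ≠ ∞)
    (G G' : Fin N → Lp (Lp ℝ q μ) q ((volume : Measure (RN N)).restrict Q)) :
    jointGrad hq (G + G') =ᵐ[prodMeas Q μ] jointGrad hq G + jointGrad hq G' := by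
  filter_upwards [ae_all_iff.2 fun i => jointFn_add hq (G i) (G' i)] with z hz
  ext i
  exact hz i

theorem jointGrad_sub (hq : q ≠ ∞)
    (G G' : Fin N → Lp (Lp ℝ q μ) q ((volume : Measure (RN N)).restrict Q)) :
    jointGrad hq (G - G') =ᵐ[prodMeas Q μ] jointGrad hq G - jointGrad hq G' := by
  filter_upwards [ae_all_iff.2 fun i => jointFn_sub hq (G i) (G' i)] with z hz
  ext i
  exact hz i

theorem eLpNorm_jointFn (hq : q ≠ ∞)
    (F : Lp (Lp ℝ q μ) q ((volume : Measure (RN N)).restrict Q)) :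
    eLpNorm (jointFn hq F) q (prodMeas Q μ) = ‖F‖ₑ := by
  rw [jointFn, ← Lp.enorm_def]
  exact (sliceEquiv (volume.restrict Q) μ hq).symm.enorm_map F

theorem eLpNorm_jointGrad_le (hq : q ≠ ∞)
    (G : Fin N → Lp (Lp ℝ q μ) q ((volume : Measure (RN N)).restrict Q)) :
    eLpNorm (jointGrad hq G) q (prodMeas Q μ) ≤ ∑ i, ‖G i‖ₑ := by
  have h1 : jointGrad hq G = ∑ i, fun z => jointFn hq (G i) z • (stdVec i : RN N) := by
    funext z
    ext j
    simp [Finset.sum_apply, jointGrad_apply, stdVec, Pi.single_apply]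
  rw [h1]
  refine (eLpNorm_sum_le (fun i _ => ((memLp_jointFn hq (G i)).1.smul_const _)) Fact.out).trans
    (Finset.sum_le_sum fun i _ => ?_)
  rw [← eLpNorm_jointFn hq]
  refine eLpNorm_mono fun z => ?_
  rw [norm_smul]
  simp [stdVec]

theorem enorm_le_eLpNorm_jointGrad (hq : q ≠ ∞)
    (G : Fin N → Lp (Lp ℝ q μ) q ((volume : Measure (RN N)).restrict Q)) (i : Fin N) :
    ‖G i‖ₑ ≤ eLpNorm (jointGrad hq G) q (prodMeas Q μ) := by
  rw [← eLpNorm_jointFn hq]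
  exact eLpNorm_mono fun z => PiLp.norm_apply_le (jointGrad hq G z) i

theorem memLp_tensor {φ : TestFn N} {h : Ω → ℝ} (hh : MemLp h q μ) :
    MemLp (fun z : RN N × Ω => (φ : RN N → ℝ) z.1 * h z.2) q (prodMeas Q μ) := by
  obtain ⟨C, hC⟩ := φ.exists_bound
  refine (hh.comp_snd (volume.restrict Q)).of_le_mul (c := C)
    (φ.continuous.aestronglyMeasurable.comp_fst.mul hh.1.comp_snd) (ae_of_all _ fun z => ?_)
  rw [norm_mul]
  gcongr
  exact hC _

theorem tensor_ae_eq_jointFn (hq : q ≠ ∞) (φ : TestFn N) {h : Ω → ℝ} (hh : MemLp h q μ) :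
    (fun z : RN N × Ω => (φ : RN N → ℝ) z.1 * h z.2) =ᵐ[prodMeas Q μ]
      jointFn hq (tens Q q φ (hh.toLp h)) := by
  refine ae_eq_jointFn_of_slice hq (memLp_tensor hh) ?_
  filter_upwards [coeFn_tens (Q := Q) (q := q) φ (hh.toLp h)] with x hx
  rw [hx]
  filter_upwards [Lp.coeFn_smul ((φ : RN N → ℝ) x) (hh.toLp h), hh.coeFn_toLp] with ω h1 h2
  rw [h1, Pi.smul_apply, h2, smul_eq_mul]

theorem wInt_ae_eq (hq : q ≠ ∞) {φ : RN N → ℝ} (hφ : BddMeas (volume.restrict Q) φ)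
    {u : RN N × Ω → ℝ} {F : Lp (Lp ℝ q μ) q ((volume : Measure (RN N)).restrict Q)}
    (h : u =ᵐ[prodMeas Q μ] jointFn hq F) :
    (wInt hφ F : Lp ℝ q μ) =ᵐ[μ] fun ω => ∫ x in Q, φ x * u (x, ω) := by
  have hu : MemLp u q (prodMeas Q μ) := (memLp_congr_ae h).2 (memLp_jointFn hq F)
  rw [← sliceEquiv_toLp_eq hq hu h]
  exact wInt_sliceEquiv_toLp hq hφ hu

end Joint

/-! ### The Orlicz-Sobolev spaces in terms of `L^q` functions -/

section OrliczSobolev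

variable {N : ℕ} {Ω : Type*} [MeasurableSpace Ω] {μ : Measure Ω} [IsProbabilityMeasure μ]
  {Q : Set (RN N)} [IsFiniteMeasure ((volume : Measure (RN N)).restrict Q)]
  {Φ : YoungFunction} {p a b : ℝ} [Fact (1 ≤ ENNReal.ofReal p)]

theorem IsTestFun.exists_testFn {φ : RN N → ℝ} (h : IsTestFun Q φ) :
    ∃ χ : TestFn N, (χ : RN N → ℝ) = φ ∧ tsupport (χ : RN N → ℝ) ⊆ Q :=
  ⟨⟨φ, h.1, h.2.1⟩, rfl, h.2.2⟩

theorem TestFn.isTestFun {χ : TestFn N} (h : tsupport (χ : RN N → ℝ) ⊆ Q) :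
    IsTestFun Q (χ : RN N → ℝ) := ⟨χ.contDiff, χ.hasCompactSupport, h⟩

/-- For a fixed test function, equality for almost every `ω` is equality of two weighted integrals
in `L^p(Ω)`. Weak differentiability becomes a family of continuous linear conditions on `(F, G)`. -/
theorem hasWeakGrad_iff (hP : Φ.IsPower p a b) {v : RN N × Ω → ℝ} {g : RN N × Ω → RN N}
    {F : Lp (Lp ℝ (ENNReal.ofReal p) μ) (ENNReal.ofReal p) ((volume : Measure (RN N)).restrict Q)}
    {G : Fin N → Lp (Lp ℝ (ENNReal.ofReal p) μ) (ENNReal.ofReal p)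
      ((volume : Measure (RN N)).restrict Q)}
    (hv : v =ᵐ[prodMeas Q μ] jointFn ENNReal.ofReal_ne_top F)
    (hg : g =ᵐ[prodMeas Q μ] jointGrad ENNReal.ofReal_ne_top G) :
    HasWeakGrad Φ Q μ v g ↔ ∀ φ : TestFn N, tsupport (φ : RN N → ℝ) ⊆ Q → ∀ i,
      wInt ((TestFn.pd i φ).bddMeas (volume.restrict Q)) F
        = - wInt (φ.bddMeas (volume.restrict Q)) (G i) := by
  have hgm : MemLp g (ENNReal.ofReal p) (prodMeas Q μ) :=
    (memLp_congr_ae hg).2 (memLp_jointGrad ENNReal.ofReal_ne_top G)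
  have key : ∀ (φ : TestFn N) (i : Fin N),
      (∀ᵐ ω ∂μ, ∫ x in Q, v (x, ω) * fderiv ℝ (φ : RN N → ℝ) x (stdVec i)
        = - ∫ x in Q, g (x, ω) i * (φ : RN N → ℝ) x) ↔
      wInt ((TestFn.pd i φ).bddMeas (volume.restrict Q)) F
        = - wInt (φ.bddMeas (volume.restrict Q)) (G i) := by
    intro φ i
    have hgi : (fun z => g z i) =ᵐ[prodMeas Q μ] jointFn ENNReal.ofReal_ne_top (G i) := by
      filter_upwards [hg] with z hz
      rw [hz, jointGrad_apply]
    have h1 := wInt_ae_eq ENNReal.ofReal_ne_top ((TestFn.pd i φ).bddMeas (volume.restrict Q)) hv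
    have h2 := wInt_ae_eq ENNReal.ofReal_ne_top (φ.bddMeas (volume.restrict Q)) hgi
    have hc1 : ∀ ω, ∫ x in Q, (TestFn.pd i φ : RN N → ℝ) x * v (x, ω)
        = ∫ x in Q, v (x, ω) * fderiv ℝ (φ : RN N → ℝ) x (stdVec i) := fun ω =>
      integral_congr_ae (ae_of_all _ fun x => mul_comm _ _)
    have hc2 : ∀ ω, ∫ x in Q, (φ : RN N → ℝ) x * g (x, ω) i
        = ∫ x in Q, g (x, ω) i * (φ : RN N → ℝ) x := fun ω =>
      integral_congr_ae (ae_of_all _ fun x => mul_comm _ _)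
    have h3 := Lp.coeFn_neg (wInt (φ.bddMeas (volume.restrict Q)) (G i))
    constructor
    · intro h
      refine Lp.ext ?_
      filter_upwards [h, h1, h2, h3] with ω e e1 e2 e3
      rw [e1, e3, Pi.neg_apply, e2, hc1, hc2, e]
    · intro h
      have h4 := h ▸ h1
      filter_upwards [h4, h2, h3] with ω e1 e2 e3
      rw [e3, Pi.neg_apply, e2, hc1, hc2] at e1
      exact e1.symm
  constructor
  · intro h φ hφ i
    exact (key φ i).1 (h.2 _ (TestFn.isTestFun hφ) i)
  · intro h
    refine ⟨hP.memOrlicz_iff.2 hgm, fun φ hφ i => ?_⟩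
    obtain ⟨χ, rfl, hχ⟩ := hφ.exists_testFn
    exact (key χ i).2 (h χ hχ i)

/-- `weakGrad` is a chosen gradient; the fundamental lemma of the calculus of variations in `Q`
makes the choice immaterial. -/
theorem HasWeakGrad.weakGrad_ae_eq (hP : Φ.IsPower p a b) (hQ : IsOpen Q) {v : RN N × Ω → ℝ}
    {g : RN N × Ω → RN N} (hv : MemOrlicz Φ (prodMeas Q μ) v) (h : HasWeakGrad Φ Q μ v g) :
    weakGrad Φ Q μ v =ᵐ[prodMeas Q μ] g := by
  have hex : ∃ g, HasWeakGrad Φ Q μ v g := ⟨g, h⟩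
  have h' : HasWeakGrad Φ Q μ v (weakGrad Φ Q μ v) := by
    rw [weakGrad, dif_pos hex]
    exact hex.choose_spec
  obtain ⟨F, hF⟩ := exists_ae_eq_jointFn ENNReal.ofReal_ne_top (hP.memOrlicz_iff.1 hv)
  obtain ⟨G, hG⟩ := exists_ae_eq_jointGrad ENNReal.ofReal_ne_top (hP.memOrlicz_iff.1 h.1)
  obtain ⟨G', hG'⟩ := exists_ae_eq_jointGrad ENNReal.ofReal_ne_top (hP.memOrlicz_iff.1 h'.1)
  have : G' = G := by
    funext i
    rw [← sub_eq_zero]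
    refine eq_zero_of_forall_wInt_eq_zero hQ fun φ hφ => ?_
    have h1 := (hasWeakGrad_iff hP hF hG).1 h φ hφ i
    have h2 := (hasWeakGrad_iff hP hF hG').1 h' φ hφ i
    rw [map_sub, sub_eq_zero]
    exact neg_injective (h2.symm.trans h1)
  exact hG'.trans (this ▸ hG.symm)

theorem weakGrad_ae_eq_of_mem_sobolev0 (hP : Φ.IsPower p a b) (hQ : IsOpen Q) {v : RN N × Ω → ℝ}
    {z : SobPair Q (ENNReal.ofReal p) (Lp ℝ (ENNReal.ofReal p) μ)}
    (hz : z ∈ sobolev0 Q (ENNReal.ofReal p) (Lp ℝ (ENNReal.ofReal p) μ))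
    (hv : v =ᵐ[prodMeas Q μ] jointFn ENNReal.ofReal_ne_top z.1) :
    HasWeakGrad Φ Q μ v (jointGrad ENNReal.ofReal_ne_top z.2) ∧
    weakGrad Φ Q μ v =ᵐ[prodMeas Q μ] jointGrad ENNReal.ofReal_ne_top z.2 := by
  have h := (hasWeakGrad_iff hP hv (ae_eq_refl (jointGrad ENNReal.ofReal_ne_top z.2))).2
    fun φ _ i => wInt_pd_of_mem_sobolev0 hz φ i
  exact ⟨h, h.weakGrad_ae_eq hP hQ
    (hP.memOrlicz_iff.2 ((memLp_congr_ae hv).2 (memLp_jointFn _ _)))⟩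

variable (μ Q p) in
/-- The finite sums of elementary tensors with their gradients. -/
def tensSpan : Submodule ℝ (SobPair Q (ENNReal.ofReal p) (Lp ℝ (ENNReal.ofReal p) μ)) :=
  Submodule.span ℝ {z | ∃ (φ : TestFn N) (h : Lp ℝ (ENNReal.ofReal p) μ),
    tsupport (φ : RN N → ℝ) ⊆ Q ∧ z = tensPair Q (ENNReal.ofReal p) φ h}

theorem exists_tensSpan_of_mem_testTensor (hP : Φ.IsPower p a b) {w : RN N × Ω → ℝ}
    (hw : w ∈ testTensor Q {h : Ω → ℝ | MemOrlicz Φ μ h}) :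
    ∃ s ∈ tensSpan μ Q p, w =ᵐ[prodMeas Q μ] jointFn ENNReal.ofReal_ne_top s.1 := by
  induction hw using Submodule.span_induction with
  | mem w hw =>
    obtain ⟨φ, h, hφ, hh, rfl⟩ := hw
    obtain ⟨χ, rfl, hχ⟩ := hφ.exists_testFn
    have hh' := hP.memOrlicz_iff.1 hh
    exact ⟨_, Submodule.subset_span ⟨χ, hh'.toLp h, hχ, rfl⟩, tensor_ae_eq_jointFn _ χ hh'⟩
  | zero =>
    refine ⟨0, Submodule.zero_mem _, ?_⟩
    have := Lp.coeFn_zero ℝ (ENNReal.ofReal p) (prodMeas Q μ)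
    rw [Prod.fst_zero, jointFn, map_zero]
    exact this.symm
  | add w w' _ _ h h' =>
    obtain ⟨s, hs, hsw⟩ := h
    obtain ⟨s', hs', hsw'⟩ := h'
    exact ⟨s + s', Submodule.add_mem _ hs hs', (hsw.add hsw').trans (jointFn_add _ _ _).symm⟩
  | smul c w _ h =>
    obtain ⟨s, hs, hsw⟩ := h
    exact ⟨c • s, Submodule.smul_mem _ c hs, (hsw.const_smul c).trans (jointFn_smul _ _ _).symm⟩

theorem exists_testTensor_of_mem_tensSpan (hP : Φ.IsPower p a b)
    {s : SobPair Q (ENNReal.ofReal p) (Lp ℝ (ENNReal.ofReal p) μ)} (hs : s ∈ tensSpan μ Q p) :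
    ∃ w ∈ testTensor Q {h : Ω → ℝ | MemOrlicz Φ μ h},
      w =ᵐ[prodMeas Q μ] jointFn ENNReal.ofReal_ne_top s.1 := by
  induction hs using Submodule.span_induction with
  | mem s hs =>
    obtain ⟨χ, h, hχ, rfl⟩ := hs
    refine ⟨fun z => (χ : RN N → ℝ) z.1 * h z.2, Submodule.subset_span ⟨_, h, TestFn.isTestFun hχ,
      hP.memOrlicz_iff.2 (Lp.memLp h), rfl⟩, ?_⟩
    have := tensor_ae_eq_jointFn (Q := Q) ENNReal.ofReal_ne_top χ (Lp.memLp h)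
    rwa [Lp.toLp_coeFn] at this
  | zero =>
    refine ⟨0, Submodule.zero_mem _, ?_⟩
    have := Lp.coeFn_zero ℝ (ENNReal.ofReal p) (prodMeas Q μ)
    rw [Prod.fst_zero, jointFn, map_zero]
    exact this.symm
  | add s s' _ _ h h' =>
    obtain ⟨w, hw, hsw⟩ := h
    obtain ⟨w', hw', hsw'⟩ := h'
    exact ⟨w + w', Submodule.add_mem _ hw hw', (hsw.add hsw').trans (jointFn_add _ _ _).symm⟩
  | smul c s _ h =>
    obtain ⟨w, hw, hsw⟩ := h
    exact ⟨c • w, Submodule.smul_mem _ c hw, (hsw.const_smul c).trans (jointFn_smul _ _ _).symm⟩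

theorem tensSpan_le : tensSpan μ Q p ≤ sobolev0 Q (ENNReal.ofReal p) (Lp ℝ (ENNReal.ofReal p) μ) :=
  Submodule.le_topologicalClosure _

/-- The Orlicz-Sobolev space `W^1_0` corresponds to the closed graph `sobolev0`. -/
theorem memW10_iff (hP : Φ.IsPower p a b) (hQ : IsOpen Q) {v : RN N × Ω → ℝ} :
    MemW10 Φ Q μ v ↔ ∃ z ∈ sobolev0 Q (ENNReal.ofReal p) (Lp ℝ (ENNReal.ofReal p) μ),
      v =ᵐ[prodMeas Q μ] jointFn ENNReal.ofReal_ne_top z.1 := by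
  have hq : ENNReal.ofReal p ≠ ∞ := ENNReal.ofReal_ne_top
  have ha : ENNReal.ofReal (a ^ (1 / p)) ≠ 0 := by
    rw [Ne, ENNReal.ofReal_eq_zero, not_le]
    exact Real.rpow_pos_of_pos hP.lower_pos _
  constructor
  · rintro ⟨⟨hv, g, hg⟩, happ⟩
    have hex : ∃ g, HasWeakGrad Φ Q μ v g := ⟨g, hg⟩
    obtain ⟨F, hF⟩ := exists_ae_eq_jointFn hq (hP.memOrlicz_iff.1 hv)
    obtain ⟨G, hG⟩ := exists_ae_eq_jointGrad hq (hP.memOrlicz_iff.1 hg.1)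
    have hvG := (hg.weakGrad_ae_eq hP hQ hv).trans hG
    refine ⟨(F, G), ?_, hF⟩
    change (F, G) ∈ closure (tensSpan μ Q p : Set (SobPair Q _ _))
    rw [EMetric.mem_closure_iff]
    intro ε hε
    -- The factor `a ^ (1 / p)` is the constant relating Luxemburg and `L^p` norms, so smallness
    -- survives the passage to `L^p`.
    obtain ⟨w, hw, h1, h2⟩ := happ (ENNReal.ofReal (a ^ (1 / p)) * min ε 1) (by
      refine ENNReal.mul_pos ha ?_
      simp [hε.ne'])
    obtain ⟨s, hs, hsw⟩ := exists_tensSpan_of_mem_testTensor hP hw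
    have hws := (weakGrad_ae_eq_of_mem_sobolev0 hP hQ (tensSpan_le hs) hsw).2
    have hlt : ∀ x : ℝ≥0∞, ENNReal.ofReal (a ^ (1 / p)) * x
        < ENNReal.ofReal (a ^ (1 / p)) * min ε 1 → x < ε := fun x hx =>
      (lt_of_mul_lt_mul_left' hx).trans_le (min_le_left _ _)
    have h3 : ‖F - s.1‖ₑ < ε := by
      rw [← eLpNorm_jointFn hq, eLpNorm_congr_ae ((jointFn_sub hq F s.1).trans
        (hF.symm.sub hsw.symm))]
      exact hlt _ ((hP.mul_eLpNorm_le_luxNorm _).trans_lt h1)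
    have h4 : ∀ i, ‖G i - s.2 i‖ₑ < ε := fun i => by
      refine (enorm_le_eLpNorm_jointGrad hq (G - s.2) i).trans_lt ?_
      rw [eLpNorm_congr_ae ((jointGrad_sub hq G s.2).trans (hvG.symm.sub hws.symm))]
      exact hlt _ ((hP.mul_eLpNorm_le_luxNorm _).trans_lt h2)
    refine ⟨s, hs, ?_⟩
    rw [Prod.edist_eq, max_lt_iff, edist_eq_enorm_sub]
    refine ⟨h3, ?_⟩
    rw [edist_pi_def, Finset.sup_lt_iff hε]
    intro i _
    rw [edist_eq_enorm_sub]
    exact h4 i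
  · rintro ⟨z, hz, hv⟩
    obtain ⟨hwg, hvG⟩ := weakGrad_ae_eq_of_mem_sobolev0 hP hQ hz hv
    refine ⟨⟨hP.memOrlicz_iff.2 ((memLp_congr_ae hv).2 (memLp_jointFn _ _)), _, hwg⟩,
      fun δ hδ => ?_⟩
    have hcl : z ∈ closure (tensSpan μ Q p : Set (SobPair Q _ _)) := hz
    set B := ENNReal.ofReal (b ^ (1 / p))
    have hcont : Tendsto (fun s : SobPair Q (ENNReal.ofReal p) (Lp ℝ (ENNReal.ofReal p) μ) =>
        B * (‖z.1 - s.1‖ₑ + ∑ i, ‖z.2 i - s.2 i‖ₑ)) (𝓝 z) (𝓝 0) := by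
      have hc : Continuous fun s : SobPair Q (ENNReal.ofReal p) (Lp ℝ (ENNReal.ofReal p) μ) =>
        B * (‖z.1 - s.1‖ₑ + ∑ i, ‖z.2 i - s.2 i‖ₑ) := by
        refine (ENNReal.continuous_const_mul ENNReal.ofReal_ne_top).comp ?_
        fun_prop
      have := hc.tendsto z
      simpa using this
    have hev := hcont.eventually (gt_mem_nhds hδ)
    obtain ⟨s, hs, hsS⟩ := (mem_closure_iff_frequently.1 hcl |>.and_eventually hev).exists
    obtain ⟨w, hw, hsw⟩ := exists_testTensor_of_mem_tensSpan hP hs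
    have hws := (weakGrad_ae_eq_of_mem_sobolev0 hP hQ (tensSpan_le hs) hsw).2
    refine ⟨w, hw, lt_of_le_of_lt ?_ hsS, lt_of_le_of_lt ?_ hsS⟩
    · refine (hP.luxNorm_le_mul_eLpNorm _).trans (mul_le_mul_right ?_ _)
      refine le_trans (le_of_eq ?_) le_self_add
      rw [← eLpNorm_jointFn hq, eLpNorm_congr_ae ((jointFn_sub hq z.1 s.1).trans
        (hv.symm.sub hsw.symm))]
    · refine (hP.luxNorm_le_mul_eLpNorm _).trans (mul_le_mul_right ?_ _)
      refine le_trans ?_ le_add_self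
      have := eLpNorm_jointGrad_le hq (z.2 - s.2)
      rwa [eLpNorm_congr_ae ((jointGrad_sub hq z.2 s.2).trans (hvG.symm.sub hws.symm))] at this

/-- Invariance of slices in terms of the Koopman operators. -/
theorem ae_memInv_iff (hP : Φ.IsPower p a b) (T : DynSystem N μ) {v : RN N × Ω → ℝ}
    {F : Lp (Lp ℝ (ENNReal.ofReal p) μ) (ENNReal.ofReal p) ((volume : Measure (RN N)).restrict Q)}
    (hv : v =ᵐ[prodMeas Q μ] jointFn ENNReal.ofReal_ne_top F) :
    (∀ᵐ x ∂(volume.restrict Q), MemInv Φ T (fun ω => v (x, ω))) ↔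
      ∀ᵐ x ∂(volume.restrict Q), ∀ y, koopman T (ENNReal.ofReal p) y (F x) = F x := by
  refine eventually_congr ?_
  filter_upwards [slice_of_ae_eq ENNReal.ofReal_ne_top hv] with x hx
  have hm : MemLp (fun ω => v (x, ω)) (ENNReal.ofReal p) μ := (memLp_congr_ae hx).1 (Lp.memLp _)
  refine ⟨fun h y => Lp.ext ?_, fun h => ⟨hP.memOrlicz_iff.2 hm, fun y => ?_⟩⟩
  · filter_upwards [coeFn_koopman T y (F x), hx, h.2 y,
      (T.measurePreserving' y).quasiMeasurePreserving.ae hx] with ω h1 h2 h3 h4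
    rw [h1, h2, h4, h3]
  · have h1 := coeFn_koopman T y (F x)
    rw [h y] at h1
    filter_upwards [h1, hx, (T.measurePreserving' y).quasiMeasurePreserving.ae hx] with ω h1 h2 h4
    rw [← h4, ← h1, h2]

end OrliczSobolev

/-! ### Unfolding -/

section Unfolding

variable {N : ℕ} {Ω : Type*} [MeasurableSpace Ω] {μ : Measure Ω} [IsProbabilityMeasure μ]
  (T : DynSystem N μ)
  {Q : Set (RN N)} [IsFiniteMeasure ((volume : Measure (RN N)).restrict Q)]
  {q : ℝ≥0∞} [Fact (1 ≤ q)] {s : ℝ}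

/-- The unfolding isometry of `L^q(Q; L^q(Ω))`. -/
def unfL (Q : Set (RN N)) [IsFiniteMeasure ((volume : Measure (RN N)).restrict Q)]
    (hq : q ≠ ∞) (hs : s ≠ 0) :
    Lp (Lp ℝ q μ) q ((volume : Measure (RN N)).restrict Q) →ₗᵢ[ℝ]
      Lp (Lp ℝ q μ) q ((volume : Measure (RN N)).restrict Q) :=
  ((sliceEquiv (volume.restrict Q) μ hq).toLinearIsometry.comp (unfoldIso T Q hq hs)).comp
    (sliceEquiv (volume.restrict Q) μ hq).symm.toLinearIsometry

theorem unfL_apply (hq : q ≠ ∞) (hs : s ≠ 0)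
    (F : Lp (Lp ℝ q μ) q ((volume : Measure (RN N)).restrict Q)) :
    unfL T Q hq hs F = sliceEquiv (volume.restrict Q) μ hq
      (unfoldIso T Q hq hs ((sliceEquiv (volume.restrict Q) μ hq).symm F)) := rfl

theorem coeFn_unfL (hq : q ≠ ∞) (hs : s ≠ 0)
    (F : Lp (Lp ℝ q μ) q ((volume : Measure (RN N)).restrict Q)) :
    ∀ᵐ x ∂(volume.restrict Q), unfL T Q hq hs F x = koopman T q (s • x) (F x) := by
  have := sliceEquiv_unfoldIso T hq hs ((sliceEquiv (volume.restrict Q) μ hq).symm F)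
  rwa [LinearIsometryEquiv.apply_symm_apply] at this

theorem jointFn_unfL (hq : q ≠ ∞) (hs : s ≠ 0)
    {F : Lp (Lp ℝ q μ) q ((volume : Measure (RN N)).restrict Q)} {u : RN N × Ω → ℝ}
    (h : u =ᵐ[prodMeas Q μ] jointFn hq F) :
    (fun z => u (skew T s z)) =ᵐ[prodMeas Q μ] jointFn hq (unfL T Q hq hs F) := by
  rw [jointFn, unfL_apply, LinearIsometryEquiv.symm_apply_apply]
  filter_upwards [ae_comp_skew T hs h,
    coeFn_unfoldIso T hq hs ((sliceEquiv (volume.restrict Q) μ hq).symm F)] with z h1 h2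
  rw [h1, h2]
  rfl

theorem unfL_neg_unfL (hq : q ≠ ∞) (hs : s ≠ 0) (hs' : -s ≠ 0)
    (F : Lp (Lp ℝ q μ) q ((volume : Measure (RN N)).restrict Q)) :
    unfL T Q hq hs' (unfL T Q hq hs F) = F := by
  rw [unfL_apply, unfL_apply, LinearIsometryEquiv.symm_apply_apply,
    unfoldIso_neg_unfoldIso T hq hs hs', LinearIsometryEquiv.apply_symm_apply]

theorem unfL_eq_self (hq : q ≠ ∞) (hs : s ≠ 0)
    {F : Lp (Lp ℝ q μ) q ((volume : Measure (RN N)).restrict Q)}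
    (hF : ∀ᵐ x ∂(volume.restrict Q), ∀ y, koopman T q y (F x) = F x) :
    unfL T Q hq hs F = F := by
  refine Lp.ext ?_
  filter_upwards [coeFn_unfL T hq hs F, hF] with x h1 h2
  rw [h1, h2]

/-- Componentwise unfolding of a function and a vector field. -/
def unfPair (Q : Set (RN N)) [IsFiniteMeasure ((volume : Measure (RN N)).restrict Q)]
    (hq : q ≠ ∞) (hs : s ≠ 0) : SobPair Q q (Lp ℝ q μ) →L[ℝ] SobPair Q q (Lp ℝ q μ) :=
  (unfL T Q hq hs).toContinuousLinearMap.prodMap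
    (ContinuousLinearMap.piMap fun _ : Fin N => (unfL T Q hq hs).toContinuousLinearMap)

theorem unfPair_apply (hq : q ≠ ∞) (hs : s ≠ 0) (z : SobPair Q q (Lp ℝ q μ)) :
    unfPair T Q hq hs z = (unfL T Q hq hs z.1, fun i => unfL T Q hq hs (z.2 i)) := rfl

/-- Averaging a function and a vector field over the orbits. -/
def invPair (Q : Set (RN N)) [IsFiniteMeasure ((volume : Measure (RN N)).restrict Q)] (q : ℝ≥0∞)
    [Fact (1 ≤ q)] : SobPair Q q (Lp ℝ q μ) →L[ℝ] SobPair Q q (Lp ℝ q μ) :=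
  ((invProj T q).compLpL q (volume.restrict Q)).prodMap
    (ContinuousLinearMap.piMap fun _ : Fin N => (invProj T q).compLpL q (volume.restrict Q))

theorem invPair_apply (z : SobPair Q q (Lp ℝ q μ)) :
    invPair T Q q z = ((invProj T q).compLp z.1, fun i => (invProj T q).compLp (z.2 i)) := rfl

theorem invPair_mem_sobolev0 {z : SobPair Q q (Lp ℝ q μ)} (hz : z ∈ sobolev0 Q q (Lp ℝ q μ)) :
    invPair T Q q z ∈ sobolev0 Q q (Lp ℝ q μ) := compLp_mem_sobolev0 _ hz

/-- Fibrewise, unfolding is a Koopman operator, which `invProj` absorbs. Averages of unfolded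
Sobolev pairs are therefore averages of the original pairs and remain in `sobolev0`. -/
theorem invProj_compLp_unfL (hq : q ≠ ∞) (hs : s ≠ 0)
    (F : Lp (Lp ℝ q μ) q ((volume : Measure (RN N)).restrict Q)) :
    (invProj T q).compLp (unfL T Q hq hs F) = (invProj T q).compLp F := by
  refine Lp.ext ?_
  filter_upwards [(invProj T q).coeFn_compLp (unfL T Q hq hs F), (invProj T q).coeFn_compLp F,
    coeFn_unfL T hq hs F] with x h1 h2 h3
  rw [h1, h2, h3, invProj_koopman]

theorem invPair_unfPair (hq : q ≠ ∞) (hs : s ≠ 0) (z : SobPair Q q (Lp ℝ q μ)) :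
    invPair T Q q (unfPair T Q hq hs z) = invPair T Q q z :=
  Prod.ext (invProj_compLp_unfL T hq hs z.1) (funext fun i => invProj_compLp_unfL T hq hs (z.2 i))

/-- The product of two test functions. -/
def TestFn.mul (φ η : TestFn N) : TestFn N :=
  ⟨fun x => (φ : RN N → ℝ) x * (η : RN N → ℝ) x, φ.contDiff.mul η.contDiff,
    φ.hasCompactSupport.mul_right⟩

theorem TestFn.pd_mul (φ η : TestFn N) (i : Fin N) :
    TestFn.pd i (φ.mul η) = φ.mul (TestFn.pd i η) + (TestFn.pd i φ).mul η := by
  ext x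
  change fderiv ℝ (fun y => (φ : RN N → ℝ) y * (η : RN N → ℝ) y) x (stdVec i)
    = (φ : RN N → ℝ) x * (TestFn.pd i η : RN N → ℝ) x
      + (TestFn.pd i φ : RN N → ℝ) x * (η : RN N → ℝ) x
  rw [fderiv_fun_mul (φ.differentiable x) (η.differentiable x)]
  simp only [add_apply, smul_apply, smul_eq_mul, TestFn.pd_apply]
  ring

variable {T}

/-- The unfolded tensor is `η(x) h(T(s x) ω)`; integrated against `φ` it is a mollification of `h`
along the flow. This is how stochastic smoothness arises from integration in `x`. -/
theorem wInt_unfL_tens (hq : q ≠ ∞) (hs : s ≠ 0) {h : Ω → ℝ} (hh : Measurable h) {C : ℝ}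
    (hC : ∀ ω, ‖h ω‖ ≤ C) (hm : MemLp h q μ) (φ η : TestFn N)
    (hη : tsupport (η : RN N → ℝ) ⊆ Q) :
    wInt (φ.bddMeas (volume.restrict Q)) (unfL T Q hq hs (tens Q q η (hm.toLp h)))
      = topToLp q (memLp_moll (T := T) hs hh hC (φ.mul η)) := by
  refine Lp.ext ?_
  have h1 := wInt_ae_eq hq (φ.bddMeas (volume.restrict Q))
    (jointFn_unfL T hq hs (tensor_ae_eq_jointFn (Q := Q) hq η hm))
  filter_upwards [h1, coeFn_topToLp (q := q) (memLp_moll (T := T) hs hh hC (φ.mul η))] with ω h1 h2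
  rw [h1, h2, moll]
  have h3 := setIntegral_mul_eq_of_tsupport
    (fun x => (φ : RN N → ℝ) x * h (T (s • x) ω)) hη
  have e1 : ∀ x, (φ.mul η : RN N → ℝ) x * h (T (s • x) ω)
      = (φ : RN N → ℝ) x * h (T (s • x) ω) * (η : RN N → ℝ) x := fun x => by
    change (φ : RN N → ℝ) x * (η : RN N → ℝ) x * h (T (s • x) ω) = _
    ring
  simp only [e1]
  rw [← h3]
  refine integral_congr_ae (ae_of_all _ fun x => ?_)
  simp only [skew]
  ring

theorem moll_add (hs : s ≠ 0) {h : Ω → ℝ} (hh : Measurable h) {C : ℝ} (hC : ∀ ω, ‖h ω‖ ≤ C)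
    (χ χ' : TestFn N) : topToLp q (memLp_moll (T := T) hs hh hC (χ + χ'))
      = topToLp q (memLp_moll (T := T) hs hh hC χ) + topToLp q (memLp_moll (T := T) hs hh hC χ') := by
  refine topToLp_congr _ ((memLp_moll hs hh hC χ).add (memLp_moll hs hh hC χ'))
    (ae_of_all _ fun ω => ?_)
  rw [Pi.add_apply, moll, moll, moll, ← integral_add (integrable_mul_orbit hs hh hC χ.integrable ω)
    (integrable_mul_orbit hs hh hC χ'.integrable ω)]
  refine integral_congr_ae (ae_of_all _ fun x => ?_)
  change ((χ : RN N → ℝ) x + (χ' : RN N → ℝ) x) * _ = _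
  ring

/-- Pairing an unfolded Sobolev function with a test function, with stochastic gradient. -/
def pairing (Q : Set (RN N)) [IsFiniteMeasure ((volume : Measure (RN N)).restrict Q)] (q : ℝ≥0∞)
    [Fact (1 ≤ q)] (φ : TestFn N) (c : ℝ) :
    SobPair Q q (Lp ℝ q μ) →L[ℝ] Lp ℝ q μ × (Fin N → Lp ℝ q μ) :=
  ((wInt (φ.bddMeas (volume.restrict Q))).comp (ContinuousLinearMap.fst ℝ _ _)).prod
    (ContinuousLinearMap.pi fun j =>
      c • (((wInt (φ.bddMeas (volume.restrict Q))).comp (ContinuousLinearMap.proj j)).comp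
        (ContinuousLinearMap.snd ℝ _ _) +
      (wInt ((TestFn.pd j φ).bddMeas (volume.restrict Q))).comp (ContinuousLinearMap.fst ℝ _ _)))

theorem pairing_apply (φ : TestFn N) (c : ℝ) (z : SobPair Q q (Lp ℝ q μ)) :
    pairing Q q φ c z = (wInt (φ.bddMeas (volume.restrict Q)) z.1, fun j =>
      c • (wInt (φ.bddMeas (volume.restrict Q)) (z.2 j)
        + wInt ((TestFn.pd j φ).bddMeas (volume.restrict Q)) z.1)) := rfl

/-- Weighted integrals of unfolded Sobolev functions are weakly differentiable in `Ω`. -/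
theorem pairing_unfPair_mem_gradGraph (hq : q ≠ ∞) (hs : s ≠ 0) (φ : TestFn N)
    {z : SobPair Q q (Lp ℝ q μ)} (hz : z ∈ sobolev0 Q q (Lp ℝ q μ)) :
    pairing Q q φ (-s⁻¹) (unfPair T Q hq hs z) ∈ gradGraph q T := by
  set B : SobPair Q q (Lp ℝ q μ) →L[ℝ] Lp ℝ q μ × (Fin N → Lp ℝ q μ) :=
    (pairing Q q φ (-s⁻¹)).comp (unfPair T Q hq hs)
  have : sobolev0 Q q (Lp ℝ q μ) ≤ (gradGraph q T).comap B.toLinearMap := by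
    refine sobolev0_le (isClosed_gradGraph.preimage B.continuous) fun η h hη => ?_
    change B (tensPair Q q η h) ∈ gradGraph q T
    set A : Lp ℝ q μ →L[ℝ] Lp ℝ q μ × (Fin N → Lp ℝ q μ) := B.comp ((tensL Q q _ η).prod
      (ContinuousLinearMap.pi fun i => tensL Q q _ (TestFn.pd i η)))
    have hA : ∀ h, A h = B (tensPair Q q η h) := fun h => rfl
    rw [← hA]
    -- Both the map and the target are closed under limits in `h`, so indicators suffice; these are
    -- bounded and can be mollified.
    refine Lp.induction hq (motive := fun h => A h ∈ gradGraph q T) ?_ ?_ ?_ h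
    · intro c S hS hSμ
      have hm : MemLp (S.indicator fun _ => c) q μ := memLp_indicator_const q hS c (Or.inr hSμ.ne)
      have e1 : ((Lp.simpleFunc.indicatorConst q hS hSμ.ne c : Lp.simpleFunc ℝ q μ) : Lp ℝ q μ)
        = hm.toLp _ := rfl
      have hh : Measurable (S.indicator fun _ : Ω => c) := measurable_const.indicator hS
      have hC : ∀ ω, ‖S.indicator (fun _ : Ω => c) ω‖ ≤ ‖c‖ := fun ω =>
        norm_indicator_le_norm_self (fun _ => c) ω
      rw [e1, hA]
      have := moll_mem_gradGraph (T := T) (q := q) hs hh hC (φ.mul η)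
      convert this using 1
      change pairing Q q φ (-s⁻¹) (unfPair T Q hq hs (tensPair Q q η (hm.toLp _))) = _
      rw [pairing_apply, unfPair_apply]
      refine Prod.ext (wInt_unfL_tens hq hs hh hC hm φ η hη) (funext fun j => ?_)
      change (-s⁻¹) • (wInt (φ.bddMeas (volume.restrict Q)) (unfL T Q hq hs
        (tens Q q (TestFn.pd j η) (hm.toLp _)))
        + wInt ((TestFn.pd j φ).bddMeas (volume.restrict Q)) (unfL T Q hq hs
          (tens Q q η (hm.toLp _)))) = _
      rw [wInt_unfL_tens hq hs hh hC hm φ _ ((η.tsupport_pd_subset j).trans hη),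
        wInt_unfL_tens hq hs hh hC hm _ η hη, ← moll_add hs hh hC]
      -- The product rule for `φ η` accounts for the second term of `pairing`.
      simp only [TestFn.pd_mul]
    · intro f g hf hg _ h1 h2
      rw [map_add]
      exact Submodule.add_mem _ h1 h2
    · exact isClosed_gradGraph.preimage A.continuous
  exact this hz

end Unfolding

/-! ### The structure of weak limits of unfolded Sobolev functions -/

section Structure

variable {N : ℕ} {Ω : Type*} [MeasurableSpace Ω] {μ : Measure Ω} [IsProbabilityMeasure μ]
  (T : DynSystem N μ)
  {Q : Set (RN N)} [IsFiniteMeasure ((volume : Measure (RN N)).restrict Q)]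
  {q : ℝ≥0∞} [Fact (1 ≤ q)]

/-- The Sobolev functions unfolded at scale `ε`. -/
def unfoldedGraph (Q : Set (RN N)) [IsFiniteMeasure ((volume : Measure (RN N)).restrict Q)]
    (hq : q ≠ ∞) (ε : ℝ) : Set (SobPair Q q (Lp ℝ q μ)) :=
  {y | ∃ hs : -ε⁻¹ ≠ 0, ∃ z ∈ sobolev0 Q q (Lp ℝ q μ), y = unfPair T Q hq hs z}

variable {T} in
theorem koopman_eq_of_forall_basis {h : Lp ℝ q μ}
    (hc : ∀ i (t : ℝ), koopman T q (t • stdVec i) h = h) (y : RN N) : koopman T q y h = h := by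
  have := norm_koopman_sub_le_sum (T := T) (h := h) (c := 0) (fun i t => by simp [hc i t]) y
  simp only [Pi.zero_apply, mul_zero, Finset.sum_const_zero, norm_le_zero_iff, sub_eq_zero] at this
  exact this

theorem ae_koopman_eq_of_compLp_eq {F : Lp (Lp ℝ q μ) q ((volume : Measure (RN N)).restrict Q)}
    (h : (invProj T q).compLp F = F) :
    ∀ᵐ x ∂(volume.restrict Q), ∀ y, koopman T q y (F x) = F x := by
  have h1 := (invProj T q).coeFn_compLp F
  rw [h] at h1
  filter_upwards [h1] with x hx y
  rw [hx, koopman_invProj]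

theorem compLp_eq_of_ae_koopman_eq {F : Lp (Lp ℝ q μ) q ((volume : Measure (RN N)).restrict Q)}
    (h : ∀ᵐ x ∂(volume.restrict Q), ∀ y, koopman T q y (F x) = F x) :
    (invProj T q).compLp F = F := by
  refine Lp.ext ?_
  filter_upwards [(invProj T q).coeFn_compLp F, h] with x hx h2
  rw [hx, invProj_eq_self T h2]

/-- The limit points of the unfolded Sobolev functions: pairs of an invariant function `U` and
`D U + b` with `b` a field of stochastic gradients. -/
def limitGraph (Q : Set (RN N)) [IsFiniteMeasure ((volume : Measure (RN N)).restrict Q)]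
    (q : ℝ≥0∞) [Fact (1 ≤ q)] : Set (SobPair Q q (Lp ℝ q μ)) :=
  {y | ∃ D, (y.1, D) ∈ sobolev0 Q q (Lp ℝ q μ) ∧ (invProj T q).compLp y.1 = y.1 ∧
    ∀ᵐ x ∂(volume.restrict Q), (fun i => (y.2 i - D i) x) ∈ gradRange q T}

variable {ι : Type*} {l : Filter ι} {ε : ι → ℝ} {y : ι → SobPair Q q (Lp ℝ q μ)}
  {y₀ : SobPair Q q (Lp ℝ q μ)}

variable {T}

/-- At scale `ε` the stochastic gradient of the pairing carries a factor `ε`. It can be divided out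
in a subspace, and closedness preserves membership in the weak limit. -/
theorem WeakLim.pairing_mem_gradRange {hq : q ≠ ∞} (h : WeakLim l y y₀)
    (hy : ∀ᶠ i in l, y i ∈ unfoldedGraph T Q hq (ε i)) (φ : TestFn N) :
    (fun j => wInt (φ.bddMeas (volume.restrict Q)) (y₀.2 j)
      + wInt ((TestFn.pd j φ).bddMeas (volume.restrict Q)) y₀.1) ∈ gradRange q T := by
  have h1 := h.map ((ContinuousLinearMap.snd ℝ _ _).comp (pairing Q q φ 1))
  have h2 := h1 (gradRange q T) isClosed_gradRange (gradRange q T).convex (by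
    filter_upwards [hy] with i hi
    obtain ⟨hs, z, hz, hyz⟩ := hi
    have h3 := snd_mem_gradRange (pairing_unfPair_mem_gradGraph (T := T) hq hs φ hz)
    rw [← hyz] at h3
    have h4 := Submodule.smul_mem _ (-(-(ε i)⁻¹)⁻¹)⁻¹ h3
    have h5 : ((-(-(ε i)⁻¹)⁻¹)⁻¹ : ℝ) • (pairing Q q φ (-(-(ε i)⁻¹)⁻¹) (y i)).2
        = (pairing Q q φ 1 (y i)).2 := by
      funext j
      rw [pairing_apply, pairing_apply, Pi.smul_apply]
      simp only
      rw [smul_smul, inv_mul_cancel₀ (neg_ne_zero.2 (inv_ne_zero hs))]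
    rw [h5] at h4
    exact h4)
  have h6 : ((ContinuousLinearMap.snd ℝ _ _).comp (pairing Q q φ 1)) y₀
      = (fun j => wInt (φ.bddMeas (volume.restrict Q)) (y₀.2 j)
      + wInt ((TestFn.pd j φ).bddMeas (volume.restrict Q)) y₀.1) := by
    change (pairing Q q φ 1 y₀).2 = _
    rw [pairing_apply]
    simp only [one_smul]
  rw [h6] at h2
  exact h2

/-- The stochastic gradient of the weighted integral is `O(ε)` on a bounded family, so a shift by
`t` along the flow changes it by `O(ε |t|)`, which vanishes in the limit. -/
theorem WeakLim.koopman_wInt_eq {hq : q ≠ ∞} (h : WeakLim l y y₀) (hε : Tendsto ε l (𝓝 0))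
    (hy : ∀ᶠ i in l, y i ∈ unfoldedGraph T Q hq (ε i)) {B : ℝ} (hB : ∀ᶠ i in l, ‖y i‖ ≤ B)
    (φ : TestFn N) (j : Fin N) (t : ℝ) :
    koopman T q (t • stdVec j) (wInt (φ.bddMeas (volume.restrict Q)) y₀.1)
      = wInt (φ.bddMeas (volume.restrict Q)) y₀.1 := by
  set K : Lp ℝ q μ →L[ℝ] Lp ℝ q μ := (koopman T q (t • stdVec j)).toContinuousLinearMap
    - ContinuousLinearMap.id ℝ _
  set A : SobPair Q q (Lp ℝ q μ) →L[ℝ] Lp ℝ q μ :=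
    K.comp ((wInt (φ.bddMeas (volume.restrict Q))).comp (ContinuousLinearMap.fst ℝ _ _))
  have h0 : A y₀ = 0 := by
    refine (h.map A).eq_zero_of_tendsto_norm ?_
    set P : SobPair Q q (Lp ℝ q μ) →L[ℝ] Lp ℝ q μ :=
      ((ContinuousLinearMap.proj j).comp (ContinuousLinearMap.snd ℝ _ _)).comp (pairing Q q φ 1)
    have hlim : Tendsto (fun i => |t| * (|ε i| * (‖P‖ * B))) l (𝓝 0) := by
      have := ((hε.abs).mul_const (‖P‖ * B)).const_mul |t|
      simpa using this
    refine squeeze_zero' (Eventually.of_forall fun i => norm_nonneg _) ?_ hlim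
    filter_upwards [hy, hB] with i hi hBi
    obtain ⟨hs, z, hz, hyz⟩ := hi
    have h3 := norm_koopman_sub_le_of_mem_gradGraph (pairing_unfPair_mem_gradGraph (T := T) hq hs φ hz) j t
    rw [← hyz] at h3
    have h5 : (pairing Q q φ (-(-(ε i)⁻¹)⁻¹) (y i)).2 j = ε i • P (y i) := by
      change _ = ε i • (pairing Q q φ 1 (y i)).2 j
      rw [pairing_apply, pairing_apply]
      simp only
      rw [one_smul, inv_neg, neg_neg, inv_inv]
    rw [h5, norm_smul, Real.norm_eq_abs] at h3
    refine (le_trans (le_of_eq rfl) h3).trans ?_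
    gcongr
    exact (P.le_opNorm _).trans (mul_le_mul_of_nonneg_left hBi (norm_nonneg _))
  exact sub_eq_zero.1 h0

theorem WeakLim.compLp_invProj_eq {hq : q ≠ ∞} (hQ : IsOpen Q) (h : WeakLim l y y₀)
    (hε : Tendsto ε l (𝓝 0))
    (hy : ∀ᶠ i in l, y i ∈ unfoldedGraph T Q hq (ε i)) {B : ℝ} (hB : ∀ᶠ i in l, ‖y i‖ ≤ B) :
    (invProj T q).compLp y₀.1 = y₀.1 := by
  rw [← sub_eq_zero]
  refine eq_zero_of_forall_wInt_eq_zero hQ fun φ _ => ?_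
  rw [map_sub, wInt_compLp, invProj_eq_self T, sub_self]
  exact koopman_eq_of_forall_basis fun j t => h.koopman_wInt_eq hε hy hB φ j t

/-- Averaging removes the dependence on the scale, so all averaged pairs lie in the one closed
subspace `sobolev0`, and so does their weak limit. -/
theorem WeakLim.invPair_mem {hq : q ≠ ∞} (h : WeakLim l y y₀)
    (hy : ∀ᶠ i in l, y i ∈ unfoldedGraph T Q hq (ε i)) :
    invPair T Q q y₀ ∈ sobolev0 Q q (Lp ℝ q μ) := by
  refine (h.map (invPair T Q q)) _ isClosed_sobolev0 (sobolev0 Q q (Lp ℝ q μ)).convex ?_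
  filter_upwards [hy] with i hi
  obtain ⟨hs, z, hz, hyz⟩ := hi
  rw [hyz, invPair_unfPair]
  exact invPair_mem_sobolev0 T hz

/-- A tuple of functions whose weighted integrals lie in a closed subspace takes values in it. -/
theorem ae_mem_of_forall_wInt_mem {Y : Type*} [NormedAddCommGroup Y] [NormedSpace ℝ Y]
    [CompleteSpace Y] (hQ : IsOpen Q) {S : Submodule ℝ (Fin N → Y)}
    (hS : IsClosed (S : Set (Fin N → Y)))
    {b : Fin N → Lp Y q ((volume : Measure (RN N)).restrict Q)}
    (h : ∀ φ : TestFn N, tsupport (φ : RN N → ℝ) ⊆ Q →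
      (fun j => wInt (φ.bddMeas (volume.restrict Q)) (b j)) ∈ S) :
    ∀ᵐ x ∂(volume.restrict Q), (fun j => b j x) ∈ S := by
  have : IsClosed (S : Set (Fin N → Y)) := hS
  set f : RN N → (Fin N → Y) := fun x j => b j x
  have hf : Integrable f (volume.restrict Q) := Integrable.of_eval fun j => integrable_coeFn (b j)
  -- Membership in `S` is the vanishing of the class modulo `S`. The quotient is a Banach space, and
  -- the fundamental lemma applies to the quotient valued function.
  have hint : Integrable (fun x => S.mkQL (f x)) (volume.restrict Q) :=
    S.mkQL.integrable_comp hf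
  have h1 := hQ.ae_eq_zero_of_integral_contDiff_smul_eq_zero (f := fun x => S.mkQL (f x))
    (μ := volume) (IntegrableOn.locallyIntegrableOn hint) fun g hg hgs hgQ => by
      set φ : TestFn N := ⟨g, hg, hgs⟩
      have h2 := h φ hgQ
      have h3 : ∫ x, g x • S.mkQL (f x) = ∫ x in Q, g x • S.mkQL (f x) := by
        symm
        refine setIntegral_eq_integral_of_forall_compl_eq_zero fun x hx => ?_
        rw [image_eq_zero_of_notMem_tsupport fun h => hx (hgQ h), zero_smul]
      have hgf : Integrable (fun x => g x • f x) (volume.restrict Q) :=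
        (φ.bddMeas (volume.restrict Q)).integrable_smul hf
      have h4 : ∫ x in Q, g x • f x = fun j => wInt (φ.bddMeas (volume.restrict Q)) (b j) := by
        funext j
        rw [eval_integral fun j => Integrable.eval hgf j]
        rfl
      rw [h3]
      simp only [← map_smul]
      rw [S.mkQL.integral_comp_comm hgf, h4]
      exact (Submodule.Quotient.mk_eq_zero S).2 h2
  have h2 := (ae_restrict_iff' hQ.measurableSet).2 h1
  filter_upwards [h2] with x hx
  exact (Submodule.Quotient.mk_eq_zero S).1 hx

/-- Weak limits of unfolded Sobolev functions lie in `limitGraph`. -/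
theorem WeakLim.mem_limitGraph {hq : q ≠ ∞} (hQ : IsOpen Q) (h : WeakLim l y y₀)
    (hε : Tendsto ε l (𝓝 0))
    (hy : ∀ᶠ i in l, y i ∈ unfoldedGraph T Q hq (ε i)) {B : ℝ} (hB : ∀ᶠ i in l, ‖y i‖ ≤ B) :
    y₀ ∈ limitGraph T Q q := by
  have hU := h.compLp_invProj_eq hQ hε hy hB
  have hD := h.invPair_mem hy
  rw [invPair_apply, hU] at hD
  refine ⟨_, hD, hU, ?_⟩
  -- Here `DU` is the average of `y₀.2`. Integration by parts for `U` rewrites the term containing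
  -- `∂φ` as minus the weighted integral of `DU`, so the weighted integrals of the difference lie in
  -- `gradRange`.
  have := ae_mem_of_forall_wInt_mem (b := fun i => y₀.2 i - (invProj T q).compLp (y₀.2 i)) hQ
    (isClosed_gradRange (T := T) (q := q)) fun φ _ => by
      have h1 := h.pairing_mem_gradRange hy φ
      convert h1 using 2 with j
      rw [map_sub, wInt_pd_of_mem_sobolev0 hD φ j, sub_eq_add_neg]
  exact this

/-- In `limitGraph` the gradient part is the invariant projection. -/
theorem eq_compLp_of_mem_limitGraph (hQ : IsOpen Q) {D}
    (hD : (y₀.1, D) ∈ sobolev0 Q q (Lp ℝ q μ)) (hU : (invProj T q).compLp y₀.1 = y₀.1)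
    (hb : ∀ᵐ x ∂(volume.restrict Q), (fun i => (y₀.2 i - D i) x) ∈ gradRange q T) (i : Fin N) :
    (invProj T q).compLp (D i) = D i ∧ D i = (invProj T q).compLp (y₀.2 i) := by
  have h1 := invPair_mem_sobolev0 T hD
  rw [invPair_apply] at h1
  simp only [hU] at h1
  -- Averaging fixes `U`, so the averaged gradient is again a gradient of `U`, and gradients are
  -- unique.
  have h2 : (fun i => (invProj T q).compLp (D i)) = D := snd_eq_of_mem_sobolev0 hQ h1 hD
  have h3 := congrFun h2 i
  refine ⟨h3, ?_⟩
  rw [← h3, ← sub_eq_zero, ← neg_eq_zero, neg_sub]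
  have h4 : (invProj T q).compLpL q (volume.restrict Q) (y₀.2 i - D i) = 0 := by
    refine Lp.ext ?_
    filter_upwards [(invProj T q).coeFn_compLp (y₀.2 i - D i), hb,
      Lp.coeFn_zero (Lp ℝ q μ) q (volume.restrict Q)] with x e1 e2 e3
    rw [e3, Pi.zero_apply]
    exact e1.trans (invProj_of_mem_gradRange T e2 i)
  rw [map_sub] at h4
  exact h4

end Structure

/-! ### Integrals of `L^q` valued functions -/

section IntegralLp

variable {N : ℕ} {Q : Set (RN N)} [IsFiniteMeasure ((volume : Measure (RN N)).restrict Q)]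
  {q : ℝ≥0∞} [Fact (1 ≤ q)] {Y : Type*} [NormedAddCommGroup Y] [NormedSpace ℝ Y] [CompleteSpace Y]

theorem continuous_of_coeFn_eq {B : RN N → RN N → Y} (hB : Continuous (Function.uncurry B))
    (hs : HasCompactSupport (Function.uncurry B))
    {t : RN N → Lp Y q ((volume : Measure (RN N)).restrict Q)}
    (ht : ∀ y, t y =ᵐ[volume.restrict Q] fun x => B x y) : Continuous t := by
  have hu := hs.uniformContinuous_of_continuous hB
  set K : ℝ := measureUnivNNReal ((volume : Measure (RN N)).restrict Q) ^ q.toReal⁻¹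
  have hK : 0 ≤ K := by positivity
  rw [Metric.continuous_iff]
  intro y ε hε
  rw [Metric.uniformContinuous_iff] at hu
  obtain ⟨δ, hδ, h⟩ := hu (ε / (K + 1)) (by positivity)
  refine ⟨δ, hδ, fun y' hy' => ?_⟩
  rw [dist_eq_norm]
  have h1 : ‖t y' - t y‖ ≤ K * (ε / (K + 1)) := by
    refine Lp.norm_le_of_ae_bound (by positivity) ?_
    filter_upwards [Lp.coeFn_sub (t y') (t y), ht y, ht y'] with x e1 e2 e3
    rw [e1, Pi.sub_apply, e2, e3, ← dist_eq_norm]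
    refine (h (a := (x, y')) (b := (x, y)) ?_).le
    simpa [Prod.dist_eq, hδ] using hy'
  refine h1.trans_lt ?_
  rw [mul_div_assoc', div_lt_iff₀ (by positivity)]
  nlinarith

/-- A Bochner integral with values in `L^q(Q; Y)` is computed pointwise: both sides have the same
integral against each test function, by Fubini. -/
theorem integral_eq_of_coeFn_eq (hQ : IsOpen Q) {B : RN N → RN N → Y}
    (hB : Continuous (Function.uncurry B)) (hs : HasCompactSupport (Function.uncurry B))
    {t : RN N → Lp Y q ((volume : Measure (RN N)).restrict Q)}
    (ht : ∀ y, t y =ᵐ[volume.restrict Q] fun x => B x y)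
    {r : Lp Y q ((volume : Measure (RN N)).restrict Q)}
    (hr : r =ᵐ[volume.restrict Q] fun x => ∫ y, B x y) : Integrable t ∧ ∫ y, t y = r := by
  have hti : Integrable t := by
    refine (continuous_of_coeFn_eq hB hs ht).integrable_of_hasCompactSupport ?_
    refine HasCompactSupport.intro (hs.isCompact.image continuous_snd) fun y hy => ?_
    refine Lp.ext ?_
    filter_upwards [ht y, Lp.coeFn_zero Y q (volume.restrict Q)] with x h1 h2
    rw [h1, h2, Pi.zero_apply]
    by_contra h0
    exact hy ⟨(x, y), subset_tsupport _ h0, rfl⟩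
  refine ⟨hti, ?_⟩
  rw [← sub_eq_zero]
  refine eq_zero_of_forall_wInt_eq_zero hQ fun φ _ => ?_
  rw [map_sub, sub_eq_zero, ← (wInt (φ.bddMeas (volume.restrict Q))).integral_comp_comm hti]
  have h1 : ∀ y, wInt (φ.bddMeas (volume.restrict Q)) (t y)
      = ∫ x in Q, (φ : RN N → ℝ) x • B x y := fun y => by
    rw [wInt_apply]
    exact integral_congr_ae ((ht y).mono fun x hx => by simp only [hx])
  have h2 : wInt (φ.bddMeas (volume.restrict Q)) r = ∫ x in Q, ∫ y, (φ : RN N → ℝ) x • B x y := by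
    rw [wInt_apply]
    refine integral_congr_ae (hr.mono fun x hx => ?_)
    simp only [hx, integral_smul]
  simp only [h1]
  rw [h2]
  have hi : Integrable (fun z : RN N × RN N => (φ : RN N → ℝ) z.1 • Function.uncurry B z)
      ((volume.restrict Q).prod volume) := by
    have h3 : Continuous fun z : RN N × RN N => (φ : RN N → ℝ) z.1 • Function.uncurry B z :=
      (φ.continuous.comp continuous_fst).smul hB
    have h4 : Integrable (fun z : RN N × RN N => (φ : RN N → ℝ) z.1 • Function.uncurry B z)
        (volume.prod volume) := by
      refine h3.integrable_of_hasCompactSupport ?_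
      exact hs.smul_left
    refine h4.mono_measure ?_
    exact Measure.prod_mono Measure.restrict_le_self le_rfl
  exact (integral_integral_swap (f := fun x y => (φ : RN N → ℝ) x • B x y) hi).symm

theorem Submodule.integral_mem_of_isClosed {α E : Type*} [MeasurableSpace α] {ν : Measure α}
    [NormedAddCommGroup E] [NormedSpace ℝ E] [CompleteSpace E] {S : Submodule ℝ E}
    (hS : IsClosed (S : Set E)) {t : α → E} (ht : Integrable t ν) (h : ∀ y, t y ∈ S) :
    ∫ y, t y ∂ν ∈ S := by
  have : IsClosed (S : Set E) := hS
  rw [← Submodule.Quotient.mk_eq_zero S]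
  change S.mkQL (∫ y, t y ∂ν) = 0
  rw [← S.mkQL.integral_comp_comm ht]
  have h1 : ∀ y, S.mkQL (t y) = 0 := fun y => (Submodule.Quotient.mk_eq_zero S).2 (h y)
  simp [h1]

end IntegralLp

/-! ### Oscillating test functions -/

section Twist

variable {N : ℕ}

/-- The test function `x ↦ a x * b (y - c x)`. -/
def TestFn.twist (c : ℝ) (a b : TestFn N) (y : RN N) : TestFn N :=
  ⟨fun x => (a : RN N → ℝ) x * (b : RN N → ℝ) (y - c • x),
    a.contDiff.mul (b.contDiff.comp (contDiff_const.sub (contDiff_id.const_smul c))),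
    a.hasCompactSupport.mul_right⟩

theorem TestFn.twist_apply (c : ℝ) (a b : TestFn N) (y x : RN N) :
    (TestFn.twist c a b y : RN N → ℝ) x = (a : RN N → ℝ) x * (b : RN N → ℝ) (y - c • x) := rfl

theorem TestFn.tsupport_twist_subset (c : ℝ) (a b : TestFn N) (y : RN N) :
    tsupport (TestFn.twist c a b y : RN N → ℝ) ⊆ tsupport (a : RN N → ℝ) :=
  tsupport_mul_subset_left

theorem TestFn.pd_twist (c : ℝ) (a b : TestFn N) (y : RN N) (i : Fin N) :
    TestFn.pd i (TestFn.twist c a b y)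
      = TestFn.twist c (TestFn.pd i a) b y - c • TestFn.twist c a (TestFn.pd i b) y := by
  ext x
  change fderiv ℝ (fun x => (a : RN N → ℝ) x * (b : RN N → ℝ) (y - c • x)) x (stdVec i)
    = (TestFn.pd i a : RN N → ℝ) x * (b : RN N → ℝ) (y - c • x)
      - c * ((a : RN N → ℝ) x * (TestFn.pd i b : RN N → ℝ) (y - c • x))
  have h1 : HasFDerivAt (fun x : RN N => y - c • x) (-(c • ContinuousLinearMap.id ℝ (RN N))) x :=
    ((hasFDerivAt_id x).const_smul c).const_sub y
  have h2 := ((a.differentiable x).hasFDerivAt.mul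
    (((b.differentiable (y - c • x)).hasFDerivAt).comp x h1)).fderiv
  have h3 := congrArg (fun A : RN N →L[ℝ] ℝ => A (stdVec i)) h2
  refine h3.trans ?_
  simp [TestFn.pd_apply]
  ring

variable {Y : Type*} [NormedAddCommGroup Y] [NormedSpace ℝ Y]

theorem continuous_twist_smul (c : ℝ) (a b : TestFn N) {k : RN N → Y} (hk : Continuous k) :
    Continuous (Function.uncurry fun x y : RN N => (TestFn.twist c a b y : RN N → ℝ) x • k y) := by
  have h1 := a.continuous
  have h2 := b.continuous
  simp only [TestFn.twist_apply, Function.uncurry_def]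
  fun_prop

theorem hasCompactSupport_twist_smul (c : ℝ) (a b : TestFn N) (k : RN N → Y) :
    HasCompactSupport
      (Function.uncurry fun x y : RN N => (TestFn.twist c a b y : RN N → ℝ) x • k y) := by
  have hc : IsCompact ((fun z : RN N × RN N => (z.1, z.2 + c • z.1)) ''
      (tsupport (a : RN N → ℝ) ×ˢ tsupport (b : RN N → ℝ))) :=
    (a.hasCompactSupport.isCompact.prod b.hasCompactSupport.isCompact).image (by fun_prop)
  refine HasCompactSupport.intro hc fun z hz => ?_
  have h0 : (TestFn.twist c a b z.2 : RN N → ℝ) z.1 = 0 := by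
    rw [TestFn.twist_apply]
    by_contra h
    refine hz ⟨(z.1, z.2 - c • z.1), ⟨subset_tsupport _ (left_ne_zero_of_mul h),
      subset_tsupport _ (right_ne_zero_of_mul h)⟩, ?_⟩
    simp
  simp [Function.uncurry_def, h0]

end Twist

/-! ### Recovery sequences -/

section Recovery

variable {N : ℕ} {Ω : Type*} [MeasurableSpace Ω] {μ : Measure Ω} [IsProbabilityMeasure μ]
  {T : DynSystem N μ}
  {Q : Set (RN N)} [IsFiniteMeasure ((volume : Measure (RN N)).restrict Q)]
  {q : ℝ≥0∞} [Fact (1 ≤ q)]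

variable (T) in
/-- The average of the translates of `h` with weight `b`. -/
def avg (b : TestFn N) (h : Lp ℝ q μ) : Lp ℝ q μ := ∫ y, (b : RN N → ℝ) y • koopman T q y h

/-- Translating the variable of integration from `y` to `y + c x` exhibits the oscillating function
`a(x) h_b(T(c x) ω)`, with `h_b` the average of `h`, as an integral over `y` of elementary tensors.
This is what places oscillating functions in the closure of tensors. -/
theorem integral_twist_smul_koopman (c : ℝ) (a b : TestFn N) (h : Lp ℝ q μ) (x : RN N) :
    ∫ y, (TestFn.twist c a b y : RN N → ℝ) x • koopman T q y h
      = (a : RN N → ℝ) x • koopman T q (c • x) (avg T b h) := by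
  have h1 : ∀ y, (TestFn.twist c a b y : RN N → ℝ) x • koopman T q y h
      = (fun y => (a : RN N → ℝ) x • (b : RN N → ℝ) y • koopman T q (y + c • x) h) (y - c • x) :=
    fun y => by simp only [TestFn.twist_apply, smul_smul, sub_add_cancel]
  simp only [h1]
  rw [integral_sub_right_eq_self (fun y =>
    (a : RN N → ℝ) x • (b : RN N → ℝ) y • koopman T q (y + c • x) h) (c • x), integral_smul, avg]
  congr 1
  rw [← LinearIsometry.integral_comp_comm]
  simp only [map_smul, koopman_add]

theorem integral_tens_twist (hQ : IsOpen Q) (hq : q ≠ ∞) {c : ℝ} (hc : c ≠ 0) (a b : TestFn N)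
    {h : Lp ℝ q μ} (hk : Continuous fun y => koopman T q y h) :
    Integrable (fun y => tens Q q (TestFn.twist c a b y) (koopman T q y h)) ∧
      ∫ y, tens Q q (TestFn.twist c a b y) (koopman T q y h)
        = unfL T Q hq hc (tens Q q a (avg T b h)) := by
  refine integral_eq_of_coeFn_eq hQ (continuous_twist_smul c a b hk)
    (hasCompactSupport_twist_smul c a b _) (fun y => coeFn_tens _ _) ?_
  filter_upwards [coeFn_unfL T hq hc (tens Q q a (avg T b h)),
    coeFn_tens (Q := Q) (q := q) a (avg T b h)] with x h1 h2
  rw [h1, h2, map_smul, integral_twist_smul_koopman]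

/-- Integration by parts in the orbit variable, where the Koopman orbit of `ψ` has the orbits of the
`D_i ψ` as partial derivatives. -/
theorem avg_pd (ψ : CInf T) (b : TestFn N) (i : Fin N) :
    avg T (TestFn.pd i b) (gradPair q T ψ).1 = - avg T b ((gradPair q T ψ).2 i) := by
  have hk := continuous_koopman (q := q) ψ
  have hk' := continuous_koopman_snd (q := q) ψ i
  have hb := b.continuous
  have hb' := (TestFn.pd i b).continuous
  have h := integral_bilinear_hasLineDerivAt_right_eq_neg_left_of_integrable
    (μ := (volume : Measure (RN N))) (f := (b : RN N → ℝ)) (f' := (TestFn.pd i b : RN N → ℝ))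
    (g := fun y => koopman T q y (gradPair q T ψ).1)
    (g' := fun y => koopman T q y ((gradPair q T ψ).2 i)) (v := stdVec i)
    (B := ContinuousLinearMap.lsmul ℝ ℝ) ?_ ?_ ?_ (fun x _ => ?_) (fun x _ => ?_)
  · simp only [ContinuousLinearMap.lsmul_apply] at h
    rw [avg, avg, h, neg_neg]
  · exact (hb'.smul hk).integrable_of_hasCompactSupport (TestFn.pd i b).hasCompactSupport.smul_right
  · exact (hb.smul hk').integrable_of_hasCompactSupport b.hasCompactSupport.smul_right
  · exact (hb.smul hk).integrable_of_hasCompactSupport b.hasCompactSupport.smul_right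
  · exact (b.differentiable x).hasFDerivAt.hasLineDerivAt (stdVec i)
  · have := hasDerivAt_koopman (q := q) ψ i x 0
    rw [zero_smul, add_zero] at this
    exact this

theorem tens_sub_smul (a b : TestFn N) (c : ℝ) {Y : Type*} [NormedAddCommGroup Y] [NormedSpace ℝ Y]
    (h : Y) : tens Q q (a - c • b) h = tens Q q a h - c • tens Q q b h := by
  refine Lp.ext ?_
  filter_upwards [coeFn_tens (Q := Q) (q := q) (a - c • b) h, coeFn_tens (Q := Q) (q := q) a h,
    coeFn_tens (Q := Q) (q := q) b h, Lp.coeFn_sub (tens Q q a h) (c • tens Q q b h),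
    Lp.coeFn_smul c (tens Q q b h)] with x h1 h2 h3 h4 h5
  rw [h1, h4, Pi.sub_apply, h5, Pi.smul_apply, h2, h3]
  change ((a : RN N → ℝ) x - c * (b : RN N → ℝ) x) • h = _
  rw [sub_smul, mul_smul]

theorem tens_neg (φ : TestFn N) {Y : Type*} [NormedAddCommGroup Y] [NormedSpace ℝ Y] (h : Y) :
    tens Q q φ (-h) = - tens Q q φ h := map_neg (tensL Q q _ φ) _

/-- The derivative of the twisted test function falls on the slow factor `φ`, or on `χ` with a
factor `-c`. In the second case `avg_pd` moves it to `ψ` and produces the fast term `c φ D_i ψ`. -/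
theorem integral_tens_pd_twist (hQ : IsOpen Q) (hq : q ≠ ∞) {c : ℝ} (hc : c ≠ 0) (φ χ : TestFn N)
    (ψ : CInf T) (i : Fin N) :
    Integrable (fun y => tens Q q (TestFn.pd i (TestFn.twist c φ χ y))
      (koopman T q y (gradPair q T ψ).1)) ∧
      ∫ y, tens Q q (TestFn.pd i (TestFn.twist c φ χ y)) (koopman T q y (gradPair q T ψ).1)
        = unfL T Q hq hc (tens Q q (TestFn.pd i φ) (avg T χ (gradPair q T ψ).1)
          + c • tens Q q φ (avg T χ ((gradPair q T ψ).2 i))) := by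
  have hk := continuous_koopman (q := q) ψ
  have e1 := integral_tens_twist hQ hq hc (TestFn.pd i φ) χ hk
  have e2 := integral_tens_twist hQ hq hc φ (TestFn.pd i χ) hk
  have e4 := e2.1.fun_smul c
  simp only [TestFn.pd_twist, tens_sub_smul]
  refine ⟨e1.1.sub e4, ?_⟩
  rw [integral_sub e1.1 e4, integral_smul, e1.2, e2.2, avg_pd, tens_neg, map_add, map_neg,
    map_smul, smul_neg, sub_neg_eq_add]

/-- The oscillating functions `φ(x) ψ_χ(T(x/ε)ω)` belong to `W^1_0`; here they are unfolded. -/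
theorem avg_mem_unfoldedGraph (hQ : IsOpen Q) (hq : q ≠ ∞) {ε : ℝ} (hε : ε ≠ 0) {φ : TestFn N}
    (hφ : tsupport (φ : RN N → ℝ) ⊆ Q) (χ : TestFn N) (ψ : CInf T) :
    ((tens Q q φ (avg T χ (gradPair q T ψ).1), fun i =>
      tens Q q (TestFn.pd i φ) (avg T χ (gradPair q T ψ).1)
        + ε⁻¹ • tens Q q φ (avg T χ ((gradPair q T ψ).2 i))) : SobPair Q q (Lp ℝ q μ))
      ∈ unfoldedGraph T Q hq ε := by
  have hc : ε⁻¹ ≠ 0 := inv_ne_zero hε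
  have hs : -ε⁻¹ ≠ 0 := neg_ne_zero.2 hc
  set t : RN N → SobPair Q q (Lp ℝ q μ) := fun y =>
    tensPair Q q (TestFn.twist ε⁻¹ φ χ y) (koopman T q y (gradPair q T ψ).1)
  have h1 := integral_tens_twist hQ hq hc φ χ (continuous_koopman (q := q) ψ)
  have h2 := integral_tens_pd_twist hQ hq hc φ χ ψ
  have hti2 : Integrable (fun y => (t y).2) := Integrable.of_eval fun i => (h2 i).1
  have hti : Integrable t := h1.1.prodMk hti2
  -- Each `t y` is a single tensor supported in `Q` together with its gradient; a closed subspace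
  -- contains the integrals of its own values.
  have hmem : ∫ y, t y ∈ sobolev0 Q q (Lp ℝ q μ) :=
    Submodule.integral_mem_of_isClosed isClosed_sobolev0 hti fun y =>
      tensPair_mem ((TestFn.tsupport_twist_subset _ _ _ _).trans hφ) _
  refine ⟨hs, _, hmem, ?_⟩
  have g1 : (∫ y, t y).1 = unfL T Q hq hc (tens Q q φ (avg T χ (gradPair q T ψ).1)) := by
    rw [fst_integral hti]
    exact h1.2
  have g2 : ∀ i, (∫ y, t y).2 i
      = unfL T Q hq hc (tens Q q (TestFn.pd i φ) (avg T χ (gradPair q T ψ).1)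
          + ε⁻¹ • tens Q q φ (avg T χ ((gradPair q T ψ).2 i))) := fun i => by
    rw [snd_integral hti]
    exact (eval_integral (fun j => (h2 j).1) i).trans (h2 i).2
  generalize ∫ y, t y = I at g1 g2
  obtain ⟨I1, I2⟩ := I
  simp only at g1 g2
  rw [unfPair_apply, g1, unfL_neg_unfL T hq hc hs]
  refine Prod.ext rfl (funext fun i => ?_)
  simp only
  rw [g2, unfL_neg_unfL T hq hc hs]

end Recovery

/-! ### Density of tensors -/

section Density

variable {N : ℕ} {Q : Set (RN N)} [IsFiniteMeasure ((volume : Measure (RN N)).restrict Q)]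
  {q : ℝ≥0∞} [Fact (1 ≤ q)]

/-- With `θ` smooth and positive exactly on `Q`, the cut-off `smoothTransition (n θ - 1)` is
supported in the closed set `n θ ≥ 1` inside `Q`, and equals `1` once `n θ x ≥ 2`. -/
theorem TestFn.exists_seq_tendsto_indicator (hQ : IsOpen Q) (g : TestFn N) :
    ∃ g' : ℕ → TestFn N, (∀ n, tsupport (g' n : RN N → ℝ) ⊆ Q) ∧
      (∀ n x, ‖(g' n : RN N → ℝ) x‖ ≤ ‖(g : RN N → ℝ) x‖) ∧
      ∀ x ∈ Q, ∀ᶠ n in atTop, (g' n : RN N → ℝ) x = (g : RN N → ℝ) x := by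
  obtain ⟨θ, hθs, hθ, hθr⟩ := hQ.exists_contDiff_support_eq (n := (⊤ : ℕ∞))
  have hθ0 : ∀ x, 0 ≤ θ x := fun x => (hθr ⟨x, rfl⟩).1
  have hη : ∀ n : ℕ, ContDiff ℝ ((⊤ : ℕ∞) : WithTop ℕ∞)
      fun x => Real.smoothTransition (n * θ x - 1) := fun n =>
    Real.smoothTransition.contDiff.comp ((contDiff_const.mul hθ).sub contDiff_const)
  refine ⟨fun n => ⟨fun x => (g : RN N → ℝ) x * Real.smoothTransition (n * θ x - 1),
    g.contDiff.mul (hη n), g.hasCompactSupport.mul_right⟩, fun n => ?_, fun n x => ?_,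
    fun x hx => ?_⟩
  · have hcl : IsClosed {x | 1 ≤ n * θ x} :=
      isClosed_le continuous_const (continuous_const.mul hθ.continuous)
    refine (closure_minimal (t := {x | 1 ≤ n * θ x}) (fun x hx => ?_) hcl).trans fun x hx => ?_
    · by_contra h
      refine hx ?_
      have : Real.smoothTransition (n * θ x - 1) = 0 :=
        Real.smoothTransition.zero_of_nonpos (by simp only [mem_ofPred_eq, not_le] at h; linarith)
      simp [this]
    · rw [← hθs]
      intro h0
      simp only [mem_ofPred_eq, h0, mul_zero] at hx
      linarith
  · change ‖(g : RN N → ℝ) x * Real.smoothTransition (n * θ x - 1)‖ ≤ _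
    rw [norm_mul, Real.norm_of_nonneg (Real.smoothTransition.nonneg _)]
    exact mul_le_of_le_one_right (norm_nonneg _) (Real.smoothTransition.le_one _)
  · have hx' : 0 < θ x := (hθ0 x).lt_of_ne' (by rw [← hθs] at hx; exact hx)
    have ht : Tendsto (fun n : ℕ => (n : ℝ) * θ x) atTop atTop :=
      tendsto_natCast_atTop_atTop.atTop_mul_const hx'
    filter_upwards [ht.eventually_ge_atTop 2] with n hn
    rw [Real.smoothTransition.one_of_one_le (by linarith), mul_one]

/-- Test functions on `ℝ^N` are dense in `L^q` of the restricted measure, and each is, by dominated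
convergence, a limit of its cut-offs supported in `Q`. -/
theorem mem_of_testFn_mem (hQ : IsOpen Q) (hq : q ≠ ∞)
    {S : Submodule ℝ (Lp ℝ q ((volume : Measure (RN N)).restrict Q))}
    (hS : IsClosed (S : Set (Lp ℝ q (volume.restrict Q))))
    (h : ∀ φ : TestFn N, tsupport (φ : RN N → ℝ) ⊆ Q →
      (φ.memLp (volume.restrict Q) q).toLp _ ∈ S)
    (f : Lp ℝ q ((volume : Measure (RN N)).restrict Q)) : f ∈ S := by
  have hq0 : q ≠ 0 := (zero_lt_one.trans_le (Fact.out : 1 ≤ q)).ne'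
  have hr : 0 < q.toReal := ENNReal.toReal_pos hq0 hq
  have hg : ∀ g : TestFn N, (g.memLp (volume.restrict Q) q).toLp _ ∈ S := by
    intro g
    obtain ⟨g', hsupp, hle, hlim⟩ := g.exists_seq_tendsto_indicator hQ
    obtain ⟨C, hC⟩ := g.exists_bound
    have ht : Tendsto (fun n => ((g' n).memLp (volume.restrict Q) q).toLp _) atTop
        (𝓝 ((g.memLp (volume.restrict Q) q).toLp _)) := by
      rw [Lp.tendsto_Lp_iff_tendsto_eLpNorm'']
      have h1 : Tendsto (fun n => ∫⁻ x in Q, ‖((g' n : RN N → ℝ) - (g : RN N → ℝ)) x‖ₑ ^ q.toReal)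
          atTop (𝓝 (∫⁻ x in Q, 0)) := by
        refine tendsto_lintegral_of_dominated_convergence
          (fun _ => ENNReal.ofReal (C + C) ^ q.toReal) (fun n => ?_) (fun n => ?_) ?_ ?_
        · exact (((g' n).continuous.sub g.continuous).enorm.measurable).pow_const _
        · refine ae_of_all _ fun x => ?_
          refine ENNReal.rpow_le_rpow ?_ hr.le
          rw [← ofReal_norm]
          refine ENNReal.ofReal_le_ofReal ((norm_sub_le _ _).trans ?_)
          exact add_le_add ((hle n x).trans (hC x)) (hC x)
        · rw [lintegral_const]
          exact ENNReal.mul_ne_top (ENNReal.rpow_ne_top_of_nonneg hr.le ENNReal.ofReal_ne_top)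
            (measure_ne_top _ _)
        · rw [ae_restrict_iff' hQ.measurableSet]
          refine ae_of_all _ fun x hx => ?_
          refine tendsto_const_nhds.congr' ?_
          filter_upwards [hlim x hx] with n hn
          simp [hn, hr]
      rw [lintegral_zero] at h1
      have h2 := ((ENNReal.continuous_rpow_const (y := 1 / q.toReal)).tendsto 0).comp h1
      rw [ENNReal.zero_rpow_of_pos (by positivity)] at h2
      refine h2.congr fun n => ?_
      rw [eLpNorm_eq_lintegral_rpow_enorm_toReal hq0 hq]
      rfl
    exact hS.mem_of_tendsto ht (Eventually.of_forall fun n => h _ (hsupp n))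
  have hcl : f ∈ closure (S : Set (Lp ℝ q (volume.restrict Q))) := by
    rw [EMetric.mem_closure_iff]
    intro ε hε
    obtain ⟨δ, hδ, hδε⟩ : ∃ δ : ℝ, 0 < δ ∧ ENNReal.ofReal δ < ε := by
      obtain ⟨r, hr0, hr⟩ := ENNReal.lt_iff_exists_nnreal_btwn.1 hε
      refine ⟨r, by exact_mod_cast hr0, by simpa using hr⟩
    obtain ⟨g, hgs, hgc, hgl⟩ := MemLp.exist_eLpNorm_sub_le hq Fact.out (Lp.memLp f) hδ
    refine ⟨_, hg ⟨g, hgc, hgs⟩, lt_of_le_of_lt ?_ hδε⟩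
    rw [Lp.edist_def]
    refine le_trans (le_of_eq (eLpNorm_congr_ae ?_)) hgl
    exact EventuallyEq.rfl.sub (MemLp.coeFn_toLp _)
  rwa [hS.closure_eq] at hcl

/-- Elementary tensors supported in `Q` span a dense subspace. -/
theorem mem_of_tens_mem {Y : Type*} [NormedAddCommGroup Y] [NormedSpace ℝ Y]
    (hQ : IsOpen Q) (hq : q ≠ ∞) {S : Submodule ℝ (Lp Y q ((volume : Measure (RN N)).restrict Q))}
    (hS : IsClosed (S : Set (Lp Y q (volume.restrict Q))))
    (h : ∀ (φ : TestFn N) (h : Y), tsupport (φ : RN N → ℝ) ⊆ Q → tens Q q φ h ∈ S)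
    (f : Lp Y q ((volume : Measure (RN N)).restrict Q)) : f ∈ S := by
  refine Lp.induction hq (motive := fun f => f ∈ S) ?_ (fun f g _ _ _ h1 h2 => S.add_mem h1 h2)
    hS f
  intro c A hA hAμ
  set L := (ContinuousLinearMap.toSpanSingleton ℝ c).compLpL q
    ((volume : Measure (RN N)).restrict Q)
  have h1 := mem_of_testFn_mem hQ hq (S := S.comap L.toLinearMap) (hS.preimage L.continuous)
    (fun φ hφ => h φ c hφ) (indicatorConstLp q hA hAμ.ne (1 : ℝ))
  have h2 : L (indicatorConstLp q hA hAμ.ne (1 : ℝ)) ∈ S := h1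
  convert h2 using 1
  refine Lp.ext ?_
  filter_upwards [(ContinuousLinearMap.toSpanSingleton ℝ c).coeFn_compLp
    (indicatorConstLp q hA hAμ.ne (1 : ℝ)),
    (indicatorConstLp_coeFn (p := q) (hs := hA) (hμs := hAμ.ne) (c := c)),
    (indicatorConstLp_coeFn (p := q) (hs := hA) (hμs := hAμ.ne) (c := (1 : ℝ)))] with x h3 h4 h5
  rw [Lp.simpleFunc.coe_indicatorConst, h4]
  refine Eq.trans ?_ h3.symm
  rw [h5]
  by_cases hx : x ∈ A <;> simp [hx]

/-- A tuple of functions with values in a closed subspace is a function with values in it. -/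
theorem exists_lp_subspace {ι Y : Type*} [Fintype ι] [NormedAddCommGroup Y] [NormedSpace ℝ Y]
    {α : Type*} [MeasurableSpace α] {lam : Measure α} (S : Submodule ℝ (ι → Y))
    (b : ι → Lp Y q lam) (hb : ∀ᵐ x ∂lam, (fun i => b i x) ∈ S) :
    ∃ β : Lp S q lam, ∀ i,
      ((ContinuousLinearMap.proj i).comp S.subtypeL : S →L[ℝ] Y).compLp β = b i := by
  classical
  set f : α → S := fun x => if h : (fun i => b i x) ∈ S then ⟨_, h⟩ else 0
  have hf : (fun x => (f x : ι → Y)) =ᵐ[lam] fun x i => b i x := by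
    filter_upwards [hb] with x hx
    simp only [f, dif_pos hx]
  have hm : MemLp (fun x i => b i x) q lam := memLp_pi_iff.2 fun i => Lp.memLp (b i)
  have hfm : MemLp f q lam := by
    have h1 : AEStronglyMeasurable f lam :=
      (Topology.IsEmbedding.subtypeVal.aestronglyMeasurable_comp_iff).1 (hm.1.congr hf.symm)
    exact ((memLp_congr_ae hf).2 hm).of_le h1 (ae_of_all _ fun x => le_rfl)
  refine ⟨hfm.toLp f, fun i => Lp.ext ?_⟩
  filter_upwards [((ContinuousLinearMap.proj i).comp S.subtypeL : S →L[ℝ] Y).coeFn_compLp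
    (hfm.toLp f), hfm.coeFn_toLp, hf] with x h1 h2 h3
  rw [h1, h2]
  exact congrFun h3 i

end Density

/-! ### The recovery property -/

section RecoverySequence

variable {N : ℕ} {Ω : Type*} [MeasurableSpace Ω] {μ : Measure Ω} [IsProbabilityMeasure μ]
  {T : DynSystem N μ}
  {Q : Set (RN N)} [IsFiniteMeasure ((volume : Measure (RN N)).restrict Q)]
  {q : ℝ≥0∞} [Fact (1 ≤ q)]

variable (T) in
/-- The unfolded Sobolev functions as a subspace. -/
def unfoldedSubmodule (Q : Set (RN N)) [IsFiniteMeasure ((volume : Measure (RN N)).restrict Q)]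
    (hq : q ≠ ∞) {ε : ℝ} (hs : -ε⁻¹ ≠ 0) : Submodule ℝ (SobPair Q q (Lp ℝ q μ)) :=
  (sobolev0 Q q (Lp ℝ q μ)).map (unfPair T Q hq hs).toLinearMap

theorem mem_unfoldedSubmodule {hq : q ≠ ∞} {ε : ℝ} (hs : -ε⁻¹ ≠ 0)
    {y : SobPair Q q (Lp ℝ q μ)} :
    y ∈ unfoldedSubmodule T Q hq hs ↔ y ∈ unfoldedGraph T Q hq ε := by
  constructor
  · rintro ⟨z, hz, rfl⟩
    exact ⟨hs, z, hz, rfl⟩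
  · rintro ⟨_, z, hz, rfl⟩
    exact ⟨z, hz, rfl⟩

theorem neg_inv_ne_zero_of_pos {ε : ℝ} (hε : 0 < ε) : -ε⁻¹ ≠ 0 :=
  neg_ne_zero.2 (inv_ne_zero hε.ne')

variable (T) in
/-- The vector fields that are limits of gradients of unfolded Sobolev functions as `ε → 0`. -/
def recoverable (Q : Set (RN N)) [IsFiniteMeasure ((volume : Measure (RN N)).restrict Q)]
    (hq : q ≠ ∞) : Submodule ℝ (Fin N → Lp (Lp ℝ q μ) q ((volume : Measure (RN N)).restrict Q)) where
  carrier := {b | ∀ δ : ℝ, 0 < δ → ∀ᶠ ε in 𝓝[>] (0 : ℝ),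
    ∃ y ∈ unfoldedGraph T Q hq ε, ‖y.2 - b‖ < δ}
  zero_mem' := fun δ hδ => by
    filter_upwards [self_mem_nhdsWithin] with ε hε
    exact ⟨0, (mem_unfoldedSubmodule (neg_inv_ne_zero_of_pos hε)).1 (Submodule.zero_mem _),
      by simpa using hδ⟩
  add_mem' := fun {b b'} hb hb' δ hδ => by
    filter_upwards [self_mem_nhdsWithin, hb (δ / 2) (half_pos hδ), hb' (δ / 2) (half_pos hδ)]
      with ε hε ⟨y, hy, h1⟩ ⟨y', hy', h2⟩
    refine ⟨y + y', (mem_unfoldedSubmodule (neg_inv_ne_zero_of_pos hε)).1 (Submodule.add_mem _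
      ((mem_unfoldedSubmodule _).2 hy) ((mem_unfoldedSubmodule _).2 hy')), ?_⟩
    rw [Prod.snd_add, add_sub_add_comm]
    exact (norm_add_le _ _).trans_lt (by linarith)
  smul_mem' := fun c b hb δ hδ => by
    filter_upwards [self_mem_nhdsWithin, hb (δ / (|c| + 1)) (by positivity)] with ε hε ⟨y, hy, h1⟩
    refine ⟨c • y, (mem_unfoldedSubmodule (neg_inv_ne_zero_of_pos hε)).1 (Submodule.smul_mem _ c
      ((mem_unfoldedSubmodule _).2 hy)), ?_⟩
    rw [Prod.smul_snd, ← smul_sub, norm_smul, Real.norm_eq_abs]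
    rw [lt_div_iff₀ (by positivity)] at h1
    nlinarith [norm_nonneg (y.2 - b), abs_nonneg c]

theorem mem_recoverable_of_tendsto {hq : q ≠ ∞}
    {b : Fin N → Lp (Lp ℝ q μ) q ((volume : Measure (RN N)).restrict Q)}
    (h : ∀ δ : ℝ, 0 < δ → ∃ b' ∈ recoverable T Q hq, ‖b' - b‖ < δ) : b ∈ recoverable T Q hq := by
  intro δ hδ
  obtain ⟨b', hb', h1⟩ := h (δ / 2) (half_pos hδ)
  filter_upwards [hb' (δ / 2) (half_pos hδ)] with ε ⟨y, hy, h2⟩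
  refine ⟨y, hy, ?_⟩
  have := norm_sub_le_norm_sub_add_norm_sub y.2 b' b
  linarith

theorem isClosed_recoverable {hq : q ≠ ∞} : IsClosed (recoverable T Q hq : Set (Fin N →
    Lp (Lp ℝ q μ) q ((volume : Measure (RN N)).restrict Q))) := by
  refine isClosed_of_closure_subset fun b hb => mem_recoverable_of_tendsto fun δ hδ => ?_
  obtain ⟨b', hb', h⟩ := Metric.mem_closure_iff.1 hb δ hδ
  exact ⟨b', hb', by rwa [← dist_eq_norm, dist_comm]⟩

/-- An invariant Sobolev pair is unchanged by unfolding at every scale, so it recovers itself. -/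
theorem mem_recoverable_of_mem_sobolev0 {hq : q ≠ ∞} {y : SobPair Q q (Lp ℝ q μ)}
    (hy : y ∈ sobolev0 Q q (Lp ℝ q μ)) (h1 : (invProj T q).compLp y.1 = y.1)
    (h2 : ∀ i, (invProj T q).compLp (y.2 i) = y.2 i) : y.2 ∈ recoverable T Q hq := by
  intro δ hδ
  filter_upwards [self_mem_nhdsWithin] with ε hε
  refine ⟨y, ⟨neg_inv_ne_zero_of_pos hε, y, hy, ?_⟩, by simpa using hδ⟩
  rw [unfPair_apply]
  exact Prod.ext (unfL_eq_self T hq _ (ae_koopman_eq_of_compLp_eq T h1)).symm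
    (funext fun i => (unfL_eq_self T hq _ (ae_koopman_eq_of_compLp_eq T (h2 i))).symm)

/-- The recovery family is `ε` times the oscillating function: the fast part of its gradient becomes
exactly the target, and the slow part is `O(ε)`. -/
theorem tens_avg_mem_recoverable (hQ : IsOpen Q) {hq : q ≠ ∞} {φ : TestFn N}
    (hφ : tsupport (φ : RN N → ℝ) ⊆ Q) (χ : TestFn N) (ψ : CInf T) :
    (fun i => tens Q q φ (avg T χ ((gradPair q T ψ).2 i))) ∈ recoverable T Q hq := by
  intro δ hδ
  set D : Fin N → Lp (Lp ℝ q μ) q ((volume : Measure (RN N)).restrict Q) := fun i =>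
    tens Q q (TestFn.pd i φ) (avg T χ (gradPair q T ψ).1)
  have hlim : Tendsto (fun ε : ℝ => |ε| * ‖D‖) (𝓝[>] 0) (𝓝 0) := by
    have : Tendsto (fun ε : ℝ => |ε| * ‖D‖) (𝓝 0) (𝓝 (|0| * ‖D‖)) :=
      (continuous_abs.mul continuous_const).tendsto 0
    rw [abs_zero, zero_mul] at this
    exact this.mono_left nhdsWithin_le_nhds
  filter_upwards [self_mem_nhdsWithin, hlim.eventually (gt_mem_nhds hδ)] with ε hε hlt
  have hε : 0 < ε := hε
  have hmem := avg_mem_unfoldedGraph hQ hq hε.ne' hφ χ ψ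
  have hmem2 := (mem_unfoldedSubmodule (neg_inv_ne_zero_of_pos hε)).1 (Submodule.smul_mem _ ε
    ((mem_unfoldedSubmodule (neg_inv_ne_zero_of_pos hε)).2 hmem))
  refine ⟨_, hmem2, lt_of_le_of_lt (le_of_eq ?_) hlt⟩
  rw [← Real.norm_eq_abs, ← norm_smul]
  congr 1
  funext i
  simp only [Prod.smul_mk, Pi.sub_apply, Pi.smul_apply, D]
  rw [smul_add, smul_smul, mul_inv_cancel₀ hε.ne', one_smul, add_sub_cancel_right]

/-- Averaging with a smooth bump near the origin is close to the identity on finitely many vectors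
with continuous orbits. -/
theorem exists_avg_near {ι : Type*} [Finite ι] (c : ι → Lp ℝ q μ)
    (hc : ∀ i, Continuous fun y => koopman T q y (c i)) {δ : ℝ} (hδ : 0 < δ) :
    ∃ χ : TestFn N, ∀ i, ‖avg T χ (c i) - c i‖ ≤ δ := by
  -- The sign of `-y` matches the convolution at `0`, which pairs the bump at `t` with the function
  -- at `-t`.
  have hev : ∀ᶠ y in 𝓝 (0 : RN N), ∀ i, dist (koopman T q (-y) (c i)) (c i) < δ := by
    rw [eventually_all]
    intro i
    have h1 : Tendsto (fun y : RN N => koopman T q (-y) (c i)) (𝓝 0) (𝓝 (c i)) := by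
      have := ((hc i).comp continuous_neg).tendsto 0
      simpa [Function.comp_def, koopman_zero] using this
    exact (Metric.tendsto_nhds.1 h1) δ hδ
  obtain ⟨r, hr, hball⟩ := Metric.eventually_nhds_iff_ball.1 hev
  set f : ContDiffBump (0 : RN N) := ⟨r / 2, r, half_pos hr, half_lt_self hr⟩
  refine ⟨⟨f.normed volume, f.contDiff_normed, f.hasCompactSupport_normed⟩, fun i => ?_⟩
  have h1 := f.dist_normed_convolution_le (μ := (volume : Measure (RN N)))
    (g := fun y => koopman T q (-y) (c i)) (x₀ := 0) (ε := δ)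
    (((hc i).comp continuous_neg).aestronglyMeasurable) (fun x hx => by
      simp only [neg_zero, koopman_zero]
      exact (hball x hx i).le)
  simp only [neg_zero, koopman_zero, convolution_def, ContinuousLinearMap.lsmul_apply, zero_sub,
    neg_neg, dist_eq_norm] at h1
  exact h1

/-- Recoverable fields form a closed set, so it suffices to take gradients of smooth functions, and
for these the averaging by `χ` is removed by concentrating `χ` at the origin. -/
theorem tens_mem_recoverable (hQ : IsOpen Q) {hq : q ≠ ∞} {φ : TestFn N}
    (hφ : tsupport (φ : RN N → ℝ) ⊆ Q) {c : Fin N → Lp ℝ q μ} (hc : c ∈ gradRange q T) :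
    (fun i => tens Q q φ (c i)) ∈ recoverable T Q hq := by
  set A : (Fin N → Lp ℝ q μ) →L[ℝ]
    (Fin N → Lp (Lp ℝ q μ) q ((volume : Measure (RN N)).restrict Q)) :=
    ContinuousLinearMap.piMap fun _ => tensL Q q _ φ
  have hA : ∀ c, A c = fun i => tens Q q φ (c i) := fun c => rfl
  rw [← hA]
  refine gradRange_induction (P := fun c => A c ∈ recoverable T Q hq)
    (isClosed_recoverable.preimage A.continuous) (fun ψ => ?_) hc
  refine mem_recoverable_of_tendsto fun δ hδ => ?_
  set K : ℝ := ‖A‖ + 1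
  have hK : 0 < K := by positivity
  obtain ⟨χ, hχ⟩ := exists_avg_near (gradPair q T ψ).2 (continuous_koopman_snd ψ)
    (show 0 < δ / (2 * K) by positivity)
  refine ⟨_, tens_avg_mem_recoverable hQ hφ χ ψ, ?_⟩
  rw [← hA, ← map_sub]
  have h1 : ‖(fun i => avg T χ ((gradPair q T ψ).2 i)) - (gradPair q T ψ).2‖ ≤ δ / (2 * K) :=
    (pi_norm_le_iff_of_nonneg (by positivity)).2 hχ
  calc _ ≤ ‖A‖ * (δ / (2 * K)) := (A.le_opNorm _).trans
        (mul_le_mul_of_nonneg_left h1 (norm_nonneg _))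
    _ ≤ K * (δ / (2 * K)) := by gcongr; simp [K]
    _ = δ / 2 := by field_simp
    _ < δ := half_lt_self hδ

/-- Viewed as an `L^q` function with values in the space `gradRange`, the field is approximated by
sums of tensors whose values are stochastic gradients in the closed sense, each of which is
recoverable. -/
theorem mem_recoverable_of_ae_mem_gradRange (hQ : IsOpen Q) {hq : q ≠ ∞}
    {b : Fin N → Lp (Lp ℝ q μ) q ((volume : Measure (RN N)).restrict Q)}
    (hb : ∀ᵐ x ∂(volume.restrict Q), (fun i => b i x) ∈ gradRange q T) :
    b ∈ recoverable T Q hq := by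
  obtain ⟨β, hβ⟩ := exists_lp_subspace (gradRange q T) b hb
  set A : Lp (gradRange q T) q ((volume : Measure (RN N)).restrict Q) →L[ℝ]
    (Fin N → Lp (Lp ℝ q μ) q ((volume : Measure (RN N)).restrict Q)) :=
    ContinuousLinearMap.pi fun i => ((ContinuousLinearMap.proj i).comp
      (gradRange q T).subtypeL : gradRange q T →L[ℝ] Lp ℝ q μ).compLpL q (volume.restrict Q)
  have h1 : A β = b := funext hβ
  have h2 := mem_of_tens_mem hQ hq (S := (recoverable T Q hq).comap A.toLinearMap)
    (isClosed_recoverable.preimage A.continuous) (fun φ c hφ => ?_) β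
  · rw [← h1]
    exact h2
  · change A (tens Q q φ c) ∈ recoverable T Q hq
    have h3 : A (tens Q q φ c) = fun i => tens Q q φ ((c : Fin N → Lp ℝ q μ) i) :=
      funext fun i => compLp_tens _ φ c
    rw [h3]
    exact tens_mem_recoverable hQ hφ c.2

/-- Every element of `limitGraph` has its gradient part recovered by unfolded gradients. -/
theorem snd_mem_recoverable_of_mem_limitGraph (hQ : IsOpen Q) {hq : q ≠ ∞}
    {y : SobPair Q q (Lp ℝ q μ)} (hy : y ∈ limitGraph T Q q) : y.2 ∈ recoverable T Q hq := by
  obtain ⟨D, hD, hU, hb⟩ := hy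
  have h1 : D ∈ recoverable T Q hq := mem_recoverable_of_mem_sobolev0 (y := (y.1, D)) hD hU
    fun i => (eq_compLp_of_mem_limitGraph hQ hD hU hb i).1
  have h2 : (fun i => y.2 i - D i) ∈ recoverable T Q hq :=
    mem_recoverable_of_ae_mem_gradRange hQ hb
  have h3 := Submodule.add_mem _ h1 h2
  convert h3 using 1
  funext i
  simp

end RecoverySequence

/-! ### Convex integral functionals -/

/-- A strictly convex integrand with `p`-growth. -/
structure IsIntegrand {N : ℕ} {Ω : Type*} [MeasurableSpace Ω] (μ : Measure Ω)
    (f : Ω → RN N → ℝ) (p c C : ℝ) : Prop where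
  measurable : ∀ l : RN N, Measurable fun ω => f ω l
  strictConvexOn : ∀ᵐ ω ∂μ, StrictConvexOn ℝ univ (f ω)
  pos : 0 < c
  upper_pos : 0 < C
  lower : ∀ᵐ ω ∂μ, ∀ l : RN N, c * ‖l‖ ^ p ≤ f ω l
  upper : ∀ᵐ ω ∂μ, ∀ l : RN N, f ω l ≤ C * (1 + ‖l‖ ^ p)

section Energy

variable {N : ℕ} {Ω : Type*} [MeasurableSpace Ω] {μ : Measure Ω} [IsProbabilityMeasure μ]
  {Q : Set (RN N)} [IsFiniteMeasure ((volume : Measure (RN N)).restrict Q)]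
  {f : Ω → RN N → ℝ} {p c C : ℝ} [Fact (1 ≤ ENNReal.ofReal p)]

theorem ae_prodMeas_of_ae {P : Ω → Prop} (h : ∀ᵐ ω ∂μ, P ω) : ∀ᵐ z ∂(prodMeas Q μ), P z.2 :=
  Measure.quasiMeasurePreserving_snd.ae h

namespace IsIntegrand

/-- A finite convex function on `ℝ^N` is continuous, so `f` is a Carathéodory integrand once it is
replaced by zero on a measurable null set. -/
theorem aestronglyMeasurable_comp (hf : IsIntegrand μ f p c C) {g : RN N × Ω → RN N}
    (hg : AEStronglyMeasurable g (prodMeas Q μ)) :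
    AEStronglyMeasurable (fun z => f z.2 (g z)) (prodMeas Q μ) := by
  classical
  have hcont : ∀ᵐ ω ∂μ, Continuous (f ω) := hf.strictConvexOn.mono fun ω h =>
    continuousOn_univ.1 (h.convexOn.continuousOn isOpen_univ)
  obtain ⟨A, hAs, hA, hA0⟩ := exists_measurable_superset_of_null hcont
  set f' : RN N → Ω → ℝ := fun l ω => if ω ∈ A then 0 else f ω l
  have h1 : ∀ ω, Continuous fun l => f' l ω := fun ω => by
    by_cases hω : ω ∈ A
    · simp only [f', if_pos hω]
      exact continuous_const
    · simp only [f', if_neg hω]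
      by_contra h
      exact hω (hAs h)
  have h2 : ∀ l, StronglyMeasurable (f' l) := fun l =>
    (Measurable.ite hA measurable_const (hf.measurable l)).stronglyMeasurable
  have h3 := stronglyMeasurable_uncurry_of_continuous_of_stronglyMeasurable h1 h2
  have h4 : AEStronglyMeasurable (fun z => Function.uncurry f' (g z, z.2)) (prodMeas Q μ) :=
    (h3.measurable.comp_aemeasurable
      (hg.aemeasurable.prodMk measurable_snd.aemeasurable)).aestronglyMeasurable
  refine h4.congr ?_
  have h5 : ∀ᵐ ω ∂μ, ω ∉ A := measure_eq_zero_iff_ae_notMem.1 hA0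
  filter_upwards [ae_prodMeas_of_ae (Q := Q) h5] with z hz
  simp only [Function.uncurry, f', if_neg hz]

theorem nonneg (hf : IsIntegrand μ f p c C) : ∀ᵐ ω ∂μ, ∀ l : RN N, 0 ≤ f ω l :=
  hf.lower.mono fun _ h l => (mul_nonneg hf.pos.le (by positivity)).trans (h l)

theorem integrable_comp (hf : IsIntegrand μ f p c C) (hp : 0 < p) {g : RN N × Ω → RN N}
    (hg : MemLp g (ENNReal.ofReal p) (prodMeas Q μ)) :
    Integrable (fun z => f z.2 (g z)) (prodMeas Q μ) := by
  have h1 : Integrable (fun z => ‖g z‖ ^ p) (prodMeas Q μ) := by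
    have := hg.integrable_norm_rpow (by simpa using hp) ENNReal.ofReal_ne_top
    rwa [ENNReal.toReal_ofReal hp.le] at this
  refine (((integrable_const (1 : ℝ)).add h1).const_mul C).mono'
    (hf.aestronglyMeasurable_comp hg.1) ?_
  filter_upwards [ae_prodMeas_of_ae (Q := Q) hf.nonneg, ae_prodMeas_of_ae (Q := Q) hf.upper]
    with z h2 h3
  rw [Real.norm_of_nonneg (h2 _)]
  exact h3 _

end IsIntegrand

theorem jointGrad_comb {q : ℝ≥0∞} [Fact (1 ≤ q)] (hq : q ≠ ∞) (s t : ℝ)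
    (G G' : Fin N → Lp (Lp ℝ q μ) q ((volume : Measure (RN N)).restrict Q)) :
    jointGrad hq (s • G + t • G')
      =ᵐ[prodMeas Q μ] fun z => s • jointGrad hq G z + t • jointGrad hq G' z := by
  filter_upwards [jointGrad_add hq (s • G) (t • G'),
    ae_all_iff.2 fun i => jointFn_smul hq s (G i), ae_all_iff.2 fun i => jointFn_smul hq t (G' i)]
    with z h1 h2 h3
  rw [h1]
  ext i
  exact congrArg₂ (· + ·) (h2 i) (h3 i)

variable (Q μ) in
/-- The integral functional `G ↦ ∬ f(ω, G)` on tuples in `L^p(Q; L^p(Ω))`. -/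
def energy (f : Ω → RN N → ℝ)
    (G : Fin N → Lp (Lp ℝ (ENNReal.ofReal p) μ) (ENNReal.ofReal p)
      ((volume : Measure (RN N)).restrict Q)) : ℝ :=
  ∫ z, f z.2 (jointGrad ENNReal.ofReal_ne_top G z) ∂(prodMeas Q μ)

namespace IsIntegrand

theorem integrable_jointGrad (hf : IsIntegrand μ f p c C) (hp : 0 < p)
    (G : Fin N → Lp (Lp ℝ (ENNReal.ofReal p) μ) (ENNReal.ofReal p)
      ((volume : Measure (RN N)).restrict Q)) :
    Integrable (fun z => f z.2 (jointGrad ENNReal.ofReal_ne_top G z)) (prodMeas Q μ) :=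
  hf.integrable_comp hp (memLp_jointGrad _ G)

/-- The convexity defect is integrable and nonnegative. If its integral vanished, strict convexity
of `f ω` would make the two fields agree almost everywhere. -/
theorem strictConvexOn_energy (hf : IsIntegrand μ f p c C) (hp : 0 < p) :
    StrictConvexOn ℝ univ (energy (p := p) μ Q f) := by
  refine ⟨convex_univ, fun G _ G' _ hne s t hs ht hst => ?_⟩
  have hi := hf.integrable_jointGrad (Q := Q) hp G
  have hi' := hf.integrable_jointGrad (Q := Q) hp G'
  have hi2 := hf.integrable_jointGrad (Q := Q) hp (s • G + t • G')
  have hcomb := jointGrad_comb (Q := Q) (μ := μ) ENNReal.ofReal_ne_top s t G G'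
  have hi3 : Integrable (fun z => s * f z.2 (jointGrad ENNReal.ofReal_ne_top G z)
      + t * f z.2 (jointGrad ENNReal.ofReal_ne_top G' z)) (prodMeas Q μ) :=
    (hi.const_mul s).add (hi'.const_mul t)
  have h0 : 0 ≤ᵐ[prodMeas Q μ] fun z => (s * f z.2 (jointGrad ENNReal.ofReal_ne_top G z)
      + t * f z.2 (jointGrad ENNReal.ofReal_ne_top G' z))
      - f z.2 (jointGrad ENNReal.ofReal_ne_top (s • G + t • G') z) := by
    filter_upwards [hcomb, ae_prodMeas_of_ae (Q := Q) hf.strictConvexOn] with z h1 h2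
    rw [Pi.zero_apply, sub_nonneg, h1]
    exact h2.convexOn.2 (mem_univ _) (mem_univ _) hs.le ht.le hst
  have h1 : ∫ z, ((s * f z.2 (jointGrad ENNReal.ofReal_ne_top G z)
      + t * f z.2 (jointGrad ENNReal.ofReal_ne_top G' z))
      - f z.2 (jointGrad ENNReal.ofReal_ne_top (s • G + t • G') z)) ∂(prodMeas Q μ)
      = s * energy μ Q f G + t * energy μ Q f G' - energy μ Q f (s • G + t • G') := by
    rw [integral_sub hi3 hi2, integral_add (hi.const_mul s) (hi'.const_mul t),
      integral_const_mul, integral_const_mul]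
    rfl
  have h2 := integral_nonneg_of_ae h0
  rw [smul_eq_mul, smul_eq_mul, ← sub_pos, ← h1]
  refine h2.lt_of_ne fun h3 => hne ?_
  rw [eq_comm, integral_eq_zero_iff_of_nonneg_ae h0 (hi3.sub hi2)] at h3
  refine (jointGrad_inj ENNReal.ofReal_ne_top).1 ?_
  filter_upwards [h3, hcomb, ae_prodMeas_of_ae (Q := Q) hf.strictConvexOn] with z e1 e2 e3
  by_contra hz
  have e4 := e3.2 (mem_univ _) (mem_univ _) hz hs ht hst
  rw [← e2] at e4
  simp only [smul_eq_mul, Pi.zero_apply] at e1 e4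
  linarith

theorem mul_norm_rpow_le_energy (hf : IsIntegrand μ f p c C) (hp : 0 < p)
    (G : Fin N → Lp (Lp ℝ (ENNReal.ofReal p) μ) (ENNReal.ofReal p)
      ((volume : Measure (RN N)).restrict Q)) (i : Fin N) :
    c * ‖G i‖ ^ p ≤ energy μ Q f G := by
  have h1 : ‖G i‖ ^ p = ∫ z, ‖jointFn ENNReal.ofReal_ne_top (G i) z‖ ^ p ∂(prodMeas Q μ) := by
    rw [← (sliceEquiv (volume.restrict Q) μ ENNReal.ofReal_ne_top).symm.norm_map (G i),
      norm_rpow_eq_integral hp]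
    rfl
  rw [h1, ← integral_const_mul]
  refine integral_mono_ae ((integrable_norm_rpow_coeFn hp _).const_mul c)
    (hf.integrable_jointGrad hp G) ?_
  filter_upwards [ae_prodMeas_of_ae (Q := Q) hf.lower] with z hz
  refine le_trans ?_ (hz _)
  have := hf.pos
  gcongr
  exact PiLp.norm_apply_le (jointGrad ENNReal.ofReal_ne_top G z) i

theorem energy_le (hf : IsIntegrand μ f p c C) (hp : 0 < p)
    (G : Fin N → Lp (Lp ℝ (ENNReal.ofReal p) μ) (ENNReal.ofReal p)
      ((volume : Measure (RN N)).restrict Q)) :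
    energy μ Q f G ≤ C * ((prodMeas Q μ).real univ + (∑ i, ‖G i‖) ^ p) := by
  have hm := memLp_jointGrad (Q := Q) (μ := μ) ENNReal.ofReal_ne_top G
  have h1 : ∫ z, ‖jointGrad ENNReal.ofReal_ne_top G z‖ ^ p ∂(prodMeas Q μ) ≤ (∑ i, ‖G i‖) ^ p := by
    have h2 : ‖hm.toLp _‖ ^ p = ∫ z, ‖jointGrad ENNReal.ofReal_ne_top G z‖ ^ p ∂(prodMeas Q μ) := by
      rw [norm_rpow_eq_integral hp]
      exact integral_congr_ae (hm.coeFn_toLp.mono fun z hz => by simp only [hz])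
    rw [← h2]
    refine Real.rpow_le_rpow (norm_nonneg _) ?_ hp.le
    rw [Lp.norm_toLp]
    have h3 := ENNReal.toReal_mono (ENNReal.sum_ne_top.2 fun i _ => enorm_ne_top)
      (eLpNorm_jointGrad_le (Q := Q) (μ := μ) ENNReal.ofReal_ne_top G)
    rw [ENNReal.toReal_sum fun i _ => enorm_ne_top] at h3
    simpa using h3
  have hi : Integrable (fun z => ‖jointGrad ENNReal.ofReal_ne_top G z‖ ^ p) (prodMeas Q μ) := by
    have := hm.integrable_norm_rpow (by simpa using hp) ENNReal.ofReal_ne_top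
    rwa [ENNReal.toReal_ofReal hp.le] at this
  calc energy μ Q f G ≤ ∫ z, C * (1 + ‖jointGrad ENNReal.ofReal_ne_top G z‖ ^ p) ∂(prodMeas Q μ) := by
        refine integral_mono_ae (hf.integrable_jointGrad hp G)
          (((integrable_const _).add hi).const_mul C) ?_
        filter_upwards [ae_prodMeas_of_ae (Q := Q) hf.upper] with z hz
        exact hz _
    _ = C * ((prodMeas Q μ).real univ
          + ∫ z, ‖jointGrad ENNReal.ofReal_ne_top G z‖ ^ p ∂(prodMeas Q μ)) := by
        rw [integral_const_mul, integral_add (integrable_const _) hi, integral_const, smul_eq_mul,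
          mul_one]
    _ ≤ _ := by
        have := hf.upper_pos
        gcongr

/-- A convex function bounded above near one point is continuous; the growth of `f` bounds the
energy on the unit ball. -/
theorem continuous_energy (hf : IsIntegrand μ f p c C) (hp : 0 < p) :
    Continuous (energy (p := p) μ Q f) := by
  have hconv := (hf.strictConvexOn_energy (Q := Q) hp).convexOn
  rw [← continuousOn_univ]
  have htfae := (hconv.continuousOn_tfae isOpen_univ univ_nonempty).out 3 1
  refine htfae.1 ⟨0, mem_univ _, ?_⟩
  refine ⟨C * ((prodMeas Q μ).real univ + (∑ _i : Fin N, (1 : ℝ)) ^ p), ?_⟩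
  rw [eventually_map]
  have h1 : ∀ᶠ G : Fin N → Lp (Lp ℝ (ENNReal.ofReal p) μ) (ENNReal.ofReal p)
      ((volume : Measure (RN N)).restrict Q) in 𝓝 0, ‖G‖ < 1 := by
    have := (continuous_norm (E := Fin N → Lp (Lp ℝ (ENNReal.ofReal p) μ) (ENNReal.ofReal p)
      ((volume : Measure (RN N)).restrict Q))).tendsto 0
    rw [norm_zero] at this
    exact this.eventually (gt_mem_nhds one_pos)
  filter_upwards [h1] with G hG
  refine (hf.energy_le hp G).trans ?_
  have := hf.upper_pos
  gcongr with i
  exact (norm_le_pi_norm G i).trans hG.le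

end IsIntegrand

/-- The functional `F_ε` in terms of unfolded gradients. -/
theorem energyEps_eq {Φ : YoungFunction} {T : DynSystem N μ} (hf : IsIntegrand μ f p c C)
    {ε : ℝ} (hs : -ε⁻¹ ≠ 0) {v : RN N × Ω → ℝ}
    {z : SobPair Q (ENNReal.ofReal p) (Lp ℝ (ENNReal.ofReal p) μ)}
    (hv : weakGrad Φ Q μ v =ᵐ[prodMeas Q μ] jointGrad ENNReal.ofReal_ne_top z.2) :
    energyEps Φ T Q f ε v = energy μ Q f (unfPair T Q ENNReal.ofReal_ne_top hs z).2 := by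
  set G := (unfPair T Q ENNReal.ofReal_ne_top hs z).2
  have hG : ∀ i, G i = unfL T Q ENNReal.ofReal_ne_top hs (z.2 i) := fun i => rfl
  have hs' : ε⁻¹ ≠ 0 := neg_ne_zero.1 hs
  -- Unfolding uses `-ε⁻¹`, so the gradient is the unfolded field composed with `skew T ε⁻¹`. The
  -- same map produces the oscillation in `f`, and invariance of the integral under it removes both
  -- at once.
  have h1 : ∀ᵐ w ∂(prodMeas Q μ), jointGrad ENNReal.ofReal_ne_top z.2 w
      = jointGrad ENNReal.ofReal_ne_top G (skew T ε⁻¹ w) := by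
    have h2 : ∀ᵐ w ∂(prodMeas Q μ), ∀ i, jointFn ENNReal.ofReal_ne_top (z.2 i) (skew T (-ε⁻¹) w)
        = jointFn ENNReal.ofReal_ne_top (G i) w :=
      ae_all_iff.2 fun i => jointFn_unfL T ENNReal.ofReal_ne_top hs ae_eq_rfl
    filter_upwards [ae_comp_skew T hs' h2] with w hw
    ext i
    have := hw i
    rw [skew_neg_skew] at this
    exact this
  have h3 : energyEps Φ T Q f ε v
      = ∫ w, (fun w => f w.2 (jointGrad ENNReal.ofReal_ne_top G w)) (skew T ε⁻¹ w) ∂(prodMeas Q μ) := by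
    refine integral_congr_ae ?_
    filter_upwards [hv, h1] with w e1 e2
    rw [e1, e2]
    rfl
  rw [h3, integral_comp_skew T hs'
    (hf.aestronglyMeasurable_comp (memLp_jointGrad ENNReal.ofReal_ne_top G).1)]
  rfl

end Energy

/-! ### The space `W^1_# L^Φ(Ω)` and the extended stochastic gradient -/

section WSharp

variable {N : ℕ} {Ω : Type*} [MeasurableSpace Ω] {μ : Measure Ω} [IsProbabilityMeasure μ]
  {T : DynSystem N μ} {Φ : YoungFunction} {p a b : ℝ} [Fact (1 ≤ ENNReal.ofReal p)]

theorem coeFn_gradPair_snd (q : ℝ≥0∞) [Fact (1 ≤ q)] (ψ : CInf T) (i : Fin N) :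
    ((gradPair q T ψ).2 i : Lp ℝ q μ) =ᵐ[μ] stochDeriv i ψ :=
  coeFn_topToLp (stochDeriv_spec i ψ).2.1

theorem enorm_gradPair_snd (q : ℝ≥0∞) [Fact (1 ≤ q)] (ψ : CInf T) (i : Fin N) :
    ‖(gradPair q T ψ).2 i‖ₑ = eLpNorm (stochDeriv i ψ) q μ := by
  rw [Lp.enorm_def]
  exact eLpNorm_congr_ae (coeFn_gradPair_snd q ψ i)

theorem norm_cInfSharp (ψ : CInfSharp Φ T) :
    ‖ψ‖ = ∑ i, (luxNorm Φ μ (stochDeriv (T := T) i ψ)).toReal := rfl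

theorem mul_norm_gradPair_snd_le (hP : Φ.IsPower p a b) (ψ : CInf T) (i : Fin N) :
    a ^ (1 / p) * ‖(gradPair (ENNReal.ofReal p) T ψ).2 i‖
      ≤ (luxNorm Φ μ (stochDeriv i ψ)).toReal := by
  have ha : 0 ≤ a ^ (1 / p) := Real.rpow_nonneg hP.lower_pos.le _
  have h := ENNReal.toReal_mono (luxNorm_lt_top Φ (stochDeriv_spec i ψ).2.1).ne
    (hP.mul_eLpNorm_le_luxNorm (ν := μ) (stochDeriv i ψ))
  rwa [← enorm_gradPair_snd, ENNReal.toReal_mul, ENNReal.toReal_ofReal ha, toReal_enorm] at h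

theorem luxNorm_stochDeriv_toReal_le (hP : Φ.IsPower p a b) (ψ : CInf T) (i : Fin N) :
    (luxNorm Φ μ (stochDeriv i ψ)).toReal
      ≤ b ^ (1 / p) * ‖(gradPair (ENNReal.ofReal p) T ψ).2 i‖ := by
  have hb : 0 ≤ b ^ (1 / p) := Real.rpow_nonneg hP.upper_pos.le _
  have h := hP.luxNorm_le_mul_eLpNorm (ν := μ) (stochDeriv i ψ)
  rw [← enorm_gradPair_snd] at h
  have h' := ENNReal.toReal_mono (ENNReal.mul_ne_top ENNReal.ofReal_ne_top enorm_ne_top) h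
  rwa [ENNReal.toReal_mul, ENNReal.toReal_ofReal hb, toReal_enorm] at h'

theorem norm_gradPair_snd_le (hP : Φ.IsPower p a b) (ψ : CInfSharp Φ T) :
    ‖(gradPair (ENNReal.ofReal p) T ψ).2‖ ≤ (a ^ (1 / p))⁻¹ * ‖ψ‖ := by
  have ha : 0 < a ^ (1 / p) := Real.rpow_pos_of_pos hP.lower_pos _
  refine (pi_norm_le_iff_of_nonneg (by positivity)).2 fun i => ?_
  rw [inv_mul_eq_div, le_div_iff₀' ha]
  refine (mul_norm_gradPair_snd_le hP ψ i).trans ?_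
  rw [norm_cInfSharp]
  exact Finset.single_le_sum
    (f := fun i => (luxNorm Φ μ (stochDeriv (T := T) i ψ)).toReal)
    (fun _ _ => ENNReal.toReal_nonneg) (Finset.mem_univ i)

theorem norm_cInfSharp_le (hP : Φ.IsPower p a b) (ψ : CInfSharp Φ T) :
    ‖ψ‖ ≤ N * b ^ (1 / p) * ‖(gradPair (ENNReal.ofReal p) T ψ).2‖ := by
  have hb : 0 ≤ b ^ (1 / p) := Real.rpow_nonneg hP.upper_pos.le _
  rw [norm_cInfSharp]
  refine (Finset.sum_le_card_nsmul _ _ (b ^ (1 / p) * ‖(gradPair (ENNReal.ofReal p) T ψ).2‖)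
    fun i _ => ?_).trans_eq ?_
  · refine (luxNorm_stochDeriv_toReal_le hP ψ i).trans ?_
    gcongr
    exact norm_le_pi_norm (gradPair (ENNReal.ofReal p) T ψ).2 i
  · rw [Finset.card_univ, Fintype.card_fin, nsmul_eq_mul, mul_assoc]

/-- The stochastic gradient on `C^∞(Ω)`, bounded for the seminorm of `W^1_# L^Φ(Ω)`. -/
def gradCInf (T : DynSystem N μ) (hP : Φ.IsPower p a b) :
    NormedAddGroupHom (CInfSharp Φ T) (Fin N → Lp ℝ (ENNReal.ofReal p) μ) where
  toFun ψ := (gradPair (ENNReal.ofReal p) T ψ).2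
  map_add' ψ χ := congrArg Prod.snd ((gradPair (ENNReal.ofReal p) T).map_add ψ χ)
  bound' := ⟨_, norm_gradPair_snd_le hP⟩

/-- The extension `D̄_ω` of the stochastic gradient to `W^1_# L^Φ(Ω)`. -/
def dbar (T : DynSystem N μ) (hP : Φ.IsPower p a b) :
    NormedAddGroupHom (WSharp Φ T) (Fin N → Lp ℝ (ENNReal.ofReal p) μ) :=
  (gradCInf T hP).extension

theorem dbar_coe (hP : Φ.IsPower p a b) (ψ : CInfSharp Φ T) :
    dbar T hP (ψ : WSharp Φ T) = (gradPair (ENNReal.ofReal p) T ψ).2 :=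
  NormedAddGroupHom.extension_coe _ _

theorem norm_dbar_le (hP : Φ.IsPower p a b) (w : WSharp Φ T) :
    ‖dbar T hP w‖ ≤ (a ^ (1 / p))⁻¹ * ‖w‖ := by
  induction w using UniformSpace.Completion.induction_on with
  | hp => exact isClosed_le (dbar T hP).continuous.norm (continuous_const.mul continuous_norm)
  | ih ψ =>
    rw [dbar_coe, UniformSpace.Completion.norm_coe]
    exact norm_gradPair_snd_le hP ψ

theorem norm_le_dbar (hP : Φ.IsPower p a b) (w : WSharp Φ T) :
    ‖w‖ ≤ N * b ^ (1 / p) * ‖dbar T hP w‖ := by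
  induction w using UniformSpace.Completion.induction_on with
  | hp => exact isClosed_le continuous_norm (continuous_const.mul (dbar T hP).continuous.norm)
  | ih ψ =>
    rw [dbar_coe, UniformSpace.Completion.norm_coe]
    exact norm_cInfSharp_le hP ψ

/-- The norm of the completion is equivalent to the `L^p` norm of the gradient, so `dbar` is bounded
above and below; completeness makes the range closed. -/
theorem isClosedEmbedding_dbar (hP : Φ.IsPower p a b) : IsClosedEmbedding (dbar T hP) := by
  have hb : 0 ≤ b ^ (1 / p) := Real.rpow_nonneg hP.upper_pos.le _
  exact (AddMonoidHomClass.antilipschitz_of_bound (dbar T hP)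
    (K := ⟨N * b ^ (1 / p), by positivity⟩) (norm_le_dbar hP)).isClosedEmbedding
    (dbar T hP).uniformContinuous

theorem dbar_mem_gradRange (hP : Φ.IsPower p a b) (w : WSharp Φ T) :
    dbar T hP w ∈ gradRange (ENNReal.ofReal p) T := by
  induction w using UniformSpace.Completion.induction_on with
  | hp => exact isClosed_gradRange.preimage (dbar T hP).continuous
  | ih ψ =>
    rw [dbar_coe]
    exact gradPair_snd_mem _

/-- The range of `dbar` is closed and contains all gradients of smooth functions, hence their
closure. -/
theorem exists_dbar_eq (hP : Φ.IsPower p a b) {g : Fin N → Lp ℝ (ENNReal.ofReal p) μ}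
    (hg : g ∈ gradRange (ENNReal.ofReal p) T) : ∃ w : WSharp Φ T, dbar T hP w = g := by
  refine gradRange_induction (P := fun g => g ∈ range (dbar T hP))
    (isClosedEmbedding_dbar hP).isClosed_range (fun ψ => 
      ⟨UniformSpace.Completion.coe' (α := CInfSharp Φ T) ψ, ?_⟩) hg
  exact dbar_coe hP ψ

/-- Approximation by smooth `ψ` in both `WSharp` and `L^Φ` is the graph relation of the continuous
map `dbar`. The tolerances in both directions compensate the constants `a ^ (1 / p)` and `b ^ (1 /
p)`. -/
theorem isStochGrad_iff (hP : Φ.IsPower p a b) {w : WSharp Φ T} {g : Ω → RN N} :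
    IsStochGrad Φ T w g ↔
      AEStronglyMeasurable g μ ∧ ∀ i, (fun ω => g ω i) =ᵐ[μ] dbar T hP w i := by
  have hA : 0 < a ^ (1 / p) := Real.rpow_pos_of_pos hP.lower_pos _
  have hB : 0 < b ^ (1 / p) := Real.rpow_pos_of_pos hP.upper_pos _
  have hq : (1 : ℝ≥0∞) ≤ ENNReal.ofReal p := Fact.out
  have key : ∀ (ψ : CInfSharp Φ T) i,
      eLpNorm (fun ω => stochDeriv (T := T) i ψ ω - dbar T hP w i ω) (ENNReal.ofReal p) μ
        ≤ ENNReal.ofReal ((a ^ (1 / p))⁻¹ * ‖w - (ψ : WSharp Φ T)‖) := by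
    intro ψ i
    have h1 : (fun ω => stochDeriv (T := T) i ψ ω - dbar T hP w i ω)
        =ᵐ[μ] (dbar T hP ((ψ : WSharp Φ T) - w) i : Lp ℝ (ENNReal.ofReal p) μ) := by
      rw [map_sub, dbar_coe, Pi.sub_apply]
      filter_upwards [Lp.coeFn_sub ((gradPair (ENNReal.ofReal p) T ψ).2 i) (dbar T hP w i),
        coeFn_gradPair_snd (T := T) (ENNReal.ofReal p) ψ i] with ω e1 e2
      rw [e1, Pi.sub_apply]
      exact congrArg (· - dbar T hP w i ω) e2.symm
    rw [eLpNorm_congr_ae h1, ← Lp.enorm_def, ← ofReal_norm]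
    refine ENNReal.ofReal_le_ofReal ((norm_le_pi_norm _ i).trans ?_)
    rw [norm_sub_rev w]
    exact norm_dbar_le hP _
  constructor
  · rintro ⟨hg, h⟩
    refine ⟨hg, fun i => ?_⟩
    have hgi : AEStronglyMeasurable (fun ω => g ω i) μ :=
      (EuclideanSpace.proj (𝕜 := ℝ) i).continuous.comp_aestronglyMeasurable hg
    have h0 : eLpNorm (fun ω => g ω i - dbar T hP w i ω) (ENNReal.ofReal p) μ = 0 := by
      refine le_antisymm (ENNReal.le_of_forall_pos_le_add fun ε hε _ => ?_) zero_le
      rw [zero_add]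
      have hε' : (0 : ℝ) < ε := hε
      obtain ⟨ψ, h1, h2⟩ := h (a ^ (1 / p) * (ε / 2)) (by positivity)
      have h3 : eLpNorm (fun ω => g ω i - stochDeriv (T := T) i ψ ω) (ENNReal.ofReal p) μ
          ≤ ENNReal.ofReal (ε / 2) := by
        have h4 := (hP.mul_eLpNorm_le_luxNorm (ν := μ)
          (fun ω => g ω i - stochDeriv (T := T) i ψ ω)).trans (h2 i).le
        rw [ENNReal.ofReal_mul hA.le] at h4
        exact (ENNReal.mul_le_mul_iff_right (by simpa using hA) ENNReal.ofReal_ne_top).1 h4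
      have h5 : eLpNorm (fun ω => stochDeriv (T := T) i ψ ω - dbar T hP w i ω)
          (ENNReal.ofReal p) μ ≤ ENNReal.ofReal (ε / 2) := by
        refine (key ψ i).trans (ENNReal.ofReal_le_ofReal ?_)
        rw [inv_mul_le_iff₀ hA]
        exact h1.le
      have h6 := eLpNorm_add_le (hgi.sub (stochDeriv_spec (T := T) i ψ).2.1.1)
        ((stochDeriv_spec (T := T) i ψ).2.1.1.sub (Lp.aestronglyMeasurable (dbar T hP w i))) hq
      have h7 : (fun ω => g ω i - dbar T hP w i ω)
          = ((fun ω => g ω i) - stochDeriv (T := T) i ψ)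
            + (stochDeriv (T := T) i ψ - (dbar T hP w i : Ω → ℝ)) := by
        funext ω
        simp
      rw [h7]
      refine h6.trans ((add_le_add h3 h5).trans_eq ?_)
      rw [← ENNReal.ofReal_add (by positivity) (by positivity), add_halves,
        ENNReal.ofReal_coe_nnreal]
    filter_upwards [(eLpNorm_eq_zero_iff (f := fun ω => g ω i - dbar T hP w i ω)
      (hgi.sub (Lp.aestronglyMeasurable _)) (one_pos.trans_le hq).ne').1 h0] with ω hω
    exact sub_eq_zero.1 hω
  · rintro ⟨hg, h⟩
    refine ⟨hg, fun δ hδ => ?_⟩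
    obtain ⟨ψ, hψ⟩ := Metric.denseRange_iff.1
      (UniformSpace.Completion.denseRange_coe (α := CInfSharp Φ T)) w
      (min δ (a ^ (1 / p) * (δ / (2 * b ^ (1 / p))))) (lt_min hδ (by positivity))
    rw [dist_eq_norm] at hψ
    refine ⟨ψ, hψ.trans_le (min_le_left _ _), fun i => ?_⟩
    have h1 : (fun ω => g ω i - stochDeriv (T := T) i ψ ω)
        =ᵐ[μ] -fun ω => stochDeriv (T := T) i ψ ω - dbar T hP w i ω := by
      filter_upwards [h i] with ω hω
      rw [Pi.neg_apply, neg_sub]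
      exact congrArg (· - _) hω
    calc luxNorm Φ μ (fun ω => g ω i - stochDeriv (T := T) i ψ ω)
        ≤ ENNReal.ofReal (b ^ (1 / p))
          * eLpNorm (fun ω => g ω i - stochDeriv (T := T) i ψ ω) (ENNReal.ofReal p) μ :=
          hP.luxNorm_le_mul_eLpNorm _
      _ ≤ ENNReal.ofReal (b ^ (1 / p)) * ENNReal.ofReal (δ / (2 * b ^ (1 / p))) := by
          rw [eLpNorm_congr_ae h1, eLpNorm_neg]
          gcongr
          refine (key ψ i).trans (ENNReal.ofReal_le_ofReal ?_)
          rw [inv_mul_le_iff₀ hA]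
          exact hψ.le.trans (min_le_right _ _)
      _ = ENNReal.ofReal (δ / 2) := by
          rw [← ENNReal.ofReal_mul hB.le]
          congr 1
          field_simp
      _ < ENNReal.ofReal δ := (ENNReal.ofReal_lt_ofReal_iff hδ).2 (half_lt_self hδ)

end WSharp

/-! ### The extended gradient of functions from `Q` to `W^1_# L^Φ(Ω)`. -/

section StochGrad

variable {N : ℕ} {Ω : Type*} [MeasurableSpace Ω] {μ : Measure Ω} [IsProbabilityMeasure μ]
  {T : DynSystem N μ} {Φ : YoungFunction} {p a b : ℝ} [Fact (1 ≤ ENNReal.ofReal p)]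
  {Q : Set (RN N)} [IsFiniteMeasure ((volume : Measure (RN N)).restrict Q)]

/-- Strongly measurable representatives make the coincidence set measurable, so that Fubini can be
read from slices to the product. -/
theorem ae_eq_of_ae_slice {F : Type*} [TopologicalSpace F] [TopologicalSpace.MetrizableSpace F]
    {g g' : RN N × Ω → F}
    (hg : AEStronglyMeasurable g (prodMeas Q μ)) (hg' : AEStronglyMeasurable g' (prodMeas Q μ))
    (h : ∀ᵐ x ∂(volume.restrict Q), (fun ω => g (x, ω)) =ᵐ[μ] fun ω => g' (x, ω)) :
    g =ᵐ[prodMeas Q μ] g' := by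
  refine hg.ae_eq_mk.trans (EventuallyEq.trans ?_ hg'.ae_eq_mk.symm)
  refine (Measure.ae_prod_iff_ae_ae
    (hg.stronglyMeasurable_mk.measurableSet_eq_fun hg'.stronglyMeasurable_mk)).2 ?_
  filter_upwards [h, Measure.ae_ae_of_ae_prod hg.ae_eq_mk, Measure.ae_ae_of_ae_prod hg'.ae_eq_mk]
    with x h1 h2 h3
  filter_upwards [h1, h2, h3] with ω e1 e2 e3
  rw [← e2, ← e3, e1]

/-- `stochGrad` is a chosen representative; its slices are determined by `dbar`, so any jointly
measurable candidate agrees with it. -/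
theorem stochGrad_ae_eq (hP : Φ.IsPower p a b) {w : RN N → WSharp Φ T}
    {G : Fin N → Lp (Lp ℝ (ENNReal.ofReal p) μ) (ENNReal.ofReal p)
      ((volume : Measure (RN N)).restrict Q)}
    (hw : ∀ᵐ x ∂(volume.restrict Q), ∀ i, G i x = dbar T hP (w x) i) :
    stochGrad Φ T Q w =ᵐ[prodMeas Q μ] jointGrad ENNReal.ofReal_ne_top G := by
  have hGm := (memLp_jointGrad (Q := Q) (μ := μ) ENNReal.ofReal_ne_top G).1
  have hslice : ∀ᵐ x ∂(volume.restrict Q), ∀ i, G i x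
      =ᵐ[μ] fun ω => jointGrad ENNReal.ofReal_ne_top G (x, ω) i :=
    ae_all_iff.2 fun i => slice_jointFn ENNReal.ofReal_ne_top (G i)
  have hex : ∃ G : RN N × Ω → RN N, AEStronglyMeasurable G ((volume.restrict Q).prod μ) ∧
      ∀ᵐ x ∂(volume.restrict Q), IsStochGrad Φ T (w x) (fun ω => G (x, ω)) := by
    refine ⟨_, hGm, ?_⟩
    filter_upwards [hw, hslice, hGm.prodMk_left] with x h1 h2 h3
    refine (isStochGrad_iff hP).2 ⟨h3, fun i => ?_⟩
    rw [← h1 i]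
    exact (h2 i).symm
  rw [stochGrad, dif_pos hex]
  refine ae_eq_of_ae_slice hex.choose_spec.1 hGm ?_
  filter_upwards [hw, hslice, hex.choose_spec.2] with x h1 h2 h3
  have h4 : ∀ᵐ ω ∂μ, ∀ i, hex.choose (x, ω) i = dbar T hP (w x) i ω :=
    ae_all_iff.2 ((isStochGrad_iff hP).1 h3).2
  have h5 : ∀ᵐ ω ∂μ, ∀ i, G i x ω = jointGrad ENNReal.ofReal_ne_top G (x, ω) i :=
    ae_all_iff.2 h2
  filter_upwards [h4, h5] with ω e1 e2
  ext i
  rw [e1 i, ← e2 i, h1 i]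

theorem exists_tuple_eq_dbar (hP : Φ.IsPower p a b) {w : RN N → WSharp Φ T}
    (hw : MemOrlicz Φ (volume.restrict Q) w) :
    ∃ G : Fin N → Lp (Lp ℝ (ENNReal.ofReal p) μ) (ENNReal.ofReal p)
      ((volume : Measure (RN N)).restrict Q),
      ∀ᵐ x ∂(volume.restrict Q), ∀ i, G i x = dbar T hP (w x) i := by
  have h1 : MemLp (fun x => dbar T hP (w x)) (ENNReal.ofReal p) (volume.restrict Q) :=
    (hP.memOrlicz_iff.1 hw).of_le_mul
      ((dbar T hP).continuous.comp_aestronglyMeasurable hw.1)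
      (ae_of_all _ fun x => norm_dbar_le hP (w x))
  exact ⟨fun i => (h1.eval i).toLp _, ae_all_iff.2 fun i => (h1.eval i).coeFn_toLp⟩

/-- The preimages are chosen point by point. Measurability and integrability of the choice come for
free because `dbar` is an embedding with a lower bound. -/
theorem exists_dbar_eq_tuple (hP : Φ.IsPower p a b)
    {G : Fin N → Lp (Lp ℝ (ENNReal.ofReal p) μ) (ENNReal.ofReal p)
      ((volume : Measure (RN N)).restrict Q)}
    (hG : ∀ᵐ x ∂(volume.restrict Q), (fun i => G i x) ∈ gradRange (ENNReal.ofReal p) T) :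
    ∃ w : RN N → WSharp Φ T, MemOrlicz Φ (volume.restrict Q) w ∧
      ∀ᵐ x ∂(volume.restrict Q), ∀ i, G i x = dbar T hP (w x) i := by
  have h1 : ∀ x, ∃ w : WSharp Φ T, (fun i => G i x) ∈ gradRange (ENNReal.ofReal p) T →
      dbar T hP w = fun i => G i x := fun x => by
    by_cases h : (fun i => G i x) ∈ gradRange (ENNReal.ofReal p) T
    · obtain ⟨w, hw⟩ := exists_dbar_eq hP h
      exact ⟨w, fun _ => hw⟩
    · exact ⟨0, fun h' => absurd h' h⟩
  choose w hw using h1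
  have h2 : ∀ᵐ x ∂(volume.restrict Q), dbar T hP (w x) = fun i => G i x :=
    hG.mono fun x hx => hw x hx
  have h3 : MemLp (fun x => dbar T hP (w x)) (ENNReal.ofReal p) (volume.restrict Q) :=
    (memLp_congr_ae h2).2 (memLp_pi_iff.2 fun i => Lp.memLp (G i))
  refine ⟨w, hP.memOrlicz_iff.2 (h3.of_le_mul
    ((isClosedEmbedding_dbar hP).isEmbedding.aestronglyMeasurable_comp_iff.1 h3.1)
    (ae_of_all _ fun x => norm_le_dbar hP (w x))), ?_⟩
  filter_upwards [h2] with x hx i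
  rw [hx]

end StochGrad

/-! ### Minimization of convex functionals -/

/-- The direct method of the calculus of variations. -/
theorem UnifConvexFun.exists_isMin {Z : Type*} [NormedAddCommGroup Z] [NormedSpace ℝ Z]
    [CompleteSpace Z] {M : Z → ℝ} (hM : UnifConvexFun M) {S : Set Z} (hS : IsClosed S)
    (hSc : Convex ℝ S) (hne : S.Nonempty) {J : Z → ℝ} (hJ : Continuous J)
    (hJc : ConvexOn ℝ univ J) (hb : ∀ z ∈ S, 0 ≤ J z)
    (hcoer : ∀ R, ∃ R', ∀ z ∈ S, J z ≤ R → M z ≤ R') : ∃ z ∈ S, ∀ w ∈ S, J z ≤ J w := by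
  set m := sInf (J '' S)
  have hbdd : BddBelow (J '' S) := ⟨0, by rintro _ ⟨z, hz, rfl⟩; exact hb z hz⟩
  have h1 : ∀ n : ℕ, ∃ z ∈ S, J z < m + 1 / (n + 1) := fun n => by
    obtain ⟨_, ⟨z, hz, rfl⟩, h⟩ := exists_lt_of_csInf_lt (hne.image J)
      (lt_add_of_pos_right m (Nat.one_div_pos_of_nat (n := n) (α := ℝ)))
    exact ⟨z, hz, h⟩
  choose z hz hzm using h1
  obtain ⟨R', hR'⟩ := hcoer (m + 1)
  have h2 : ∀ n, J (z n) ≤ m + 1 := fun n => (hzm n).le.trans (by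
    gcongr
    rw [div_le_one (by positivity)]
    simp)
  -- Coercivity bounds `M` along the minimizing sequence. The constraint set and the sublevel sets
  -- of `J` are closed and convex, so the weak limit remains in them.
  obtain ⟨z₀, hz₀⟩ := hM.exists_weakLim (l := atTop) (z := z)
    (Eventually.of_forall fun n => hR' _ (hz n) (h2 n))
  refine ⟨z₀, hz₀ S hS hSc (Eventually.of_forall hz), fun w hw => ?_⟩
  refine le_trans (le_of_forall_pos_le_add fun δ hδ => ?_) (csInf_le hbdd ⟨w, hw, rfl⟩)
  refine hz₀.le_of_eventually_le hJ hJc ?_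
  have h3 := (tendsto_one_div_add_atTop_nhds_zero_nat (𝕜 := ℝ)).eventually (gt_mem_nhds hδ)
  filter_upwards [h3] with n hn
  exact (hzm n).le.trans (by gcongr)

/-- The midpoint of two minimizers would have smaller energy. Strict convexity concerns the gradient
component, so only that component is determined here. -/
theorem snd_eq_of_isMin {Z W : Type*} [AddCommGroup Z] [Module ℝ Z]
    [AddCommGroup W] [Module ℝ W] {E : W → ℝ} (hE : StrictConvexOn ℝ univ E) {S : Set (Z × W)}
    (hS : Convex ℝ S) {y y' : Z × W} (hy : y ∈ S) (hy' : y' ∈ S)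
    (h : ∀ w ∈ S, E y.2 ≤ E w.2) (h' : ∀ w ∈ S, E y'.2 ≤ E w.2) : y.2 = y'.2 := by
  by_contra hne
  have h1 := hE.2 (mem_univ y.2) (mem_univ y'.2) hne (show (0 : ℝ) < 1 / 2 by norm_num)
    (show (0 : ℝ) < 1 / 2 by norm_num) (by norm_num)
  have h2 := hS hy hy' (show (0 : ℝ) ≤ 1 / 2 by norm_num) (show (0 : ℝ) ≤ 1 / 2 by norm_num)
    (by norm_num)
  have h3 : E y.2 ≤ E ((1 / 2 : ℝ) • y.2 + (1 / 2 : ℝ) • y'.2) := h _ h2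
  have h4 : E y'.2 ≤ E ((1 / 2 : ℝ) • y.2 + (1 / 2 : ℝ) • y'.2) := h' _ h2
  simp only [smul_eq_mul] at h1
  linarith

section Minimizers

variable {N : ℕ} {Ω : Type*} [MeasurableSpace Ω] {μ : Measure Ω} [IsProbabilityMeasure μ]
  {T : DynSystem N μ} {Q : Set (RN N)} [IsFiniteMeasure ((volume : Measure (RN N)).restrict Q)]
  {f : Ω → RN N → ℝ} {p c C : ℝ} [Fact (1 ≤ ENNReal.ofReal p)]

/-- A uniformly convex power of the norm of a function and a vector field. -/
def sobPow (z : SobPair Q (ENNReal.ofReal p) (Lp ℝ (ENNReal.ofReal p) μ)) : ℝ :=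
  ‖z.1‖ ^ p + ∑ i, ‖z.2 i‖ ^ p

/-- `PowerUC` is lifted twice, from `ℝ` to `L^p(Ω)` and from there to `L^p(Q; L^p(Ω))`. -/
theorem unifConvexFun_sobPow (hp : 1 < p) : UnifConvexFun (sobPow (Q := Q) (μ := μ) (p := p)) := by
  have h : UnifConvexFun fun F : Lp (Lp ℝ (ENNReal.ofReal p) μ) (ENNReal.ofReal p)
      ((volume : Measure (RN N)).restrict Q) => ‖F‖ ^ p :=
    ((powerUC_real hp).lp hp |>.lp hp).unifConvexFun hp
  exact h.prod h.pi

theorem sobPow_unfPair {s : ℝ} (hs : s ≠ 0)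
    (z : SobPair Q (ENNReal.ofReal p) (Lp ℝ (ENNReal.ofReal p) μ)) :
    sobPow (unfPair T Q ENNReal.ofReal_ne_top hs z) = sobPow z := by
  simp only [sobPow, unfPair_apply, LinearIsometry.norm_map]

theorem norm_le_one_add_sobPow (hp : 1 < p)
    (z : SobPair Q (ENNReal.ofReal p) (Lp ℝ (ENNReal.ofReal p) μ)) : ‖z‖ ≤ 1 + sobPow z := by
  have h1 : ∀ t : ℝ, 0 ≤ t → t ≤ 1 + t ^ p := fun t ht => by
    rcases le_total t 1 with h | h
    · have := Real.rpow_nonneg ht p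
      linarith
    · have := Real.self_le_rpow_of_one_le h hp.le
      linarith
  have h2 : 0 ≤ ∑ i, ‖z.2 i‖ ^ p := Finset.sum_nonneg fun i _ => by positivity
  have h3 : 0 ≤ ‖z.1‖ ^ p := by positivity
  refine norm_prod_le_iff.2 ⟨?_, (pi_norm_le_iff_of_nonneg (by rw [sobPow]; linarith)).2 fun i => ?_⟩
  · have := h1 _ (norm_nonneg z.1)
    rw [sobPow]
    linarith
  · have := h1 _ (norm_nonneg (z.2 i))
    have h4 := Finset.single_le_sum (f := fun i => ‖z.2 i‖ ^ p)
      (fun i _ => Real.rpow_nonneg (norm_nonneg _) p) (Finset.mem_univ i)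
    rw [sobPow]
    linarith

theorem convex_unfoldedGraph {ε : ℝ} (hε : 0 < ε) {q : ℝ≥0∞} [Fact (1 ≤ q)] {hq : q ≠ ∞} :
    Convex ℝ (unfoldedGraph T Q hq ε) := by
  have h : unfoldedGraph T Q hq ε = unfoldedSubmodule T Q hq (neg_inv_ne_zero_of_pos hε) :=
    Set.ext fun y => (mem_unfoldedSubmodule _).symm
  rw [h]
  exact Submodule.convex _

theorem convex_limitGraph {q : ℝ≥0∞} [Fact (1 ≤ q)] : Convex ℝ (limitGraph T Q q) := by
  rintro y ⟨D, hD, hU, hb⟩ y' ⟨D', hD', hU', hb'⟩ s t - - -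
  refine ⟨s • D + t • D', ?_, ?_, ?_⟩
  · exact (sobolev0 Q q (Lp ℝ q μ)).add_mem (Submodule.smul_mem _ s hD)
      (Submodule.smul_mem _ t hD')
  · change (invProj T q).compLpL q (volume.restrict Q) (s • y.1 + t • y'.1) = s • y.1 + t • y'.1
    rw [map_add, map_smul, map_smul]
    exact congrArg₂ (fun a b => s • a + t • b) hU hU'
  · have h1 : ∀ i, (s • y + t • y').2 i - (s • D + t • D') i
        = s • (y.2 i - D i) + t • (y'.2 i - D' i) := fun i => by
      simp only [Prod.snd_add, Prod.smul_snd, Pi.add_apply, Pi.smul_apply, smul_sub]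
      abel
    have h2 : ∀ᵐ x ∂(volume.restrict Q), ∀ i,
        ((s • y + t • y').2 i - (s • D + t • D') i) x
          = s • (y.2 i - D i) x + t • (y'.2 i - D' i) x := ae_all_iff.2 fun i => by
      rw [h1]
      filter_upwards [Lp.coeFn_add (s • (y.2 i - D i)) (t • (y'.2 i - D' i)),
        Lp.coeFn_smul s (y.2 i - D i), Lp.coeFn_smul t (y'.2 i - D' i)] with x e1 e2 e3
      rw [e1, Pi.add_apply, e2, e3, Pi.smul_apply, Pi.smul_apply]
    filter_upwards [hb, hb', h2] with x e1 e2 e3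
    have h3 := (gradRange q T).add_mem (Submodule.smul_mem _ s e1) (Submodule.smul_mem _ t e2)
    convert h3 using 1
    exact funext e3

namespace IsIntegrand

/-- The lower growth bound controls every gradient component and the Poincaré inequality controls
the function. Unfolding is isometric, so the constant does not depend on `ε`, which gives
compactness as `ε → 0`. -/
theorem exists_sobPow_le (hf : IsIntegrand μ f p c C) (hp : 1 < p) (hQ : MeasurableSet Q)
    (hb : Bornology.IsBounded Q) (i : Fin N) :
    ∃ K : ℝ, 0 ≤ K ∧ ∀ ε, ∀ y ∈ unfoldedGraph T Q (ENNReal.ofReal_ne_top (r := p)) ε,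
      sobPow y ≤ K * energy μ Q f y.2 := by
  have hp0 : 0 < p := zero_lt_one.trans hp
  obtain ⟨R, hR, h⟩ := exists_norm_le_of_mem_sobolev0 (Y := Lp ℝ (ENNReal.ofReal p) μ)
    (ENNReal.ofReal_ne_top (r := p)) hQ hb i
  have hc := hf.pos
  refine ⟨(R ^ p + N) / c, by positivity, fun ε y hy => ?_⟩
  obtain ⟨hs, z, hz, rfl⟩ := hy
  set G := (unfPair T Q ENNReal.ofReal_ne_top hs z).2
  have hG : ∀ j, ‖z.2 j‖ ^ p ≤ energy μ Q f G / c := fun j => by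
    rw [le_div_iff₀' hc]
    refine le_trans (le_of_eq ?_) (hf.mul_norm_rpow_le_energy hp0 G j)
    rw [← LinearIsometry.norm_map (unfL T Q ENNReal.ofReal_ne_top hs) (z.2 j)]
    rfl
  rw [sobPow_unfPair, sobPow]
  have h1 : ‖z.1‖ ^ p ≤ R ^ p * (energy μ Q f G / c) :=
    calc ‖z.1‖ ^ p ≤ (R * ‖z.2 i‖) ^ p := Real.rpow_le_rpow (norm_nonneg _) (h z hz) hp0.le
      _ = R ^ p * ‖z.2 i‖ ^ p := Real.mul_rpow hR (norm_nonneg _)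
      _ ≤ _ := by
        gcongr
        exact hG i
  have h2 : ∑ j, ‖z.2 j‖ ^ p ≤ N * (energy μ Q f G / c) := by
    refine (Finset.sum_le_card_nsmul _ _ _ fun j _ => hG j).trans_eq ?_
    rw [Finset.card_univ, Fintype.card_fin, nsmul_eq_mul]
  calc _ ≤ R ^ p * (energy μ Q f G / c) + N * (energy μ Q f G / c) := add_le_add h1 h2
    _ = _ := by ring

theorem exists_isMin_unfoldedGraph (hf : IsIntegrand μ f p c C) (hp : 1 < p) (hQ : MeasurableSet Q)
    (hb : Bornology.IsBounded Q) (i : Fin N) {ε : ℝ} (hε : 0 < ε) :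
    ∃ y ∈ unfoldedGraph T Q (ENNReal.ofReal_ne_top (r := p)) ε,
      ∀ w ∈ unfoldedGraph T Q (ENNReal.ofReal_ne_top (r := p)) ε,
        energy μ Q f y.2 ≤ energy μ Q f w.2 := by
  have hp0 : 0 < p := zero_lt_one.trans hp
  have hs := neg_inv_ne_zero_of_pos hε
  obtain ⟨K, hK, h⟩ := hf.exists_sobPow_le (T := T) hp hQ hb i
  set A : SobPair Q (ENNReal.ofReal p) (Lp ℝ (ENNReal.ofReal p) μ) →L[ℝ]
      (Fin N → Lp (Lp ℝ (ENNReal.ofReal p) μ) (ENNReal.ofReal p) (volume.restrict Q)) :=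
    (ContinuousLinearMap.snd ℝ _ _).comp (unfPair T Q ENNReal.ofReal_ne_top hs)
  obtain ⟨z, hz, hmin⟩ := (unifConvexFun_sobPow (Q := Q) (μ := μ) hp).exists_isMin
    (S := sobolev0 Q (ENNReal.ofReal p) (Lp ℝ (ENNReal.ofReal p) μ)) isClosed_sobolev0
    (Submodule.convex _) ⟨0, Submodule.zero_mem _⟩ (J := fun z => energy μ Q f (A z))
    ((hf.continuous_energy hp0).comp A.continuous)
    ((hf.strictConvexOn_energy hp0).convexOn.comp_linearMap A.toLinearMap)
    (fun z _ => (mul_nonneg hf.pos.le (by positivity)).trans (hf.mul_norm_rpow_le_energy hp0 _ i))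
    (fun R => ⟨K * R, fun z hz hR => by
      rw [← sobPow_unfPair (T := T) hs z]
      exact (h ε _ ⟨hs, z, hz, rfl⟩).trans (mul_le_mul_of_nonneg_left hR hK)⟩)
  refine ⟨_, ⟨hs, z, hz, rfl⟩, ?_⟩
  rintro _ ⟨_, w, hw, rfl⟩
  exact hmin w hw

/-- Strict convexity determines the gradients; the Poincaré inequality, applied before unfolding,
then determines the functions. -/
theorem eq_of_isMin_unfoldedGraph (hf : IsIntegrand μ f p c C) (hp : 0 < p) (hQ : MeasurableSet Q)
    (hb : Bornology.IsBounded Q) (i : Fin N) {ε : ℝ} (hε : 0 < ε)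
    {y y' : SobPair Q (ENNReal.ofReal p) (Lp ℝ (ENNReal.ofReal p) μ)}
    (hy : y ∈ unfoldedGraph T Q ENNReal.ofReal_ne_top ε)
    (hy' : y' ∈ unfoldedGraph T Q ENNReal.ofReal_ne_top ε)
    (h : ∀ w ∈ unfoldedGraph T Q (ENNReal.ofReal_ne_top (r := p)) ε,
      energy μ Q f y.2 ≤ energy μ Q f w.2)
    (h' : ∀ w ∈ unfoldedGraph T Q (ENNReal.ofReal_ne_top (r := p)) ε,
      energy μ Q f y'.2 ≤ energy μ Q f w.2) : y = y' := by
  have h2 := snd_eq_of_isMin (hf.strictConvexOn_energy hp) (convex_unfoldedGraph hε) hy hy' h h'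
  obtain ⟨R, hR, hP⟩ := exists_norm_le_of_mem_sobolev0 (Y := Lp ℝ (ENNReal.ofReal p) μ)
    (ENNReal.ofReal_ne_top (r := p)) hQ hb i
  obtain ⟨hs, z, hz, rfl⟩ := hy
  obtain ⟨_, z', hz', rfl⟩ := hy'
  have h3 : (z - z').2 i = 0 := by
    have h4 := congrFun h2 i
    exact sub_eq_zero.2 ((unfL T Q ENNReal.ofReal_ne_top hs).injective h4)
  have h5 := hP _ (Submodule.sub_mem _ hz hz')
  rw [h3, norm_zero, mul_zero, norm_le_zero_iff] at h5
  refine Prod.ext ?_ h2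
  exact congrArg (unfL T Q ENNReal.ofReal_ne_top hs) (sub_eq_zero.1 h5)

/-- The total field determines `DU` as its invariant average, and the Poincaré inequality determines
`U` from `DU`. -/
theorem eq_of_isMin_limitGraph (hf : IsIntegrand μ f p c C) (hp : 0 < p) (hQ : IsOpen Q)
    (hb : Bornology.IsBounded Q) (i : Fin N)
    {y y' : SobPair Q (ENNReal.ofReal p) (Lp ℝ (ENNReal.ofReal p) μ)}
    (hy : y ∈ limitGraph T Q (ENNReal.ofReal p)) (hy' : y' ∈ limitGraph T Q (ENNReal.ofReal p))
    (h : ∀ w ∈ limitGraph T Q (ENNReal.ofReal p), energy μ Q f y.2 ≤ energy μ Q f w.2)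
    (h' : ∀ w ∈ limitGraph T Q (ENNReal.ofReal p), energy μ Q f y'.2 ≤ energy μ Q f w.2) :
    y = y' := by
  have h2 := snd_eq_of_isMin (hf.strictConvexOn_energy hp) convex_limitGraph hy hy' h h'
  obtain ⟨R, hR, hP⟩ := exists_norm_le_of_mem_sobolev0 (Y := Lp ℝ (ENNReal.ofReal p) μ)
    (ENNReal.ofReal_ne_top (r := p)) hQ.measurableSet hb i
  obtain ⟨D, hD, hU, hb⟩ := hy
  obtain ⟨D', hD', hU', hb'⟩ := hy'
  have h3 : D i = D' i := by
    rw [(eq_compLp_of_mem_limitGraph hQ hD hU hb i).2,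
      (eq_compLp_of_mem_limitGraph hQ hD' hU' hb' i).2, h2]
  have h5 := hP _ (Submodule.sub_mem _ hD hD')
  simp only [Prod.mk_sub_mk, Pi.sub_apply, h3, sub_self, norm_zero, mul_zero] at h5
  exact Prod.ext (sub_eq_zero.1 (norm_le_zero_iff.1 h5)) h2

/-- Weak limits of minimizers at scale `ε → 0` minimize the homogenized functional. -/
theorem isMin_limitGraph_of_weakLim (hf : IsIntegrand μ f p c C) (hp : 0 < p) (hQ : IsOpen Q)
    {y : ℝ → SobPair Q (ENNReal.ofReal p) (Lp ℝ (ENNReal.ofReal p) μ)}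
    (hmin : ∀ ε, 0 < ε → ∀ w ∈ unfoldedGraph T Q (ENNReal.ofReal_ne_top (r := p)) ε,
      energy μ Q f (y ε).2 ≤ energy μ Q f w.2)
    {l : Filter ℝ} [l.NeBot] (hl : l ≤ 𝓝[>] 0)
    {y₀ : SobPair Q (ENNReal.ofReal p) (Lp ℝ (ENNReal.ofReal p) μ)} (h : WeakLim l y y₀)
    {w : SobPair Q (ENNReal.ofReal p) (Lp ℝ (ENNReal.ofReal p) μ)}
    (hw : w ∈ limitGraph T Q (ENNReal.ofReal p)) : energy μ Q f y₀.2 ≤ energy μ Q f w.2 := by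
  have hcont := hf.continuous_energy (Q := Q) hp
  refine le_of_forall_pos_le_add fun η hη => ?_
  refine h.le_of_eventually_le (E := fun y => energy μ Q f y.2) (hcont.comp continuous_snd)
    ((hf.strictConvexOn_energy hp).convexOn.comp_linearMap (LinearMap.snd ℝ _ _)) ?_
  -- A recovery field close to `w.2` is a competitor at scale `ε` with energy at most `energy w.2 +
  -- η`; lower semicontinuity along the weak limit then gives the claim.
  obtain ⟨δ, hδ, hδ'⟩ := Metric.continuousAt_iff.1 (hcont.continuousAt (x := w.2)) η hη
  have h1 := snd_mem_recoverable_of_mem_limitGraph hQ (hq := ENNReal.ofReal_ne_top) hw δ hδ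
  filter_upwards [hl h1, hl self_mem_nhdsWithin] with ε ⟨v, hv, hvw⟩ hε
  have h2 := hδ' (x := v.2) (by rwa [dist_eq_norm])
  rw [Real.dist_eq] at h2
  have h3 := (abs_lt.1 h2).2
  have h4 := hmin ε hε v hv
  linarith

/-- Existence of the minimizer of the homogenized functional and weak convergence to it. -/
theorem exists_isMin_limitGraph (hf : IsIntegrand μ f p c C) (hp : 1 < p) (hQ : IsOpen Q)
    (hb : Bornology.IsBounded Q) (i : Fin N) :
    ∃ y₀ ∈ limitGraph T Q (ENNReal.ofReal p),
      (∀ w ∈ limitGraph T Q (ENNReal.ofReal p), energy μ Q f y₀.2 ≤ energy μ Q f w.2) ∧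
      ∀ y : ℝ → SobPair Q (ENNReal.ofReal p) (Lp ℝ (ENNReal.ofReal p) μ),
        (∀ ε, 0 < ε → y ε ∈ unfoldedGraph T Q ENNReal.ofReal_ne_top ε) →
        (∀ ε, 0 < ε → ∀ w ∈ unfoldedGraph T Q (ENNReal.ofReal_ne_top (r := p)) ε,
          energy μ Q f (y ε).2 ≤ energy μ Q f w.2) →
        ∀ A : SobPair Q (ENNReal.ofReal p) (Lp ℝ (ENNReal.ofReal p) μ) →L[ℝ] ℝ,
          Tendsto (fun ε => A (y ε)) (𝓝[>] 0) (𝓝 (A y₀)) := by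
  have hp0 : 0 < p := zero_lt_one.trans hp
  obtain ⟨K, hK, hbd⟩ := hf.exists_sobPow_le (T := T) hp hQ.measurableSet hb i
  have key : ∀ (y : ℝ → SobPair Q (ENNReal.ofReal p) (Lp ℝ (ENNReal.ofReal p) μ)),
      (∀ ε, 0 < ε → y ε ∈ unfoldedGraph T Q ENNReal.ofReal_ne_top ε) →
      (∀ ε, 0 < ε → ∀ w ∈ unfoldedGraph T Q (ENNReal.ofReal_ne_top (r := p)) ε,
        energy μ Q f (y ε).2 ≤ energy μ Q f w.2) →
      ∀ l : Filter ℝ, l.NeBot → l ≤ 𝓝[>] 0 → ∃ y₀ ∈ limitGraph T Q (ENNReal.ofReal p),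
        (∀ w ∈ limitGraph T Q (ENNReal.ofReal p), energy μ Q f y₀.2 ≤ energy μ Q f w.2) ∧
        WeakLim l y y₀ ∧ ∃ B, ∀ᶠ ε in l, ‖y ε‖ ≤ B := by
    intro y hy hmin l _ hl
    have hpos : ∀ᶠ ε in l, 0 < ε := hl self_mem_nhdsWithin
    -- The zero pair is admissible at every scale, so its energy bounds the minima uniformly.
    have h1 : ∀ᶠ ε in l, sobPow (y ε) ≤ K * energy μ Q f 0 := hpos.mono fun ε hε =>
      (hbd ε _ (hy ε hε)).trans (mul_le_mul_of_nonneg_left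
        (hmin ε hε 0 ⟨neg_inv_ne_zero_of_pos hε, 0, Submodule.zero_mem _, (map_zero _).symm⟩) hK)
    have h2 : ∀ᶠ ε in l, ‖y ε‖ ≤ 1 + K * energy μ Q f 0 := h1.mono fun ε h =>
      (norm_le_one_add_sobPow hp _).trans (by gcongr)
    obtain ⟨y₀, hy₀⟩ := (unifConvexFun_sobPow (Q := Q) (μ := μ) hp).exists_weakLim h1
    exact ⟨y₀, hy₀.mem_limitGraph hQ (ε := id)
      (tendsto_id'.2 (hl.trans nhdsWithin_le_nhds)) (hpos.mono hy) h2,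
      fun w hw => hf.isMin_limitGraph_of_weakLim hp0 hQ hmin hl hy₀ hw, hy₀, _, h2⟩
  have h1 : ∀ ε : ℝ, ∃ y : SobPair Q (ENNReal.ofReal p) (Lp ℝ (ENNReal.ofReal p) μ), 0 < ε →
      y ∈ unfoldedGraph T Q ENNReal.ofReal_ne_top ε ∧
      ∀ w ∈ unfoldedGraph T Q (ENNReal.ofReal_ne_top (r := p)) ε,
        energy μ Q f y.2 ≤ energy μ Q f w.2 := fun ε => by
    by_cases hε : 0 < ε
    · obtain ⟨y, hy, h⟩ := hf.exists_isMin_unfoldedGraph (T := T) hp hQ.measurableSet hb i hε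
      exact ⟨y, fun _ => ⟨hy, h⟩⟩
    · exact ⟨0, fun h => absurd h hε⟩
  choose v hv using h1
  obtain ⟨y₀, hy₀, hmin₀, -⟩ := key v (fun ε hε => (hv ε hε).1) (fun ε hε => (hv ε hε).2) (𝓝[>] 0)
    inferInstance le_rfl
  -- Along each ultrafilter finer than `𝓝[>] 0` the family has a weak limit, which is a minimizer
  -- over `limitGraph` and hence equals `y₀`. Agreement along all ultrafilters is convergence.
  refine ⟨y₀, hy₀, hmin₀, fun y hy hmin A => (tendsto_iff_ultrafilter _ _ _).2 fun U hU => ?_⟩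
  obtain ⟨y₁, hy₁, hmin₁, hlim, B, hB⟩ := key y hy hmin U inferInstance hU
  rw [hf.eq_of_isMin_limitGraph hp0 hQ hb i hy₀ hy₁ hmin₀ hmin₁]
  exact hlim.tendsto A hB

end IsIntegrand

end Minimizers

/-! ### The minimization problems and two-scale convergence -/

section Homogenization

variable {N : ℕ} {Ω : Type*} [MeasurableSpace Ω] {μ : Measure Ω} [IsProbabilityMeasure μ]
  {T : DynSystem N μ} {Φ : YoungFunction} {Q : Set (RN N)}
  [IsFiniteMeasure ((volume : Measure (RN N)).restrict Q)]
  {f : Ω → RN N → ℝ} {p a b c C : ℝ} [Fact (1 ≤ ENNReal.ofReal p)]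

theorem YoungFunction.IsPower.isIntegrand (hP : Φ.IsPower p a b)
    (hf1 : ∀ l : RN N, Measurable fun ω => f ω l)
    (hf2 : ∀ᵐ ω ∂μ, StrictConvexOn ℝ univ (f ω)) {c₁ c₂ : ℝ} (h1 : 0 < c₁) (h2 : 0 < c₂)
    (h : ∀ᵐ ω ∂μ, ∀ l : RN N, c₁ * Φ ‖l‖ ≤ f ω l ∧ f ω l ≤ c₂ * (1 + Φ ‖l‖)) :
    IsIntegrand μ f p (c₁ * a) (c₂ * max 1 b) where
  measurable := hf1
  strictConvexOn := hf2
  pos := mul_pos h1 hP.lower_pos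
  upper_pos := mul_pos h2 (one_pos.trans_le (le_max_left _ _))
  lower := h.mono fun ω hω l => by
    rw [mul_assoc]
    exact (mul_le_mul_of_nonneg_left (hP.lower _ (norm_nonneg l)) h1.le).trans (hω l).1
  upper := h.mono fun ω hω l => by
    rw [mul_assoc]
    refine (hω l).2.trans (mul_le_mul_of_nonneg_left ?_ h2.le)
    have h3 : 0 ≤ ‖l‖ ^ p := by positivity
    have h4 := mul_le_mul_of_nonneg_right (le_max_right 1 b) h3
    have h5 := hP.upper _ (norm_nonneg l)
    rw [mul_add, mul_one]
    linarith [le_max_left 1 b]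

theorem isMinimizerEps_iff (hP : Φ.IsPower p a b) (hf : IsIntegrand μ f p c C) (hQ : IsOpen Q)
    {ε : ℝ} (hε : 0 < ε) {v : RN N × Ω → ℝ} :
    IsMinimizerEps Φ T Q f ε v ↔
      ∃ z ∈ sobolev0 Q (ENNReal.ofReal p) (Lp ℝ (ENNReal.ofReal p) μ),
        v =ᵐ[prodMeas Q μ] jointFn ENNReal.ofReal_ne_top z.1 ∧
        ∀ w ∈ unfoldedGraph T Q (ENNReal.ofReal_ne_top (r := p)) ε,
          energy μ Q f (unfPair T Q ENNReal.ofReal_ne_top (neg_inv_ne_zero_of_pos hε) z).2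
            ≤ energy μ Q f w.2 := by
  constructor
  · rintro ⟨hv, hmin⟩
    obtain ⟨z, hz, hvz⟩ := (memW10_iff hP hQ).1 hv
    refine ⟨z, hz, hvz, ?_⟩
    rintro _ ⟨hs, w, hw, rfl⟩
    have h1 := hmin _ ((memW10_iff hP hQ).2 ⟨w, hw, ae_eq_rfl⟩)
    rwa [energyEps_eq hf hs (weakGrad_ae_eq_of_mem_sobolev0 hP hQ hz hvz).2,
      energyEps_eq hf hs (weakGrad_ae_eq_of_mem_sobolev0 hP hQ hw ae_eq_rfl).2] at h1
  · rintro ⟨z, hz, hvz, hmin⟩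
    refine ⟨(memW10_iff hP hQ).2 ⟨z, hz, hvz⟩, fun w hw => ?_⟩
    obtain ⟨z', hz', hwz⟩ := (memW10_iff hP hQ).1 hw
    have hs := neg_inv_ne_zero_of_pos hε
    rw [energyEps_eq hf hs (weakGrad_ae_eq_of_mem_sobolev0 hP hQ hz hvz).2,
      energyEps_eq hf hs (weakGrad_ae_eq_of_mem_sobolev0 hP hQ hz' hwz).2]
    exact hmin _ ⟨hs, z', hz', rfl⟩

/-- Existence and uniqueness of the minimizer of `F_ε`. -/
theorem exists_unique_isMinimizerEps (hP : Φ.IsPower p a b) (hf : IsIntegrand μ f p c C)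
    (hQ : IsOpen Q) (hb : Bornology.IsBounded Q) (i : Fin N) {ε : ℝ} (hε : 0 < ε) :
    ∃ u, IsMinimizerEps Φ T Q f ε u ∧
      ∀ v, IsMinimizerEps Φ T Q f ε v → v =ᵐ[prodMeas Q μ] u := by
  obtain ⟨_, ⟨hs, z, hz, rfl⟩, hmin⟩ :=
    hf.exists_isMin_unfoldedGraph (T := T) hP.one_lt hQ.measurableSet hb i hε
  refine ⟨_, (isMinimizerEps_iff hP hf hQ hε).2 ⟨z, hz, ae_eq_rfl, hmin⟩, fun v hv => ?_⟩
  obtain ⟨z', hz', hvz', hmin'⟩ := (isMinimizerEps_iff hP hf hQ hε).1 hv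
  have h1 := hf.eq_of_isMin_unfoldedGraph hP.pos hQ.measurableSet hb i hε ⟨hs, z', hz', rfl⟩
    ⟨hs, z, hz, rfl⟩ hmin' hmin
  have h2 : z'.1 = z.1 :=
    (unfL T Q ENNReal.ofReal_ne_top hs).injective (congrArg Prod.fst h1)
  rwa [h2] at hvz'

variable (T) in
/-- The pair `(v₀, v₁)` corresponds to the invariant function and the vector field `y`. -/
def Represents (hP : Φ.IsPower p a b) (v₀ : RN N × Ω → ℝ) (v₁ : RN N → WSharp Φ T)
    (y : SobPair Q (ENNReal.ofReal p) (Lp ℝ (ENNReal.ofReal p) μ)) : Prop :=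
  v₀ =ᵐ[prodMeas Q μ] jointFn ENNReal.ofReal_ne_top y.1 ∧
    (invProj T (ENNReal.ofReal p)).compLp y.1 = y.1 ∧
    ∃ D, (y.1, D) ∈ sobolev0 Q (ENNReal.ofReal p) (Lp ℝ (ENNReal.ofReal p) μ) ∧
      ∀ᵐ x ∂(volume.restrict Q), ∀ i, (y.2 i - D i) x = dbar T hP (v₁ x) i

namespace Represents

variable {hP : Φ.IsPower p a b} {v₀ v₀' : RN N × Ω → ℝ} {v₁ v₁' : RN N → WSharp Φ T}
  {y : SobPair Q (ENNReal.ofReal p) (Lp ℝ (ENNReal.ofReal p) μ)}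

theorem mem_limitGraph (h : Represents T hP v₀ v₁ y) : y ∈ limitGraph T Q (ENNReal.ofReal p) := by
  obtain ⟨-, hU, D, hD, hb⟩ := h
  refine ⟨D, hD, hU, ?_⟩
  filter_upwards [hb] with x hx
  have h1 : (fun i => (y.2 i - D i) x) = dbar T hP (v₁ x) := funext hx
  rw [h1]
  exact dbar_mem_gradRange hP _

theorem grad_ae_eq (hQ : IsOpen Q) (h : Represents T hP v₀ v₁ y) :
    (fun z => weakGrad Φ Q μ v₀ z + stochGrad Φ T Q v₁ z)
      =ᵐ[prodMeas Q μ] jointGrad ENNReal.ofReal_ne_top y.2 := by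
  obtain ⟨h0, hU, D, hD, hb⟩ := h
  have h1 := jointGrad_add (Q := Q) (μ := μ) ENNReal.ofReal_ne_top D fun i => y.2 i - D i
  have h2 : D + (fun i => y.2 i - D i) = y.2 := funext fun i => add_sub_cancel _ _
  rw [h2] at h1
  filter_upwards [h1, (weakGrad_ae_eq_of_mem_sobolev0 hP hQ hD h0).2, stochGrad_ae_eq hP hb]
    with z e1 e2 e3
  rw [e1, e2, e3]
  rfl

theorem energyHom_eq (hQ : IsOpen Q) (h : Represents T hP v₀ v₁ y) :
    energyHom Φ T Q f v₀ v₁ = energy μ Q f y.2 :=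
  integral_congr_ae ((h.grad_ae_eq hQ).mono fun z hz => congrArg (f z.2) hz)

theorem memF10 (hQ : IsOpen Q) (h : Represents T hP v₀ v₁ y)
    (h1 : MemOrlicz Φ (volume.restrict Q) v₁) : MemF10 Φ T Q v₀ v₁ := by
  obtain ⟨h0, hU, D, hD, hb⟩ := h
  exact ⟨⟨(memW10_iff hP hQ).2 ⟨_, hD, h0⟩,
    (ae_memInv_iff hP T h0).2 (ae_koopman_eq_of_compLp_eq T hU)⟩, h1⟩

theorem ae_eq (hQ : IsOpen Q) (h : Represents T hP v₀ v₁ y) (h' : Represents T hP v₀' v₁' y) :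
    v₀ =ᵐ[prodMeas Q μ] v₀' ∧ v₁ =ᵐ[volume.restrict Q] v₁' := by
  obtain ⟨h0, -, D, hD, hb⟩ := h
  obtain ⟨h0', -, D', hD', hb'⟩ := h'
  refine ⟨h0.trans h0'.symm, ?_⟩
  rw [snd_eq_of_mem_sobolev0 hQ hD' hD] at hb'
  filter_upwards [hb, hb'] with x e1 e2
  exact (isClosedEmbedding_dbar hP).injective (funext fun i => (e1 i).symm.trans (e2 i))

end Represents

theorem MemF10.exists_represents (hP : Φ.IsPower p a b) (hQ : IsOpen Q) {v₀ : RN N × Ω → ℝ}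
    {v₁ : RN N → WSharp Φ T} (h : MemF10 Φ T Q v₀ v₁) :
    ∃ y : SobPair Q (ENNReal.ofReal p) (Lp ℝ (ENNReal.ofReal p) μ), Represents T hP v₀ v₁ y := by
  obtain ⟨⟨h0, hinv⟩, h1⟩ := h
  obtain ⟨z, hz, hvz⟩ := (memW10_iff hP hQ).1 h0
  obtain ⟨G, hG⟩ := exists_tuple_eq_dbar hP h1
  refine ⟨(z.1, z.2 + G), hvz,
    compLp_eq_of_ae_koopman_eq T ((ae_memInv_iff hP T hvz).1 hinv), z.2, hz, ?_⟩
  simpa only [Pi.add_apply, add_sub_cancel_left] using hG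

theorem exists_represents_of_mem_limitGraph (hP : Φ.IsPower p a b)
    {y : SobPair Q (ENNReal.ofReal p) (Lp ℝ (ENNReal.ofReal p) μ)}
    (hy : y ∈ limitGraph T Q (ENNReal.ofReal p)) :
    ∃ (v₀ : RN N × Ω → ℝ) (v₁ : RN N → WSharp Φ T),
      MemOrlicz Φ (volume.restrict Q) v₁ ∧ Represents T hP v₀ v₁ y := by
  obtain ⟨D, hD, hU, hb⟩ := hy
  obtain ⟨v₁, h1, h2⟩ := exists_dbar_eq_tuple hP (G := fun i => y.2 i - D i) hb
  exact ⟨_, v₁, h1, ae_eq_rfl, hU, D, hD, h2⟩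

theorem isMinimizerHom_iff (hP : Φ.IsPower p a b) (hQ : IsOpen Q) {v₀ : RN N × Ω → ℝ}
    {v₁ : RN N → WSharp Φ T} {y : SobPair Q (ENNReal.ofReal p) (Lp ℝ (ENNReal.ofReal p) μ)}
    (hy : Represents T hP v₀ v₁ y) (hv : MemF10 Φ T Q v₀ v₁) :
    IsMinimizerHom Φ T Q f v₀ v₁ ↔
      ∀ w ∈ limitGraph T Q (ENNReal.ofReal p), energy μ Q f y.2 ≤ energy μ Q f w.2 := by
  constructor
  · rintro ⟨-, hmin⟩ w hw
    obtain ⟨w₀, w₁, h1, h2⟩ := exists_represents_of_mem_limitGraph hP hw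
    have h3 := hmin w₀ w₁ (h2.memF10 hQ h1)
    rwa [hy.energyHom_eq hQ, h2.energyHom_eq hQ] at h3
  · refine fun hmin => ⟨hv, fun w₀ w₁ hw => ?_⟩
    obtain ⟨w, h2⟩ := hw.exists_represents hP hQ
    rw [hy.energyHom_eq hQ, h2.energyHom_eq hQ]
    exact hmin w h2.mem_limitGraph

theorem memLp_top_of_mem_testTensor {h : RN N × Ω → ℝ}
    (hh : h ∈ testTensor Q (CInf T : Set (Ω → ℝ))) : MemLp h ∞ (prodMeas Q μ) := by
  induction hh using Submodule.span_induction with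
  | mem w hw =>
    obtain ⟨φ, ψ, hφ, hψ, rfl⟩ := hw
    obtain ⟨χ, rfl, -⟩ := hφ.exists_testFn
    exact memLp_tensor (CInf.memLp ⟨ψ, hψ⟩)
  | zero => exact MemLp.zero
  | add _ _ _ _ h1 h2 => exact h1.add h2
  | smul c _ _ h1 => exact h1.const_smul c

/-- Bounded `h` lies in the dual exponent space over a finite measure, so pairing with it is a
continuous functional on the slices. -/
theorem exists_clm_integral_mul {q : ℝ≥0∞} [Fact (1 ≤ q)] (hq : q ≠ ∞) {h : RN N × Ω → ℝ}
    (hh : MemLp h ∞ (prodMeas Q μ)) :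
    ∃ A : Lp (Lp ℝ q μ) q ((volume : Measure (RN N)).restrict Q) →L[ℝ] ℝ,
      ∀ F, A F = ∫ z, jointFn hq F z * h z ∂(prodMeas Q μ) := by
  have : Fact (1 ≤ ENNReal.conjExponent q) := ⟨ENNReal.HolderConjugate.one_le _ q⟩
  have hm : MemLp h (ENNReal.conjExponent q) (prodMeas Q μ) := hh.mono_exponent le_top
  refine ⟨((ContinuousLinearMap.mul ℝ ℝ).lpPairing (prodMeas Q μ) q (ENNReal.conjExponent q)).flip
    (hm.toLp h) |>.comp (sliceEquiv (volume.restrict Q) μ hq).symm.toLinearIsometry.toContinuousLinearMap,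
    fun F => ?_⟩
  refine (ContinuousLinearMap.lpPairing_eq_integral _ _ _).trans (integral_congr_ae ?_)
  filter_upwards [hm.coeFn_toLp] with z hz
  rw [hz]
  rfl

/-- The change of variables moves the oscillation from the test function to `u`: two-scale
convergence in the mean is tested by fixed functionals on the unfolded functions. -/
theorem integral_mul_comp_skew {q : ℝ≥0∞} [Fact (1 ≤ q)] {hq : q ≠ ∞} {ε : ℝ} (hs : -ε⁻¹ ≠ 0)
    {u h : RN N × Ω → ℝ} {F : Lp (Lp ℝ q μ) q ((volume : Measure (RN N)).restrict Q)}
    (hu : u =ᵐ[prodMeas Q μ] jointFn hq F) (hh : AEStronglyMeasurable h (prodMeas Q μ)) :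
    ∫ z, u z * h (z.1, T (ε⁻¹ • z.1) z.2) ∂(prodMeas Q μ)
      = ∫ z, jointFn hq (unfL T Q hq hs F) z * h z ∂(prodMeas Q μ) := by
  have hs' : ε⁻¹ ≠ 0 := neg_ne_zero.1 hs
  refine Eq.trans (integral_congr_ae ?_)
    (integral_comp_skew T hs' ((memLp_jointFn hq (unfL T Q hq hs F)).1.mul hh))
  filter_upwards [ae_comp_skew T hs' (jointFn_unfL T hq hs hu)] with z hz
  rw [skew_neg_skew] at hz
  rw [hz]
  rfl

theorem twoScaleTendsto_of_tendsto (hP : Φ.IsPower p a b) {u : ℝ → RN N × Ω → ℝ}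
    {u₀ : RN N × Ω → ℝ}
    {F G : ℝ → Lp (Lp ℝ (ENNReal.ofReal p) μ) (ENNReal.ofReal p) (volume.restrict Q)}
    {G₀ : Lp (Lp ℝ (ENNReal.ofReal p) μ) (ENNReal.ofReal p) (volume.restrict Q)}
    (hu : ∀ ε, 0 < ε → u ε =ᵐ[prodMeas Q μ] jointFn ENNReal.ofReal_ne_top (F ε))
    (hG : ∀ ε (hε : 0 < ε),
      G ε = unfL T Q ENNReal.ofReal_ne_top (neg_inv_ne_zero_of_pos hε) (F ε))
    (hu₀ : u₀ =ᵐ[prodMeas Q μ] jointFn ENNReal.ofReal_ne_top G₀)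
    (h : ∀ A : Lp (Lp ℝ (ENNReal.ofReal p) μ) (ENNReal.ofReal p) (volume.restrict Q) →L[ℝ] ℝ,
      Tendsto (fun ε => A (G ε)) (𝓝[>] 0) (𝓝 (A G₀))) :
    TwoScaleTendsto Φ T Q u u₀ := by
  refine ⟨fun ε hε => hP.memOrlicz_iff.2 ((memLp_congr_ae (hu ε hε)).2 (memLp_jointFn _ _)),
    hP.memOrlicz_iff.2 ((memLp_congr_ae hu₀).2 (memLp_jointFn _ _)), fun w hw => ?_⟩
  have hm : MemLp w ∞ (prodMeas Q μ) := memLp_top_of_mem_testTensor hw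
  obtain ⟨A, hA⟩ := exists_clm_integral_mul (ENNReal.ofReal_ne_top (r := p)) hm
  have h1 : ∫ z, u₀ z * w z ∂(prodMeas Q μ) = A G₀ := by
    rw [hA]
    exact integral_congr_ae (hu₀.mono fun z hz => congrArg (· * w z) hz)
  change Tendsto _ _ (𝓝 (∫ z, u₀ z * w z ∂(prodMeas Q μ)))
  rw [h1]
  refine (h A).congr' ?_
  filter_upwards [self_mem_nhdsWithin] with ε hε
  rw [hG ε hε, hA]
  exact (integral_mul_comp_skew (neg_inv_ne_zero_of_pos hε) (hu ε hε) hm.1).symm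

/-- Existence and uniqueness of the minimizer of the homogenized functional, and two-scale
convergence to it of the minimizers of `F_ε` and of their gradients. -/
theorem exists_isMinimizerHom (hP : Φ.IsPower p a b) (hf : IsIntegrand μ f p c C)
    (hQ : IsOpen Q) (hb : Bornology.IsBounded Q) (i : Fin N) :
    ∃ (u₀ : RN N × Ω → ℝ) (u₁ : RN N → WSharp Φ T),
      IsMinimizerHom Φ T Q f u₀ u₁ ∧
      (∀ v₀ v₁, IsMinimizerHom Φ T Q f v₀ v₁ →
        v₀ =ᵐ[prodMeas Q μ] u₀ ∧ v₁ =ᵐ[volume.restrict Q] u₁) ∧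
      ∀ u : ℝ → RN N × Ω → ℝ, (∀ ε, 0 < ε → IsMinimizerEps Φ T Q f ε (u ε)) →
        TwoScaleTendsto Φ T Q u u₀ ∧
        ∀ i : Fin N, TwoScaleTendsto Φ T Q
          (fun ε z => weakGrad Φ Q μ (u ε) z i)
          (fun z => weakGrad Φ Q μ u₀ z i + stochGrad Φ T Q u₁ z i) := by
  obtain ⟨y₀, hy₀, hmin, hlim⟩ := hf.exists_isMin_limitGraph (T := T) hP.one_lt hQ hb i
  obtain ⟨u₀, u₁, h1, h2⟩ := exists_represents_of_mem_limitGraph hP hy₀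
  refine ⟨u₀, u₁, (isMinimizerHom_iff hP hQ h2 (h2.memF10 hQ h1)).2 hmin, fun v₀ v₁ hv => ?_,
    fun u hu => ?_⟩
  · obtain ⟨y, hy⟩ := hv.1.exists_represents hP hQ
    have h3 := (isMinimizerHom_iff hP hQ hy hv.1).1 hv
    rw [hf.eq_of_isMin_limitGraph hP.pos hQ hb i hy.mem_limitGraph hy₀ h3 hmin] at hy
    exact hy.ae_eq hQ h2
  · have h3 : ∀ ε, ∃ z : SobPair Q (ENNReal.ofReal p) (Lp ℝ (ENNReal.ofReal p) μ), ∀ hε : 0 < ε,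
        z ∈ sobolev0 Q (ENNReal.ofReal p) (Lp ℝ (ENNReal.ofReal p) μ) ∧
        u ε =ᵐ[prodMeas Q μ] jointFn ENNReal.ofReal_ne_top z.1 ∧
        ∀ w ∈ unfoldedGraph T Q (ENNReal.ofReal_ne_top (r := p)) ε,
          energy μ Q f (unfPair T Q ENNReal.ofReal_ne_top (neg_inv_ne_zero_of_pos hε) z).2
            ≤ energy μ Q f w.2 := fun ε => by
      by_cases hε : 0 < ε
      · obtain ⟨z, hz⟩ := (isMinimizerEps_iff hP hf hQ hε).1 (hu ε hε)
        exact ⟨z, fun _ => hz⟩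
      · exact ⟨0, fun h => absurd h hε⟩
    choose z hz using h3
    -- The value `0` for `ε ≤ 0` is never seen by the filter `𝓝[>] 0`.
    set y : ℝ → SobPair Q (ENNReal.ofReal p) (Lp ℝ (ENNReal.ofReal p) μ) := fun ε =>
      if hε : 0 < ε then unfPair T Q ENNReal.ofReal_ne_top (neg_inv_ne_zero_of_pos hε) (z ε) else 0
    have hy : ∀ ε (hε : 0 < ε),
        y ε = unfPair T Q ENNReal.ofReal_ne_top (neg_inv_ne_zero_of_pos hε) (z ε) := fun ε hε =>
      dif_pos hε
    have h4 := hlim y (fun ε hε => ⟨neg_inv_ne_zero_of_pos hε, z ε, (hz ε hε).1, hy ε hε⟩)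
      (fun ε hε => by
        rw [hy ε hε]
        exact (hz ε hε).2.2)
    refine ⟨twoScaleTendsto_of_tendsto hP (F := fun ε => (z ε).1) (G := fun ε => (y ε).1)
      (G₀ := y₀.1) (fun ε hε => (hz ε hε).2.1) (fun ε hε => congrArg Prod.fst (hy ε hε)) h2.1
      fun A => h4 (A.comp (ContinuousLinearMap.fst ℝ _ _)), fun j => ?_⟩
    refine twoScaleTendsto_of_tendsto hP (F := fun ε => (z ε).2 j) (G := fun ε => (y ε).2 j)
      (G₀ := y₀.2 j) (fun ε hε => ?_) (fun ε hε => congrArg (fun y => y.2 j) (hy ε hε)) ?_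
      fun A => h4 (A.comp ((ContinuousLinearMap.proj j).comp (ContinuousLinearMap.snd ℝ _ _)))
    · filter_upwards [(weakGrad_ae_eq_of_mem_sobolev0 hP hQ (hz ε hε).1 (hz ε hε).2.1).2] with w hw
      rw [hw]
      rfl
    · filter_upwards [h2.grad_ae_eq hQ] with w hw
      exact congrArg (fun g : RN N => g j) hw

end Homogenization

end

/-! ### The homogenization theorem. -/

theorem theorem4 {N : ℕ} (hN : 1 ≤ N)
    {Ω : Type*} [MeasurableSpace Ω] (μ : Measure Ω) [IsProbabilityMeasure μ]
    (T : DynSystem N μ)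
    (Φ : YoungFunction)
    (hΦ2 : Delta2 Φ) (hΦ' : DeltaPrime Φ)
    (hΨ2 : Delta2 (youngConj Φ)) (hΨ' : DeltaPrime (youngConj Φ))
    (Q : Set (RN N)) (hQo : IsOpen Q) (hQb : Bornology.IsBounded Q)
    (f : Ω → RN N → ℝ)
    (hf1 : ∀ l : RN N, Measurable fun ω => f ω l)
    (hf2 : ∀ᵐ ω ∂μ, StrictConvexOn ℝ univ (f ω))
    (hf3 : ∃ c₁ c₂ : ℝ, 0 < c₁ ∧ 0 < c₂ ∧
      ∀ᵐ ω ∂μ, ∀ l : RN N, c₁ * Φ ‖l‖ ≤ f ω l ∧ f ω l ≤ c₂ * (1 + Φ ‖l‖)) :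
    -- for every `ε > 0` there is a unique minimizer of `F_ε`
    (∀ ε : ℝ, 0 < ε → ∃ u, IsMinimizerEps Φ T Q f ε u ∧
      ∀ v, IsMinimizerEps Φ T Q f ε v → v =ᵐ[(volume.restrict Q).prod μ] u) ∧
    -- the homogenized functional has a unique minimizer `(u₀, u₁)`
    ∃ (u₀ : RN N × Ω → ℝ) (u₁ : RN N → WSharp Φ T),
      IsMinimizerHom Φ T Q f u₀ u₁ ∧
      (∀ v₀ v₁, IsMinimizerHom Φ T Q f v₀ v₁ →
        v₀ =ᵐ[(volume.restrict Q).prod μ] u₀ ∧ v₁ =ᵐ[volume.restrict Q] u₁) ∧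
      -- the minimizers of `F_ε` and their gradients converge as `ε → 0`
      ∀ u : ℝ → RN N × Ω → ℝ, (∀ ε, 0 < ε → IsMinimizerEps Φ T Q f ε (u ε)) →
        TwoScaleTendsto Φ T Q u u₀ ∧
        ∀ i : Fin N, TwoScaleTendsto Φ T Q
          (fun ε p => weakGrad Φ Q μ (u ε) p i)
          (fun p => weakGrad Φ Q μ u₀ p i + stochGrad Φ T Q u₁ p i) := by
  obtain ⟨p, a, b, hp, ha, hb, hΦ⟩ := Φ.exists_rpow_equiv hΦ' hΨ'
  have hP : Φ.IsPower p a b := ⟨hp, ha, hb, fun t ht => (hΦ t ht).1, fun t ht => (hΦ t ht).2⟩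
  have : Fact (1 ≤ ENNReal.ofReal p) := ⟨hP.one_le_ofReal⟩
  have : IsFiniteMeasure ((volume : Measure (RN N)).restrict Q) :=
    ⟨by rw [Measure.restrict_apply_univ]; exact hQb.measure_lt_top⟩
  obtain ⟨c₁, c₂, h1, h2, h3⟩ := hf3
  have hf := hP.isIntegrand hf1 hf2 h1 h2 h3
  -- The index `⟨0, hN⟩` is the coordinate direction along which the Poincaré inequality is applied.
  exact ⟨fun ε hε => exists_unique_isMinimizerEps hP hf hQo hQb ⟨0, hN⟩ hε,
    exists_isMinimizerHom hP hf hQo hQb ⟨0, hN⟩⟩
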